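/- **Setting.** Let $\mathcal S,\mathcal A$ be measurable spaces with base probability measures $\mu_{\mathcal S},\mu_{\mathcal A}$, $H\ge1$ an episode length and $s_1\in\mathcal S$ a fixed initial state. An environment $\mathcal E=\{(P_h,r_h)\}_{h=1}^H$ consists of transition densities $P_h(s'|s,a)$ with respect to $\mu_{\mathcal S}$ and reward densities $r_h(x|s,a)$ with respect to Lebesgue measure on $[0,1]$; write $r_h(s,a)=\int_0^1x\,r_h(x|s,a)\,dx$. Here $P_h$ ranges over a separable metrizable space $\Theta_h^P$ with prior $\rho_h^P$ and $r_h$ over a separable metrizable space $\Theta_h^R$ with prior $\rho_h^R$; all these spaces are convex, $\Theta=\prod_h\Theta_h$ with $\Theta_h=\Theta_h^P\times\Theta_h^R$, and the prior on $\Theta$ is the product $\rho=\bigotimes_h(\rho_h^P\otimes\rho_h^R)$. Everything is jointly measurable. A class $\Pi$ of policies $\pi=(\pi_h(a|s))_{h\le H}$ (densities with respect to $\mu_{\mathcal A}$) is given. Let $V^{\mathcal E}_{h,\pi}(s)=\mathbb E^{\mathcal E}_\pi[\sum_{h'=h}^Hr_{h'}(s_{h'},a_{h'})\mid s_h=s]$,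 and let $\mathcal E\mapsto\pi^*_{\mathcal E}\in\Pi$ be a measurable map with $V^{\mathcal E}_{h,\pi^*_{\mathcal E}}(s)=\max_{\pi\in\Pi}V^{\mathcal E}_{h,\pi}(s)$ for all $h,s$. Let $d^{\mathcal E}_{h,\pi}$ be the density of the law of $(s_h,a_h)$, under $\pi$ in $\mathcal E$ and started at $s_1$, with respect to the base measure $\nu_h$, where $\nu_1=\delta_{s_1}\otimes\mu_{\mathcal A}$ and $\nu_h=\mu_{\mathcal S}\otimes\mu_{\mathcal A}$ for $h\ge2$; assume that these densities are bounded uniformly in $h$, $\mathcal E\in\Theta$ and $\pi\in\Pi$. **Thompson Sampling.** The true environment $\mathcal E$ is drawn from $\rho$. In episode $\ell=1,2,\dots$, given the history $\mathcal D_\ell$ of the previous episodes (all states, including the final state $s_{H+1}$, actions and rewards), an environment $\mathcal E_\ell$ is drawn from the posterior $\mathbb P(\mathcal E\in\cdot\mid\mathcal D_\ell)$, independently of $\mathcal E$, and an episode is run in $\mathcal E$ from $s_1$ under $\pi^*_{\mathcal E_\ell}$. The Bayesian regret is $\mathfrak{BR}_L(\pi_{\mathrm{TS}})=\sum_{\ell=1}^L\mathbb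 E\big[V^{\mathcal E}_{1,\pi^*_{\mathcal E}}(s_1)-V^{\mathcal E}_{1,\pi^*_{\mathcal E_\ell}}(s_1)\big]$, and $T=LH$. **Quantities.** The value diameter of $\mathcal E$ is $\lambda_{\mathcal E}=\max_h\big(\sup_sV^{\mathcal E}_{h,\pi^*_{\mathcal E}}(s)-\inf_sV^{\mathcal E}_{h,\pi^*_{\mathcal E}}(s)\big)+\sup_{h,s,a}\big(r_h^{\sup}(s,a)-r_h^{\inf}(s,a)\big)$, with $r_h^{\sup}(s,a),r_h^{\inf}(s,a)$ the essential supremum and infimum of the reward distribution $r_h(\cdot|s,a)$, and $\lambda=\mathbb E_{\mathcal E\sim\rho}[\lambda_{\mathcal E}^2]^{1/2}$ is the average value diameter. For $\varepsilon>0$, a layered $\varepsilon$-value partition is a finite measurable partition $\{\Theta_k\}_{k=1}^K$ of $\Theta$ such that $V^{\mathcal E}_{1,\pi^*_{\mathcal E}}(s_1)-V^{\mathcal E'}_{1,\pi^*_{\mathcal E}}(s_1)\le\varepsilon$ for all $k$ and all $\mathcal E,\mathcal E'\in\Theta_k$, and such that, for every $k$ with $\rho(\Theta_k)>0$, the layers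 $(P_1,r_1),\dots,(P_H,r_H)$ are independent under $\rho(\cdot\mid\Theta_k)$; $K_{\mathrm{surr}}(\varepsilon)\in\mathbb N\cup\{\infty\}$ is the smallest such $K$. The $l_1$-distance on $\Theta_h^P$ is $l_1(P,Q)=\sup_{s,a}\|P(\cdot|s,a)-Q(\cdot|s,a)\|_1$, similarly on $\Theta_h^R$. The $l_1$-dimension of such a space is $\limsup_{\varepsilon\to0}\log K(\varepsilon)/\log(1/\varepsilon)$, where $K(\varepsilon)$ is the least number of $l_1$-balls of radius $\varepsilon$, with centres in the space, that cover it; $d_{l_1,h}$ is the sum of the $l_1$-dimensions of $\Theta_h^P$ and $\Theta_h^R$, and $d_{l_1}=\sum_hd_{l_1,h}$. **Assumptions.** (1) There is a strongly consistent estimator: measurable maps $T_\ell$ such that, for $\rho$-almost every environment $\mathcal E_0$ and almost every infinite history generated by Thompson Sampling in $\mathcal E_0$, $T_\ell(\mathcal D_\ell)\to\mathcal E_0$. (2) For $\rho$-almost every $\mathcal E$, every $h$ and $\nu_h$-almost every $(s,a)$, $d^{\mathcal E}_{h,\pi^*_{\mathcal E}}(s,a)\ne0$. **Theorem.** There is a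 constant $T_0$, not depending on $L$ (hence not on $T$) nor on $\varepsilon$, such that for all $\varepsilon>0$ and all $L$ $$\mathfrak{BR}_L(\pi_{\mathrm{TS}})\le2\lambda\sqrt{\log(K_{\mathrm{surr}}(\varepsilon))\,T}+L\varepsilon+T_0 .$$ Moreover, there are universal constants $C>0$ and $k\in\mathbb N$ such that, for every such problem with $d_{l_1}<\infty$ for which the $l_1$-distance to each point of $\Theta_h^P$ and of $\Theta_h^R$ is measurable, and for all large enough $T$, $$\mathfrak{BR}_L(\pi_{\mathrm{TS}})\le C\,\lambda\sqrt{d_{l_1}T}\,(\log T)^k=\widetilde O\big(\lambda\sqrt{d_{l_1}T}\big).$$ If $d_{l_1,h}=d_{\mathrm{hom}}<\infty$ for all $h$, then for all large enough $T$ this reads $\mathfrak{BR}_L(\pi_{\mathrm{TS}})\le C\,\lambda\sqrt{H\,d_{\mathrm{hom}}\,T}\,(\log T)^k=\widetilde O(\lambda\sqrt{H\,d_{\mathrm{hom}}T})$. -/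

import Mathlib

open MeasureTheory ProbabilityTheory Filter Topology Set

noncomputable section

/-- The data of a time-inhomogeneous finite-horizon Bayesian reinforcement learning problem with
`H` layers, indexed by `Fin H`.  The points of the space `TP h` are the transition functions
of layer `h`, the points of `TR h` its reward functions, both given by their densities. -/
structure BayesRL (S A : Type*) [MeasurableSpace S] [MeasurableSpace A] (H : ℕ)
    (TP TR : Fin H → Type*) [∀ h, MeasurableSpace (TP h)] [∀ h, MeasurableSpace (TR h)] where
  /-- Base probability measure on states. -/
  μS : Measure S
  /-- Base probability measure on actions. -/
  μA : Measure A
  [probS : IsProbabilityMeasure μS]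
  [probA : IsProbabilityMeasure μA]
  /-- The initial state of every episode. -/
  s₁ : S
  /-- `p h θ s a s'` is the transition density at `s'`, with respect to `μS`. -/
  p : ∀ h, TP h → S → A → S → ℝ
  /-- `r h θ s a x` is the reward density at `x ∈ [0,1]`, with respect to Lebesgue measure. -/
  r : ∀ h, TR h → S → A → ℝ → ℝ
  /-- Priors of the individual layers. -/
  ρP : ∀ h, Measure (TP h)
  ρR : ∀ h, Measure (TR h)
  [probP : ∀ h, IsProbabilityMeasure (ρP h)]
  [probR : ∀ h, IsProbabilityMeasure (ρR h)]
  /-- The class of admissible stationary policies, `π h s a` being the density of the action `a`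
  played in state `s` at layer `h`, with respect to `μA`. -/
  Pol : Set (Fin H → S → A → ℝ)
  /-- The selected optimal policy of an environment. -/
  star : (∀ h, TP h × TR h) → Fin H → S → A → ℝ
  p_measurable : ∀ h, Measurable fun x : TP h × S × A × S => p h x.1 x.2.1 x.2.2.1 x.2.2.2
  p_nonneg : ∀ h θ s a s', 0 ≤ p h θ s a s'
  p_prob : ∀ h θ s a, ∫⁻ s', ENNReal.ofReal (p h θ s a s') ∂μS = 1
  r_measurable : ∀ h, Measurable fun x : TR h × S × A × ℝ => r h x.1 x.2.1 x.2.2.1 x.2.2.2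
  r_nonneg : ∀ h θ s a x, 0 ≤ r h θ s a x
  r_prob : ∀ h θ s a, ∫⁻ x in Icc (0 : ℝ) 1, ENNReal.ofReal (r h θ s a x) = 1
  pol_measurable : ∀ π ∈ Pol, ∀ h, Measurable fun x : S × A => π h x.1 x.2
  pol_nonneg : ∀ π ∈ Pol, ∀ h s a, 0 ≤ π h s a
  pol_prob : ∀ π ∈ Pol, ∀ h s, ∫⁻ a, ENNReal.ofReal (π h s a) ∂μA = 1
  star_mem : ∀ E, star E ∈ Pol
  star_measurable :
    ∀ h, Measurable fun x : (∀ h, TP h × TR h) × S × A => star x.1 h x.2.1 x.2.2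

namespace BayesRL

variable {S A : Type*} [MeasurableSpace S] [MeasurableSpace A] {H : ℕ}
  {TP TR : Fin H → Type*} [∀ h, MeasurableSpace (TP h)] [∀ h, MeasurableSpace (TR h)]

attribute [instance] probS probA probP probR

/-! ### Trajectories, values, occupancies -/

/-- An episode: the `h`-th entry is `(a_h, r_h, s_{h+1})`. -/
abbrev Traj (S A : Type*) (H : ℕ) : Type _ := Fin H → A × ℝ × S

/-- The state at layer `h` of a trajectory that is started at layer `h₀` in the state `s`. -/
def stateAt (h₀ : Fin H) (s : S) (τ : Traj S A H) (h : Fin H) : S :=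
  if h ≤ h₀ then s else (τ ⟨h.1 - 1, lt_of_le_of_lt (Nat.sub_le _ _) h.2⟩).2.2

variable (B : BayesRL S A H TP TR)

/-- An environment: the transition and reward functions of all layers. -/
abbrev Env (_B : BayesRL S A H TP TR) : Type _ := ∀ h, TP h × TR h

/-- The prior, independent over layers and over transitions and rewards. -/
def prior : Measure B.Env := Measure.pi fun h => (B.ρP h).prod (B.ρR h)

/-- Reference measure on trajectories. -/
def refMeasure : Measure (Traj S A H) :=
  Measure.pi fun _ => B.μA.prod ((volume.restrict (Icc (0 : ℝ) 1)).prod B.μS)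

/-- Density of the trajectories that start at layer `h₀` in state `s`, follow `π` and evolve in the
environment `E`.  The coordinates before `h₀` are dummies, distributed as in `refMeasure`. -/
def trajDensity (E : B.Env) (π : Fin H → S → A → ℝ) (h₀ : Fin H) (s : S) (τ : Traj S A H) :
    ENNReal :=
  ∏ h ∈ Finset.Ici h₀, ENNReal.ofReal
    (π h (stateAt h₀ s τ h) (τ h).1
      * B.r h (E h).2 (stateAt h₀ s τ h) (τ h).1 (τ h).2.1
      * B.p h (E h).1 (stateAt h₀ s τ h) (τ h).1 (τ h).2.2)

/-- Law of the trajectory started at layer `h₀` in state `s`. -/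
def trajLaw (E : B.Env) (π : Fin H → S → A → ℝ) (h₀ : Fin H) (s : S) : Measure (Traj S A H) :=
  B.refMeasure.withDensity (B.trajDensity E π h₀ s)

/-- Mean reward. -/
def meanReward (h : Fin H) (θ : TR h) (s : S) (a : A) : ℝ :=
  ∫ x in Icc (0 : ℝ) 1, x * B.r h θ s a x

/-- The value function: expected sum of the mean rewards from layer `h` on, started in `s`. -/
def value (E : B.Env) (π : Fin H → S → A → ℝ) (h : Fin H) (s : S) : ℝ :=
  ∫ τ, ∑ h' ∈ Finset.Ici h, B.meanReward h' (E h').2 (stateAt h s τ h') (τ h').1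
    ∂(B.trajLaw E π h s)

/-- The distribution of a reward. -/
def rewardLaw (h : Fin H) (θ : TR h) (s : S) (a : A) : Measure ℝ :=
  (volume.restrict (Icc (0 : ℝ) 1)).withDensity fun x => ENNReal.ofReal (B.r h θ s a x)

/-- The value diameter of an environment. -/
def valueDiameter (E : B.Env) : ℝ :=
  (⨆ h : Fin H, ((⨆ s, B.value E (B.star E) h s) - ⨅ s, B.value E (B.star E) h s))
    + ⨆ x : Fin H × S × A,
        (essSup (fun y : ℝ => y) (B.rewardLaw x.1 (E x.1).2 x.2.1 x.2.2)
          - essInf (fun y : ℝ => y) (B.rewardLaw x.1 (E x.1).2 x.2.1 x.2.2))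

/-- The average value diameter. -/
def avgDiameter : ℝ := √(∫ E, B.valueDiameter E ^ 2 ∂B.prior)

section Occupancy

variable [NeZero H]

/-- The state-action occupancy measure at layer `h`. -/
def occupancy (E : B.Env) (π : Fin H → S → A → ℝ) (h : Fin H) : Measure (S × A) :=
  (B.trajLaw E π 0 B.s₁).map fun τ => (stateAt 0 B.s₁ τ h, (τ h).1)

/-- The base measure on state-action pairs at layer `h`; as the initial state is deterministic,
the base measure on states is the Dirac measure `δ_{s₁}` at the first layer. -/
def base (h : Fin H) : Measure (S × A) :=
  if h = 0 then (Measure.dirac B.s₁).prod B.μA else B.μS.prod B.μA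

/-- The state-action occupancy density. -/
def occDensity (E : B.Env) (π : Fin H → S → A → ℝ) (h : Fin H) : S × A → ENNReal :=
  (B.occupancy E π h).rnDeriv (B.base h)

/-- The standing assumptions on a Bayesian reinforcement learning problem. -/
structure Standing : Prop where
  /-- `star E` is optimal in the policy class, at all layers and states. -/
  optimal : ∀ E, ∀ π ∈ B.Pol, ∀ h s, B.value E π h s ≤ B.value E (B.star E) h s
  /-- Occupancy densities are uniformly bounded. -/
  bounded : ∃ M : NNReal, ∀ E, ∀ π ∈ B.Pol, ∀ h, ∀ᵐ x ∂(B.base h), B.occDensity E π h x ≤ M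
  /-- The space of environments is convex. -/
  convexP : ∀ h (θ θ' : TP h), ∀ t ∈ Icc (0 : ℝ) 1, ∃ θ'' : TP h, ∀ s a, ∀ᵐ s' ∂B.μS,
    B.p h θ'' s a s' = t * B.p h θ s a s' + (1 - t) * B.p h θ' s a s'
  convexR : ∀ h (θ θ' : TR h), ∀ t ∈ Icc (0 : ℝ) 1, ∃ θ'' : TR h, ∀ s a,
    ∀ᵐ x ∂(volume.restrict (Icc (0 : ℝ) 1)),
      B.r h θ'' s a x = t * B.r h θ s a x + (1 - t) * B.r h θ' s a x
  /-- The value diameter is a random variable. -/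
  diameter_measurable : Measurable B.valueDiameter

/-- In almost every environment, the optimal policy visits almost every state-action pair at every
layer. -/
def VisitsAll : Prop :=
  ∀ᵐ E ∂B.prior, ∀ h, ∀ᵐ x ∂(B.base h), B.occDensity E (B.star E) h x ≠ 0

end Occupancy

/-! ### Thompson sampling -/

lemma measurable_trajDensity (h₀ : Fin H) (s : S) :
    Measurable fun x : (B.Env × B.Env) × Traj S A H =>
      B.trajDensity x.1.1 (B.star x.1.2) h₀ s x.2 := by
  have hst : ∀ h, Measurable fun x : (B.Env × B.Env) × Traj S A H => stateAt h₀ s x.2 h := by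
    intro h
    unfold stateAt
    split_ifs <;> fun_prop
  unfold trajDensity
  refine Finset.measurable_prod _ fun h _ => ENNReal.measurable_ofReal.comp ?_
  refine ((?_ : Measurable _).mul ?_).mul ?_
  · exact (B.star_measurable h).comp
      (f := fun x : (B.Env × B.Env) × Traj S A H => (x.1.2, stateAt h₀ s x.2 h, (x.2 h).1))
      (by have := hst h; fun_prop)
  · exact (B.r_measurable h).comp
      (f := fun x : (B.Env × B.Env) × Traj S A H =>
        ((x.1.1 h).2, stateAt h₀ s x.2 h, (x.2 h).1, (x.2 h).2.1))
      (by have := hst h; fun_prop)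
  · exact (B.p_measurable h).comp
      (f := fun x : (B.Env × B.Env) × Traj S A H =>
        ((x.1.1 h).1, stateAt h₀ s x.2 h, (x.2 h).1, (x.2 h).2.2))
      (by have := hst h; fun_prop)

instance : SigmaFinite B.refMeasure := by unfold refMeasure; infer_instance

section TS

variable [NeZero H]

/-- Law of an episode in the true environment `x.1` under the optimal policy of the sampled
environment `x.2`. -/
def episodeKernel : Kernel (B.Env × B.Env) (Traj S A H) where
  toFun x := B.trajLaw x.1 (B.star x.2) 0 B.s₁
  measurable' := by
    refine Measure.measurable_of_measurable_coe _ fun s hs => ?_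
    simp_rw [trajLaw, withDensity_apply _ hs]
    exact (B.measurable_trajDensity 0 B.s₁).lintegral_prod_right'

/-- The same, as a kernel from (history, true environment, sampled environment). -/
def stepKernel (ℓ : ℕ) : Kernel ((Fin ℓ → Traj S A H) × B.Env × B.Env) (Traj S A H) :=
  B.episodeKernel.comap Prod.snd measurable_snd

/-- The history of the first `ℓ` episodes. -/
def hist {Ω : Type*} (epi : ℕ → Ω → Traj S A H) (ℓ : ℕ) (ω : Ω) : Fin ℓ → Traj S A H :=
  fun i => epi i ω

/-- The interaction of Thompson sampling with a random environment: `env` is the true environment,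
`smp ℓ` the environment sampled in episode `ℓ` and `epi ℓ` the episode observed then, in which
the optimal policy of `smp ℓ` is played (episodes are numbered from `0`). -/
structure IsTSRun {Ω : Type*} [MeasurableSpace Ω] (P : Measure Ω) (env : Ω → B.Env)
    (smp : ℕ → Ω → B.Env) (epi : ℕ → Ω → Traj S A H) : Prop where
  /-- The true environment is drawn from the prior. -/
  env_law : HasLaw env B.prior P
  /-- Given the history, the sampled environment and the true one are independent and distributed
  according to the posterior `q`. -/
  sample : ∀ ℓ, ∃ q : Kernel (Fin ℓ → Traj S A H) B.Env, IsMarkovKernel q ∧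
    HasCondDistrib (fun ω => (env ω, smp ℓ ω)) (hist epi ℓ) (q ×ₖ q) P
  /-- Given the past, the episode follows the law of the true environment and the policy played. -/
  episode : ∀ ℓ, HasCondDistrib (epi ℓ) (fun ω => (hist epi ℓ ω, env ω, smp ℓ ω))
    (B.stepKernel ℓ) P

/-- The Bayesian regret of Thompson sampling over `L` episodes. -/
def bayesRegret {Ω : Type*} [MeasurableSpace Ω] (P : Measure Ω) (env : Ω → B.Env)
    (smp : ℕ → Ω → B.Env) (L : ℕ) : ℝ :=
  ∑ ℓ ∈ Finset.range L, ∫ ω,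
    (B.value (env ω) (B.star (env ω)) 0 B.s₁ - B.value (env ω) (B.star (smp ℓ ω)) 0 B.s₁) ∂P

/-- There is a strongly consistent estimator of the true environment given the history: for almost
every environment and almost every infinite history in it, the estimates converge to it. -/
def HasConsistentEstimator [∀ h, TopologicalSpace (TP h)] [∀ h, TopologicalSpace (TR h)]
    {Ω : Type*} [MeasurableSpace Ω] (P : Measure Ω) (env : Ω → B.Env)
    (epi : ℕ → Ω → Traj S A H) : Prop :=
  ∃ T : ∀ ℓ : ℕ, (Fin ℓ → Traj S A H) → B.Env, (∀ ℓ, Measurable (T ℓ)) ∧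
    ∀ᵐ ω ∂P, Tendsto (fun ℓ => T ℓ (hist epi ℓ ω)) atTop (𝓝 (env ω))

/-! ### Value partitions and dimensions -/

/-- `ζ` is the index map of a layered `ε`-value partition into `K` cells: within a cell, layers are
independent of each other under the prior. -/
structure IsLayeredPartition (ε : ℝ) (K : ℕ) (ζ : B.Env → Fin K) : Prop where
  measurable : Measurable ζ
  value_le : ∀ E E', ζ E = ζ E' →
    B.value E (B.star E) 0 B.s₁ - B.value E' (B.star E) 0 B.s₁ ≤ ε
  layered : ∀ k, B.prior (ζ ⁻¹' {k}) ≠ 0 →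
    iIndepFun (fun h (E : B.Env) => E h) (ProbabilityTheory.cond B.prior (ζ ⁻¹' {k}))

/-- The smallest number of cells of a layered `ε`-value partition (`⊤` if there is none). -/
def Ksurr (ε : ℝ) : ℕ∞ :=
  ⨅ (K : ℕ) (_ : ∃ ζ : B.Env → Fin K, B.IsLayeredPartition ε K ζ), (K : ℕ∞)

end TS

/-- The `l₁`-distance of two transition functions. -/
def l1P (h : Fin H) (θ θ' : TP h) : ENNReal :=
  ⨆ (s : S) (a : A), ∫⁻ s', ENNReal.ofReal |B.p h θ s a s' - B.p h θ' s a s'| ∂B.μS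

/-- The `l₁`-distance of two reward functions. -/
def l1R (h : Fin H) (θ θ' : TR h) : ENNReal :=
  ⨆ (s : S) (a : A), ∫⁻ x in Icc (0 : ℝ) 1, ENNReal.ofReal |B.r h θ s a x - B.r h θ' s a x|

/-- Covering number of a set for a distance, with centres in the set. -/
def covNum {X : Type*} (d : X → X → ENNReal) (ε : ℝ) : ℕ∞ :=
  ⨅ (C : Finset X) (_ : ∀ x, ∃ c ∈ C, d x c ≤ ENNReal.ofReal ε), (C.card : ℕ∞)

/-- Kolmogorov dimension of a set for a distance. -/
def kolDim {X : Type*} (d : X → X → ENNReal) : EReal :=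
  limsup (fun ε : ℝ =>
    ENNReal.log ((covNum d ε : ℕ∞) : ENNReal) / ((Real.log (1 / ε) : ℝ) : EReal)) (𝓝[>] 0)

/-- The `l₁`-dimension of a layer. -/
def dimLayer (h : Fin H) : EReal := kolDim (B.l1P h) + kolDim (B.l1R h)

/-- The `l₁`-dimension of the space of environments. -/
def dimL1 : EReal := ∑ h, B.dimLayer h

/-- Measurability of the `l₁`-distance to a point. -/
def L1Measurable : Prop :=
  (∀ h θ₀, Measurable fun θ => B.l1P h θ θ₀) ∧ ∀ h θ₀, Measurable fun θ => B.l1R h θ θ₀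

end BayesRL

end

set_option linter.unusedSectionVars false

noncomputable section

/-! ### Integration over products -/

lemma lintegral_pi_update {ι : Type*} [Fintype ι] [DecidableEq ι] {X : ι → Type*}
    [∀ i, MeasurableSpace (X i)] (μ : ∀ i, Measure (X i)) [∀ i, IsProbabilityMeasure (μ i)]
    (i : ι) {F : (∀ i, X i) → ENNReal} (hF : Measurable F) :
    ∫⁻ τ, F τ ∂(Measure.pi μ) = ∫⁻ τ, ∫⁻ y, F (Function.update τ i y) ∂(μ i) ∂(Measure.pi μ) := by
  have hm : Measurable fun τ => ∫⁻ y, F (Function.update τ i y) ∂(μ i) := by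
    refine Measurable.lintegral_prod_right' (f := fun x : (∀ i, X i) × X i =>
      F (Function.update x.1 i x.2)) (hF.comp ?_)
    exact measurable_update'
  refine lintegral_eq_of_lmarginal_eq {i} hF hm ?_
  rw [lmarginal_singleton, lmarginal_singleton]
  funext τ
  simp

lemma lintegral_prod_of_iIndepFun {ι : Type*} [Fintype ι] {X : ι → Type*}
    [∀ i, MeasurableSpace (X i)] {μ : Measure (∀ i, X i)} [IsProbabilityMeasure μ]
    (h : iIndepFun (fun i (x : ∀ i, X i) => x i) μ) {f : ∀ i, X i → ENNReal}
    (hf : ∀ i, Measurable (f i)) :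
    ∫⁻ x, ∏ i, f i (x i) ∂μ = ∏ i, ∫⁻ x, f i (x i) ∂μ := by
  have := lintegral_prod_eq_prod_lintegral_of_indepFun Finset.univ
    (fun i (x : ∀ i, X i) => f i (x i)) (h.comp f hf)
    (fun i => (hf i).comp (measurable_pi_apply i))
  simpa [Finset.prod_apply] using this

/-- Independence of the coordinates is preserved under product densities. -/
lemma iIndepFun_smul_withDensity_prod {ι : Type*} [Fintype ι] {X : ι → Type*}
    [∀ i, MeasurableSpace (X i)] {μ : Measure (∀ i, X i)} [IsProbabilityMeasure μ]
    (h : iIndepFun (fun i (x : ∀ i, X i) => x i) μ) {f : ∀ i, X i → ENNReal}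
    (hf : ∀ i, Measurable (f i)) {c : ENNReal}
    (hc : IsProbabilityMeasure (c • μ.withDensity fun x => ∏ i, f i (x i))) :
    iIndepFun (fun i (x : ∀ i, X i) => x i) (c • μ.withDensity fun x => ∏ i, f i (x i)) := by
  classical
  set F : ι → ENNReal := fun i => ∫⁻ x, f i (x i) ∂μ with hF
  have hbox : ∀ A : ∀ i, Set (X i), (∀ i, MeasurableSet (A i)) →
      (c • μ.withDensity fun x => ∏ i, f i (x i)) (⋂ i, (fun x : ∀ i, X i => x i) ⁻¹' A i)
        = c * ∏ i, ∫⁻ x, (A i).indicator (f i) (x i) ∂μ := by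
    intro A hA
    have hmeas : MeasurableSet (⋂ i, (fun x : ∀ i, X i => x i) ⁻¹' A i) :=
      MeasurableSet.iInter fun i => measurable_pi_apply i (hA i)
    rw [Measure.smul_apply, withDensity_apply _ hmeas, ← lintegral_indicator hmeas,
      ← lintegral_prod_of_iIndepFun h (fun i => (hf i).indicator (hA i)), smul_eq_mul]
    congr 1
    refine lintegral_congr fun x => ?_
    by_cases hx : x ∈ ⋂ i, (fun x : ∀ i, X i => x i) ⁻¹' A i
    · rw [indicator_of_mem hx]
      refine Finset.prod_congr rfl fun i _ => ?_
      exact (indicator_of_mem (show x i ∈ A i from mem_iInter.1 hx i) _).symm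
    · rw [indicator_of_notMem hx]
      simp only [mem_iInter, not_forall] at hx
      obtain ⟨i, hi⟩ := hx
      exact (Finset.prod_eq_zero (Finset.mem_univ i) (indicator_of_notMem (show x i ∉ A i from hi) _)).symm
  have htot : c * ∏ i, F i = 1 := by
    have := hbox (fun _ => univ) (fun _ => MeasurableSet.univ)
    simp only [preimage_univ, iInter_univ, measure_univ, indicator_univ] at this
    exact this.symm
  have hP0 : ∏ i, F i ≠ 0 := by
    intro h0; rw [h0, mul_zero] at htot; exact zero_ne_one htot
  have hc0 : c ≠ 0 := by rintro rfl; rw [zero_mul] at htot; exact zero_ne_one htot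
  have hPt : ∏ i, F i ≠ ⊤ := by
    intro h0; rw [h0, ENNReal.mul_top hc0] at htot; exact ENNReal.top_ne_one htot
  have hF0 : ∀ i, F i ≠ 0 := fun i => Finset.prod_ne_zero_iff.1 hP0 i (Finset.mem_univ i)
  have hFt : ∀ i, F i ≠ ⊤ := by
    intro i hi
    apply hPt
    rw [← Finset.mul_prod_erase _ _ (Finset.mem_univ i), hi]
    exact ENNReal.top_mul (Finset.prod_ne_zero_iff.2 fun j _ => hF0 j)
  have hcF : c = ∏ i, (F i)⁻¹ := by
    rw [← ENNReal.prod_inv_distrib (fun i _ j _ _ => Or.inl (hF0 i))]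
    exact ENNReal.eq_inv_of_mul_eq_one_left htot
  have hnorm : ∀ A : ∀ i, Set (X i), (∀ i, MeasurableSet (A i)) →
      (c • μ.withDensity fun x => ∏ i, f i (x i)) (⋂ i, (fun x : ∀ i, X i => x i) ⁻¹' A i)
        = ∏ i, ((F i)⁻¹ * ∫⁻ x, (A i).indicator (f i) (x i) ∂μ) := by
    intro A hA
    rw [hbox A hA, hcF, Finset.prod_mul_distrib]
  have hone : ∀ i, (F i)⁻¹ * ∫⁻ x, (univ : Set (X i)).indicator (f i) (x i) ∂μ = 1 := by
    intro i
    simp only [indicator_univ]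
    exact ENNReal.inv_mul_cancel (hF0 i) (hFt i)
  rw [iIndepFun_iff_measure_inter_preimage_eq_mul]
  intro T A hA
  set A' : ∀ i, Set (X i) := fun i => if i ∈ T then A i else univ with hA'
  have hA'm : ∀ i, MeasurableSet (A' i) := by
    intro i; simp only [hA']; split_ifs with hi
    · exact hA i hi
    · exact MeasurableSet.univ
  have e1 : (⋂ i ∈ T, (fun x : ∀ i, X i => x i) ⁻¹' A i)
      = ⋂ i, (fun x : ∀ i, X i => x i) ⁻¹' A' i := by
    ext x
    simp only [mem_iInter, mem_preimage, hA']
    refine forall_congr' fun i => ?_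
    split_ifs with hi <;> simp [hi]
  have e2 : ∀ i ∈ T, (c • μ.withDensity fun x => ∏ i, f i (x i))
      ((fun x : ∀ i, X i => x i) ⁻¹' A i)
      = (F i)⁻¹ * ∫⁻ x, (A i).indicator (f i) (x i) ∂μ := by
    intro i hi
    set A'' : ∀ j, Set (X j) := fun j => if h : j = i then h ▸ A i else univ with hA''
    have hAm : ∀ j, MeasurableSet (A'' j) := by
      intro j; simp only [hA'']; split_ifs with hj
      · subst hj; exact hA j hi
      · exact MeasurableSet.univ
    have e3 : (fun x : ∀ i, X i => x i) ⁻¹' A i = ⋂ j, (fun x : ∀ i, X i => x j) ⁻¹' A'' j := by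
      ext x
      simp only [mem_iInter, mem_preimage, hA'']
      constructor
      · intro hx j
        split_ifs with hj
        · subst hj; exact hx
        · trivial
      · intro hx
        simpa using hx i
    rw [e3, hnorm A'' hAm, Finset.prod_eq_single i]
    · simp [hA'']
    · intro j _ hj
      have : A'' j = univ := by simp [hA'', hj]
      rw [this]; exact hone j
    · simp
  rw [e1, hnorm A' hA'm, Finset.prod_congr rfl e2,
    ← Finset.prod_subset (Finset.subset_univ T)]
  · refine Finset.prod_congr rfl fun i hi => ?_
    simp [hA', hi]
  · intro i _ hi
    have : A' i = univ := by simp [hA', hi]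
    rw [this]; exact hone i

/-! ### Absolute differences and triangular discrimination in `ENNReal` -/

/-- The absolute difference of extended nonnegative reals. -/
def absDiff (a b : ENNReal) : ENNReal := (a - b) + (b - a)

lemma absDiff_comm (a b : ENNReal) : absDiff a b = absDiff b a := add_comm _ _

@[simp] lemma absDiff_self (a : ENNReal) : absDiff a a = 0 := by simp [absDiff]

lemma le_add_absDiff (a b : ENNReal) : a ≤ b + absDiff a b :=
  le_add_tsub.trans (add_le_add le_rfl le_self_add)

lemma absDiff_le_of_le {a b c : ENNReal} (h₁ : a ≤ b + c) (h₂ : b ≤ a + c) : absDiff a b ≤ c := by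
  rcases le_total a b with h | h
  · simp only [absDiff, tsub_eq_zero_of_le h, zero_add]; exact tsub_le_iff_left.2 h₂
  · simp only [absDiff, tsub_eq_zero_of_le h, add_zero]; exact tsub_le_iff_left.2 h₁

lemma absDiff_triangle (a b c : ENNReal) : absDiff a c ≤ absDiff a b + absDiff b c := by
  refine absDiff_le_of_le ?_ ?_
  · calc a ≤ b + absDiff a b := le_add_absDiff a b
      _ ≤ (c + absDiff b c) + absDiff a b := add_le_add (le_add_absDiff b c) le_rfl
      _ = _ := by ring
  · calc c ≤ b + absDiff b c := by rw [absDiff_comm]; exact le_add_absDiff c b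
      _ ≤ (a + absDiff a b) + absDiff b c :=
        add_le_add (by rw [absDiff_comm]; exact le_add_absDiff b a) le_rfl
      _ = _ := by ring

lemma absDiff_le_max (a b : ENNReal) : absDiff a b ≤ max a b := by
  refine absDiff_le_of_le ?_ ?_
  · exact (le_max_left a b).trans le_add_self
  · exact (le_max_right a b).trans le_add_self

lemma absDiff_le_add (a b : ENNReal) : absDiff a b ≤ a + b :=
  add_le_add tsub_le_self tsub_le_self

lemma absDiff_mul_left (a b c : ENNReal) : absDiff (c * a) (c * b) ≤ c * absDiff a b := by
  refine absDiff_le_of_le ?_ ?_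
  · rw [← mul_add]; exact mul_le_mul_right (le_add_absDiff a b) c
  · rw [← mul_add, absDiff_comm]; exact mul_le_mul_right (le_add_absDiff b a) c

lemma absDiff_mul_le (a b a' b' : ENNReal) :
    absDiff (a * b) (a' * b') ≤ absDiff a a' * b + a' * absDiff b b' := by
  refine (absDiff_triangle _ (a' * b) _).trans (add_le_add ?_ (absDiff_mul_left _ _ _))
  rw [mul_comm a, mul_comm a', mul_comm _ b]
  exact absDiff_mul_left _ _ _

lemma absDiff_add_le (a b a' b' : ENNReal) :
    absDiff (a + b) (a' + b') ≤ absDiff a a' + absDiff b b' := by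
  refine absDiff_le_of_le ?_ ?_
  · calc a + b ≤ (a' + absDiff a a') + (b' + absDiff b b') :=
        add_le_add (le_add_absDiff _ _) (le_add_absDiff _ _)
      _ = _ := by ring
  · calc a' + b' ≤ (a + absDiff a' a) + (b + absDiff b' b) :=
        add_le_add (le_add_absDiff _ _) (le_add_absDiff _ _)
      _ = _ := by rw [absDiff_comm a', absDiff_comm b']; ring

@[fun_prop]
lemma Measurable.absDiff {X : Type*} [MeasurableSpace X] {f g : X → ENNReal} (hf : Measurable f)
    (hg : Measurable g) : Measurable fun x => absDiff (f x) (g x) :=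
  (hf.sub hg).add (hg.sub hf)

lemma absDiff_lintegral_le {X : Type*} [MeasurableSpace X] {μ : Measure X} {f g : X → ENNReal}
    (hf : Measurable f) (hg : Measurable g) :
    absDiff (∫⁻ x, f x ∂μ) (∫⁻ x, g x ∂μ) ≤ ∫⁻ x, absDiff (f x) (g x) ∂μ := by
  refine absDiff_le_of_le ?_ ?_
  · rw [← lintegral_add_left hg]
    exact lintegral_mono fun x => le_add_absDiff _ _
  · rw [← lintegral_add_left hf]
    refine lintegral_mono fun x => ?_
    simp only []
    rw [absDiff_comm]; exact le_add_absDiff _ _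

lemma absDiff_ofReal {a b : ℝ} (ha : 0 ≤ a) (hb : 0 ≤ b) :
    absDiff (ENNReal.ofReal a) (ENNReal.ofReal b) = ENNReal.ofReal |a - b| := by
  unfold absDiff
  rw [← ENNReal.ofReal_sub _ hb, ← ENNReal.ofReal_sub _ ha]
  rcases le_total a b with h | h
  · rw [ENNReal.ofReal_of_nonpos (sub_nonpos.2 h), zero_add, abs_sub_comm,
      abs_of_nonneg (sub_nonneg.2 h)]
  · rw [ENNReal.ofReal_of_nonpos (sub_nonpos.2 h), add_zero, abs_of_nonneg (sub_nonneg.2 h)]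

/-- The density of the triangular discrimination. -/
def triDisc (p q : ENNReal) : ENNReal := absDiff p q ^ 2 / (p + q)

@[fun_prop]
lemma Measurable.triDisc {X : Type*} [MeasurableSpace X] {f g : X → ENNReal} (hf : Measurable f)
    (hg : Measurable g) : Measurable fun x => triDisc (f x) (g x) :=
  ((hf.absDiff hg).pow_const 2).div (hf.add hg)

lemma triDisc_ofReal {a b : ℝ} (ha : 0 ≤ a) (hb : 0 ≤ b) :
    triDisc (ENNReal.ofReal a) (ENNReal.ofReal b) = ENNReal.ofReal ((a - b) ^ 2 / (a + b)) := by
  unfold triDisc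
  rw [absDiff_ofReal ha hb]
  rcases eq_or_lt_of_le (add_nonneg ha hb) with h | h
  · have h1 : a = 0 := by linarith
    have h2 : b = 0 := by linarith
    simp [h1, h2]
  · rw [← ENNReal.ofReal_add ha hb, ENNReal.ofReal_div_of_pos h,
      ← ENNReal.ofReal_pow (abs_nonneg _), sq_abs]

lemma sub_one_sub_log_ge {t : ℝ} (ht : 0 < t) :
    (t - 1) ^ 2 / (2 * (t + 1)) ≤ t - 1 - Real.log t := by
  set g : ℝ → ℝ := fun t => t - 1 - Real.log t - (t - 1) ^ 2 / (2 * (t + 1)) with hg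
  have hd : ∀ x : ℝ, 0 < x →
      HasDerivAt g ((x - 1) * (x ^ 2 + x + 2) / (2 * x * (x + 1) ^ 2)) x := by
    intro x hx
    have h1 : HasDerivAt (fun t : ℝ => t - 1 - Real.log t) (1 - x⁻¹) x :=
      ((hasDerivAt_id x).sub_const 1).sub (Real.hasDerivAt_log hx.ne')
    have h2 : HasDerivAt (fun t : ℝ => (t - 1) ^ 2) (2 * (x - 1)) x := by
      have := ((hasDerivAt_id x).sub_const 1).fun_pow 2
      simpa using this
    have h3 : HasDerivAt (fun t : ℝ => 2 * (t + 1)) 2 x := by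
      simpa using ((hasDerivAt_id x).add_const 1).const_mul 2
    have h4 := h1.sub (h2.div h3 (by positivity))
    refine h4.congr_deriv ?_
    field_simp
    ring
  have hcont : ContinuousOn g (Ioi 0) := fun x hx => (hd x hx).continuousAt.continuousWithinAt
  have g1 : g 1 = 0 := by simp [hg]
  suffices 0 ≤ g t by simp only [hg] at this; linarith
  rw [← g1]
  rcases le_total t 1 with h | h
  · have hanti : AntitoneOn g (Icc t 1) := by
      refine antitoneOn_of_deriv_nonpos (convex_Icc _ _)
        (hcont.mono fun x hx => lt_of_lt_of_le ht hx.1) ?_ ?_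
      · intro x hx
        rw [interior_Icc] at hx
        exact (hd x (ht.trans hx.1)).differentiableAt.differentiableWithinAt
      · intro x hx
        rw [interior_Icc] at hx
        have hx0 : 0 < x := ht.trans hx.1
        rw [(hd x hx0).deriv]
        refine div_nonpos_of_nonpos_of_nonneg ?_ (by positivity)
        exact mul_nonpos_of_nonpos_of_nonneg (by linarith [hx.2]) (by positivity)
    exact hanti (left_mem_Icc.2 h) (right_mem_Icc.2 h) h
  · have hmono : MonotoneOn g (Icc 1 t) := by
      refine monotoneOn_of_deriv_nonneg (convex_Icc _ _)
        (hcont.mono fun x hx => lt_of_lt_of_le one_pos hx.1) ?_ ?_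
      · intro x hx
        rw [interior_Icc] at hx
        exact (hd x (one_pos.trans hx.1)).differentiableAt.differentiableWithinAt
      · intro x hx
        rw [interior_Icc] at hx
        have hx0 : 0 < x := one_pos.trans hx.1
        rw [(hd x hx0).deriv]
        refine div_nonneg ?_ (by positivity)
        exact mul_nonneg (by linarith [hx.1]) (by positivity)
    exact hmono (left_mem_Icc.2 h) (right_mem_Icc.2 h) h

lemma mul_log_div_ge {p q : ℝ} (hp : 0 < p) (hq : 0 < q) :
    p - q + (p - q) ^ 2 / (2 * (p + q)) ≤ p * Real.log (p / q) := by
  have h := mul_le_mul_of_nonneg_left (sub_one_sub_log_ge (div_pos hq hp)) hp.le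
  have e1 : p * ((q / p - 1) ^ 2 / (2 * (q / p + 1))) = (p - q) ^ 2 / (2 * (p + q)) := by
    field_simp; ring
  have e2 : Real.log (p / q) = - Real.log (q / p) := by
    rw [← Real.log_inv, inv_div]
  have e3 : p * (q / p - 1 - Real.log (q / p)) = q - p - p * Real.log (q / p) := by
    field_simp
  rw [e1, e3] at h
  rw [e2]; linarith

/-- Relative entropy dominates triangular discrimination. -/
lemma lintegral_log_add_triDisc_le {X : Type*} [MeasurableSpace X] {μ : Measure X}
    {p q : X → ENNReal} (hp : Measurable p) (hq : Measurable q) (hp1 : ∫⁻ x, p x ∂μ = 1)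
    (hq1 : ∫⁻ x, q x ∂μ = 1) {b : ℝ} (hb : 0 ≤ b)
    (hpq : ∀ᵐ x ∂μ, p x ≤ ENNReal.ofReal (Real.exp b) * q x) :
    ∫⁻ x, p x * ENNReal.ofReal (b - Real.log (p x / q x).toReal) ∂μ
      + 2⁻¹ * ∫⁻ x, triDisc (p x) (q x) ∂μ ≤ ENNReal.ofReal b := by
  have hpt : ∀ᵐ x ∂μ, p x < ⊤ := ae_lt_top hp (by rw [hp1]; exact ENNReal.one_ne_top)
  have hqt : ∀ᵐ x ∂μ, q x < ⊤ := ae_lt_top hq (by rw [hq1]; exact ENNReal.one_ne_top)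
  have key : ∀ᵐ x ∂μ, p x * ENNReal.ofReal (b - Real.log (p x / q x).toReal)
      + 2⁻¹ * triDisc (p x) (q x) + p x ≤ ENNReal.ofReal b * p x + q x := by
    filter_upwards [hpt, hqt, hpq] with x hx1 hx2 hx3
    rw [← ENNReal.ofReal_toReal hx1.ne, ← ENNReal.ofReal_toReal hx2.ne] at hx3 ⊢
    set a := (p x).toReal
    set c := (q x).toReal
    have ha : 0 ≤ a := ENNReal.toReal_nonneg
    have hc : 0 ≤ c := ENNReal.toReal_nonneg
    rw [triDisc_ofReal ha hc]
    have h2 : (2⁻¹ : ENNReal) = ENNReal.ofReal (2⁻¹) := by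
      rw [ENNReal.ofReal_inv_of_pos (by norm_num)]; simp
    have htri : 0 ≤ (a - c) ^ 2 / (a + c) := by positivity
    rcases eq_or_lt_of_le ha with h0 | h0
    · rw [← h0]
      simp only [ENNReal.ofReal_zero, zero_mul, zero_add, add_zero, mul_zero, zero_sub]
      rw [h2, ← ENNReal.ofReal_mul (by norm_num)]
      refine ENNReal.ofReal_le_ofReal ?_
      rcases eq_or_lt_of_le hc with h1 | h1
      · simp [← h1]
      · rw [neg_sq, sq, mul_div_assoc, div_self h1.ne']; linarith
    · rw [← ENNReal.ofReal_mul (Real.exp_pos _).le] at hx3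
      have hc0 : 0 < c := by
        by_contra hcon
        have : c = 0 := le_antisymm (not_lt.1 hcon) hc
        rw [this] at hx3; simp at hx3; linarith
      have hac : a ≤ Real.exp b * c := (ENNReal.ofReal_le_ofReal_iff (by positivity)).1 hx3
      rw [← ENNReal.ofReal_div_of_pos hc0, ENNReal.toReal_ofReal (by positivity)]
      have hlog : Real.log (a / c) ≤ b := by
        rw [Real.log_le_iff_le_exp (by positivity), div_le_iff₀ hc0]; exact hac
      rw [h2, ← ENNReal.ofReal_mul ha, ← ENNReal.ofReal_mul (by norm_num),
        ← ENNReal.ofReal_mul hb, ← ENNReal.ofReal_add (mul_nonneg ha (by linarith)) (by positivity),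
        ← ENNReal.ofReal_add (add_nonneg (mul_nonneg ha (by linarith)) (by positivity)) ha,
        ← ENNReal.ofReal_add (by positivity) hc]
      refine ENNReal.ofReal_le_ofReal ?_
      have := mul_log_div_ge h0 hc0
      have e : (a - c) ^ 2 / (2 * (a + c)) = 2⁻¹ * ((a - c) ^ 2 / (a + c)) := by
        field_simp
      rw [e] at this
      nlinarith
  have hm : Measurable fun x => p x * ENNReal.ofReal (b - Real.log (p x / q x).toReal) :=
    hp.mul (by have := hp.div hq; fun_prop)
  have hm2 : Measurable fun x => 2⁻¹ * triDisc (p x) (q x) := (hp.triDisc hq).const_mul _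
  have hI := lintegral_mono_ae key
  rw [lintegral_add_right _ hp, lintegral_add_left hm, lintegral_const_mul _ (hp.triDisc hq),
    lintegral_add_left (hp.const_mul _), lintegral_const_mul _ hp, hp1, hq1, mul_one] at hI
  exact (ENNReal.add_le_add_iff_right ENNReal.one_ne_top).1 hI

end

noncomputable section

/-! ### Layered decision processes given by densities -/

/-- Reference measures and initial state of a layered decision process. -/
structure MDPBase (S A : Type*) [MeasurableSpace S] [MeasurableSpace A] where
  μS : Measure S
  μA : Measure A
  lam : Measure ℝ
  s₁ : S
  [probS : IsProbabilityMeasure μS]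
  [probA : IsProbabilityMeasure μA]
  [probL : IsProbabilityMeasure lam]

namespace MDPBase

attribute [instance] probS probA probL

variable {S A : Type*} [MeasurableSpace S] [MeasurableSpace A]

/-- Joint densities of the reward and the next state, layer by layer. -/
abbrev Trans (S A : Type*) : Type _ := ℕ → S → A → ℝ × S → ENNReal

/-- Action densities, layer by layer. -/
abbrev Policy (S A : Type*) : Type _ := ℕ → S → A → ENNReal

variable (b : MDPBase S A)

/-- The reference measure on pairs of a reward and a next state. -/
def ν : Measure (ℝ × S) := b.lam.prod b.μS

instance : IsProbabilityMeasure b.ν := by unfold ν; infer_instance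

/-- The reference measure on states at a layer. -/
def baseS (h : ℕ) : Measure S := if h = 0 then Measure.dirac b.s₁ else b.μS

instance (h : ℕ) : IsProbabilityMeasure (b.baseS h) := by unfold baseS; split_ifs <;> infer_instance

/-- `Q` consists of jointly measurable probability densities. -/
structure IsTrans (Q : Trans S A) : Prop where
  meas : ∀ n, Measurable fun x : S × A × (ℝ × S) => Q n x.1 x.2.1 x.2.2
  prob : ∀ n s a, ∫⁻ z, Q n s a z ∂b.ν = 1

/-- `π` consists of jointly measurable probability densities. -/
structure IsPolicy (π : Policy S A) : Prop where
  meas : ∀ n, Measurable fun x : S × A => π n x.1 x.2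
  prob : ∀ n s, ∫⁻ a, π n s a ∂b.μA = 1

/-- Expectation of the sum of `F` over the `n` layers that follow the start in `s` at layer `h`. -/
def acc (Q : Trans S A) (π : Policy S A) (F : Trans S A) : ℕ → ℕ → S → ENNReal
  | 0, _, _ => 0
  | n + 1, h, s => ∫⁻ a, π h s a * ∫⁻ z, Q h s a z * (F h s a z + acc Q π F n (h + 1) z.2) ∂b.ν ∂b.μA

/-- Occupancy density of the states at a layer. -/
def stateOcc (Q : Trans S A) (π : Policy S A) : ℕ → S → ENNReal
  | 0, _ => 1
  | h + 1, s' => ∫⁻ s, ∫⁻ a, ∫⁻ x, stateOcc Q π h s * π h s a * Q h s a (x, s')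
      ∂b.lam ∂b.μA ∂(b.baseS h)

/-- Occupancy density of the state-action pairs at a layer. -/
def occ (Q : Trans S A) (π : Policy S A) (h : ℕ) (s : S) (a : A) : ENNReal :=
  b.stateOcc Q π h s * π h s a

section Measurability

variable {X : Type*} [MeasurableSpace X] {Q : X → Trans S A} {π : X → Policy S A}
  {F : X → Trans S A}

lemma measurable_acc (hQ : ∀ n, Measurable fun y : X × S × A × (ℝ × S) =>
      Q y.1 n y.2.1 y.2.2.1 y.2.2.2)
    (hπ : ∀ n, Measurable fun y : X × S × A => π y.1 n y.2.1 y.2.2)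
    (hF : ∀ n, Measurable fun y : X × S × A × (ℝ × S) => F y.1 n y.2.1 y.2.2.1 y.2.2.2)
    (n h : ℕ) : Measurable fun y : X × S => b.acc (Q y.1) (π y.1) (F y.1) n h y.2 := by
  induction n generalizing h with
  | zero => exact measurable_const
  | succ n ih =>
    have h1 := hQ h
    have h2 := hπ h
    have h3 := hF h
    have h4 := ih (h + 1)
    simp only [acc]
    refine Measurable.lintegral_prod_right' (f := fun w : (X × S) × A => π w.1.1 h w.1.2 w.2 *
      ∫⁻ z, Q w.1.1 h w.1.2 w.2 z *
        (F w.1.1 h w.1.2 w.2 z + b.acc (Q w.1.1) (π w.1.1) (F w.1.1) n (h + 1) z.2) ∂b.ν) ?_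
    refine (h2.comp (f := fun w : (X × S) × A => (w.1.1, w.1.2, w.2)) (by fun_prop)).mul ?_
    refine Measurable.lintegral_prod_right' (f := fun v : ((X × S) × A) × (ℝ × S) =>
      Q v.1.1.1 h v.1.1.2 v.1.2 v.2 *
        (F v.1.1.1 h v.1.1.2 v.1.2 v.2
          + b.acc (Q v.1.1.1) (π v.1.1.1) (F v.1.1.1) n (h + 1) v.2.2)) ?_
    refine Measurable.mul ?_ (Measurable.add ?_ ?_)
    · exact h1.comp (f := fun v : ((X × S) × A) × (ℝ × S) =>
        (v.1.1.1, v.1.1.2, v.1.2, v.2)) (by fun_prop)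
    · exact h3.comp (f := fun v : ((X × S) × A) × (ℝ × S) =>
        (v.1.1.1, v.1.1.2, v.1.2, v.2)) (by fun_prop)
    · exact h4.comp (f := fun v : ((X × S) × A) × (ℝ × S) => (v.1.1.1, v.2.2)) (by fun_prop)

lemma measurable_stateOcc (hQ : ∀ n, Measurable fun y : X × S × A × (ℝ × S) =>
      Q y.1 n y.2.1 y.2.2.1 y.2.2.2)
    (hπ : ∀ n, Measurable fun y : X × S × A => π y.1 n y.2.1 y.2.2) (h : ℕ) :
    Measurable fun y : X × S => b.stateOcc (Q y.1) (π y.1) h y.2 := by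
  induction h with
  | zero => exact measurable_const
  | succ h ih =>
    have h1 := hQ h
    have h2 := hπ h
    simp only [stateOcc]
    refine Measurable.lintegral_prod_right' (f := fun w : (X × S) × S =>
      ∫⁻ a, ∫⁻ x, b.stateOcc (Q w.1.1) (π w.1.1) h w.2 * π w.1.1 h w.2 a
        * Q w.1.1 h w.2 a (x, w.1.2) ∂b.lam ∂b.μA) ?_
    refine Measurable.lintegral_prod_right' (f := fun w : ((X × S) × S) × A =>
      ∫⁻ x, b.stateOcc (Q w.1.1.1) (π w.1.1.1) h w.1.2 * π w.1.1.1 h w.1.2 w.2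
        * Q w.1.1.1 h w.1.2 w.2 (x, w.1.1.2) ∂b.lam) ?_
    refine Measurable.lintegral_prod_right' (f := fun w : (((X × S) × S) × A) × ℝ =>
      b.stateOcc (Q w.1.1.1.1) (π w.1.1.1.1) h w.1.1.2 * π w.1.1.1.1 h w.1.1.2 w.1.2
        * Q w.1.1.1.1 h w.1.1.2 w.1.2 (w.2, w.1.1.1.2)) ?_
    refine Measurable.mul (Measurable.mul ?_ ?_) ?_
    · exact ih.comp (f := fun w : (((X × S) × S) × A) × ℝ => (w.1.1.1.1, w.1.1.2)) (by fun_prop)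
    · exact h2.comp (f := fun w : (((X × S) × S) × A) × ℝ => (w.1.1.1.1, w.1.1.2, w.1.2))
        (by fun_prop)
    · exact h1.comp (f := fun w : (((X × S) × S) × A) × ℝ =>
        (w.1.1.1.1, w.1.1.2, w.1.2, (w.2, w.1.1.1.2))) (by fun_prop)

lemma measurable_occ (hQ : ∀ n, Measurable fun y : X × S × A × (ℝ × S) =>
      Q y.1 n y.2.1 y.2.2.1 y.2.2.2)
    (hπ : ∀ n, Measurable fun y : X × S × A => π y.1 n y.2.1 y.2.2) (h : ℕ) :
    Measurable fun y : X × S × A => b.occ (Q y.1) (π y.1) h y.2.1 y.2.2 := by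
  have h1 := b.measurable_stateOcc hQ hπ h
  have h2 := hπ h
  unfold occ
  exact (h1.comp (f := fun y : X × S × A => (y.1, y.2.1)) (by fun_prop)).mul h2

end Measurability

variable {b} {Q Q' : Trans S A} {π π' : Policy S A} {F G : Trans S A}

/-- Joint measurability of a family of functions of a state, an action and an outcome. -/
def MeasTrans (F : Trans S A) : Prop :=
  ∀ n, Measurable fun x : S × A × (ℝ × S) => F n x.1 x.2.1 x.2.2

lemma IsTrans.measurable_acc (hQ : b.IsTrans Q) (hπ : b.IsPolicy π) (hF : MeasTrans F) (n h : ℕ) :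
    Measurable (b.acc Q π F n h) := by
  have := b.measurable_acc (X := Unit) (Q := fun _ => Q) (π := fun _ => π) (F := fun _ => F)
    (fun n => (hQ.meas n).comp measurable_snd) (fun n => (hπ.meas n).comp measurable_snd)
    (fun n => (hF n).comp measurable_snd) n h
  exact this.comp (measurable_const (a := ()) |>.prodMk measurable_id)

lemma IsTrans.measurable_stateOcc (hQ : b.IsTrans Q) (hπ : b.IsPolicy π) (h : ℕ) :
    Measurable (b.stateOcc Q π h) := by
  have := b.measurable_stateOcc (X := Unit) (Q := fun _ => Q) (π := fun _ => π)
    (fun n => (hQ.meas n).comp measurable_snd) (fun n => (hπ.meas n).comp measurable_snd) h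
  exact this.comp (measurable_const (a := ()) |>.prodMk measurable_id)

lemma IsTrans.measurable_occ (hQ : b.IsTrans Q) (hπ : b.IsPolicy π) (h : ℕ) :
    Measurable fun x : S × A => b.occ Q π h x.1 x.2 := by
  have h1 := hQ.measurable_stateOcc hπ h
  have h2 := hπ.meas h
  unfold occ
  fun_prop

lemma lintegral_next_state (κ : Measure S) [SFinite κ] {G : S → A → ℝ × S → ENNReal}
    (hG : Measurable fun x : S × A × (ℝ × S) => G x.1 x.2.1 x.2.2) :
    ∫⁻ s', ∫⁻ s, ∫⁻ a, ∫⁻ x, G s a (x, s') ∂b.lam ∂b.μA ∂κ ∂b.μS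
      = ∫⁻ s, ∫⁻ a, ∫⁻ z, G s a z ∂b.ν ∂b.μA ∂κ := by
  rw [lintegral_lintegral_swap (by fun_prop)]
  refine lintegral_congr fun s => ?_
  rw [lintegral_lintegral_swap (by fun_prop)]
  refine lintegral_congr fun a => ?_
  rw [ν, lintegral_prod_symm _ (by fun_prop)]

lemma baseS_succ (h : ℕ) : b.baseS (h + 1) = b.μS := by simp [baseS]

lemma IsTrans.lintegral_stateOcc_succ (hQ : b.IsTrans Q) (hπ : b.IsPolicy π) (h : ℕ)
    {g : S → ENNReal} (hg : Measurable g) :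
    ∫⁻ s, b.stateOcc Q π (h + 1) s * g s ∂(b.baseS (h + 1))
      = ∫⁻ s, ∫⁻ a, b.occ Q π h s a * ∫⁻ z, Q h s a z * g z.2 ∂b.ν ∂b.μA ∂(b.baseS h) := by
  have h1 := hQ.meas h
  have h2 := hπ.meas h
  have h3 := hQ.measurable_stateOcc hπ h
  have h4 := hQ.measurable_occ hπ h
  have e := b.lintegral_next_state (b.baseS h)
    (G := fun s a z => b.occ Q π h s a * (Q h s a z * g z.2)) (by fun_prop)
  rw [baseS_succ]
  calc _ = ∫⁻ s', ∫⁻ s, ∫⁻ a, ∫⁻ x, b.occ Q π h s a * (Q h s a (x, s') * g s')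
        ∂b.lam ∂b.μA ∂(b.baseS h) ∂b.μS := by
        refine lintegral_congr fun s' => ?_
        simp only [stateOcc]
        rw [← lintegral_mul_const _ (by fun_prop)]
        refine lintegral_congr fun s => ?_
        rw [← lintegral_mul_const _ (by fun_prop)]
        refine lintegral_congr fun a => ?_
        rw [← lintegral_mul_const _ (by fun_prop)]
        refine lintegral_congr fun x => ?_
        simp only [occ]; ring
    _ = _ := by
        rw [e]
        refine lintegral_congr fun s => lintegral_congr fun a => ?_
        rw [lintegral_const_mul _ (by fun_prop)]

lemma IsTrans.lintegral_stateOcc (hQ : b.IsTrans Q) (hπ : b.IsPolicy π) (h : ℕ) :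
    ∫⁻ s, b.stateOcc Q π h s ∂(b.baseS h) = 1 := by
  induction h with
  | zero => simp [stateOcc]
  | succ h ih =>
    have h2 := hπ.meas h
    have := hQ.lintegral_stateOcc_succ hπ h (g := fun _ => 1) measurable_const
    simp only [mul_one, hQ.prob] at this
    rw [this, ← ih]
    refine lintegral_congr fun s => ?_
    simp only [occ]
    rw [lintegral_const_mul _ (by fun_prop), hπ.prob, mul_one]

lemma IsTrans.lintegral_occ (hQ : b.IsTrans Q) (hπ : b.IsPolicy π) (h : ℕ) :
    ∫⁻ s, ∫⁻ a, b.occ Q π h s a ∂b.μA ∂(b.baseS h) = 1 := by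
  have h2 := hπ.meas h
  rw [← hQ.lintegral_stateOcc hπ h]
  refine lintegral_congr fun s => ?_
  simp only [occ]
  rw [lintegral_const_mul _ (by fun_prop), hπ.prob, mul_one]

/-- Expected sums are sums of integrals against occupancies. -/
lemma IsTrans.lintegral_stateOcc_mul_acc (hQ : b.IsTrans Q) (hπ : b.IsPolicy π)
    (hF : MeasTrans F) (n h : ℕ) :
    ∫⁻ s, b.stateOcc Q π h s * b.acc Q π F n h s ∂(b.baseS h)
      = ∑ i ∈ Finset.range n, ∫⁻ s, ∫⁻ a, b.occ Q π (h + i) s a *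
          ∫⁻ z, Q (h + i) s a z * F (h + i) s a z ∂b.ν ∂b.μA ∂(b.baseS (h + i)) := by
  induction n generalizing h with
  | zero => simp [acc]
  | succ n ih =>
    have h1 := hQ.meas h
    have h2 := hπ.meas h
    have h3 := hQ.measurable_stateOcc hπ h
    have h4 := hQ.measurable_occ hπ h
    have h5 := hQ.measurable_acc hπ hF n (h + 1)
    have h6 := hF h
    rw [Finset.sum_range_succ', add_comm (Finset.sum _ _)]
    have ih' := ih (h + 1)
    have e : ∀ i, h + 1 + i = h + (i + 1) := fun i => by ring
    simp only [e] at ih'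
    simp only [add_zero]
    rw [← ih', hQ.lintegral_stateOcc_succ hπ h h5,
      ← lintegral_add_left (by fun_prop)]
    refine lintegral_congr fun s => ?_
    simp only [acc]
    rw [← lintegral_const_mul _ (by fun_prop), ← lintegral_add_left (by fun_prop)]
    refine lintegral_congr fun a => ?_
    simp only [mul_add, occ]
    rw [lintegral_add_left (by fun_prop)]
    ring

lemma IsTrans.acc_eq_sum (hQ : b.IsTrans Q) (hπ : b.IsPolicy π) (hF : MeasTrans F) (n : ℕ) :
    b.acc Q π F n 0 b.s₁ = ∑ i ∈ Finset.range n, ∫⁻ s, ∫⁻ a, b.occ Q π i s a *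
          ∫⁻ z, Q i s a z * F i s a z ∂b.ν ∂b.μA ∂(b.baseS i) := by
  have := hQ.lintegral_stateOcc_mul_acc hπ hF n 0
  simp only [zero_add] at this
  rw [← this]
  have h5 := hQ.measurable_acc hπ hF n 0
  simp only [baseS, if_true, stateOcc, one_mul]
  rw [lintegral_dirac' _ h5]

lemma IsTrans.acc_add (hQ : b.IsTrans Q) (hπ : b.IsPolicy π) (hF : MeasTrans F)
    (hG : MeasTrans G) (n k : ℕ) (s : S) :
    b.acc Q π (fun n s a z => F n s a z + G n s a z) n k s
      = b.acc Q π F n k s + b.acc Q π G n k s := by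
  induction n generalizing k s with
  | zero => simp [acc]
  | succ n ih =>
    have h1 := hQ.meas k
    have h2 := hπ.meas k
    have h5 := hQ.measurable_acc hπ hF n (k + 1)
    have h6 := hF k
    have h7 := hG k
    have h8 := hQ.measurable_acc hπ hG n (k + 1)
    simp only [acc, ih]
    rw [← lintegral_add_left (by fun_prop)]
    refine lintegral_congr fun a => ?_
    rw [← mul_add, ← lintegral_add_left (by fun_prop)]
    congr 1
    refine lintegral_congr fun z => ?_
    ring

lemma IsTrans.acc_le (hQ : b.IsTrans Q) (hπ : b.IsPolicy π)
    (hF : ∀ n s a z, F n s a z ≤ 1) (n k : ℕ) (s : S) : b.acc Q π F n k s ≤ n := by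
  induction n generalizing k s with
  | zero => simp [acc]
  | succ n ih =>
    have h1 := hQ.meas k
    have h2 := hπ.meas k
    calc b.acc Q π F (n + 1) k s ≤ ∫⁻ a, π k s a * ∫⁻ z, Q k s a z * (1 + n) ∂b.ν ∂b.μA := by
          simp only [acc]
          gcongr
          · exact hF _ _ _ _
          · exact ih _ _
      _ = ((n + 1 : ℕ) : ENNReal) := by
          have : ∀ a, ∫⁻ z, Q k s a z * (1 + n) ∂b.ν = 1 + n := by
            intro a
            rw [lintegral_mul_const _ (by fun_prop), hQ.prob, one_mul]
          simp only [this]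
          rw [lintegral_mul_const _ (by fun_prop), hπ.prob, one_mul]
          push_cast; ring

/-! ### Trajectories -/

section Traj

variable {H : ℕ}

/-- The state at layer `h` of a trajectory started at layer `k` in `s`. -/
def stateFrom (k : ℕ) (s : S) (τ : BayesRL.Traj S A H) (h : Fin H) : S :=
  if h.1 ≤ k then s else (τ ⟨h.1 - 1, lt_of_le_of_lt (Nat.sub_le _ _) h.2⟩).2.2

variable (b) in
/-- Reference measure on trajectories. -/
def trajRef (H : ℕ) : Measure (BayesRL.Traj S A H) := Measure.pi fun _ => b.μA.prod b.ν

instance : IsProbabilityMeasure (b.trajRef H) := by unfold trajRef; infer_instance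

/-- The layers from `k` on. -/
def layersFrom (H k : ℕ) : Finset (Fin H) := Finset.univ.filter fun h => k ≤ h.1

/-- Density of the trajectories started at layer `k` in `s`. -/
def trajDens (Q : Trans S A) (π : Policy S A) (k : ℕ) (s : S) (τ : BayesRL.Traj S A H) : ENNReal :=
  ∏ h ∈ layersFrom H k, (π h.1 (stateFrom k s τ h) (τ h).1
    * Q h.1 (stateFrom k s τ h) (τ h).1 (τ h).2)

lemma measurable_stateFrom (k : ℕ) (h : Fin H) :
    Measurable fun x : S × BayesRL.Traj S A H => stateFrom k x.1 x.2 h := by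
  unfold stateFrom; split_ifs <;> fun_prop

lemma IsTrans.measurable_trajDens (hQ : b.IsTrans Q) (hπ : b.IsPolicy π) (k : ℕ) :
    Measurable fun x : S × BayesRL.Traj S A H => trajDens Q π k x.1 x.2 := by
  unfold trajDens
  refine Finset.measurable_prod _ fun h _ => ?_
  have h1 := hQ.meas h.1
  have h2 := hπ.meas h.1
  have h3 := measurable_stateFrom (S := S) (A := A) k h
  fun_prop

/-- Sum of `F` over the layers of a trajectory from `k` on. -/
def trajSum (F : Trans S A) (k : ℕ) (s : S) (τ : BayesRL.Traj S A H) : ENNReal :=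
  ∑ h ∈ layersFrom H k, F h.1 (stateFrom k s τ h) (τ h).1 (τ h).2

lemma measurable_trajSum (hF : MeasTrans F) (k : ℕ) :
    Measurable fun x : S × BayesRL.Traj S A H => trajSum F k x.1 x.2 := by
  unfold trajSum
  refine Finset.measurable_sum _ fun h _ => ?_
  have h1 := hF h.1
  have h3 := measurable_stateFrom (S := S) (A := A) k h
  fun_prop

lemma layersFrom_eq_insert {k : ℕ} (hk : k < H) :
    layersFrom H k = insert ⟨k, hk⟩ (layersFrom H (k + 1)) := by
  ext h
  simp only [layersFrom, Finset.mem_filter, Finset.mem_univ, true_and, Finset.mem_insert,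
    Fin.ext_iff]
  omega

lemma notMem_layersFrom {k : ℕ} (hk : k < H) : (⟨k, hk⟩ : Fin H) ∉ layersFrom H (k + 1) := by
  simp [layersFrom]

lemma stateFrom_update {k : ℕ} (hk : k < H) (s : S) (τ : BayesRL.Traj S A H) (y : A × ℝ × S)
    {h : Fin H} (hh : h ∈ layersFrom H (k + 1)) :
    stateFrom k s (Function.update τ ⟨k, hk⟩ y) h = stateFrom (k + 1) y.2.2 τ h := by
  simp only [layersFrom, Finset.mem_filter, Finset.mem_univ, true_and] at hh
  unfold stateFrom
  rw [if_neg (by omega)]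
  by_cases h1 : h.1 = k + 1
  · rw [if_pos (by omega)]
    have : (⟨h.1 - 1, lt_of_le_of_lt (Nat.sub_le _ _) h.2⟩ : Fin H) = ⟨k, hk⟩ :=
      Fin.ext (by simp; omega)
    rw [this, Function.update_self]
  · rw [if_neg (by omega), Function.update_of_ne]
    intro h2
    rw [Fin.ext_iff] at h2
    simp at h2; omega

lemma stateFrom_self {k : ℕ} (hk : k < H) (s : S) (τ : BayesRL.Traj S A H) :
    stateFrom k s τ ⟨k, hk⟩ = s := by simp [stateFrom]

lemma ne_of_mem_layersFrom {k : ℕ} (hk : k < H) {h : Fin H} (hh : h ∈ layersFrom H (k + 1)) :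
    h ≠ ⟨k, hk⟩ := fun e => notMem_layersFrom hk (e ▸ hh)

lemma trajDens_update {k : ℕ} (hk : k < H) (s : S) (τ : BayesRL.Traj S A H) (y : A × ℝ × S) :
    trajDens Q π k s (Function.update τ ⟨k, hk⟩ y)
      = π k s y.1 * Q k s y.1 y.2 * trajDens Q π (k + 1) y.2.2 τ := by
  unfold trajDens
  rw [layersFrom_eq_insert hk, Finset.prod_insert (notMem_layersFrom hk), stateFrom_self,
    Function.update_self]
  congr 1
  refine Finset.prod_congr rfl fun h hh => ?_
  rw [stateFrom_update hk s τ y hh, Function.update_of_ne (ne_of_mem_layersFrom hk hh)]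

lemma trajSum_update {k : ℕ} (hk : k < H) (s : S) (τ : BayesRL.Traj S A H) (y : A × ℝ × S) :
    trajSum F k s (Function.update τ ⟨k, hk⟩ y)
      = F k s y.1 y.2 + trajSum F (k + 1) y.2.2 τ := by
  unfold trajSum
  rw [layersFrom_eq_insert hk, Finset.sum_insert (notMem_layersFrom hk), stateFrom_self,
    Function.update_self]
  congr 1
  refine Finset.sum_congr rfl fun h hh => ?_
  rw [stateFrom_update hk s τ y hh, Function.update_of_ne (ne_of_mem_layersFrom hk hh)]

lemma IsTrans.lintegral_trajDens (hQ : b.IsTrans Q) (hπ : b.IsPolicy π) (n : ℕ) :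
    ∀ k, k + n = H → ∀ s, ∫⁻ τ : BayesRL.Traj S A H, trajDens Q π k s τ ∂(b.trajRef H) = 1 := by
  induction n with
  | zero =>
    intro k hk s
    have : layersFrom H k = ∅ := by
      ext h; have := h.2; simp [layersFrom]; omega
    simp [trajDens, this]
  | succ n ih =>
    intro k hk s
    have hkH : k < H := by omega
    have h1 := hQ.meas k
    have h2 := hπ.meas k
    have h3 := hQ.measurable_trajDens (H := H) hπ k
    have h4 := hQ.measurable_trajDens (H := H) hπ (k + 1)
    have ih' := ih (k + 1) (by omega)
    unfold trajRef at ih' ⊢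
    rw [lintegral_pi_update _ ⟨k, hkH⟩ (by fun_prop)]
    simp only [trajDens_update hkH]
    rw [lintegral_lintegral_swap (by fun_prop)]
    rw [lintegral_congr fun y : A × ℝ × S => lintegral_const_mul (π k s y.1 * Q k s y.1 y.2)
      (f := fun τ : BayesRL.Traj S A H => trajDens Q π (k + 1) y.2.2 τ) (by fun_prop)]
    simp only [ih', mul_one]
    rw [lintegral_prod _ (by fun_prop)]
    rw [lintegral_congr fun a : A => lintegral_const_mul (π k s a)
      (f := fun z => Q k s a z) (by fun_prop)]
    simp only [hQ.prob, mul_one, hπ.prob]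

lemma IsTrans.lintegral_trajDens_mul_trajSum (hQ : b.IsTrans Q) (hπ : b.IsPolicy π)
    (hF : MeasTrans F) (n : ℕ) :
    ∀ k, k + n = H → ∀ s, ∫⁻ τ : BayesRL.Traj S A H, trajDens Q π k s τ * trajSum F k s τ
      ∂(b.trajRef H) = b.acc Q π F n k s := by
  induction n with
  | zero =>
    intro k hk s
    have : layersFrom H k = ∅ := by
      ext h; have := h.2; simp [layersFrom]; omega
    simp [trajSum, this, acc]
  | succ n ih =>
    intro k hk s
    have hkH : k < H := by omega
    have h1 := hQ.meas k
    have h2 := hπ.meas k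
    have h3 := hQ.measurable_trajDens (H := H) hπ k
    have h4 := hQ.measurable_trajDens (H := H) hπ (k + 1)
    have h5 := measurable_trajSum (H := H) hF k
    have h6 := measurable_trajSum (H := H) hF (k + 1)
    have h7 := hF k
    have h8 := hQ.measurable_acc hπ hF n (k + 1)
    have ih' := ih (k + 1) (by omega)
    have hmass := hQ.lintegral_trajDens (H := H) hπ n (k + 1) (by omega)
    unfold trajRef at ih' hmass ⊢
    rw [lintegral_pi_update _ ⟨k, hkH⟩ (by fun_prop)]
    simp only [trajDens_update hkH, trajSum_update hkH]
    rw [lintegral_lintegral_swap (by fun_prop)]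
    have e : ∀ y : A × ℝ × S, ∫⁻ τ : BayesRL.Traj S A H, π k s y.1 * Q k s y.1 y.2
        * trajDens Q π (k + 1) y.2.2 τ * (F k s y.1 y.2 + trajSum F (k + 1) y.2.2 τ)
          ∂(Measure.pi fun _ => b.μA.prod b.ν)
        = π k s y.1 * (Q k s y.1 y.2 * (F k s y.1 y.2 + b.acc Q π F n (k + 1) y.2.2)) := by
      intro y
      have e1 : ∀ τ : BayesRL.Traj S A H, π k s y.1 * Q k s y.1 y.2
        * trajDens Q π (k + 1) y.2.2 τ * (F k s y.1 y.2 + trajSum F (k + 1) y.2.2 τ)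
        = (π k s y.1 * Q k s y.1 y.2) * (F k s y.1 y.2 * trajDens Q π (k + 1) y.2.2 τ
          + trajDens Q π (k + 1) y.2.2 τ * trajSum F (k + 1) y.2.2 τ) := fun τ => by ring
      simp only [e1]
      rw [lintegral_const_mul _ (by fun_prop), lintegral_add_left (by fun_prop),
        lintegral_const_mul _ (by fun_prop), hmass, ih']
      ring
    simp only [e]
    rw [lintegral_prod _ (by fun_prop)]
    simp only [acc]
    refine lintegral_congr fun a => ?_
    rw [lintegral_const_mul _ (by fun_prop)]

end Traj

/-! ### Comparison of two processes -/

lemma mul_add_mul_le (p q f c : ENNReal) :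
    p * f + q * c ≤ q * f + p * c + absDiff p q * absDiff f c := by
  rcases le_total p q with h | h
  · obtain ⟨δ, rfl⟩ := le_iff_exists_add.1 h
    have h1 : δ * absDiff f c ≤ absDiff p (p + δ) * absDiff f c ∨ p = ⊤ := by
      by_cases hp : p = ⊤
      · exact Or.inr hp
      · left
        gcongr
        unfold absDiff
        rw [ENNReal.add_sub_cancel_left hp]
        exact le_add_self
    rcases h1 with h1 | h1
    · calc p * f + (p + δ) * c = p * f + p * c + δ * c := by ring
        _ ≤ p * f + p * c + δ * (f + absDiff f c) := by
            gcongr; rw [absDiff_comm]; exact le_add_absDiff c f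
        _ = (p + δ) * f + p * c + δ * absDiff f c := by ring
        _ ≤ _ := by gcongr
    · subst h1; simp [add_comm]
  · obtain ⟨δ, rfl⟩ := le_iff_exists_add.1 h
    have h1 : δ * absDiff f c ≤ absDiff (q + δ) q * absDiff f c ∨ q = ⊤ := by
      by_cases hp : q = ⊤
      · exact Or.inr hp
      · left
        gcongr
        unfold absDiff
        rw [ENNReal.add_sub_cancel_left hp]
        exact le_self_add
    rcases h1 with h1 | h1
    · calc (q + δ) * f + q * c = q * f + q * c + δ * f := by ring
        _ ≤ q * f + q * c + δ * (c + absDiff f c) := by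
            gcongr; exact le_add_absDiff f c
        _ = q * f + (q + δ) * c + δ * absDiff f c := by ring
        _ ≤ _ := by gcongr
    · subst h1; simp

/-- The one-layer error when transitions `Q` are replaced by `Q'` and the values are centred at
`c`. -/
def simErr (b : MDPBase S A) (H : ℕ) (Q Q' : Trans S A) (π : Policy S A) (r : ℝ × S → ENNReal)
    (c : ℕ → S → A → ENNReal) (h : ℕ) (s : S) (a : A) : ENNReal :=
  ∫⁻ z, absDiff (Q' h s a z) (Q h s a z) *
    absDiff (r z + b.acc Q' π (fun _ _ _ => r) (H - (h + 1)) (h + 1) z.2) (c h s a) ∂b.ν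

lemma IsTrans.measurable_simErr (hQ : b.IsTrans Q) (hQ' : b.IsTrans Q') (hπ : b.IsPolicy π)
    {r : ℝ × S → ENNReal} (hr : Measurable r) {c : ℕ → S → A → ENNReal}
    (hc : ∀ n, Measurable fun x : S × A => c n x.1 x.2) (H h : ℕ) :
    Measurable fun x : S × A => simErr b H Q Q' π r c h x.1 x.2 := by
  have h1 := hQ.meas h
  have h2 := hQ'.meas h
  have h3 := hc h
  have h4 := hQ'.measurable_acc hπ (F := fun _ _ _ => r) (fun n => by fun_prop) (H - (h + 1)) (h + 1)
  unfold simErr absDiff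
  fun_prop

/-- Simulation lemma. -/
lemma IsTrans.acc_le_acc_add (hQ : b.IsTrans Q) (hQ' : b.IsTrans Q') (hπ : b.IsPolicy π)
    {r : ℝ × S → ENNReal} (hr : Measurable r) {c : ℕ → S → A → ENNReal}
    (hc : ∀ n, Measurable fun x : S × A => c n x.1 x.2) (hct : ∀ n s a, c n s a ≠ ⊤) {H : ℕ}
    (n : ℕ) : ∀ h, h + n = H → ∀ s, b.acc Q' π (fun _ _ _ => r) n h s
      ≤ b.acc Q π (fun h s a z => r z + simErr b H Q Q' π r c h s a) n h s := by
  induction n with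
  | zero => intro h _ s; simp [acc]
  | succ n ih =>
    intro h hh s
    have h1 := hQ.meas h
    have h2 := hQ'.meas h
    have h3 := hc h
    have hFr : MeasTrans (S := S) (A := A) (fun _ _ _ => r) := fun n => by fun_prop
    have h4 := hQ'.measurable_acc hπ hFr n (h + 1)
    have h5 := hQ.measurable_simErr hQ' hπ hr hc H h
    simp only [acc]
    refine lintegral_mono fun a => mul_le_mul_right ?_ _
    set V := b.acc Q' π (fun _ _ _ => r) n (h + 1) with hV
    have hn : H - (h + 1) = n := by omega
    have key : ∫⁻ z, Q' h s a z * (r z + V z.2) ∂b.ν + c h s a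
        ≤ ∫⁻ z, Q h s a z * (r z + V z.2) ∂b.ν + simErr b H Q Q' π r c h s a + c h s a := by
      have e1 : c h s a = ∫⁻ z, Q h s a z * c h s a ∂b.ν := by
        rw [lintegral_mul_const _ (by fun_prop), hQ.prob, one_mul]
      have e2 : c h s a = ∫⁻ z, Q' h s a z * c h s a ∂b.ν := by
        rw [lintegral_mul_const _ (by fun_prop), hQ'.prob, one_mul]
      conv_lhs => rw [e1]
      conv_rhs => rw [e2]
      unfold simErr
      rw [hn, ← hV, ← lintegral_add_left (by fun_prop), add_assoc, add_comm (∫⁻ z, absDiff _ _ * _ ∂b.ν),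
        ← lintegral_add_left (by fun_prop), ← lintegral_add_left (by fun_prop)]
      refine lintegral_mono fun z => ?_
      rw [← add_assoc]
      exact mul_add_mul_le _ _ _ _
    have key2 := (ENNReal.add_le_add_iff_right (hct h s a)).1 key
    refine key2.trans ?_
    have e3 : simErr b H Q Q' π r c h s a
        = ∫⁻ z, Q h s a z * simErr b H Q Q' π r c h s a ∂b.ν := by
      rw [lintegral_mul_const _ (by fun_prop), hQ.prob, one_mul]
    nth_rewrite 1 [e3]
    rw [← lintegral_add_left (by fun_prop)]
    refine lintegral_mono fun z => ?_
    simp only []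
    rw [← mul_add]
    refine mul_le_mul_right ?_ _
    have := ih (h + 1) (by omega) z.2
    rw [← hV] at this
    calc r z + V z.2 + simErr b H Q Q' π r c h s a
        = r z + simErr b H Q Q' π r c h s a + V z.2 := by ring
      _ ≤ _ := by gcongr

lemma IsTrans.acc_le_acc_add_sum (hQ : b.IsTrans Q) (hQ' : b.IsTrans Q') (hπ : b.IsPolicy π)
    {r : ℝ × S → ENNReal} (hr : Measurable r) {c : ℕ → S → A → ENNReal}
    (hc : ∀ n, Measurable fun x : S × A => c n x.1 x.2) (hct : ∀ n s a, c n s a ≠ ⊤) (H : ℕ) :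
    b.acc Q' π (fun _ _ _ => r) H 0 b.s₁ ≤ b.acc Q π (fun _ _ _ => r) H 0 b.s₁
      + ∑ h ∈ Finset.range H, ∫⁻ s, ∫⁻ a, b.occ Q π h s a * simErr b H Q Q' π r c h s a
        ∂b.μA ∂(b.baseS h) := by
  have hFr : MeasTrans (S := S) (A := A) (fun _ _ _ => r) := fun n => by fun_prop
  have hFe : MeasTrans (S := S) (A := A) (fun h s a _ => simErr b H Q Q' π r c h s a) := fun n => by
    have := hQ.measurable_simErr hQ' hπ hr hc H n
    fun_prop
  refine (hQ.acc_le_acc_add hQ' hπ hr hc hct (H := H) H 0 (by omega) b.s₁).trans ?_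
  rw [hQ.acc_add hπ hFr hFe, hQ.acc_eq_sum hπ hFe]
  gcongr with h hh s a
  have h1 := hQ.meas h
  rw [lintegral_mul_const _ (by fun_prop), hQ.prob, one_mul]

/-! ### Stability of occupancies and values -/

variable (b) in
/-- Expected `l₁`-distance of the transitions under the reference process `(Q₀, π₀)`. -/
def transDist (Q Q₀ : Trans S A) (π₀ : Policy S A) (h : ℕ) : ENNReal :=
  ∫⁻ s, ∫⁻ a, b.occ Q₀ π₀ h s a * ∫⁻ z, absDiff (Q h s a z) (Q₀ h s a z) ∂b.ν ∂b.μA ∂(b.baseS h)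

variable (b) in
/-- Expected `l₁`-distance of the policies under the reference process `(Q₀, π₀)`. -/
def polDist (π : Policy S A) (Q₀ : Trans S A) (π₀ : Policy S A) (h : ℕ) : ENNReal :=
  ∫⁻ s, b.stateOcc Q₀ π₀ h s * ∫⁻ a, absDiff (π h s a) (π₀ h s a) ∂b.μA ∂(b.baseS h)

lemma IsTrans.lintegral_absDiff_occ_le (hQ : b.IsTrans Q) (hπ : b.IsPolicy π) (hQ' : b.IsTrans Q')
    (hπ' : b.IsPolicy π') (h : ℕ) :
    ∫⁻ s, ∫⁻ a, absDiff (b.occ Q π h s a) (b.occ Q' π' h s a) ∂b.μA ∂(b.baseS h)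
      ≤ ∫⁻ s, absDiff (b.stateOcc Q π h s) (b.stateOcc Q' π' h s) ∂(b.baseS h)
        + b.polDist π Q' π' h := by
  have h2 := hπ.meas h
  have h2' := hπ'.meas h
  have h3 := hQ.measurable_stateOcc hπ h
  have h3' := hQ'.measurable_stateOcc hπ' h
  unfold polDist
  rw [← lintegral_add_left (h3.absDiff h3')]
  refine lintegral_mono fun s => ?_
  simp only [occ]
  have hmd : Measurable fun a => absDiff (π h s a) (π' h s a) :=
    Measurable.absDiff (by fun_prop) (by fun_prop)
  calc _ ≤ ∫⁻ a, (absDiff (b.stateOcc Q π h s) (b.stateOcc Q' π' h s) * π h s a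
        + b.stateOcc Q' π' h s * absDiff (π h s a) (π' h s a)) ∂b.μA :=
        lintegral_mono fun a => absDiff_mul_le _ _ _ _
    _ = _ := by
        rw [lintegral_add_left (by fun_prop), lintegral_const_mul _ (by fun_prop), hπ.prob,
          mul_one, lintegral_const_mul _ hmd]

lemma IsTrans.lintegral_absDiff_stateOcc_le (hQ : b.IsTrans Q) (hπ : b.IsPolicy π)
    (hQ' : b.IsTrans Q') (hπ' : b.IsPolicy π') (h : ℕ) :
    ∫⁻ s, absDiff (b.stateOcc Q π h s) (b.stateOcc Q' π' h s) ∂(b.baseS h)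
      ≤ ∑ i ∈ Finset.range h, (b.transDist Q Q' π' i + b.polDist π Q' π' i) := by
  induction h with
  | zero => simp [stateOcc]
  | succ h ih =>
    have h1 := hQ.meas h
    have h1' := hQ'.meas h
    have h4 := hQ.measurable_occ hπ h
    have h4' := hQ'.measurable_occ hπ' h
    have hm1 : Measurable fun x : S × A => absDiff (b.occ Q π h x.1 x.2) (b.occ Q' π' h x.1 x.2) :=
      h4.absDiff h4'
    have hm2 : Measurable fun x : S × A × (ℝ × S) =>
      absDiff (Q h x.1 x.2.1 x.2.2) (Q' h x.1 x.2.1 x.2.2) := h1.absDiff h1'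
    have e := b.lintegral_next_state (b.baseS h)
      (G := fun s a z => absDiff (b.occ Q π h s a) (b.occ Q' π' h s a) * Q h s a z
        + b.occ Q' π' h s a * absDiff (Q h s a z) (Q' h s a z)) (by fun_prop)
    rw [baseS_succ, Finset.sum_range_succ]
    calc _ ≤ ∫⁻ s', ∫⁻ s, ∫⁻ a, ∫⁻ x, (absDiff (b.occ Q π h s a) (b.occ Q' π' h s a) * Q h s a (x, s')
        + b.occ Q' π' h s a * absDiff (Q h s a (x, s')) (Q' h s a (x, s')))
          ∂b.lam ∂b.μA ∂(b.baseS h) ∂b.μS := by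
          refine lintegral_mono fun s' => ?_
          simp only [stateOcc]
          have h2 := hπ.meas h
          have h2' := hπ'.meas h
          have h3 := hQ.measurable_stateOcc hπ h
          have h3' := hQ'.measurable_stateOcc hπ' h
          refine (absDiff_lintegral_le (by fun_prop) (by fun_prop)).trans
            (lintegral_mono fun s => ?_)
          refine (absDiff_lintegral_le (by fun_prop) (by fun_prop)).trans
            (lintegral_mono fun a => ?_)
          refine (absDiff_lintegral_le (by fun_prop)
            (by fun_prop)).trans (lintegral_mono fun x => ?_)
          exact absDiff_mul_le _ _ _ _
      _ = ∫⁻ s, ∫⁻ a, absDiff (b.occ Q π h s a) (b.occ Q' π' h s a) ∂b.μA ∂(b.baseS h)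
          + b.transDist Q Q' π' h := by
          rw [e]
          unfold transDist
          rw [← lintegral_add_left (by fun_prop)]
          refine lintegral_congr fun s => ?_
          rw [← lintegral_add_left (by fun_prop)]
          refine lintegral_congr fun a => ?_
          rw [lintegral_add_left (by fun_prop), lintegral_const_mul _ (by fun_prop), hQ.prob,
            mul_one, lintegral_const_mul _ (by fun_prop)]
      _ ≤ _ := by
          have := hQ.lintegral_absDiff_occ_le hπ hQ' hπ' h
          calc _ ≤ (∑ i ∈ Finset.range h, (b.transDist Q Q' π' i + b.polDist π Q' π' i)
                + b.polDist π Q' π' h) + b.transDist Q Q' π' h := by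
                gcongr
                exact this.trans (by gcongr)
            _ = _ := by ring

lemma IsTrans.lintegral_absDiff_acc_le (hQ : b.IsTrans Q) (hπ : b.IsPolicy π)
    (hQ' : b.IsTrans Q') (hπ' : b.IsPolicy π') {r : ℝ × S → ENNReal} (hr : Measurable r)
    (hr1 : ∀ z, r z ≤ 1) (n h : ℕ) :
    ∫⁻ s, b.stateOcc Q' π' h s * absDiff (b.acc Q π (fun _ _ _ => r) n h s)
        (b.acc Q' π' (fun _ _ _ => r) n h s) ∂(b.baseS h)
      ≤ n * ∑ i ∈ Finset.range n, (b.transDist Q Q' π' (h + i) + b.polDist π Q' π' (h + i)) := by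
  induction n generalizing h with
  | zero => simp [acc]
  | succ n ih =>
    have hFr : MeasTrans (S := S) (A := A) (fun _ _ _ => r) := fun n => by fun_prop
    have h1 := hQ.meas h
    have h1' := hQ'.meas h
    have h2 := hπ.meas h
    have h2' := hπ'.meas h
    have h3' := hQ'.measurable_stateOcc hπ' h
    have h4' := hQ'.measurable_occ hπ' h
    set V := b.acc Q π (fun _ _ _ => r) n (h + 1) with hV
    set V' := b.acc Q' π' (fun _ _ _ => r) n (h + 1) with hV'
    have h5 : Measurable V := hQ.measurable_acc hπ hFr n (h + 1)
    have h5' : Measurable V' := hQ'.measurable_acc hπ' hFr n (h + 1)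
    have hVn : ∀ s, V s ≤ n := fun s => hQ.acc_le hπ (fun _ _ _ z => hr1 z) n (h + 1) s
    have hVd : Measurable fun s => absDiff (V s) (V' s) := h5.absDiff h5'
    have hm2 : Measurable fun x : S × A × (ℝ × S) =>
      absDiff (Q h x.1 x.2.1 x.2.2) (Q' h x.1 x.2.1 x.2.2) := h1.absDiff h1'
    have hm3 : Measurable fun x : S × A =>
      absDiff (π h x.1 x.2) (π' h x.1 x.2) := h2.absDiff h2'
    have hpt : ∀ s, absDiff (b.acc Q π (fun _ _ _ => r) (n + 1) h s)
        (b.acc Q' π' (fun _ _ _ => r) (n + 1) h s)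
        ≤ (n + 1) * ∫⁻ a, absDiff (π h s a) (π' h s a) ∂b.μA
          + ((n + 1) * ∫⁻ a, π' h s a * ∫⁻ z, absDiff (Q h s a z) (Q' h s a z) ∂b.ν ∂b.μA
          + ∫⁻ a, π' h s a * ∫⁻ z, Q' h s a z * absDiff (V z.2) (V' z.2) ∂b.ν ∂b.μA) := by
      intro s
      simp only [acc]
      rw [← hV, ← hV']
      refine (absDiff_lintegral_le (by fun_prop) (by fun_prop)).trans ?_
      rw [← lintegral_const_mul _ (by fun_prop), ← lintegral_const_mul _ (by fun_prop),
        ← lintegral_add_left (by fun_prop), ← lintegral_add_left (by fun_prop)]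
      refine lintegral_mono fun a => ?_
      refine (absDiff_mul_le _ _ _ _).trans ?_
      have ht : ∀ z : ℝ × S, r z + V z.2 ≤ n + 1 := fun z => by
        rw [add_comm (r z)]; exact add_le_add (hVn z.2) (hr1 z)
      have b1 : ∫⁻ z, Q h s a z * (r z + V z.2) ∂b.ν ≤ n + 1 := by
        calc _ ≤ ∫⁻ z, Q h s a z * (n + 1) ∂b.ν := by exact lintegral_mono fun z => mul_le_mul_right (ht z) _
          _ = _ := by rw [lintegral_mul_const _ (by fun_prop), hQ.prob, one_mul]
      have b2 : absDiff (∫⁻ z, Q h s a z * (r z + V z.2) ∂b.ν)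
          (∫⁻ z, Q' h s a z * (r z + V' z.2) ∂b.ν)
          ≤ (n + 1) * ∫⁻ z, absDiff (Q h s a z) (Q' h s a z) ∂b.ν
            + ∫⁻ z, Q' h s a z * absDiff (V z.2) (V' z.2) ∂b.ν := by
        refine (absDiff_lintegral_le (by fun_prop) (by fun_prop)).trans ?_
        rw [← lintegral_const_mul _ (by fun_prop), ← lintegral_add_left (by fun_prop)]
        refine lintegral_mono fun z => (absDiff_mul_le _ _ _ _).trans ?_
        refine add_le_add ?_ (mul_le_mul_right ?_ _)
        · rw [mul_comm]; exact mul_le_mul_left (ht z) _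
        · refine (absDiff_add_le _ _ _ _).trans ?_
          simp
      calc _ ≤ absDiff (π h s a) (π' h s a) * (n + 1) + π' h s a *
            ((n + 1) * ∫⁻ z, absDiff (Q h s a z) (Q' h s a z) ∂b.ν
            + ∫⁻ z, Q' h s a z * absDiff (V z.2) (V' z.2) ∂b.ν) := by gcongr
        _ = _ := by ring
    calc _ ≤ ∫⁻ s, b.stateOcc Q' π' h s * ((n + 1) * ∫⁻ a, absDiff (π h s a) (π' h s a) ∂b.μA
          + ((n + 1) * ∫⁻ a, π' h s a * ∫⁻ z, absDiff (Q h s a z) (Q' h s a z) ∂b.ν ∂b.μA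
          + ∫⁻ a, π' h s a * ∫⁻ z, Q' h s a z * absDiff (V z.2) (V' z.2) ∂b.ν ∂b.μA))
            ∂(b.baseS h) := by gcongr with s; exact hpt s
      _ = (n + 1) * b.polDist π Q' π' h + ((n + 1) * b.transDist Q Q' π' h
          + ∫⁻ s, b.stateOcc Q' π' (h + 1) s * absDiff (V s) (V' s) ∂(b.baseS (h + 1))) := by
          rw [hQ'.lintegral_stateOcc_succ hπ' h hVd]
          unfold polDist transDist
          rw [← lintegral_const_mul _ (by fun_prop), ← lintegral_const_mul _ (by fun_prop),
            ← lintegral_add_left (by fun_prop), ← lintegral_add_left (by fun_prop)]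
          refine lintegral_congr fun s => ?_
          have e1 : ∫⁻ a, b.occ Q' π' h s a * ∫⁻ z, absDiff (Q h s a z) (Q' h s a z) ∂b.ν ∂b.μA
              = b.stateOcc Q' π' h s * ∫⁻ a, π' h s a * ∫⁻ z, absDiff (Q h s a z) (Q' h s a z) ∂b.ν
                ∂b.μA := by
            rw [← lintegral_const_mul _ (by fun_prop)]
            simp only [occ, mul_assoc]
          have e2 : ∫⁻ a, b.occ Q' π' h s a * ∫⁻ z, Q' h s a z * absDiff (V z.2) (V' z.2) ∂b.ν ∂b.μA
              = b.stateOcc Q' π' h s * ∫⁻ a, π' h s a *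
                ∫⁻ z, Q' h s a z * absDiff (V z.2) (V' z.2) ∂b.ν ∂b.μA := by
            rw [← lintegral_const_mul _ (by fun_prop)]
            simp only [occ, mul_assoc]
          rw [e1, e2]
          ring
      _ ≤ (n + 1) * b.polDist π Q' π' h + ((n + 1) * b.transDist Q Q' π' h
          + (n + 1) * ∑ i ∈ Finset.range n,
            (b.transDist Q Q' π' (h + 1 + i) + b.polDist π Q' π' (h + 1 + i))) := by
          gcongr
          refine (ih (h + 1)).trans ?_
          gcongr
          exact le_self_add
      _ = _ := by
          rw [Finset.sum_range_succ']
          have e : ∀ i, h + 1 + i = h + (i + 1) := fun i => by ring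
          simp only [e, add_zero]
          push_cast
          ring

end MDPBase

end

noncomputable section

lemma MDPBase.acc_congr {S A : Type*} [MeasurableSpace S] [MeasurableSpace A] {b : MDPBase S A}
    {Q F G : MDPBase.Trans S A} {π : MDPBase.Policy S A} (hQ : b.IsTrans Q) (hF : MDPBase.MeasTrans F)
    (hG : MDPBase.MeasTrans G)
    (h : ∀ n s a, ∫⁻ z, Q n s a z * F n s a z ∂b.ν = ∫⁻ z, Q n s a z * G n s a z ∂b.ν)
    (n k : ℕ) (s : S) : b.acc Q π F n k s = b.acc Q π G n k s := by
  induction n generalizing k s with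
  | zero => rfl
  | succ n ih =>
    have h1 := hQ.meas k
    have h6 := hF k
    have h7 := hG k
    simp only [MDPBase.acc]
    refine lintegral_congr fun a => ?_
    congr 1
    simp only [mul_add]
    rw [lintegral_add_left (by fun_prop), lintegral_add_left (by fun_prop), h]
    congr 1
    exact lintegral_congr fun z => by rw [ih]

namespace BayesRL

variable {S A : Type*} [MeasurableSpace S] [MeasurableSpace A] {H : ℕ}
  {TP TR : Fin H → Type*} [∀ h, MeasurableSpace (TP h)] [∀ h, MeasurableSpace (TR h)]
  (B : BayesRL S A H TP TR)

open MDPBase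

instance isProbabilityMeasure_unit_interval :
    IsProbabilityMeasure ((volume : Measure ℝ).restrict (Icc (0 : ℝ) 1)) :=
  ⟨by simp⟩

/-- The reference measures of a reinforcement learning problem. -/
def mdp : MDPBase S A where
  μS := B.μS
  μA := B.μA
  lam := volume.restrict (Icc (0 : ℝ) 1)
  s₁ := B.s₁

/-- The joint density of the reward and the next state in an environment. -/
def trans (E : B.Env) : Trans S A := fun n s a z =>
  if h : n < H then ENNReal.ofReal (B.r ⟨n, h⟩ (E ⟨n, h⟩).2 s a z.1)
    * ENNReal.ofReal (B.p ⟨n, h⟩ (E ⟨n, h⟩).1 s a z.2) else 1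

/-- The action densities of a policy. -/
def polDens (π : Fin H → S → A → ℝ) : Policy S A := fun n s a =>
  if h : n < H then ENNReal.ofReal (π ⟨n, h⟩ s a) else 1

/-- The optimal policy of an environment, given by its densities. -/
def optPol (E : B.Env) : Policy S A := polDens (B.star E)

/-- The reward, truncated so that it is bounded everywhere. -/
def rew (z : ℝ × S) : ENNReal := ENNReal.ofReal (min z.1 1)

lemma measurable_rew : Measurable (rew (S := S)) := by unfold rew; fun_prop

lemma rew_le_one (z : ℝ × S) : rew z ≤ 1 := by
  unfold rew; exact ENNReal.ofReal_le_one.2 (min_le_right _ _)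

lemma measTrans_rew : MeasTrans (S := S) (A := A) (fun _ _ _ => rew) := fun _ => by
  have := measurable_rew (S := S)
  fun_prop

lemma measurable_trans (n : ℕ) : Measurable fun y : B.Env × S × A × (ℝ × S) =>
    B.trans y.1 n y.2.1 y.2.2.1 y.2.2.2 := by
  unfold trans
  split_ifs with h
  · refine Measurable.mul (M := ENNReal) ?_ ?_
    · exact ENNReal.measurable_ofReal.comp ((B.r_measurable ⟨n, h⟩).comp
        (f := fun y : B.Env × S × A × (ℝ × S) =>
          ((y.1 ⟨n, h⟩).2, y.2.1, y.2.2.1, y.2.2.2.1)) (by fun_prop))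
    · exact ENNReal.measurable_ofReal.comp ((B.p_measurable ⟨n, h⟩).comp
        (f := fun y : B.Env × S × A × (ℝ × S) =>
          ((y.1 ⟨n, h⟩).1, y.2.1, y.2.2.1, y.2.2.2.2)) (by fun_prop))
  · exact measurable_const

lemma measurable_optPol (n : ℕ) : Measurable fun y : B.Env × S × A =>
    B.optPol y.1 n y.2.1 y.2.2 := by
  unfold optPol polDens
  split_ifs with h
  · exact ENNReal.measurable_ofReal.comp (B.star_measurable ⟨n, h⟩)
  · exact measurable_const

lemma isTrans_trans (E : B.Env) : B.mdp.IsTrans (B.trans E) where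
  meas n := (B.measurable_trans n).comp (f := fun x : S × A × (ℝ × S) => (E, x)) (by fun_prop)
  prob n s a := by
    have hm : Measurable fun z : ℝ × S => B.trans E n s a z := (B.measurable_trans n).comp
      (f := fun z : ℝ × S => (E, s, a, z)) (by fun_prop)
    unfold MDPBase.ν
    rw [lintegral_prod _ hm.aemeasurable]
    unfold trans
    split_ifs with h
    · have h1 : Measurable fun s' => B.p ⟨n, h⟩ (E ⟨n, h⟩).1 s a s' :=
        (B.p_measurable ⟨n, h⟩).comp (f := fun s' => ((E ⟨n, h⟩).1, s, a, s')) (by fun_prop)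
      rw [← B.r_prob ⟨n, h⟩ (E ⟨n, h⟩).2 s a]
      refine lintegral_congr fun x => ?_
      dsimp only
      rw [lintegral_const_mul _ (by fun_prop)]
      have := B.p_prob ⟨n, h⟩ (E ⟨n, h⟩).1 s a
      simp only [mdp, this, mul_one]
    · simp

lemma isPolicy_polDens {π : Fin H → S → A → ℝ} (hπ : π ∈ B.Pol) :
    B.mdp.IsPolicy (polDens π) where
  meas n := by
    unfold polDens
    split_ifs with h
    · exact ENNReal.measurable_ofReal.comp (B.pol_measurable π hπ ⟨n, h⟩)
    · exact measurable_const
  prob n s := by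
    unfold polDens
    split_ifs with h
    · exact B.pol_prob π hπ ⟨n, h⟩ s
    · simp

lemma isPolicy_optPol (E : B.Env) : B.mdp.IsPolicy (B.optPol E) :=
  B.isPolicy_polDens (B.star_mem E)

lemma refMeasure_eq : B.refMeasure = B.mdp.trajRef H := rfl

lemma stateAt_eq (h₀ : Fin H) (s : S) (τ : Traj S A H) (h : Fin H) :
    stateAt h₀ s τ h = stateFrom h₀.1 s τ h := rfl

lemma layersFrom_coe (h₀ : Fin H) : layersFrom H h₀.1 = Finset.Ici h₀ := by
  ext h
  simp only [layersFrom, Finset.mem_filter, Finset.mem_univ, true_and, Finset.mem_Ici, Fin.le_def]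

lemma trajDensity_eq (E : B.Env) {π : Fin H → S → A → ℝ} (hπ : π ∈ B.Pol) (h₀ : Fin H) (s : S)
    (τ : Traj S A H) :
    B.trajDensity E π h₀ s τ = trajDens (B.trans E) (polDens π) h₀.1 s τ := by
  unfold trajDensity trajDens
  rw [layersFrom_coe]
  refine Finset.prod_congr rfl fun h _ => ?_
  rw [stateAt_eq]
  have h1 := B.pol_nonneg π hπ h (stateFrom h₀.1 s τ h) (τ h).1
  have h2 := B.r_nonneg h (E h).2 (stateFrom h₀.1 s τ h) (τ h).1 (τ h).2.1
  rw [ENNReal.ofReal_mul (mul_nonneg h1 h2), ENNReal.ofReal_mul h1]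
  simp [trans, polDens, mul_assoc]

lemma trajLaw_eq (E : B.Env) {π : Fin H → S → A → ℝ} (hπ : π ∈ B.Pol) (h₀ : Fin H) (s : S) :
    B.trajLaw E π h₀ s
      = (B.mdp.trajRef H).withDensity (trajDens (B.trans E) (polDens π) h₀.1 s) := by
  unfold trajLaw
  rw [refMeasure_eq]
  congr 1
  funext τ
  exact B.trajDensity_eq E hπ h₀ s τ

lemma measurable_trajDens_trans (E : B.Env) {π : Fin H → S → A → ℝ} (hπ : π ∈ B.Pol) (k : ℕ)
    (s : S) : Measurable fun τ : Traj S A H => trajDens (B.trans E) (polDens π) k s τ :=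
  ((B.isTrans_trans E).measurable_trajDens (B.isPolicy_polDens hπ) k).comp
    (f := fun τ => (s, τ)) (by fun_prop)

lemma measurable_meanReward (h : Fin H) (θ : TR h) :
    Measurable fun x : S × A => B.meanReward h θ x.1 x.2 := by
  unfold meanReward
  refine StronglyMeasurable.measurable ?_
  refine StronglyMeasurable.integral_prod_right'
    (f := fun y : (S × A) × ℝ => y.2 * B.r h θ y.1.1 y.1.2 y.2) ?_
  refine Measurable.stronglyMeasurable (Measurable.mul (by fun_prop) ?_)
  exact (B.r_measurable h).comp (f := fun y : (S × A) × ℝ => (θ, y.1.1, y.1.2, y.2)) (by fun_prop)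

lemma meanReward_nonneg (h : Fin H) (θ : TR h) (s : S) (a : A) : 0 ≤ B.meanReward h θ s a :=
  setIntegral_nonneg measurableSet_Icc fun x hx => mul_nonneg hx.1 (B.r_nonneg h θ s a x)

lemma ofReal_meanReward (h : Fin H) (θ : TR h) (s : S) (a : A) :
    ENNReal.ofReal (B.meanReward h θ s a)
      = ∫⁻ x in Icc (0 : ℝ) 1, ENNReal.ofReal (B.r h θ s a x) * ENNReal.ofReal (min x 1) := by
  have hm : Measurable fun x => B.r h θ s a x :=
    (B.r_measurable h).comp (f := fun x => (θ, s, a, x)) (by fun_prop)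
  have hae : ∀ᵐ x ∂(volume.restrict (Icc (0 : ℝ) 1)), x ∈ Icc (0 : ℝ) 1 :=
    ae_restrict_mem measurableSet_Icc
  have hint : Integrable (fun x => x * B.r h θ s a x) (volume.restrict (Icc (0 : ℝ) 1)) := by
    refine ⟨by fun_prop, ?_⟩
    refine lt_of_le_of_lt (b := ∫⁻ x in Icc (0 : ℝ) 1, ENNReal.ofReal (B.r h θ s a x)) ?_ ?_
    · refine lintegral_mono_ae ?_
      filter_upwards [hae] with x hx
      rw [Real.enorm_eq_ofReal_abs, abs_of_nonneg (mul_nonneg hx.1 (B.r_nonneg h θ s a x))]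
      exact ENNReal.ofReal_le_ofReal (mul_le_of_le_one_left (B.r_nonneg h θ s a x) hx.2)
    · rw [B.r_prob]; exact ENNReal.one_lt_top
  unfold meanReward
  rw [ofReal_integral_eq_lintegral_ofReal hint]
  · refine lintegral_congr_ae ?_
    filter_upwards [hae] with x hx
    rw [min_eq_left hx.2, mul_comm, ENNReal.ofReal_mul (B.r_nonneg h θ s a x)]
  · filter_upwards [hae] with x hx
    exact mul_nonneg hx.1 (B.r_nonneg h θ s a x)

/-- Values in the sense of densities: the expected sum of rewards from layer `h` on. -/
def accValue (Q : Trans S A) (π : Policy S A) (h : ℕ) (s : S) : ENNReal :=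
  B.mdp.acc Q π (fun _ _ _ => rew) (H - h) h s

lemma accValue_le {Q : Trans S A} {π : Policy S A} (hQ : B.mdp.IsTrans Q) (hπ : B.mdp.IsPolicy π)
    (h : ℕ) (s : S) : B.accValue Q π h s ≤ H :=
  (hQ.acc_le hπ (fun _ _ _ z => rew_le_one z) _ _ _).trans (by exact_mod_cast Nat.sub_le _ _)

lemma accValue_ne_top {Q : Trans S A} {π : Policy S A} (hQ : B.mdp.IsTrans Q)
    (hπ : B.mdp.IsPolicy π) (h : ℕ) (s : S) : B.accValue Q π h s ≠ ⊤ :=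
  ((B.accValue_le hQ hπ h s).trans_lt (ENNReal.natCast_lt_top H)).ne

lemma value_eq (E : B.Env) {π : Fin H → S → A → ℝ} (hπ : π ∈ B.Pol) (h : Fin H) (s : S) :
    B.value E π h s = (B.accValue (B.trans E) (polDens π) h.1 s).toReal := by
  have hQ := B.isTrans_trans E
  have hP := B.isPolicy_polDens hπ
  set F : Trans S A := fun n s a z => if k : n < H then
    ENNReal.ofReal (B.meanReward ⟨n, k⟩ (E ⟨n, k⟩).2 s a) else rew z with hF
  have hFm : MeasTrans F := by
    intro n
    simp only [hF]
    split_ifs with k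
    · have := B.measurable_meanReward ⟨n, k⟩ (E ⟨n, k⟩).2
      fun_prop
    · have := measurable_rew (S := S)
      fun_prop
  have hst : ∀ h', Measurable fun τ : Traj S A H => stateAt h s τ h' := fun h' =>
    (measurable_stateFrom (S := S) (A := A) h.1 h').comp (f := fun τ => (s, τ)) (by fun_prop)
  have hsum : Measurable fun τ : Traj S A H =>
      ∑ h' ∈ Finset.Ici h, B.meanReward h' (E h').2 (stateAt h s τ h') (τ h').1 := by
    refine Finset.measurable_sum _ fun h' _ => ?_
    have h1 := hst h'
    have h2 := B.measurable_meanReward h' (E h').2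
    fun_prop
  unfold value
  rw [integral_eq_lintegral_of_nonneg_ae
    (Eventually.of_forall fun τ => Finset.sum_nonneg fun h' _ => B.meanReward_nonneg _ _ _ _)
    hsum.aestronglyMeasurable, B.trajLaw_eq E hπ,
    lintegral_withDensity_eq_lintegral_mul _ (B.measurable_trajDens_trans E hπ _ _) (by fun_prop)]
  congr 1
  unfold accValue
  rw [← acc_congr hQ hFm measTrans_rew (π := polDens π),
    ← hQ.lintegral_trajDens_mul_trajSum (H := H) hP hFm (H - h.1) h.1 (by omega) s]
  · refine lintegral_congr fun τ => ?_
    simp only [Pi.mul_apply]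
    congr 1
    rw [ENNReal.ofReal_sum_of_nonneg fun h' _ => B.meanReward_nonneg _ _ _ _]
    unfold trajSum
    rw [layersFrom_coe]
    refine Finset.sum_congr rfl fun h' _ => ?_
    simp [hF, stateAt_eq]
  · intro n s a
    by_cases k : n < H
    · simp only [hF, k, dif_pos]
      have h1 := hQ.meas n
      rw [lintegral_mul_const _ (by fun_prop), hQ.prob, one_mul, ofReal_meanReward]
      unfold MDPBase.ν
      have hr := measurable_rew (S := S)
      rw [lintegral_prod _ (by fun_prop)]
      refine lintegral_congr fun x => ?_
      simp only [trans, k, dif_pos, rew]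
      have h1 : Measurable fun s' => B.p ⟨n, k⟩ (E ⟨n, k⟩).1 s a s' :=
        (B.p_measurable ⟨n, k⟩).comp (f := fun s' => ((E ⟨n, k⟩).1, s, a, s')) (by fun_prop)
      rw [lintegral_mul_const _ (by fun_prop), lintegral_const_mul _ (by fun_prop)]
      have := B.p_prob ⟨n, k⟩ (E ⟨n, k⟩).1 s a
      simp only [mdp, this, mul_one]
    · simp [hF, k]

lemma value_zero_eq [NeZero H] (E : B.Env) {π : Fin H → S → A → ℝ} (hπ : π ∈ B.Pol) (s : S) :
    B.value E π 0 s = (B.accValue (B.trans E) (polDens π) 0 s).toReal := by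
  rw [B.value_eq E hπ]; rfl

section Occupancy

variable [NeZero H]

lemma base_eq (h : Fin H) : B.base h = (B.mdp.baseS h.1).prod B.μA := by
  unfold base baseS
  have : (h = 0) ↔ h.1 = 0 := by rw [Fin.ext_iff]; rfl
  simp only [this]
  split_ifs <;> rfl

instance (h : Fin H) : IsProbabilityMeasure (B.base h) := by rw [base_eq]; infer_instance

lemma occupancy_eq (E : B.Env) {π : Fin H → S → A → ℝ} (hπ : π ∈ B.Pol) (h : Fin H) :
    B.occupancy E π h = (B.base h).withDensity
      fun x => B.mdp.occ (B.trans E) (polDens π) h.1 x.1 x.2 := by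
  classical
  have hQ := B.isTrans_trans E
  have hP := B.isPolicy_polDens hπ
  have hst : Measurable fun τ : Traj S A H => (stateAt 0 B.s₁ τ h, (τ h).1) := by
    have := (measurable_stateFrom (S := S) (A := A) (0 : Fin H).1 h).comp
      (f := fun τ => (B.s₁, τ)) (by fun_prop)
    exact this.prodMk (by fun_prop)
  have hocc := hQ.measurable_occ hP h.1
  ext U hU
  have hUi : Measurable (U.indicator (1 : S × A → ENNReal)) := measurable_one.indicator hU
  unfold occupancy
  rw [Measure.map_apply hst hU, B.trajLaw_eq E hπ, withDensity_apply _ (hst hU),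
    withDensity_apply _ hU]
  set F : Trans S A := fun n s a _ => if n = h.1 then U.indicator 1 (s, a) else 0 with hF
  have hFm : MeasTrans F := by
    intro n
    simp only [hF]
    split_ifs
    · fun_prop
    · exact measurable_const
  have h1 := hQ.lintegral_trajDens_mul_trajSum (H := H) hP hFm H 0 (by omega) B.s₁
  have h2 := hQ.acc_eq_sum hP hFm H
  change _ = B.mdp.acc _ _ _ _ _ B.mdp.s₁ at h1
  rw [h2, Finset.sum_eq_single h.1] at h1
  · rw [← lintegral_indicator (hst hU)]
    refine Eq.trans ?_ (h1.trans ?_)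
    · refine lintegral_congr fun τ => ?_
      unfold trajSum
      rw [Finset.sum_eq_single h]
      · simp only [hF, if_true]
        by_cases hτ : (stateAt 0 B.s₁ τ h, (τ h).1) ∈ U
        · rw [indicator_of_mem (by exact hτ), indicator_of_mem (by exact hτ), Pi.one_apply, mul_one]
          rfl
        · rw [indicator_of_notMem (by exact hτ), indicator_of_notMem (by exact hτ), mul_zero]
      · intro j _ hj
        simp only [hF]
        rw [if_neg (fun e => hj (Fin.ext e))]
      · intro hn
        exact absurd (by simp [layersFrom]) hn
    · rw [← lintegral_indicator hU, base_eq, lintegral_prod _ (hocc.indicator hU).aemeasurable]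
      refine lintegral_congr fun s => lintegral_congr fun a => ?_
      simp only [hF, if_true]
      have h3 := hQ.meas h.1
      rw [lintegral_mul_const _ (by fun_prop), hQ.prob, one_mul]
      by_cases hτ : (s, a) ∈ U
      · rw [indicator_of_mem hτ, indicator_of_mem hτ, Pi.one_apply, mul_one]
      · rw [indicator_of_notMem hτ, indicator_of_notMem hτ, mul_zero]
  · intro j _ hj
    simp [hF, hj]
  · intro hn
    exact absurd (Finset.mem_range.2 h.2) hn

lemma occDensity_eq (E : B.Env) {π : Fin H → S → A → ℝ} (hπ : π ∈ B.Pol) (h : Fin H) :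
    B.occDensity E π h =ᵐ[B.base h] fun x => B.mdp.occ (B.trans E) (polDens π) h.1 x.1 x.2 := by
  unfold occDensity
  rw [B.occupancy_eq E hπ]
  exact Measure.rnDeriv_withDensity _
    ((B.isTrans_trans E).measurable_occ (B.isPolicy_polDens hπ) h.1)

end Occupancy

instance : IsProbabilityMeasure B.prior := by unfold prior; infer_instance

lemma iIndepFun_prior : iIndepFun (fun h (E : B.Env) => E h) B.prior :=
  iIndepFun_pi (X := fun _ => id) (fun _ => aemeasurable_id)

end BayesRL

end

noncomputable section

namespace MDPBase

variable {S A : Type*} [MeasurableSpace S] [MeasurableSpace A] {b : MDPBase S A}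
  {Q Q' : Trans S A} {π : Policy S A} {H : ℕ}

/-- The functional that evaluates `g` at the layer `h` only. -/
def singleLayer (h : ℕ) (g : S → A → ℝ × S → ENNReal) : Trans S A :=
  fun n s a z => if n = h then g s a z else 0

lemma measTrans_singleLayer {g : S → A → ℝ × S → ENNReal}
    (hg : Measurable fun x : S × A × (ℝ × S) => g x.1 x.2.1 x.2.2) (h : ℕ) :
    MeasTrans (singleLayer h g) := by
  intro n
  unfold singleLayer
  split_ifs
  · exact hg
  · exact measurable_const

lemma IsTrans.acc_singleLayer (hQ : b.IsTrans Q) (hπ : b.IsPolicy π)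
    {g : S → A → ℝ × S → ENNReal} (hg : Measurable fun x : S × A × (ℝ × S) => g x.1 x.2.1 x.2.2)
    {h : ℕ} (hh : h < H) :
    b.acc Q π (singleLayer h g) H 0 b.s₁
      = ∫⁻ s, ∫⁻ a, b.occ Q π h s a * ∫⁻ z, Q h s a z * g s a z ∂b.ν ∂b.μA ∂(b.baseS h) := by
  rw [hQ.acc_eq_sum hπ (measTrans_singleLayer hg h), Finset.sum_eq_single h]
  · simp [singleLayer]
  · intro j _ hj
    simp [singleLayer, hj]
  · intro hn
    exact absurd (Finset.mem_range.2 hh) hn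

lemma trajSum_singleLayer (g : S → A → ℝ × S → ENNReal) (h : Fin H) (s : S)
    (τ : BayesRL.Traj S A H) :
    trajSum (singleLayer h.1 g) 0 s τ = g (stateFrom 0 s τ h) (τ h).1 (τ h).2 := by
  unfold trajSum
  rw [Finset.sum_eq_single h]
  · simp [singleLayer]
  · intro j _ hj
    simp only [singleLayer]
    rw [if_neg (fun e => hj (Fin.ext e))]
  · intro hn
    exact absurd (by simp [layersFrom]) hn

/-- The product of the action densities along a trajectory. -/
def polWeight (π : Policy S A) (s : S) (τ : BayesRL.Traj S A H) : ENNReal :=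
  ∏ h : Fin H, π h.1 (stateFrom 0 s τ h) (τ h).1

/-- The product of the transition densities along a trajectory. -/
def likelihood (Q : Trans S A) (s : S) (τ : BayesRL.Traj S A H) : ENNReal :=
  ∏ h : Fin H, Q h.1 (stateFrom 0 s τ h) (τ h).1 (τ h).2

lemma trajDens_zero (s : S) (τ : BayesRL.Traj S A H) :
    trajDens Q π 0 s τ = polWeight π s τ * likelihood Q s τ := by
  unfold trajDens polWeight likelihood
  rw [← Finset.prod_mul_distrib]
  congr 1
  ext h; simp [layersFrom]

lemma IsTrans.measurable_likelihood (hQ : b.IsTrans Q) (s : S) :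
    Measurable fun τ : BayesRL.Traj S A H => likelihood Q s τ := by
  unfold likelihood
  refine Finset.measurable_prod _ fun h _ => ?_
  have h1 := hQ.meas h.1
  have h3 := measurable_stateFrom (S := S) (A := A) 0 h
  fun_prop

end MDPBase

lemma absDiff_mul_mul_le {d D p q g : ENNReal} (hd : d ≠ ⊤) (hD : D ≠ ⊤) (hp : p ≠ ⊤)
    (hq : q ≠ ⊤) (hg : g ≠ ⊤) {α β : ℝ} (hα : 0 < α) (hβ : 0 < β) (hαβ : 1 ≤ 4 * α * β) :
    d * (absDiff p q * g) ≤ ENNReal.ofReal α * (D * triDisc p q)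
      + ENNReal.ofReal β * (d ^ 2 / D * ((p + q) * g ^ 2)) := by
  rcases eq_or_ne (p + q) 0 with h0 | h0
  · obtain ⟨rfl, rfl⟩ := add_eq_zero.1 h0
    simp
  rcases eq_or_ne g 0 with h1 | h1
  · simp [h1]
  rcases eq_or_ne d 0 with h2 | h2
  · simp [h2]
  rcases eq_or_ne D 0 with h3 | h3
  · have e : d ^ 2 / D = ⊤ := by
      rw [h3]; exact ENNReal.div_zero (pow_ne_zero 2 h2)
    rw [e, ENNReal.top_mul (mul_ne_zero h0 (pow_ne_zero 2 h1)),
      ENNReal.mul_top (by simpa using hβ)]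
    exact le_top.trans le_add_self
  lift d to NNReal using hd
  lift D to NNReal using hD
  lift p to NNReal using hp
  lift q to NNReal using hq
  lift g to NNReal using hg
  rw [← ENNReal.ofReal_coe_nnreal (p := d), ← ENNReal.ofReal_coe_nnreal (p := D),
    ← ENNReal.ofReal_coe_nnreal (p := p), ← ENNReal.ofReal_coe_nnreal (p := q),
    ← ENNReal.ofReal_coe_nnreal (p := g)]
  have hD0 : (0 : ℝ) < D := NNReal.coe_pos.2 (pos_iff_ne_zero.2 (by simpa using h3))
  have hpq : (0 : ℝ) < p + q := by
    have : 0 < p + q := pos_iff_ne_zero.2 (by intro h; apply h0; exact_mod_cast h)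
    exact_mod_cast this
  rw [absDiff_ofReal p.coe_nonneg q.coe_nonneg, triDisc_ofReal p.coe_nonneg q.coe_nonneg, ← ENNReal.ofReal_mul (abs_nonneg _),
    ← ENNReal.ofReal_mul d.coe_nonneg, ← ENNReal.ofReal_mul D.coe_nonneg, ← ENNReal.ofReal_mul hα.le,
    ← ENNReal.ofReal_pow d.coe_nonneg, ← ENNReal.ofReal_div_of_pos hD0,
    ← ENNReal.ofReal_add p.coe_nonneg q.coe_nonneg, ← ENNReal.ofReal_pow g.coe_nonneg, ← ENNReal.ofReal_mul hpq.le,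
    ← ENNReal.ofReal_mul (by positivity), ← ENNReal.ofReal_mul hβ.le,
    ← ENNReal.ofReal_add (by positivity) (by positivity)]
  refine ENNReal.ofReal_le_ofReal ?_
  set X : ℝ := D * ((p - q : ℝ) ^ 2 / (p + q)) with hX
  set Y : ℝ := (d : ℝ) ^ 2 / D * ((p + q) * g ^ 2) with hY
  have hX0 : 0 ≤ X := by positivity
  have hY0 : 0 ≤ Y := by positivity
  have hXY : X * Y = ((d : ℝ) * (|(p : ℝ) - q| * g)) ^ 2 := by
    rw [hX, hY, mul_pow, mul_pow, sq_abs]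
    field_simp
  refine abs_le_of_sq_le_sq' ?_ (by positivity) |>.2
  rw [← hXY]
  nlinarith [sq_nonneg (α * X - β * Y), mul_nonneg hX0 hY0]

lemma ENNReal.two_mul_mul_le {d D : ENNReal} (hd : d ≠ ⊤) (hD : D ≠ ⊤) {c γ : ℝ} (hc : 0 ≤ c)
    (hγ : 0 < γ) : ENNReal.ofReal (2 * c) * d
      ≤ ENNReal.ofReal γ * D + ENNReal.ofReal (c ^ 2 / γ) * (d ^ 2 / D) := by
  rcases eq_or_ne d 0 with h2 | h2
  · simp [h2]
  rcases eq_or_lt_of_le hc with h4 | h4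
  · simp [← h4]
  rcases eq_or_ne D 0 with h3 | h3
  · have e : d ^ 2 / D = ⊤ := by
      rw [h3]; exact ENNReal.div_zero (pow_ne_zero 2 h2)
    have : 0 < c ^ 2 / γ := by positivity
    rw [e, ENNReal.mul_top (by simpa using this)]
    exact le_top.trans le_add_self
  lift d to NNReal using hd
  lift D to NNReal using hD
  have hD0 : (0 : ℝ) < D := NNReal.coe_pos.2 (pos_iff_ne_zero.2 (by simpa using h3))
  rw [← ENNReal.ofReal_coe_nnreal (p := d), ← ENNReal.ofReal_coe_nnreal (p := D),
    ← ENNReal.ofReal_mul (by positivity), ← ENNReal.ofReal_mul hγ.le, ← ENNReal.ofReal_pow d.coe_nonneg,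
    ← ENNReal.ofReal_div_of_pos hD0, ← ENNReal.ofReal_mul (by positivity),
    ← ENNReal.ofReal_add (by positivity) (by positivity)]
  refine ENNReal.ofReal_le_ofReal ?_
  have hd0 : (0 : ℝ) ≤ d := d.2
  have : γ * D + c ^ 2 / γ * ((d : ℝ) ^ 2 / D) - 2 * c * d = (γ * D - c * d) ^ 2 / (γ * D) := by
    field_simp; ring
  have h5 : 0 ≤ (γ * D - c * d) ^ 2 / (γ * D) := by positivity
  linarith

lemma lintegral_lintegral_lintegral_comm {X Y Z : Type*} [MeasurableSpace X] [MeasurableSpace Y]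
    [MeasurableSpace Z] {μ : Measure X} {κ : Measure Y} {ρ : Measure Z} [SFinite μ] [SFinite κ]
    [SFinite ρ] {f : X → Y → Z → ENNReal} (hf : Measurable fun x : X × Y × Z => f x.1 x.2.1 x.2.2) :
    ∫⁻ y, ∫⁻ z, ∫⁻ x, f x y z ∂μ ∂ρ ∂κ = ∫⁻ x, ∫⁻ y, ∫⁻ z, f x y z ∂ρ ∂κ ∂μ := by
  have e : ∀ y, ∫⁻ z, ∫⁻ x, f x y z ∂μ ∂ρ = ∫⁻ x, ∫⁻ z, f x y z ∂ρ ∂μ := fun y =>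
    lintegral_lintegral_swap (by fun_prop)
  simp only [e]
  exact lintegral_lintegral_swap (by fun_prop)

namespace BayesRL

open MDPBase

variable {S A : Type*} [MeasurableSpace S] [MeasurableSpace A] {H : ℕ}
  {TP TR : Fin H → Type*} [∀ h, MeasurableSpace (TP h)] [∀ h, MeasurableSpace (TR h)]
  (B : BayesRL S A H TP TR)

/-- The environment whose densities are the means of the densities under `N`. -/
def meanTrans (N : Measure B.Env) : Trans S A := fun n s a z => ∫⁻ E, B.trans E n s a z ∂N

lemma isTrans_meanTrans (N : Measure B.Env) [IsProbabilityMeasure N] :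
    B.mdp.IsTrans (B.meanTrans N) where
  meas n := by
    have := B.measurable_trans n
    unfold meanTrans
    refine Measurable.lintegral_prod_left' (f := fun y : B.Env × S × A × (ℝ × S) =>
      B.trans y.1 n y.2.1 y.2.2.1 y.2.2.2) this
  prob n s a := by
    have := B.measurable_trans n
    unfold meanTrans
    rw [lintegral_lintegral_swap (by fun_prop)]
    simp [(B.isTrans_trans _).prob]

lemma mul_meanTrans_le {N N' : Measure B.Env} {w : ENNReal} (h : w • N' ≤ N) (n : ℕ) (s : S)
    (a : A) (z : ℝ × S) : w * B.meanTrans N' n s a z ≤ B.meanTrans N n s a z := by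
  unfold meanTrans
  rw [← smul_eq_mul, ← lintegral_smul_measure]
  exact lintegral_mono' h le_rfl

lemma lintegral_likelihood {N : Measure B.Env} [IsProbabilityMeasure N]
    (hN : iIndepFun (fun h (E : B.Env) => E h) N) (s : S) (τ : Traj S A H) :
    ∫⁻ E, likelihood (B.trans E) s τ ∂N = likelihood (B.meanTrans N) s τ := by
  unfold likelihood meanTrans
  set f : ∀ h, TP h × TR h → ENNReal := fun h e =>
    ENNReal.ofReal (B.r h e.2 (stateFrom 0 s τ h) (τ h).1 (τ h).2.1)
      * ENNReal.ofReal (B.p h e.1 (stateFrom 0 s τ h) (τ h).1 (τ h).2.2) with hf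
  have hfm : ∀ h, Measurable (f h) := by
    intro h
    refine Measurable.mul (M := ENNReal) ?_ ?_
    · exact ENNReal.measurable_ofReal.comp ((B.r_measurable h).comp
        (f := fun e : TP h × TR h => (e.2, stateFrom 0 s τ h, (τ h).1, (τ h).2.1)) (by fun_prop))
    · exact ENNReal.measurable_ofReal.comp ((B.p_measurable h).comp
        (f := fun e : TP h × TR h => (e.1, stateFrom 0 s τ h, (τ h).1, (τ h).2.2)) (by fun_prop))
  have e : ∀ (E : B.Env) (h : Fin H),
      B.trans E h.1 (stateFrom 0 s τ h) (τ h).1 (τ h).2 = f h (E h) := by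
    intro E h
    simp [trans, hf]
  simp only [e]
  exact lintegral_prod_of_iIndepFun hN hfm

lemma measurable_likelihood (s : S) : Measurable fun x : B.Env × Traj S A H =>
    likelihood (B.trans x.1) s x.2 := by
  unfold likelihood
  refine Finset.measurable_prod _ fun h _ => ?_
  have h1 := B.measurable_trans h.1
  have h3 := measurable_stateFrom (S := S) (A := A) 0 h
  fun_prop

lemma measurable_polWeight (s : S) : Measurable fun x : B.Env × Traj S A H =>
    polWeight (B.optPol x.1) s x.2 := by
  unfold polWeight
  refine Finset.measurable_prod _ fun h _ => ?_
  have h1 := B.measurable_optPol h.1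
  have h3 := measurable_stateFrom (S := S) (A := A) 0 h
  fun_prop

lemma lintegral_acc_trans {N : Measure B.Env} [IsProbabilityMeasure N]
    (hN : iIndepFun (fun h (E : B.Env) => E h) N) {π : Policy S A} (hπ : B.mdp.IsPolicy π)
    {F : Trans S A} (hF : MeasTrans F) (s : S) :
    ∫⁻ E, B.mdp.acc (B.trans E) π F H 0 s ∂N = B.mdp.acc (B.meanTrans N) π F H 0 s := by
  have e : ∀ E, B.mdp.acc (B.trans E) π F H 0 s = _ := fun E =>
    ((B.isTrans_trans E).lintegral_trajDens_mul_trajSum (H := H) hπ hF H 0 (by omega) s).symm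
  simp only [e]
  rw [← (B.isTrans_meanTrans N).lintegral_trajDens_mul_trajSum (H := H) hπ hF H 0 (by omega) s]
  have hlik := B.measurable_likelihood s
  have hpol : Measurable fun τ : Traj S A H => polWeight π s τ := by
    unfold polWeight
    refine Finset.measurable_prod _ fun h _ => ?_
    have h1 := hπ.meas h.1
    have h3 := measurable_stateFrom (S := S) (A := A) 0 h
    fun_prop
  have hsum := measurable_trajSum (H := H) hF 0
  have hlik' : ∀ τ : Traj S A H, Measurable fun E => likelihood (B.trans E) s τ := fun τ =>
    hlik.comp (f := fun E => (E, τ)) (by fun_prop)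
  simp only [trajDens_zero]
  rw [lintegral_lintegral_swap (by fun_prop)]
  refine lintegral_congr fun τ => ?_
  rw [lintegral_mul_const _ ((hlik' τ).const_mul _), lintegral_const_mul _ (hlik' τ),
    B.lintegral_likelihood hN]

lemma lintegral_accValue_trans {N : Measure B.Env} [IsProbabilityMeasure N]
    (hN : iIndepFun (fun h (E : B.Env) => E h) N) {π : Policy S A} (hπ : B.mdp.IsPolicy π) (s : S) :
    ∫⁻ E, B.accValue (B.trans E) π 0 s ∂N = B.accValue (B.meanTrans N) π 0 s :=
  B.lintegral_acc_trans hN hπ measTrans_rew s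

/-- Uniform bound on the occupancy densities of the environments. -/
def OccBound (M : NNReal) : Prop :=
  ∀ E E' : B.Env, ∀ h < H, ∀ᵐ x ∂((B.mdp.baseS h).prod B.μA),
    B.mdp.occ (B.trans E) (B.optPol E') h x.1 x.2 ≤ M

lemma Standing.exists_occBound [NeZero H] {B : BayesRL S A H TP TR} (hB : B.Standing) :
    ∃ M : NNReal, B.OccBound M := by
  obtain ⟨M, hM⟩ := hB.bounded
  refine ⟨M, fun E E' h hh => ?_⟩
  have h1 := hM E (B.star E') (B.star_mem E') ⟨h, hh⟩
  have h2 := B.occDensity_eq E (B.star_mem E') ⟨h, hh⟩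
  rw [base_eq] at h1 h2
  filter_upwards [h1, h2] with x hx1 hx2
  rw [hx2] at hx1
  exact hx1

lemma OccBound.meanTrans {B : BayesRL S A H TP TR} {M : NNReal} (hM : B.OccBound M)
    {N : Measure B.Env} [IsProbabilityMeasure N]
    (hN : iIndepFun (fun h (E : B.Env) => E h) N) (E' : B.Env) {h : ℕ} (hh : h < H) :
    ∀ᵐ x ∂((B.mdp.baseS h).prod B.μA),
      B.mdp.occ (B.meanTrans N) (B.optPol E') h x.1 x.2 ≤ M := by
  have hπ := B.isPolicy_optPol E'
  have hQ := B.isTrans_meanTrans N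
  have hocc := hQ.measurable_occ hπ h
  refine ae_le_of_forall_setLIntegral_le_of_sigmaFinite hocc fun U hU _ => ?_
  have hUi : Measurable (U.indicator (1 : S × A → ENNReal)) := measurable_one.indicator hU
  have key : ∀ Q : Trans S A, B.mdp.IsTrans Q → ∫⁻ x in U, B.mdp.occ Q (B.optPol E') h x.1 x.2
        ∂((B.mdp.baseS h).prod B.μA)
      = B.mdp.acc Q (B.optPol E') (singleLayer h fun s a _ => U.indicator 1 (s, a)) H 0 B.s₁ := by
    intro Q hQ
    have hocc := hQ.measurable_occ hπ h
    refine Eq.trans ?_ (hQ.acc_singleLayer hπ (by fun_prop) hh).symm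
    rw [← lintegral_indicator hU, lintegral_prod _ (hocc.indicator hU).aemeasurable]
    refine lintegral_congr fun s => lintegral_congr fun a => ?_
    have h3 := hQ.meas h
    rw [lintegral_mul_const _ (by fun_prop), hQ.prob, one_mul]
    by_cases hτ : (s, a) ∈ U
    · rw [indicator_of_mem hτ, indicator_of_mem hτ, Pi.one_apply, mul_one]
    · rw [indicator_of_notMem hτ, indicator_of_notMem hτ, mul_zero]
  rw [key _ hQ, ← B.lintegral_acc_trans hN hπ (measTrans_singleLayer (by fun_prop) h)]
  calc _ ≤ ∫⁻ _, ∫⁻ x in U, (M : ENNReal) ∂((B.mdp.baseS h).prod B.μA) ∂N := by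
        refine lintegral_mono fun E => ?_
        rw [← key _ (B.isTrans_trans E)]
        exact lintegral_mono_ae (ae_restrict_of_ae (hM E E' h hh))
    _ = _ := by simp

/-- Mean occupancy density when the policy is the optimal policy of a random environment. -/
def avgOcc (N : Measure B.Env) (Q : Trans S A) (h : ℕ) (s : S) (a : A) : ENNReal :=
  ∫⁻ E, B.mdp.occ Q (B.optPol E) h s a ∂N

lemma measurable_occ_optPol {Q : Trans S A} (hQ : B.mdp.IsTrans Q) (h : ℕ) :
    Measurable fun x : B.Env × S × A => B.mdp.occ Q (B.optPol x.1) h x.2.1 x.2.2 :=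
  B.mdp.measurable_occ (Q := fun _ : B.Env => Q) (π := B.optPol)
    (fun n => (hQ.meas n).comp measurable_snd) B.measurable_optPol h

lemma measurable_avgOcc (N : Measure B.Env) [SFinite N] {Q : Trans S A} (hQ : B.mdp.IsTrans Q)
    (h : ℕ) : Measurable fun x : S × A => B.avgOcc N Q h x.1 x.2 :=
  (B.measurable_occ_optPol hQ h).lintegral_prod_left'

/-- Mean of the policy weights of trajectories. -/
def avgPol (N : Measure B.Env) (τ : Traj S A H) : ENNReal :=
  ∫⁻ E, polWeight (B.optPol E) B.s₁ τ ∂N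

lemma measurable_avgPol (N : Measure B.Env) [SFinite N] : Measurable (B.avgPol N) :=
  (B.measurable_polWeight B.s₁).lintegral_prod_left'

lemma lintegral_avgPol_mul (N : Measure B.Env) [IsProbabilityMeasure N] {Q : Trans S A}
    (hQ : B.mdp.IsTrans Q) {g : S → A → ℝ × S → ENNReal}
    (hg : Measurable fun x : S × A × (ℝ × S) => g x.1 x.2.1 x.2.2) (h : Fin H) :
    ∫⁻ τ, B.avgPol N τ * likelihood Q B.s₁ τ *
        g (stateFrom 0 B.s₁ τ h) (τ h).1 (τ h).2 ∂(B.mdp.trajRef H)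
      = ∫⁻ s, ∫⁻ a, B.avgOcc N Q h.1 s a * ∫⁻ z, Q h.1 s a z * g s a z ∂B.mdp.ν
          ∂B.μA ∂(B.mdp.baseS h.1) := by
  have hpol := B.measurable_polWeight B.s₁
  have hlik := hQ.measurable_likelihood (H := H) B.s₁
  have hst := measurable_stateFrom (S := S) (A := A) 0 h
  have hocc := B.measurable_occ_optPol hQ h.1
  have hQm := hQ.meas h.1
  have e1 : ∀ E, ∫⁻ τ, polWeight (B.optPol E) B.s₁ τ * likelihood Q B.s₁ τ *
        g (stateFrom 0 B.s₁ τ h) (τ h).1 (τ h).2 ∂(B.mdp.trajRef H)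
      = ∫⁻ s, ∫⁻ a, B.mdp.occ Q (B.optPol E) h.1 s a * ∫⁻ z, Q h.1 s a z * g s a z ∂B.mdp.ν
          ∂B.μA ∂(B.mdp.baseS h.1) := by
    intro E
    have hπ := B.isPolicy_optPol E
    refine Eq.trans ?_ (hQ.acc_singleLayer hπ hg h.2)
    refine Eq.trans ?_ (hQ.lintegral_trajDens_mul_trajSum (H := H) hπ
      (measTrans_singleLayer hg h.1) H 0 (by omega) B.s₁)
    refine lintegral_congr fun τ => ?_
    rw [trajSum_singleLayer, trajDens_zero]
  calc _ = ∫⁻ τ, ∫⁻ E, polWeight (B.optPol E) B.s₁ τ * likelihood Q B.s₁ τ *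
        g (stateFrom 0 B.s₁ τ h) (τ h).1 (τ h).2 ∂N ∂(B.mdp.trajRef H) := by
        refine lintegral_congr fun τ => ?_
        unfold avgPol
        simp only [mul_assoc]
        exact (lintegral_mul_const _ (hpol.comp (f := fun E => (E, τ)) (by fun_prop))).symm
    _ = ∫⁻ E, ∫⁻ s, ∫⁻ a, B.mdp.occ Q (B.optPol E) h.1 s a * ∫⁻ z, Q h.1 s a z * g s a z ∂B.mdp.ν
          ∂B.μA ∂(B.mdp.baseS h.1) ∂N := by
        have hgm : Measurable fun τ : Traj S A H => g (stateFrom 0 B.s₁ τ h) (τ h).1 (τ h).2 := by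
          have := hst.comp (f := fun τ : Traj S A H => (B.s₁, τ)) (by fun_prop)
          exact hg.comp (f := fun τ : Traj S A H => (stateFrom 0 B.s₁ τ h, τ h)) (by fun_prop)
        have hm : Measurable fun x : Traj S A H × B.Env => polWeight (B.optPol x.2) B.s₁ x.1 *
            likelihood Q B.s₁ x.1 * g (stateFrom 0 B.s₁ x.1 h) (x.1 h).1 (x.1 h).2 :=
          ((hpol.comp (f := fun x : Traj S A H × B.Env => (x.2, x.1)) (by fun_prop)).mul
            (hlik.comp measurable_fst)).mul (hgm.comp measurable_fst)
        rw [lintegral_lintegral_swap hm.aemeasurable]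
        exact lintegral_congr e1
    _ = _ := by
        unfold avgOcc
        have hJ : Measurable fun x : S × A => ∫⁻ z, Q h.1 x.1 x.2 z * g x.1 x.2 z ∂B.mdp.ν := by
          fun_prop
        rw [← lintegral_lintegral_lintegral_comm (hocc.mul (hJ.comp measurable_snd))]
        refine lintegral_congr fun s => lintegral_congr fun a => ?_
        exact lintegral_mul_const _ (hocc.comp (f := fun E => (E, s, a)) (by fun_prop))

lemma lintegral_avgOcc (N : Measure B.Env) [IsProbabilityMeasure N] {Q : Trans S A}
    (hQ : B.mdp.IsTrans Q) (h : ℕ) :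
    ∫⁻ s, ∫⁻ a, B.avgOcc N Q h s a ∂B.μA ∂(B.mdp.baseS h) = 1 := by
  have hocc := B.measurable_occ_optPol hQ h
  unfold avgOcc
  rw [lintegral_lintegral_lintegral_comm hocc]
  have e2 : ∀ E, ∫⁻ s, ∫⁻ a, B.mdp.occ Q (B.optPol E) h s a ∂B.μA ∂(B.mdp.baseS h) = 1 :=
    fun E => hQ.lintegral_occ (B.isPolicy_optPol E) h
  simp [e2]

lemma lintegral_avgPol_mul_likelihood [NeZero H] (N : Measure B.Env) [IsProbabilityMeasure N]
    {Q : Trans S A} (hQ : B.mdp.IsTrans Q) :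
    ∫⁻ τ, B.avgPol N τ * likelihood Q B.s₁ τ ∂(B.mdp.trajRef H) = 1 := by
  have := B.lintegral_avgPol_mul N hQ (g := fun _ _ _ => 1) measurable_const (0 : Fin H)
  simp only [mul_one, hQ.prob] at this
  rw [this, B.lintegral_avgOcc N hQ]

end BayesRL

end

noncomputable section

namespace BayesRL

open MDPBase

variable {S A : Type*} [MeasurableSpace S] [MeasurableSpace A] {H : ℕ} [NeZero H]
  {TP TR : Fin H → Type*} [∀ h, MeasurableSpace (TP h)] [∀ h, MeasurableSpace (TR h)]
  (B : BayesRL S A H TP TR)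

/-- Expected deficit of the log-likelihood ratio of a trajectory with respect to its bound `c`. -/
def logDeficit (N : Measure B.Env) (Q Q' : Trans S A) (c : ℝ) : ENNReal :=
  ∫⁻ τ : Traj S A H, B.avgPol N τ * likelihood Q' B.s₁ τ *
    ENNReal.ofReal (c - Real.log (likelihood Q' B.s₁ τ / likelihood Q B.s₁ τ).toReal)
      ∂(B.mdp.trajRef H)

lemma ofReal_exp_neg_log {w : ENNReal} (hw0 : w ≠ 0) (hw1 : w ≤ 1) :
    ENNReal.ofReal (Real.exp (-Real.log w.toReal)) = w⁻¹ := by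
  have hwt : w ≠ ⊤ := (hw1.trans_lt ENNReal.one_lt_top).ne
  have h1 : 0 < w.toReal := ENNReal.toReal_pos hw0 hwt
  rw [Real.exp_neg, Real.exp_log h1, ENNReal.ofReal_inv_of_pos h1, ENNReal.ofReal_toReal hwt]

lemma neg_log_toReal_nonneg {w : ENNReal} (hw1 : w ≤ 1) : 0 ≤ -Real.log w.toReal := by
  have : w.toReal ≤ 1 := ENNReal.toReal_le_of_le_ofReal zero_le_one (by simpa using hw1)
  have := Real.log_nonpos ENNReal.toReal_nonneg this
  linarith

lemma le_inv_mul_of_mul_le {w p q : ENNReal} (hw0 : w ≠ 0) (hwt : w ≠ ⊤) (h : w * p ≤ q) :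
    p ≤ w⁻¹ * q := by
  calc p = w⁻¹ * (w * p) := by rw [← mul_assoc, ENNReal.inv_mul_cancel hw0 hwt, one_mul]
    _ ≤ _ := by gcongr

lemma ae_avgPol_mul_likelihood_lt_top (N : Measure B.Env) [IsProbabilityMeasure N]
    {Q : Trans S A} (hQ : B.mdp.IsTrans Q) :
    ∀ᵐ τ ∂(B.mdp.trajRef H), B.avgPol N τ * likelihood Q B.s₁ τ < ⊤ := by
  refine ae_lt_top ((B.measurable_avgPol N).mul (hQ.measurable_likelihood B.s₁)) ?_
  rw [B.lintegral_avgPol_mul_likelihood N hQ]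
  exact ENNReal.one_ne_top

variable {N : Measure B.Env} [IsProbabilityMeasure N] {Q Q' : Trans S A}

lemma logDeficit_add_traj (hQ : B.mdp.IsTrans Q) (hQ' : B.mdp.IsTrans Q') {w : ENNReal}
    (hw0 : w ≠ 0) (hw1 : w ≤ 1)
    (hlik : ∀ τ : Traj S A H, w * likelihood Q' B.s₁ τ ≤ likelihood Q B.s₁ τ) :
    B.logDeficit N Q Q' (-Real.log w.toReal)
      + 2⁻¹ * ∫⁻ τ : Traj S A H, triDisc (B.avgPol N τ * likelihood Q' B.s₁ τ)
          (B.avgPol N τ * likelihood Q B.s₁ τ) ∂(B.mdp.trajRef H)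
      ≤ ENNReal.ofReal (-Real.log w.toReal) := by
  have hwt : w ≠ ⊤ := (hw1.trans_lt ENNReal.one_lt_top).ne
  have hg := B.measurable_avgPol N
  have h1 := hQ.measurable_likelihood (H := H) B.s₁
  have h2 := hQ'.measurable_likelihood (H := H) B.s₁
  refine le_trans (le_of_eq ?_) (lintegral_log_add_triDisc_le (hg.mul h2) (hg.mul h1)
    (B.lintegral_avgPol_mul_likelihood N hQ') (B.lintegral_avgPol_mul_likelihood N hQ)
    (neg_log_toReal_nonneg hw1) (Eventually.of_forall fun τ => ?_))
  · congr 1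
    refine lintegral_congr_ae ?_
    filter_upwards [B.ae_avgPol_mul_likelihood_lt_top N hQ,
      B.ae_avgPol_mul_likelihood_lt_top N hQ'] with τ h3 h4
    simp only [Pi.mul_apply]
    rcases eq_or_ne (likelihood Q' B.s₁ τ) 0 with h0 | h0
    · simp [h0]
    rcases eq_or_ne (B.avgPol N τ) 0 with h5 | h5
    · simp [h5]
    have h6 : B.avgPol N τ ≠ ⊤ := by
      intro h; rw [h, ENNReal.top_mul h0] at h4; exact lt_irrefl _ h4
    rw [ENNReal.mul_div_mul_left _ _ h5 h6]
  · rw [ofReal_exp_neg_log hw0 hw1]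
    have := le_inv_mul_of_mul_le hw0 hwt (hlik τ)
    simp only [Pi.mul_apply]
    calc _ ≤ B.avgPol N τ * (w⁻¹ * likelihood Q B.s₁ τ) := by gcongr
      _ = _ := by ring

lemma ofReal_sub_log_prod_add {ι : Type*} [Fintype ι] [Nonempty ι] {p q : ι → ENNReal} {w : ENNReal}
    (hw0 : w ≠ 0) (hw1 : w ≤ 1) (hpq : ∀ i, w * p i ≤ q i) (hprod : w * ∏ i, p i ≤ ∏ i, q i)
    (hp : ∏ i, p i ≠ 0) (hq : ∏ i, q i ≠ ⊤) :
    ENNReal.ofReal (-Real.log w.toReal - Real.log ((∏ i, p i) / ∏ i, q i).toReal)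
      + ENNReal.ofReal ((Fintype.card ι - 1) * (-Real.log w.toReal))
      = ∑ i, ENNReal.ofReal (-Real.log w.toReal - Real.log (p i / q i).toReal) := by
  classical
  have hwt : w ≠ ⊤ := (hw1.trans_lt ENNReal.one_lt_top).ne
  have hwr : 0 < w.toReal := ENNReal.toReal_pos hw0 hwt
  have hp0 : ∀ i, p i ≠ 0 := fun i => Finset.prod_ne_zero_iff.1 hp i (Finset.mem_univ i)
  have hq0 : ∀ i, q i ≠ 0 := fun i h0 => by
    have := hpq i
    rw [h0] at this
    exact mul_ne_zero hw0 (hp0 i) (le_zero_iff.1 this)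
  have hqt : ∀ i, q i ≠ ⊤ := by
    intro i hi
    apply hq
    rw [← Finset.mul_prod_erase _ _ (Finset.mem_univ i), hi]
    exact ENNReal.top_mul (Finset.prod_ne_zero_iff.2 fun j _ => hq0 j)
  have hpt : ∀ i, p i ≠ ⊤ := by
    intro i hi
    have := hpq i
    rw [hi, ENNReal.mul_top hw0] at this
    exact hqt i (top_le_iff.1 this)
  have key : ∀ {x y : ENNReal}, w * x ≤ y → x ≠ 0 → y ≠ ⊤ →
      0 ≤ -Real.log w.toReal - Real.log (x / y).toReal := by
    intro x y hxy hx hy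
    have hy0 : y ≠ 0 := fun h0 => by
      rw [h0] at hxy
      exact mul_ne_zero hw0 hx (le_zero_iff.1 hxy)
    have hxt : x ≠ ⊤ := by
      rintro rfl
      rw [ENNReal.mul_top hw0] at hxy
      exact hy (top_le_iff.1 hxy)
    have hxr : 0 < x.toReal := ENNReal.toReal_pos hx hxt
    have hyr : 0 < y.toReal := ENNReal.toReal_pos hy0 hy
    have h1 : w.toReal * x.toReal ≤ y.toReal := by
      rw [← ENNReal.toReal_mul]; exact ENNReal.toReal_mono hy hxy
    rw [ENNReal.toReal_div, ← neg_add', ← Real.log_mul hwr.ne' (by positivity), neg_nonneg]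
    refine Real.log_nonpos (by positivity) ?_
    rw [← mul_div_assoc]
    exact div_le_one_of_le₀ h1 hyr.le
  have hcard : (1 : ℝ) ≤ Fintype.card ι := by exact_mod_cast Fintype.card_pos
  rw [← ENNReal.ofReal_sum_of_nonneg (fun i _ => key (hpq i) (hp0 i) (hqt i)),
    ← ENNReal.ofReal_add (key hprod hp hq)
      (mul_nonneg (by linarith) (neg_log_toReal_nonneg hw1))]
  congr 1
  have e : Real.log ((∏ i, p i) / ∏ i, q i).toReal = ∑ i, Real.log (p i / q i).toReal := by
    rw [ENNReal.toReal_div, ENNReal.toReal_prod, ENNReal.toReal_prod, ← Finset.prod_div_distrib,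
      Real.log_prod]
    · simp only [ENNReal.toReal_div]
    · intro i _
      exact div_ne_zero (ENNReal.toReal_pos (hp0 i) (hpt i)).ne'
        (ENNReal.toReal_pos (hq0 i) (hqt i)).ne'
  rw [e, Finset.sum_sub_distrib]
  simp only [Finset.sum_const, Finset.card_univ, nsmul_eq_mul]
  ring

lemma logDeficit_add_layers (hQ : B.mdp.IsTrans Q) (hQ' : B.mdp.IsTrans Q') {w : ENNReal}
    (hw0 : w ≠ 0) (hw1 : w ≤ 1) (hw : ∀ n s a z, w * Q' n s a z ≤ Q n s a z)
    (hlik : ∀ τ : Traj S A H, w * likelihood Q' B.s₁ τ ≤ likelihood Q B.s₁ τ) :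
    B.logDeficit N Q Q' (-Real.log w.toReal)
      + 2⁻¹ * ∑ h : Fin H, ∫⁻ s, ∫⁻ a, B.avgOcc N Q' h.1 s a *
          ∫⁻ z, triDisc (Q' h.1 s a z) (Q h.1 s a z) ∂B.mdp.ν ∂B.μA ∂(B.mdp.baseS h.1)
      ≤ ENNReal.ofReal (-Real.log w.toReal) := by
  have hwt : w ≠ ⊤ := (hw1.trans_lt ENNReal.one_lt_top).ne
  set b : ℝ := -Real.log w.toReal with hb
  have hb0 : 0 ≤ b := neg_log_toReal_nonneg hw1
  have hg := B.measurable_avgPol N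
  have hl := hQ.measurable_likelihood (H := H) B.s₁
  have hl' := hQ'.measurable_likelihood (H := H) B.s₁
  have hgl : Measurable fun τ : Traj S A H => B.avgPol N τ * likelihood Q' B.s₁ τ := hg.mul hl'
  set G : Fin H → S → A → ℝ × S → ENNReal := fun h s a z =>
    ENNReal.ofReal (b - Real.log (Q' h.1 s a z / Q h.1 s a z).toReal) with hG
  have hGm : ∀ h, Measurable fun x : S × A × (ℝ × S) => G h x.1 x.2.1 x.2.2 := by
    intro h
    have h1 := hQ.meas h.1
    have h2 := hQ'.meas h.1
    have h3 := h2.div h1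
    simp only [hG]
    exact ENNReal.measurable_ofReal.comp
      (measurable_const.sub (Real.measurable_log.comp h3.ennreal_toReal))
  have hlayer : ∀ h : Fin H, ∫⁻ τ, B.avgPol N τ * likelihood Q' B.s₁ τ *
        G h (stateFrom 0 B.s₁ τ h) (τ h).1 (τ h).2 ∂(B.mdp.trajRef H)
      + 2⁻¹ * ∫⁻ s, ∫⁻ a, B.avgOcc N Q' h.1 s a *
          ∫⁻ z, triDisc (Q' h.1 s a z) (Q h.1 s a z) ∂B.mdp.ν ∂B.μA ∂(B.mdp.baseS h.1)
      ≤ ENNReal.ofReal b := by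
    intro h
    have h1 := hQ.meas h.1
    have h2 := hQ'.meas h.1
    have h3 := B.measurable_avgOcc N hQ' h.1
    have h4 := hGm h
    rw [B.lintegral_avgPol_mul N hQ' (hGm h) h, ← lintegral_const_mul _ (by fun_prop),
      ← lintegral_add_left (by fun_prop)]
    calc _ ≤ ∫⁻ s, ∫⁻ a, B.avgOcc N Q' h.1 s a * ENNReal.ofReal b ∂B.μA ∂(B.mdp.baseS h.1) := by
          refine lintegral_mono fun s => ?_
          dsimp only
          rw [← lintegral_const_mul _ (by fun_prop), ← lintegral_add_left (by fun_prop)]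
          refine lintegral_mono fun a => ?_
          calc _ = B.avgOcc N Q' h.1 s a * (∫⁻ z, Q' h.1 s a z * G h s a z ∂B.mdp.ν
                + 2⁻¹ * ∫⁻ z, triDisc (Q' h.1 s a z) (Q h.1 s a z) ∂B.mdp.ν) := by ring
            _ ≤ _ := by
              gcongr
              refine lintegral_log_add_triDisc_le (by fun_prop) (by fun_prop) (hQ'.prob _ _ _)
                (hQ.prob _ _ _) hb0 (Eventually.of_forall fun z => ?_)
              rw [hb, ofReal_exp_neg_log hw0 hw1]
              exact le_inv_mul_of_mul_le hw0 hwt (hw _ _ _ _)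
      _ = _ := by
          have e : ∀ s, ∫⁻ a, B.avgOcc N Q' h.1 s a * ENNReal.ofReal b ∂B.μA
              = (∫⁻ a, B.avgOcc N Q' h.1 s a ∂B.μA) * ENNReal.ofReal b := fun s =>
            lintegral_mul_const _ (by fun_prop)
          simp only [e]
          rw [lintegral_mul_const _ (by fun_prop), B.lintegral_avgOcc N hQ', one_mul]
  have hsum := Finset.sum_le_sum fun h (_ : h ∈ Finset.univ) => hlayer h
  rw [Finset.sum_add_distrib, ← Finset.mul_sum, ← lintegral_finsetSum _ (fun h _ => by
    have := (measurable_stateFrom (S := S) (A := A) 0 h).comp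
      (f := fun τ : Traj S A H => (B.s₁, τ)) (by fun_prop)
    exact (hg.mul hl').mul ((hGm h).comp
      (f := fun τ : Traj S A H => (stateFrom 0 B.s₁ τ h, τ h)) (by fun_prop)))] at hsum
  have hpt : B.logDeficit N Q Q' b + ENNReal.ofReal ((H - 1) * b)
      ≤ ∫⁻ τ, ∑ h : Fin H, B.avgPol N τ * likelihood Q' B.s₁ τ *
        G h (stateFrom 0 B.s₁ τ h) (τ h).1 (τ h).2 ∂(B.mdp.trajRef H) := by
    have e : ENNReal.ofReal ((H - 1) * b) = ∫⁻ τ, B.avgPol N τ * likelihood Q' B.s₁ τ *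
        ENNReal.ofReal ((H - 1) * b) ∂(B.mdp.trajRef H) := by
      rw [lintegral_mul_const _ hgl, B.lintegral_avgPol_mul_likelihood N hQ', one_mul]
    rw [e]
    unfold logDeficit
    rw [← lintegral_add_right _ (hgl.mul_const _)]
    refine lintegral_mono_ae ?_
    filter_upwards [B.ae_avgPol_mul_likelihood_lt_top N hQ] with τ h3
    rw [← Finset.mul_sum, ← mul_add]
    rcases eq_or_ne (likelihood Q' B.s₁ τ) 0 with h0 | h0
    · simp [h0]
    rcases eq_or_ne (B.avgPol N τ) 0 with h5 | h5
    · simp [h5]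
    have h6 : likelihood Q B.s₁ τ ≠ ⊤ := by
      intro h; rw [h, ENNReal.mul_top h5] at h3; exact lt_irrefl _ h3
    refine mul_le_mul_right (le_of_eq ?_) _
    have := ofReal_sub_log_prod_add (ι := Fin H)
      (p := fun h => Q' h.1 (stateFrom 0 B.s₁ τ h) (τ h).1 (τ h).2)
      (q := fun h => Q h.1 (stateFrom 0 B.s₁ τ h) (τ h).1 (τ h).2) hw0 hw1
      (fun i => hw _ _ _ _) (hlik τ) h0 h6
    rw [Fintype.card_fin] at this
    exact this
  have hfin : ENNReal.ofReal ((H - 1) * b) ≠ ⊤ := ENNReal.ofReal_ne_top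
  have hH : (1 : ℝ) ≤ H := by exact_mod_cast NeZero.one_le
  have hR : ∑ _h : Fin H, ENNReal.ofReal b = ENNReal.ofReal b + ENNReal.ofReal ((H - 1) * b) := by
    rw [← ENNReal.ofReal_add hb0 (mul_nonneg (by linarith) hb0), Finset.sum_const, Finset.card_univ,
      Fintype.card_fin, ← ENNReal.ofReal_nsmul, nsmul_eq_mul]
    congr 1; ring
  rw [hR] at hsum
  refine (ENNReal.add_le_add_iff_right hfin).1 (le_trans ?_ hsum)
  calc _ = (B.logDeficit N Q Q' b + ENNReal.ofReal ((H - 1) * b)) + 2⁻¹ * ∑ h : Fin H, ∫⁻ s, ∫⁻ a,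
        B.avgOcc N Q' h.1 s a * ∫⁻ z, triDisc (Q' h.1 s a z) (Q h.1 s a z) ∂B.mdp.ν ∂B.μA
          ∂(B.mdp.baseS h.1) := by ring
    _ ≤ _ := by gcongr

lemma le_mul_of_le_half {x x' T : ENNReal} (hx : x ≠ ⊤) (h : x' ≤ 2⁻¹ * x)
    (hm : x ≤ x' + (ENNReal.ofReal (3 / 2) * T + ENNReal.ofReal (1 / 6) * (x' + x))) :
    x ≤ 6 * T := by
  by_cases hTt : T = ⊤
  · rw [hTt]; simp
  have hx't : x' ≠ ⊤ := (h.trans_lt (ENNReal.mul_lt_top (by simp) hx.lt_top)).ne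
  lift x to NNReal using hx
  lift x' to NNReal using hx't
  lift T to NNReal using hTt
  have e2 : (2⁻¹ : ENNReal) = ((2⁻¹ : NNReal) : ENNReal) := by simp
  rw [e2] at h
  rw [ENNReal.ofReal, ENNReal.ofReal] at hm
  have h' : x' ≤ 2⁻¹ * x := by exact_mod_cast h
  have hm' : x ≤ x' + ((3 / 2 : ℝ).toNNReal * T + (1 / 6 : ℝ).toNNReal * (x' + x)) := by
    exact_mod_cast hm
  have g : (x' : ℝ) ≤ 2⁻¹ * x := by exact_mod_cast h'
  have gm : (x : ℝ) ≤ x' + (((3 / 2 : ℝ).toNNReal : ℝ) * T + ((1 / 6 : ℝ).toNNReal : ℝ) * (x' + x)) := by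
    exact_mod_cast hm'
  rw [Real.coe_toNNReal _ (by norm_num), Real.coe_toNNReal _ (by norm_num)] at gm
  have : (x : ℝ) ≤ 6 * T := by linarith
  exact_mod_cast this

/-- A region where the mean occupancy under `Q'` is at most half of that under `Q` has small mass
if the laws of the trajectories are close. -/
lemma lintegral_avgOcc_le_triDisc (hQ : B.mdp.IsTrans Q) (hQ' : B.mdp.IsTrans Q') (h : Fin H)
    {U : Set (S × A)} (hU : MeasurableSet U)
    (hle : ∀ x ∈ U, B.avgOcc N Q' h.1 x.1 x.2 ≤ 2⁻¹ * B.avgOcc N Q h.1 x.1 x.2) :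
    ∫⁻ s, ∫⁻ a, U.indicator (fun x => B.avgOcc N Q h.1 x.1 x.2) (s, a) ∂B.μA ∂(B.mdp.baseS h.1)
      ≤ 6 * ∫⁻ τ : Traj S A H, triDisc (B.avgPol N τ * likelihood Q' B.s₁ τ)
          (B.avgPol N τ * likelihood Q B.s₁ τ) ∂(B.mdp.trajRef H) := by
  have hUi : Measurable (U.indicator (1 : S × A → ENNReal)) := measurable_one.indicator hU
  have hg := B.measurable_avgPol N
  have hl := hQ.measurable_likelihood (H := H) B.s₁
  have hl' := hQ'.measurable_likelihood (H := H) B.s₁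
  set V : Set (Traj S A H) := (fun τ => (stateFrom 0 B.s₁ τ h, (τ h).1)) ⁻¹' U with hV
  have hVm : MeasurableSet V := by
    have := (measurable_stateFrom (S := S) (A := A) 0 h).comp
      (f := fun τ : Traj S A H => (B.s₁, τ)) (by fun_prop)
    exact (this.prodMk (by fun_prop : Measurable fun τ : Traj S A H => (τ h).1)) hU
  have hVi : Measurable (V.indicator (1 : Traj S A H → ENNReal)) := measurable_one.indicator hVm
  have key : ∀ P : Trans S A, B.mdp.IsTrans P →
      ∫⁻ τ, B.avgPol N τ * likelihood P B.s₁ τ * V.indicator 1 τ ∂(B.mdp.trajRef H)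
      = ∫⁻ s, ∫⁻ a, U.indicator (fun x => B.avgOcc N P h.1 x.1 x.2) (s, a)
        ∂B.μA ∂(B.mdp.baseS h.1) := by
    intro P hP
    have := B.lintegral_avgPol_mul N hP (g := fun s a _ => U.indicator 1 (s, a)) (by fun_prop) h
    refine Eq.trans (Eq.trans ?_ this) ?_
    · rfl
    · refine lintegral_congr fun s => lintegral_congr fun a => ?_
      have h3 := hP.meas h.1
      rw [lintegral_mul_const _ (by fun_prop), hP.prob, one_mul]
      by_cases hτ : (s, a) ∈ U
      · rw [indicator_of_mem hτ, indicator_of_mem hτ, Pi.one_apply, mul_one]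
      · rw [indicator_of_notMem hτ, indicator_of_notMem hτ, mul_zero]
  set x := ∫⁻ s, ∫⁻ a, U.indicator (fun x => B.avgOcc N Q h.1 x.1 x.2) (s, a)
    ∂B.μA ∂(B.mdp.baseS h.1) with hx
  set x' := ∫⁻ s, ∫⁻ a, U.indicator (fun x => B.avgOcc N Q' h.1 x.1 x.2) (s, a)
    ∂B.μA ∂(B.mdp.baseS h.1) with hx'
  set T := ∫⁻ τ : Traj S A H, triDisc (B.avgPol N τ * likelihood Q' B.s₁ τ)
          (B.avgPol N τ * likelihood Q B.s₁ τ) ∂(B.mdp.trajRef H) with hT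
  have hocc := B.measurable_avgOcc N hQ h.1
  have hxx : x' ≤ 2⁻¹ * x := by
    have hm : Measurable fun y : S × A =>
      U.indicator (fun x => B.avgOcc N Q h.1 x.1 x.2) (y.1, y.2) := hocc.indicator hU
    rw [hx, hx', ← lintegral_const_mul _ hm.lintegral_prod_right']
    refine lintegral_mono fun s => ?_
    dsimp only
    have hms : Measurable fun a => U.indicator (fun x => B.avgOcc N Q h.1 x.1 x.2) (s, a) :=
      hm.comp (f := fun a => (s, a)) (by fun_prop)
    rw [← lintegral_const_mul _ hms]
    refine lintegral_mono fun a => ?_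
    by_cases hτ : (s, a) ∈ U
    · rw [indicator_of_mem hτ, indicator_of_mem hτ]; exact hle _ hτ
    · rw [indicator_of_notMem hτ, indicator_of_notMem hτ, mul_zero]
  have hx1 : x ≠ ⊤ := by
    have : x ≤ 1 := by
      rw [← B.lintegral_avgOcc N hQ h.1]
      exact lintegral_mono fun s => lintegral_mono fun a => indicator_le_self' (fun _ _ => zero_le) _
    exact (this.trans_lt ENNReal.one_lt_top).ne
  have hmain : x ≤ x' + (ENNReal.ofReal (3 / 2) * T + ENNReal.ofReal (1 / 6) * (x' + x)) := by
    have hgl : Measurable fun τ : Traj S A H => B.avgPol N τ * likelihood Q B.s₁ τ := hg.mul hl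
    have hgl' : Measurable fun τ : Traj S A H => B.avgPol N τ * likelihood Q' B.s₁ τ := hg.mul hl'
    have hglV : Measurable fun τ : Traj S A H => B.avgPol N τ * likelihood Q' B.s₁ τ *
        V.indicator 1 τ := hgl'.mul hVi
    rw [hx, hx', ← key Q hQ, ← key Q' hQ', hT, ← lintegral_const_mul _ (hgl'.triDisc hgl),
      ← lintegral_add_left hglV, ← lintegral_const_mul _ (by fun_prop),
      ← lintegral_add_left ((hgl'.triDisc hgl).const_mul _),
      ← lintegral_add_left hglV]
    refine lintegral_mono_ae ?_
    filter_upwards [B.ae_avgPol_mul_likelihood_lt_top N hQ,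
      B.ae_avgPol_mul_likelihood_lt_top N hQ'] with τ h3 h4
    by_cases hτ : τ ∈ V
    · rw [indicator_of_mem hτ, Pi.one_apply, mul_one, mul_one]
      refine (le_add_absDiff _ (B.avgPol N τ * likelihood Q' B.s₁ τ)).trans ?_
      gcongr
      have := absDiff_mul_mul_le (d := 1) (D := 1) (g := 1) ENNReal.one_ne_top ENNReal.one_ne_top
        h4.ne h3.ne ENNReal.one_ne_top (α := 3 / 2) (β := 1 / 6) (by norm_num) (by norm_num)
        (by norm_num)
      rw [absDiff_comm]
      simpa using this
    · rw [indicator_of_notMem hτ]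
      simp
  exact le_mul_of_le_half hx1 hxx hmain

/-- Expected contribution of a cell to the entropy of the cells after an episode. -/
def postEntropy (N : Measure B.Env) (C : Set B.Env) : ENNReal :=
  ∫⁻ τ : Traj S A H, B.avgPol N τ * (∫⁻ E, likelihood (B.trans E) B.s₁ τ ∂N) *
    ENNReal.ofReal (Real.negMulLog ((∫⁻ E in C, likelihood (B.trans E) B.s₁ τ ∂N) /
      ∫⁻ E, likelihood (B.trans E) B.s₁ τ ∂N).toReal) ∂(B.mdp.trajRef H)

lemma smul_cond {C : Set B.Env} (hw0 : N C ≠ 0) :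
    N C • ProbabilityTheory.cond N C = N.restrict C := by
  rw [ProbabilityTheory.cond, smul_smul, ENNReal.mul_inv_cancel hw0 (measure_ne_top N C), one_smul]

variable (hN : iIndepFun (fun h (E : B.Env) => E h) N) {C : Set B.Env}
  (hw0 : N C ≠ 0) (hNC : iIndepFun (fun h (E : B.Env) => E h) (ProbabilityTheory.cond N C))

include hN hw0 hNC

lemma setLIntegral_likelihood (τ : Traj S A H) :
    ∫⁻ E in C, likelihood (B.trans E) B.s₁ τ ∂N
      = N C * likelihood (B.meanTrans (ProbabilityTheory.cond N C)) B.s₁ τ := by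
  have : IsProbabilityMeasure (ProbabilityTheory.cond N C) := cond_isProbabilityMeasure hw0
  rw [← B.smul_cond hw0, lintegral_smul_measure, B.lintegral_likelihood hNC, smul_eq_mul]

lemma postEntropy_eq : B.postEntropy N C
    = N C * B.logDeficit N (B.meanTrans N) (B.meanTrans (ProbabilityTheory.cond N C))
      (-Real.log (N C).toReal) := by
  have hp : IsProbabilityMeasure (ProbabilityTheory.cond N C) := cond_isProbabilityMeasure hw0
  have hQ := B.isTrans_meanTrans N
  have hQ' := B.isTrans_meanTrans (ProbabilityTheory.cond N C)
  unfold postEntropy logDeficit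
  have hwt := measure_ne_top N C
  have hwr : 0 < (N C).toReal := ENNReal.toReal_pos hw0 hwt
  rw [← lintegral_const_mul' _ _ hwt]
  refine lintegral_congr_ae ?_
  filter_upwards [B.ae_avgPol_mul_likelihood_lt_top N hQ,
    B.ae_avgPol_mul_likelihood_lt_top N hQ'] with τ h3 h4
  rw [B.setLIntegral_likelihood hN hw0 hNC, B.lintegral_likelihood hN]
  have hle : N C * likelihood (B.meanTrans (ProbabilityTheory.cond N C)) B.s₁ τ
      ≤ likelihood (B.meanTrans N) B.s₁ τ := by
    rw [← B.setLIntegral_likelihood hN hw0 hNC, ← B.lintegral_likelihood hN]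
    exact setLIntegral_le_lintegral _ _
  set l := likelihood (B.meanTrans N) B.s₁ τ
  set l' := likelihood (B.meanTrans (ProbabilityTheory.cond N C)) B.s₁ τ
  rcases eq_or_ne (B.avgPol N τ) 0 with h5 | h5
  · simp [h5]
  rcases eq_or_ne l' 0 with h0 | h0
  · simp [h0]
  have hlt : l ≠ ⊤ := by
    intro h; rw [h, ENNReal.mul_top h5] at h3; exact lt_irrefl _ h3
  have hlt' : l' ≠ ⊤ := by
    intro h; rw [h, ENNReal.mul_top h5] at h4; exact lt_irrefl _ h4
  have hl0 : l ≠ 0 := by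
    intro h; rw [h] at hle; exact mul_ne_zero hw0 h0 (le_zero_iff.1 hle)
  have hlr : 0 < l.toReal := ENNReal.toReal_pos hl0 hlt
  have hlr' : 0 < l'.toReal := ENNReal.toReal_pos h0 hlt'
  have e : l * ENNReal.ofReal (Real.negMulLog (N C * l' / l).toReal)
      = N C * l' * ENNReal.ofReal (-Real.log (N C).toReal - Real.log (l' / l).toReal) := by
    rw [← ENNReal.ofReal_toReal hlt, ← ENNReal.ofReal_toReal hlt', ← ENNReal.ofReal_toReal hwt,
      ← ENNReal.ofReal_mul hwr.le, ← ENNReal.ofReal_div_of_pos hlr, ← ENNReal.ofReal_div_of_pos hlr,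
      ENNReal.toReal_ofReal hwr.le, ENNReal.toReal_ofReal (by positivity),
      ENNReal.toReal_ofReal (by positivity), ← ENNReal.ofReal_mul (by positivity),
      ← ENNReal.ofReal_mul (by positivity)]
    congr 1
    rw [Real.negMulLog, mul_div_assoc, Real.log_mul hwr.ne' (by positivity)]
    field_simp
    ring
  calc _ = B.avgPol N τ * (l * ENNReal.ofReal (Real.negMulLog (N C * l' / l).toReal)) := by ring
    _ = _ := by rw [e]; ring

lemma postEntropy_add_le {X : ENNReal}
    (hX : B.logDeficit N (B.meanTrans N) (B.meanTrans (ProbabilityTheory.cond N C))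
      (-Real.log (N C).toReal) + X ≤ ENNReal.ofReal (-Real.log (N C).toReal)) :
    B.postEntropy N C + N C * X ≤ ENNReal.ofReal (Real.negMulLog (N C).toReal) := by
  rw [B.postEntropy_eq hN hw0 hNC, ← mul_add]
  calc _ ≤ N C * ENNReal.ofReal (-Real.log (N C).toReal) := by gcongr
    _ = _ := by
      nth_rewrite 1 [← ENNReal.ofReal_toReal (measure_ne_top N C)]
      rw [← ENNReal.ofReal_mul ENNReal.toReal_nonneg, Real.negMulLog]
      congr 1; ring

lemma likelihood_cond_le (τ : Traj S A H) :
    N C * likelihood (B.meanTrans (ProbabilityTheory.cond N C)) B.s₁ τ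
      ≤ likelihood (B.meanTrans N) B.s₁ τ := by
  rw [← B.setLIntegral_likelihood hN hw0 hNC, ← B.lintegral_likelihood hN]
  exact setLIntegral_le_lintegral _ _

/-- The entropy decrease controls the distances of the layers. -/
lemma postEntropy_add_layers : B.postEntropy N C + N C * (2⁻¹ * ∑ h : Fin H, ∫⁻ s, ∫⁻ a,
      B.avgOcc N (B.meanTrans (ProbabilityTheory.cond N C)) h.1 s a *
        ∫⁻ z, triDisc (B.meanTrans (ProbabilityTheory.cond N C) h.1 s a z)
          (B.meanTrans N h.1 s a z) ∂B.mdp.ν ∂B.μA ∂(B.mdp.baseS h.1))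
      ≤ ENNReal.ofReal (Real.negMulLog (N C).toReal) := by
  have hp : IsProbabilityMeasure (ProbabilityTheory.cond N C) := cond_isProbabilityMeasure hw0
  refine B.postEntropy_add_le hN hw0 hNC (B.logDeficit_add_layers (B.isTrans_meanTrans N)
    (B.isTrans_meanTrans _) hw0 prob_le_one (B.mul_meanTrans_le ?_)
    (B.likelihood_cond_le hN hw0 hNC))
  rw [B.smul_cond hw0]
  exact Measure.restrict_le_self

/-- The entropy decrease controls the distance of the laws of the trajectories. -/
lemma postEntropy_add_traj : B.postEntropy N C + N C * (2⁻¹ * ∫⁻ τ : Traj S A H,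
        triDisc (B.avgPol N τ * likelihood (B.meanTrans (ProbabilityTheory.cond N C)) B.s₁ τ)
          (B.avgPol N τ * likelihood (B.meanTrans N) B.s₁ τ) ∂(B.mdp.trajRef H))
      ≤ ENNReal.ofReal (Real.negMulLog (N C).toReal) := by
  have hp : IsProbabilityMeasure (ProbabilityTheory.cond N C) := cond_isProbabilityMeasure hw0
  exact B.postEntropy_add_le hN hw0 hNC (B.logDeficit_add_traj (B.isTrans_meanTrans N)
    (B.isTrans_meanTrans _) hw0 prob_le_one (B.likelihood_cond_le hN hw0 hNC))

end BayesRL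

end

noncomputable section

lemma sq_le_sq_add_of_le_add {g u v K : ENNReal} (hg : g ≤ K) (hu : u ≤ K) (h : g ≤ u + v) :
    g ^ 2 ≤ u ^ 2 + 2 * K * v := by
  rcases le_total g u with h1 | h1
  · exact (pow_le_pow_left₀ zero_le h1 2).trans le_self_add
  · obtain ⟨e, rfl⟩ := le_iff_exists_add.1 h1
    by_cases hut : u = ⊤
    · simp [hut]
    have he : e ≤ v := (ENNReal.add_le_add_iff_left hut).1 h
    calc (u + e) ^ 2 = u ^ 2 + (u + (u + e)) * e := by ring
      _ ≤ u ^ 2 + (K + K) * v := by gcongr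
      _ = _ := by ring

lemma ae_ne_top_of_lintegral_eq_one {X : Type*} [MeasurableSpace X] {μ : Measure X}
    {f : X → ENNReal} (hf : Measurable f) (h : ∫⁻ x, f x ∂μ = 1) : ∀ᵐ x ∂μ, f x ≠ ⊤ := by
  filter_upwards [ae_lt_top hf (by rw [h]; exact ENNReal.one_ne_top)] with x hx using hx.ne

namespace MDPBase

variable {S A : Type*} [MeasurableSpace S] [MeasurableSpace A] {b : MDPBase S A}
  {Q Q' Q₀ : Trans S A} {π π₀ : Policy S A} {r : ℝ × S → ENNReal}

/-- The reference measure on state-action pairs at a layer. -/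
def baseSA (b : MDPBase S A) (h : ℕ) : Measure (S × A) := (b.baseS h).prod b.μA

instance (h : ℕ) : IsProbabilityMeasure (b.baseSA h) := by unfold baseSA; infer_instance

lemma lintegral_baseSA (h : ℕ) {f : S × A → ENNReal} (hf : Measurable f) :
    ∫⁻ x, f x ∂(b.baseSA h) = ∫⁻ s, ∫⁻ a, f (s, a) ∂b.μA ∂(b.baseS h) :=
  lintegral_prod _ hf.aemeasurable

/-- Reward of a layer plus the value of the next state. -/
def contVal (b : MDPBase S A) (H : ℕ) (Q : Trans S A) (π : Policy S A) (r : ℝ × S → ENNReal)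
    (h : ℕ) (z : ℝ × S) : ENNReal :=
  r z + b.acc Q π (fun _ _ _ => r) (H - (h + 1)) (h + 1) z.2

/-- The value of an action. -/
def actionValue (b : MDPBase S A) (H : ℕ) (Q : Trans S A) (π : Policy S A) (r : ℝ × S → ENNReal)
    (h : ℕ) (s : S) (a : A) : ENNReal :=
  ∫⁻ z, Q h s a z * b.contVal H Q π r h z ∂b.ν

/-- Expected squared deviation of the continuation value from `c`, for the sum of two transition
densities. -/
def sqErr (b : MDPBase S A) (H : ℕ) (Q Q' : Trans S A) (π : Policy S A) (r : ℝ × S → ENNReal)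
    (c : ENNReal) (h : ℕ) (s : S) (a : A) : ENNReal :=
  ∫⁻ z, (Q' h s a z + Q h s a z) * absDiff (b.contVal H Q' π r h z) c ^ 2 ∂b.ν

variable {H : ℕ}

lemma IsTrans.measurable_contVal (hQ : b.IsTrans Q) (hπ : b.IsPolicy π) (hr : Measurable r)
    (h : ℕ) : Measurable (b.contVal H Q π r h) := by
  have := hQ.measurable_acc hπ (F := fun _ _ _ => r) (fun n => by fun_prop) (H - (h + 1)) (h + 1)
  unfold contVal
  fun_prop

lemma IsTrans.measurable_actionValue (hQ : b.IsTrans Q) (hπ : b.IsPolicy π) (hr : Measurable r)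
    (h : ℕ) : Measurable fun x : S × A => b.actionValue H Q π r h x.1 x.2 := by
  have h1 := hQ.measurable_contVal (H := H) hπ hr h
  have h2 := hQ.meas h
  unfold actionValue
  fun_prop

lemma IsTrans.contVal_le [NeZero H] (hQ : b.IsTrans Q) (hπ : b.IsPolicy π) (hr1 : ∀ z, r z ≤ 1)
    (h : ℕ) (z : ℝ × S) : b.contVal H Q π r h z ≤ H := by
  have h0 : 1 ≤ H := NeZero.one_le
  calc b.contVal H Q π r h z ≤ 1 + ((H - (h + 1) : ℕ) : ENNReal) :=
        add_le_add (hr1 z) (hQ.acc_le hπ (fun _ _ _ z => hr1 z) _ _ _)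
    _ = ((1 + (H - (h + 1)) : ℕ) : ENNReal) := by push_cast; rfl
    _ ≤ H := by exact_mod_cast (by omega)

lemma IsTrans.actionValue_le [NeZero H] (hQ : b.IsTrans Q) (hπ : b.IsPolicy π)
    (hr1 : ∀ z, r z ≤ 1) (h : ℕ) (s : S) (a : A) : b.actionValue H Q π r h s a ≤ H := by
  have h2 := hQ.meas h
  calc b.actionValue H Q π r h s a ≤ ∫⁻ z, Q h s a z * H ∂b.ν :=
        lintegral_mono fun z => mul_le_mul_right (hQ.contVal_le hπ hr1 h z) _
    _ = H := by rw [lintegral_mul_const _ (by fun_prop), hQ.prob, one_mul]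

lemma absDiff_le_of_le_of_le {x y K : ENNReal} (hx : x ≤ K) (hy : y ≤ K) : absDiff x y ≤ K :=
  (absDiff_le_max x y).trans (max_le hx hy)

variable [NeZero H] {c : ℕ → S → A → ENNReal}

lemma IsTrans.simErr_le (hQ : b.IsTrans Q) (hQ' : b.IsTrans Q') (hπ : b.IsPolicy π)
    (hr1 : ∀ z, r z ≤ 1) {h : ℕ} {s : S} {a : A} (hc : c h s a ≤ H) :
    simErr b H Q Q' π r c h s a ≤ 2 * H := by
  have h1 := hQ.meas h
  have h2 := hQ'.meas h
  calc simErr b H Q Q' π r c h s a ≤ ∫⁻ z, (Q' h s a z + Q h s a z) * H ∂b.ν :=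
        lintegral_mono fun z => mul_le_mul' (absDiff_le_add _ _)
          (absDiff_le_of_le_of_le (hQ'.contVal_le hπ hr1 h z) hc)
    _ = _ := by
      rw [lintegral_mul_const _ (by fun_prop), lintegral_add_left (by fun_prop), hQ.prob, hQ'.prob,
        one_add_one_eq_two]

lemma IsTrans.sqErr_le (hQ : b.IsTrans Q) (hQ' : b.IsTrans Q') (hπ : b.IsPolicy π)
    (hr1 : ∀ z, r z ≤ 1) {h : ℕ} {s : S} {a : A} {c : ENNReal} (hc : c ≤ H) :
    sqErr b H Q Q' π r c h s a ≤ 2 * (H : ENNReal) ^ 2 := by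
  have h1 := hQ.meas h
  have h2 := hQ'.meas h
  calc sqErr b H Q Q' π r c h s a ≤ ∫⁻ z, (Q' h s a z + Q h s a z) * (H : ENNReal) ^ 2 ∂b.ν :=
        lintegral_mono fun z => mul_le_mul_right (pow_le_pow_left₀ zero_le
          (absDiff_le_of_le_of_le (hQ'.contVal_le hπ hr1 h z) hc) 2) _
    _ = _ := by
      rw [lintegral_mul_const _ (by fun_prop), lintegral_add_left (by fun_prop), hQ.prob, hQ'.prob,
        one_add_one_eq_two]

/-- Weighted Cauchy-Schwarz bound for the simulation error at a state-action pair, where the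
weights `D'` and `D` are comparable or not. -/
lemma IsTrans.mul_simErr_le (hQ : b.IsTrans Q) (hQ' : b.IsTrans Q') (hπ : b.IsPolicy π)
    (hr : Measurable r) (hr1 : ∀ z, r z ≤ 1) {h : ℕ} {s : S} {a : A} (hc : c h s a ≤ H)
    {d D D' : ENNReal} (hd : d ≠ ⊤) (hD : D ≠ ⊤) {t : ℝ} (ht : 0 < t) :
    d * simErr b H Q Q' π r c h s a
      ≤ ENNReal.ofReal t * (D' * ∫⁻ z, triDisc (Q' h s a z) (Q h s a z) ∂b.ν)
        + ENNReal.ofReal (t / (12 * H)) * (if D' ≤ 2⁻¹ * D then D else 0)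
        + ENNReal.ofReal (1 / t) * (2⁻¹ * (d ^ 2 / D * sqErr b H Q Q' π r (c h s a) h s a)
          + 12 * H ^ 3 * (if D' ≤ 2⁻¹ * D then d ^ 2 / D else 0)) := by
  have hH : (0 : ℝ) < H := by exact_mod_cast NeZero.pos H
  split_ifs with hR
  · have h1 := ENNReal.two_mul_mul_le hd hD hH.le (γ := t / (12 * H)) (by positivity)
    have e1 : ENNReal.ofReal (2 * H) = 2 * H := by
      rw [ENNReal.ofReal_mul (by norm_num)]; simp
    have e2 : ENNReal.ofReal ((H : ℝ) ^ 2 / (t / (12 * H)))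
        = ENNReal.ofReal (1 / t) * (12 * H ^ 3) := by
      rw [show (H : ℝ) ^ 2 / (t / (12 * H)) = 1 / t * (12 * H ^ 3) by field_simp,
        ENNReal.ofReal_mul (by positivity), ENNReal.ofReal_mul (by positivity),
        ENNReal.ofReal_pow hH.le]
      simp
    rw [e1, e2] at h1
    calc d * simErr b H Q Q' π r c h s a ≤ d * (2 * H) :=
          mul_le_mul_right (hQ.simErr_le hQ' hπ hr1 hc) _
      _ = 2 * H * d := mul_comm _ _
      _ ≤ _ := h1
      _ = 0 + ENNReal.ofReal (t / (12 * H)) * D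
          + ENNReal.ofReal (1 / t) * (0 + 12 * H ^ 3 * (d ^ 2 / D)) := by ring
      _ ≤ _ := by gcongr <;> exact zero_le
  · have hDD : D ≤ 2 * D' := by
      have := (not_le.1 hR).le
      calc D = 2 * (2⁻¹ * D) := by
            rw [← mul_assoc, ENNReal.mul_inv_cancel (by simp) (by simp), one_mul]
        _ ≤ _ := by gcongr
    have h1 := hQ.meas h
    have h2 := hQ'.meas h
    have h3 := hQ'.measurable_contVal (H := H) hπ hr h
    have h4 : Measurable fun z => absDiff (Q' h s a z) (Q h s a z) *
        absDiff (b.contVal H Q' π r h z) (c h s a) := by fun_prop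
    have hpt : ∀ᵐ z ∂b.ν, d * (absDiff (Q' h s a z) (Q h s a z) *
          absDiff (b.contVal H Q' π r h z) (c h s a))
        ≤ ENNReal.ofReal (t / 2) * (D * triDisc (Q' h s a z) (Q h s a z))
          + ENNReal.ofReal (1 / (2 * t)) * (d ^ 2 / D * ((Q' h s a z + Q h s a z) *
            absDiff (b.contVal H Q' π r h z) (c h s a) ^ 2)) := by
      filter_upwards [ae_ne_top_of_lintegral_eq_one (by fun_prop) (hQ.prob h s a),
        ae_ne_top_of_lintegral_eq_one (by fun_prop) (hQ'.prob h s a)] with z hz hz'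
      refine absDiff_mul_mul_le hd hD hz' hz ?_ (by positivity) (by positivity)
        (by field_simp; norm_num)
      exact ((absDiff_le_of_le_of_le (hQ'.contVal_le hπ hr1 h z) hc).trans_lt
        (ENNReal.natCast_lt_top H)).ne
    have e1 : ENNReal.ofReal (t / 2) * 2 = ENNReal.ofReal t := by
      rw [show (2 : ENNReal) = ENNReal.ofReal 2 by simp, ← ENNReal.ofReal_mul (by positivity)]
      congr 1; ring
    have e2 : ENNReal.ofReal (1 / (2 * t)) = ENNReal.ofReal (1 / t) * 2⁻¹ := by
      rw [show (2⁻¹ : ENNReal) = ENNReal.ofReal 2⁻¹ by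
        rw [ENNReal.ofReal_inv_of_pos (by norm_num)]; simp, ← ENNReal.ofReal_mul (by positivity)]
      congr 1; field_simp
    calc d * simErr b H Q Q' π r c h s a
        = ∫⁻ z, d * (absDiff (Q' h s a z) (Q h s a z) *
          absDiff (b.contVal H Q' π r h z) (c h s a)) ∂b.ν :=
          (lintegral_const_mul _ h4).symm
      _ ≤ _ := lintegral_mono_ae hpt
      _ = ENNReal.ofReal (t / 2) * (D * ∫⁻ z, triDisc (Q' h s a z) (Q h s a z) ∂b.ν)
          + ENNReal.ofReal (1 / (2 * t)) * (d ^ 2 / D * sqErr b H Q Q' π r (c h s a) h s a) := by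
          rw [lintegral_add_left (by fun_prop), lintegral_const_mul _ (by fun_prop),
            lintegral_const_mul _ (by fun_prop), lintegral_const_mul _ (by fun_prop),
            lintegral_const_mul _ (by fun_prop)]
          rfl
      _ ≤ ENNReal.ofReal (t / 2) * (2 * D' * ∫⁻ z, triDisc (Q' h s a z) (Q h s a z) ∂b.ν)
          + ENNReal.ofReal (1 / (2 * t)) * (d ^ 2 / D * sqErr b H Q Q' π r (c h s a) h s a) := by
          gcongr
      _ = ENNReal.ofReal t * (D' * ∫⁻ z, triDisc (Q' h s a z) (Q h s a z) ∂b.ν) + 0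
        + ENNReal.ofReal (1 / t) * (2⁻¹ * (d ^ 2 / D * sqErr b H Q Q' π r (c h s a) h s a) + 0) := by
          rw [e2, ← e1]; ring
      _ ≤ _ := by gcongr <;> exact zero_le

/-- Comparison of the squared error with that of a reference environment and policy. -/
lemma IsTrans.half_sqErr_le (hQ : b.IsTrans Q) (hQ' : b.IsTrans Q') (hπ : b.IsPolicy π)
    (hQ₀ : b.IsTrans Q₀) (hπ₀ : b.IsPolicy π₀)
    (hr : Measurable r) (hr1 : ∀ z, r z ≤ 1) {h : ℕ} {s : S} {a : A} {c : ENNReal} (hc : c ≤ H) :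
    2⁻¹ * sqErr b H Q Q' π r c h s a
      ≤ ∫⁻ z, Q₀ h s a z * absDiff (b.contVal H Q₀ π₀ r h z) c ^ 2 ∂b.ν
        + 2 * H * ∫⁻ z, Q₀ h s a z * absDiff (b.acc Q' π (fun _ _ _ => r) (H - (h + 1)) (h + 1) z.2)
          (b.acc Q₀ π₀ (fun _ _ _ => r) (H - (h + 1)) (h + 1) z.2) ∂b.ν
        + H ^ 2 * (∫⁻ z, absDiff (Q' h s a z) (Q₀ h s a z) ∂b.ν
          + ∫⁻ z, absDiff (Q h s a z) (Q₀ h s a z) ∂b.ν) := by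
  have h1 := hQ.meas h
  have h2 := hQ'.meas h
  have h3 := hQ'.measurable_contVal (H := H) hπ hr h
  have h4 := hQ₀.measurable_contVal (H := H) hπ₀ hr h
  have h5 := hQ₀.meas h
  have h6 := hQ'.measurable_acc hπ (F := fun _ _ _ => r) (fun n => by fun_prop) (H - (h + 1)) (h + 1)
  have h7 := hQ₀.measurable_acc hπ₀ (F := fun _ _ _ => r) (fun n => by fun_prop)
    (H - (h + 1)) (h + 1)
  rw [← lintegral_const_mul _ (by fun_prop), ← lintegral_add_left (by fun_prop),
    ← lintegral_add_left (by fun_prop), ← lintegral_const_mul _ (by fun_prop),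
    ← lintegral_add_left (by fun_prop)]
  unfold sqErr
  rw [← lintegral_const_mul _ (by fun_prop)]
  refine lintegral_mono fun z => ?_
  dsimp only
  set g := absDiff (b.contVal H Q' π r h z) c
  set u := absDiff (b.contVal H Q₀ π₀ r h z) c
  set v := absDiff (b.acc Q' π (fun _ _ _ => r) (H - (h + 1)) (h + 1) z.2)
          (b.acc Q₀ π₀ (fun _ _ _ => r) (H - (h + 1)) (h + 1) z.2)
  have hg : g ≤ H := absDiff_le_of_le_of_le (hQ'.contVal_le hπ hr1 h z) hc
  have hu : u ≤ H := absDiff_le_of_le_of_le (hQ₀.contVal_le hπ₀ hr1 h z) hc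
  have hguv : g ≤ u + v := by
    refine (absDiff_triangle _ (b.contVal H Q₀ π₀ r h z) _).trans ?_
    rw [add_comm]
    gcongr
    refine (absDiff_add_le _ _ _ _).trans ?_
    rw [absDiff_self, zero_add]
  have hg2 := sq_le_sq_add_of_le_add hg hu hguv
  have hgH : g ^ 2 ≤ (H : ENNReal) ^ 2 := pow_le_pow_left₀ zero_le hg 2
  have key : ∀ p q : ENNReal, p * g ^ 2 ≤ q * (u ^ 2 + 2 * H * v) + H ^ 2 * absDiff p q := by
    intro p q
    calc p * g ^ 2 ≤ (q + absDiff p q) * g ^ 2 := by gcongr; exact le_add_absDiff p q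
      _ = q * g ^ 2 + g ^ 2 * absDiff p q := by ring
      _ ≤ _ := by gcongr
  calc 2⁻¹ * ((Q' h s a z + Q h s a z) * g ^ 2)
      = 2⁻¹ * (Q' h s a z * g ^ 2 + Q h s a z * g ^ 2) := by ring
    _ ≤ 2⁻¹ * ((Q₀ h s a z * (u ^ 2 + 2 * H * v) + H ^ 2 * absDiff (Q' h s a z) (Q₀ h s a z))
        + (Q₀ h s a z * (u ^ 2 + 2 * H * v) + H ^ 2 * absDiff (Q h s a z) (Q₀ h s a z))) := by
        gcongr
        · exact key _ _
        · exact key _ _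
    _ = (2⁻¹ * 2) * (Q₀ h s a z * (u ^ 2 + 2 * H * v)) + 2⁻¹ * (H ^ 2 *
        (absDiff (Q' h s a z) (Q₀ h s a z) + absDiff (Q h s a z) (Q₀ h s a z))) := by ring
    _ ≤ 1 * (Q₀ h s a z * (u ^ 2 + 2 * H * v)) + 1 * (H ^ 2 *
        (absDiff (Q' h s a z) (Q₀ h s a z) + absDiff (Q h s a z) (Q₀ h s a z))) := by
        gcongr
        · rw [ENNReal.inv_mul_cancel (by simp) (by simp)]
        · simp
    _ = _ := by ring

lemma ite_le_of_half_le {d D D' d₀ : ENNReal} (hD : D ≠ ⊤) :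
    (if D' ≤ 2⁻¹ * D then d ^ 2 / D else 0)
      ≤ absDiff (d ^ 2 / D) d₀ + (2 * absDiff D' d₀ + 3 * absDiff D d₀) := by
  split_ifs with h
  · refine (le_add_absDiff _ d₀).trans ?_
    rw [add_comm]
    gcongr
    have e : D = 2⁻¹ * D + 2⁻¹ * D := by
      rw [← add_mul, ENNReal.inv_two_add_inv_two, one_mul]
    have h1 : 2⁻¹ * D ≤ absDiff D D' := by
      have hlt : 2⁻¹ * D ≠ ⊤ := ENNReal.mul_ne_top (by simp) hD
      refine (ENNReal.add_le_add_iff_left hlt).1 ?_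
      calc 2⁻¹ * D + 2⁻¹ * D = D := e.symm
        _ ≤ D' + absDiff D D' := le_add_absDiff _ _
        _ ≤ _ := by gcongr
    calc d₀ ≤ D + absDiff d₀ D := le_add_absDiff _ _
      _ = 2⁻¹ * D + 2⁻¹ * D + absDiff d₀ D := by rw [← e]
      _ ≤ absDiff D D' + absDiff D D' + absDiff d₀ D := by gcongr
      _ ≤ (absDiff D d₀ + absDiff d₀ D') + (absDiff D d₀ + absDiff d₀ D') + absDiff d₀ D := by
        gcongr <;> exact absDiff_triangle _ _ _
      _ = _ := by rw [absDiff_comm d₀ D, absDiff_comm d₀ D']; ring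
  · exact zero_le

end MDPBase

end

noncomputable section

lemma lintegral_linear_combination {X : Type*} [MeasurableSpace X] {μ : Measure X}
    {f₁ f₂ f₃ f₄ f₅ f₆ f₇ f₈ f₉ : X → ENNReal} (h₁ : Measurable f₁) (h₂ : Measurable f₂)
    (h₃ : Measurable f₃) (h₄ : Measurable f₄) (h₅ : Measurable f₅) (h₆ : Measurable f₆)
    (h₇ : Measurable f₇) (h₈ : Measurable f₈) (h₉ : Measurable f₉)
    (α β γ k₄ k₅ k₇ k₈ k₉ : ENNReal) :
    ∫⁻ x, (α * f₁ x + β * f₂ x + γ * (f₃ x + k₄ * f₄ x + k₅ * (f₅ x + f₆ x) + k₇ * f₇ x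
        + k₈ * f₈ x + k₉ * f₉ x)) ∂μ
      = α * ∫⁻ x, f₁ x ∂μ + β * ∫⁻ x, f₂ x ∂μ + γ * (∫⁻ x, f₃ x ∂μ + k₄ * ∫⁻ x, f₄ x ∂μ
        + k₅ * (∫⁻ x, f₅ x ∂μ + ∫⁻ x, f₆ x ∂μ) + k₇ * ∫⁻ x, f₇ x ∂μ
        + k₈ * ∫⁻ x, f₈ x ∂μ + k₉ * ∫⁻ x, f₉ x ∂μ) := by
  rw [lintegral_add_left (by fun_prop), lintegral_add_left (by fun_prop),
    lintegral_const_mul _ (by fun_prop), lintegral_const_mul _ (by fun_prop),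
    lintegral_const_mul _ (by fun_prop), lintegral_add_left (by fun_prop),
    lintegral_add_left (by fun_prop), lintegral_add_left (by fun_prop),
    lintegral_add_left (by fun_prop), lintegral_add_left (by fun_prop),
    lintegral_const_mul _ (by fun_prop), lintegral_const_mul _ (by fun_prop),
    lintegral_const_mul _ (by fun_prop), lintegral_const_mul _ (by fun_prop),
    lintegral_const_mul _ (by fun_prop), lintegral_add_left (by fun_prop)]

namespace BayesRL

open MDPBase

variable {S A : Type*} [MeasurableSpace S] [MeasurableSpace A] {H : ℕ}
  {TP TR : Fin H → Type*} [∀ h, MeasurableSpace (TP h)] [∀ h, MeasurableSpace (TR h)]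
  (B : BayesRL S A H TP TR)

/-- Total distance of a transition function from an environment, along its optimal policy. -/
def transGap (Q : Trans S A) (E₀ : B.Env) : ENNReal :=
  ∑ i ∈ Finset.range H, B.mdp.transDist Q (B.trans E₀) (B.optPol E₀) i

/-- Total distance of the optimal policies of two environments, in the second one. -/
def polGap (E E₀ : B.Env) : ENNReal :=
  ∑ i ∈ Finset.range H, B.mdp.polDist (B.optPol E) (B.trans E₀) (B.optPol E₀) i

/-- Expected sum of the conditional variances of the continuation values. -/
def valueVar (E₀ : B.Env) : ENNReal :=
  ∑ h ∈ Finset.range H, ∫⁻ x, B.mdp.occ (B.trans E₀) (B.optPol E₀) h x.1 x.2 *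
    ∫⁻ z, B.trans E₀ h x.1 x.2 z * absDiff (B.mdp.contVal H (B.trans E₀) (B.optPol E₀) rew h z)
      (B.mdp.actionValue H (B.trans E₀) (B.optPol E₀) rew h x.1 x.2) ^ 2 ∂B.mdp.ν ∂(B.mdp.baseSA h)

/-- Distance of the relative occupancy densities of `E` under `N` from the occupancies of `E₀`. -/
def occGap (N : Measure B.Env) (Q : Trans S A) (E E₀ : B.Env) : ENNReal :=
  ∑ h ∈ Finset.range H, ∫⁻ x, absDiff (B.mdp.occ Q (B.optPol E) h x.1 x.2 ^ 2
    / B.avgOcc N Q h x.1 x.2) (B.mdp.occ (B.trans E₀) (B.optPol E₀) h x.1 x.2) ∂(B.mdp.baseSA h)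

variable {N : Measure B.Env} [IsProbabilityMeasure N] {Q Q' : Trans S A}

lemma transDist_le_transGap (Q : Trans S A) (E₀ : B.Env) {h : ℕ} (hh : h < H) :
    B.mdp.transDist Q (B.trans E₀) (B.optPol E₀) h ≤ B.transGap Q E₀ :=
  Finset.single_le_sum (f := fun i => B.mdp.transDist Q (B.trans E₀) (B.optPol E₀) i)
    (fun _ _ => zero_le) (Finset.mem_range.2 hh)

lemma measurable_occ_pair (h : ℕ) : Measurable fun x : B.Env × S × A =>
    B.mdp.occ (B.trans x.1) (B.optPol x.1) h x.2.1 x.2.2 :=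
  B.mdp.measurable_occ (X := B.Env) (Q := B.trans) (π := B.optPol) B.measurable_trans
    B.measurable_optPol h

lemma lintegral_absDiff_occ_le_gap (hQ : B.mdp.IsTrans Q) (E E₀ : B.Env) {h : ℕ} (hh : h < H) :
    ∫⁻ s, ∫⁻ a, absDiff (B.mdp.occ Q (B.optPol E) h s a)
        (B.mdp.occ (B.trans E₀) (B.optPol E₀) h s a) ∂B.μA ∂(B.mdp.baseS h)
      ≤ B.transGap Q E₀ + B.polGap E E₀ := by
  have hπ := B.isPolicy_optPol E
  have hQ₀ := B.isTrans_trans E₀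
  have hπ₀ := B.isPolicy_optPol E₀
  calc _ ≤ _ := hQ.lintegral_absDiff_occ_le hπ hQ₀ hπ₀ h
    _ ≤ ∑ i ∈ Finset.range h, (B.mdp.transDist Q (B.trans E₀) (B.optPol E₀) i
          + B.mdp.polDist (B.optPol E) (B.trans E₀) (B.optPol E₀) i)
        + (B.mdp.transDist Q (B.trans E₀) (B.optPol E₀) h
          + B.mdp.polDist (B.optPol E) (B.trans E₀) (B.optPol E₀) h) := by
        gcongr
        · exact hQ.lintegral_absDiff_stateOcc_le hπ hQ₀ hπ₀ h
        · exact le_add_self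
    _ = ∑ i ∈ Finset.range (h + 1), (B.mdp.transDist Q (B.trans E₀) (B.optPol E₀) i
          + B.mdp.polDist (B.optPol E) (B.trans E₀) (B.optPol E₀) i) :=
        (Finset.sum_range_succ _ _).symm
    _ ≤ ∑ i ∈ Finset.range H, (B.mdp.transDist Q (B.trans E₀) (B.optPol E₀) i
          + B.mdp.polDist (B.optPol E) (B.trans E₀) (B.optPol E₀) i) :=
        Finset.sum_le_sum_of_subset (Finset.range_mono hh)
    _ = _ := Finset.sum_add_distrib

lemma lintegral_absDiff_avgOcc_le (hQ : B.mdp.IsTrans Q) (E₀ : B.Env) {h : ℕ} (hh : h < H) :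
    ∫⁻ x, absDiff (B.avgOcc N Q h x.1 x.2)
        (B.mdp.occ (B.trans E₀) (B.optPol E₀) h x.1 x.2) ∂(B.mdp.baseSA h)
      ≤ B.transGap Q E₀ + ∫⁻ E, B.polGap E E₀ ∂N := by
  have h1 := B.measurable_occ_optPol hQ h
  have h2 := (B.isTrans_trans E₀).measurable_occ (B.isPolicy_optPol E₀) h
  have h3 := B.measurable_avgOcc N hQ h
  have h4 : Measurable fun x : B.Env × S × A => absDiff (B.mdp.occ Q (B.optPol x.1) h x.2.1 x.2.2)
        (B.mdp.occ (B.trans E₀) (B.optPol E₀) h x.2.1 x.2.2) :=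
    h1.absDiff (h2.comp measurable_snd)
  rw [lintegral_baseSA _ (h3.absDiff h2)]
  calc _ ≤ ∫⁻ s, ∫⁻ a, ∫⁻ E, absDiff (B.mdp.occ Q (B.optPol E) h s a)
        (B.mdp.occ (B.trans E₀) (B.optPol E₀) h s a) ∂N ∂B.μA ∂(B.mdp.baseS h) := by
        refine lintegral_mono fun s => lintegral_mono fun a => ?_
        have := absDiff_lintegral_le (μ := N)
          (f := fun E => B.mdp.occ Q (B.optPol E) h s a)
          (g := fun E => B.mdp.occ (B.trans E₀) (B.optPol E₀) h s a)
          (h1.comp (f := fun E => (E, s, a)) (by fun_prop)) measurable_const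
        rwa [lintegral_const, measure_univ, mul_one] at this
    _ = ∫⁻ E, ∫⁻ s, ∫⁻ a, absDiff (B.mdp.occ Q (B.optPol E) h s a)
        (B.mdp.occ (B.trans E₀) (B.optPol E₀) h s a) ∂B.μA ∂(B.mdp.baseS h) ∂N :=
        lintegral_lintegral_lintegral_comm h4
    _ ≤ ∫⁻ E, (B.transGap Q E₀ + B.polGap E E₀) ∂N :=
        lintegral_mono fun E => B.lintegral_absDiff_occ_le_gap hQ E E₀ hh
    _ = _ := by rw [lintegral_add_left measurable_const, lintegral_const, measure_univ, mul_one]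

variable [NeZero H]

/-- The simulation error at a layer. -/
lemma lintegral_occ_mul_simErr_le (hQ : B.mdp.IsTrans Q) (hQ' : B.mdp.IsTrans Q') (E E₀ : B.Env)
    {h : ℕ} (hh : h < H) {t : ℝ} (ht : 0 < t) :
    ∫⁻ s, ∫⁻ a, B.mdp.occ Q (B.optPol E) h s a * simErr B.mdp H Q Q' (B.optPol E) rew
        (B.mdp.actionValue H (B.trans E₀) (B.optPol E₀) rew) h s a ∂B.μA ∂(B.mdp.baseS h)
      ≤ ENNReal.ofReal t * ∫⁻ x, B.avgOcc N Q' h x.1 x.2 *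
          ∫⁻ z, triDisc (Q' h x.1 x.2 z) (Q h x.1 x.2 z) ∂B.mdp.ν ∂(B.mdp.baseSA h)
        + ENNReal.ofReal (t / (12 * H)) * ∫⁻ x, (if B.avgOcc N Q' h x.1 x.2
          ≤ 2⁻¹ * B.avgOcc N Q h x.1 x.2 then B.avgOcc N Q h x.1 x.2 else 0) ∂(B.mdp.baseSA h)
        + ENNReal.ofReal (1 / t) * (∫⁻ x, B.mdp.occ (B.trans E₀) (B.optPol E₀) h x.1 x.2 *
            ∫⁻ z, B.trans E₀ h x.1 x.2 z *
              absDiff (B.mdp.contVal H (B.trans E₀) (B.optPol E₀) rew h z)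
                (B.mdp.actionValue H (B.trans E₀) (B.optPol E₀) rew h x.1 x.2) ^ 2
              ∂B.mdp.ν ∂(B.mdp.baseSA h)
          + 13 * H ^ 3 * ∫⁻ x, absDiff (B.mdp.occ Q (B.optPol E) h x.1 x.2 ^ 2
            / B.avgOcc N Q h x.1 x.2) (B.mdp.occ (B.trans E₀) (B.optPol E₀) h x.1 x.2)
              ∂(B.mdp.baseSA h)
          + 63 * H ^ 3 * (B.transGap Q' E₀ + B.transGap Q E₀ + B.polGap E E₀
            + ∫⁻ E', B.polGap E' E₀ ∂N)) := by
  classical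
  have hπ := B.isPolicy_optPol E
  have hQ₀ := B.isTrans_trans E₀
  have hπ₀ := B.isPolicy_optPol E₀
  have hr := measurable_rew (S := S)
  set c := B.mdp.actionValue H (B.trans E₀) (B.optPol E₀) rew with hc
  have hcH : ∀ h s a, c h s a ≤ H := hQ₀.actionValue_le hπ₀ rew_le_one
  set d : S × A → ENNReal := fun x => B.mdp.occ Q (B.optPol E) h x.1 x.2 with hd
  set d₀ : S × A → ENNReal := fun x => B.mdp.occ (B.trans E₀) (B.optPol E₀) h x.1 x.2 with hd₀
  set D : S × A → ENNReal := fun x => B.avgOcc N Q h x.1 x.2 with hD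
  set D' : S × A → ENNReal := fun x => B.avgOcc N Q' h x.1 x.2 with hD'
  set tri : S × A → ENNReal := fun x => ∫⁻ z, triDisc (Q' h x.1 x.2 z) (Q h x.1 x.2 z) ∂B.mdp.ν
    with htri
  set U : S × A → ENNReal := fun x => ∫⁻ z, B.trans E₀ h x.1 x.2 z *
    absDiff (B.mdp.contVal H (B.trans E₀) (B.optPol E₀) rew h z) (c h x.1 x.2) ^ 2 ∂B.mdp.ν with hU
  set V : S × A → ENNReal := fun x => ∫⁻ z, B.trans E₀ h x.1 x.2 z *
    absDiff (B.mdp.acc Q' (B.optPol E) (fun _ _ _ => rew) (H - (h + 1)) (h + 1) z.2)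
      (B.mdp.acc (B.trans E₀) (B.optPol E₀) (fun _ _ _ => rew) (H - (h + 1)) (h + 1) z.2) ∂B.mdp.ν
    with hV
  set G' : S × A → ENNReal := fun x => ∫⁻ z, absDiff (Q' h x.1 x.2 z) (B.trans E₀ h x.1 x.2 z)
    ∂B.mdp.ν with hG'
  set G : S × A → ENNReal := fun x => ∫⁻ z, absDiff (Q h x.1 x.2 z) (B.trans E₀ h x.1 x.2 z)
    ∂B.mdp.ν with hG
  have m1 := hQ.meas h
  have m2 := hQ'.meas h
  have m3 := hQ₀.meas h
  have m4 := hQ₀.measurable_contVal (H := H) hπ₀ hr h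
  have m5 : Measurable fun x : S × A => c h x.1 x.2 := hQ₀.measurable_actionValue hπ₀ hr h
  have m6 := hQ'.measurable_acc hπ (F := fun _ _ _ => rew) measTrans_rew (H - (h + 1)) (h + 1)
  have m7 := hQ₀.measurable_acc hπ₀ (F := fun _ _ _ => rew) measTrans_rew (H - (h + 1)) (h + 1)
  have md : Measurable d := hQ.measurable_occ hπ h
  have md₀ : Measurable d₀ := hQ₀.measurable_occ hπ₀ h
  have mD : Measurable D := B.measurable_avgOcc N hQ h
  have mD' : Measurable D' := B.measurable_avgOcc N hQ' h
  have mtri : Measurable tri := by fun_prop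
  have mU : Measurable U := by fun_prop
  have mV : Measurable V := by fun_prop
  have mG : Measurable G := by fun_prop
  have mG' : Measurable G' := by fun_prop
  have mite : Measurable fun x => if D' x ≤ 2⁻¹ * D x then D x else 0 :=
    Measurable.ite (measurableSet_le mD' (by fun_prop)) mD measurable_const
  have msim : Measurable fun x : S × A => simErr B.mdp H Q Q' (B.optPol E) rew c h x.1 x.2 :=
    hQ.measurable_simErr hQ' hπ hr
      (fun n => hQ₀.measurable_actionValue hπ₀ hr n) H h
  have ed : ∀ᵐ x ∂(B.mdp.baseSA h), d x ≠ ⊤ := ae_ne_top_of_lintegral_eq_one md (by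
    rw [lintegral_baseSA _ md]; exact hQ.lintegral_occ hπ h)
  have eD : ∀ᵐ x ∂(B.mdp.baseSA h), D x ≠ ⊤ := ae_ne_top_of_lintegral_eq_one mD (by
    rw [lintegral_baseSA _ mD]; exact B.lintegral_avgOcc N hQ h)
  have hH1 : (1 : ENNReal) ≤ H := by exact_mod_cast (NeZero.one_le : 1 ≤ H)
  have hpt : ∀ᵐ x ∂(B.mdp.baseSA h), d x * simErr B.mdp H Q Q' (B.optPol E) rew c h x.1 x.2
      ≤ ENNReal.ofReal t * (D' x * tri x)
        + ENNReal.ofReal (t / (12 * H)) * (if D' x ≤ 2⁻¹ * D x then D x else 0)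
        + ENNReal.ofReal (1 / t) * (d₀ x * U x + 2 * H * (d₀ x * V x)
          + H ^ 2 * (d₀ x * G' x + d₀ x * G x)
          + 13 * H ^ 3 * absDiff (d x ^ 2 / D x) (d₀ x)
          + 24 * H ^ 3 * absDiff (D' x) (d₀ x) + 36 * H ^ 3 * absDiff (D x) (d₀ x)) := by
    filter_upwards [ed, eD] with x hx1 hx2
    refine (hQ.mul_simErr_le hQ' hπ hr rew_le_one (hcH h x.1 x.2) hx1 hx2 (D' := D' x) ht).trans ?_
    refine add_le_add le_rfl (mul_le_mul_right ?_ _)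
    have k1 := hQ.half_sqErr_le hQ' hπ hQ₀ hπ₀ hr rew_le_one (h := h) (s := x.1) (a := x.2)
      (hcH h x.1 x.2)
    have k2 := hQ.sqErr_le hQ' hπ rew_le_one (h := h) (s := x.1) (a := x.2) (hcH h x.1 x.2)
    set Sq := sqErr B.mdp H Q Q' (B.optPol E) rew (c h x.1 x.2) h x.1 x.2
    have k3 : 2⁻¹ * Sq ≤ (H : ENNReal) ^ 3 := by
      calc 2⁻¹ * Sq ≤ 2⁻¹ * (2 * (H : ENNReal) ^ 2) := by gcongr
        _ = H ^ 2 * 1 := by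
          rw [← mul_assoc, ENNReal.inv_mul_cancel (by simp) (by simp), one_mul, mul_one]
        _ ≤ H ^ 2 * H := by gcongr
        _ = _ := by ring
    have k4 := ite_le_of_half_le (d := d x) (D' := D' x) (d₀ := d₀ x) hx2
    set ψ := absDiff (d x ^ 2 / D x) (d₀ x) with hψ
    calc 2⁻¹ * (d x ^ 2 / D x * Sq) + 12 * H ^ 3 * (if D' x ≤ 2⁻¹ * D x then d x ^ 2 / D x else 0)
        = d x ^ 2 / D x * (2⁻¹ * Sq)
          + 12 * H ^ 3 * (if D' x ≤ 2⁻¹ * D x then d x ^ 2 / D x else 0) := by ring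
      _ ≤ (d₀ x + ψ) * (2⁻¹ * Sq) + 12 * H ^ 3 * (ψ + (2 * absDiff (D' x) (d₀ x)
          + 3 * absDiff (D x) (d₀ x))) := by
          gcongr
          exact le_add_absDiff _ _
      _ = d₀ x * (2⁻¹ * Sq) + ψ * (2⁻¹ * Sq) + 12 * H ^ 3 * (ψ + (2 * absDiff (D' x) (d₀ x)
          + 3 * absDiff (D x) (d₀ x))) := by ring
      _ ≤ d₀ x * (U x + 2 * H * V x + H ^ 2 * (G' x + G x)) + ψ * H ^ 3
          + 12 * H ^ 3 * (ψ + (2 * absDiff (D' x) (d₀ x) + 3 * absDiff (D x) (d₀ x))) := by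
          gcongr
      _ = _ := by ring
  have hV' : ∫⁻ x, d₀ x * V x ∂(B.mdp.baseSA h) ≤ H * (B.transGap Q' E₀ + B.polGap E E₀) := by
    have m8 : Measurable fun x => d₀ x * V x := md₀.mul mV
    rw [lintegral_baseSA _ m8]
    have e := hQ₀.lintegral_stateOcc_succ hπ₀ h (g := fun s => absDiff
      (B.mdp.acc Q' (B.optPol E) (fun _ _ _ => rew) (H - (h + 1)) (h + 1) s)
      (B.mdp.acc (B.trans E₀) (B.optPol E₀) (fun _ _ _ => rew) (H - (h + 1)) (h + 1) s))
      (by fun_prop)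
    refine (le_of_eq e.symm).trans ((hQ'.lintegral_absDiff_acc_le hπ hQ₀ hπ₀ hr rew_le_one
      (H - (h + 1)) (h + 1)).trans ?_)
    have e2 : ∑ i ∈ Finset.range (H - (h + 1)),
        (B.mdp.transDist Q' (B.trans E₀) (B.optPol E₀) (h + 1 + i)
          + B.mdp.polDist (B.optPol E) (B.trans E₀) (B.optPol E₀) (h + 1 + i))
        ≤ B.transGap Q' E₀ + B.polGap E E₀ := by
      unfold transGap polGap
      rw [← Finset.sum_add_distrib, ← Finset.sum_Ico_eq_sum_range (fun i =>
        B.mdp.transDist Q' (B.trans E₀) (B.optPol E₀) i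
          + B.mdp.polDist (B.optPol E) (B.trans E₀) (B.optPol E₀) i)]
      exact Finset.sum_le_sum_of_subset fun i hi => by
        rw [Finset.mem_Ico] at hi
        exact Finset.mem_range.2 hi.2
    gcongr
    · exact_mod_cast Nat.sub_le _ _
  have hGG : ∀ P : Trans S A, B.mdp.IsTrans P → ∫⁻ x, d₀ x * ∫⁻ z, absDiff (P h x.1 x.2 z)
      (B.trans E₀ h x.1 x.2 z) ∂B.mdp.ν ∂(B.mdp.baseSA h) ≤ B.transGap P E₀ := by
    intro P hP
    have := hP.meas h
    have m8 : Measurable fun x => d₀ x * ∫⁻ z, absDiff (P h x.1 x.2 z) (B.trans E₀ h x.1 x.2 z)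
      ∂B.mdp.ν := by fun_prop
    rw [lintegral_baseSA _ m8]
    exact B.transDist_le_transGap P E₀ hh
  have hD1 := B.lintegral_absDiff_avgOcc_le (N := N) hQ E₀ hh
  have hD2 := B.lintegral_absDiff_avgOcc_le (N := N) hQ' E₀ hh
  have m9 : Measurable fun x => d x * simErr B.mdp H Q Q' (B.optPol E) rew c h x.1 x.2 :=
    md.mul msim
  refine (lintegral_baseSA (b := B.mdp) h m9).symm.le.trans ?_
  refine (lintegral_mono_ae hpt).trans ?_
  rw [lintegral_linear_combination (by fun_prop) mite (by fun_prop) (by fun_prop) (by fun_prop)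
    (by fun_prop) (by fun_prop) (by fun_prop) (by fun_prop)]
  refine add_le_add le_rfl (mul_le_mul_right ?_ _)
  set pa := ∫⁻ E', B.polGap E' E₀ ∂N
  set T' := B.transGap Q' E₀
  set T := B.transGap Q E₀
  set p := B.polGap E E₀
  calc _ ≤ ∫⁻ x, d₀ x * U x ∂(B.mdp.baseSA h) + 2 * H * (H * (T' + p)) + H ^ 2 * (T' + T)
      + 13 * H ^ 3 * ∫⁻ x, absDiff (d x ^ 2 / D x) (d₀ x) ∂(B.mdp.baseSA h)
      + 24 * H ^ 3 * (T' + pa) + 36 * H ^ 3 * (T + pa) := by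
        gcongr
        · exact hGG Q' hQ'
        · exact hGG Q hQ
    _ = ∫⁻ x, d₀ x * U x ∂(B.mdp.baseSA h)
      + 13 * H ^ 3 * ∫⁻ x, absDiff (d x ^ 2 / D x) (d₀ x) ∂(B.mdp.baseSA h)
      + (H ^ 2 * 1 * (3 * T' + T + 2 * p)
        + H ^ 3 * (24 * T' + 36 * T + 60 * pa)) := by ring
    _ ≤ ∫⁻ x, d₀ x * U x ∂(B.mdp.baseSA h)
      + 13 * H ^ 3 * ∫⁻ x, absDiff (d x ^ 2 / D x) (d₀ x) ∂(B.mdp.baseSA h)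
      + (H ^ 2 * H * (3 * T' + T + 2 * p)
        + H ^ 3 * (24 * T' + 36 * T + 60 * pa)) := by gcongr
    _ = ∫⁻ x, d₀ x * U x ∂(B.mdp.baseSA h)
      + 13 * H ^ 3 * ∫⁻ x, absDiff (d x ^ 2 / D x) (d₀ x) ∂(B.mdp.baseSA h)
      + (H ^ 3 * (27 * T' + 37 * T + 2 * p + 60 * pa)) := by ring
    _ ≤ ∫⁻ x, d₀ x * U x ∂(B.mdp.baseSA h)
      + 13 * H ^ 3 * ∫⁻ x, absDiff (d x ^ 2 / D x) (d₀ x) ∂(B.mdp.baseSA h)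
      + (H ^ 3 * (63 * T' + 63 * T + 63 * p + 63 * pa)) := by gcongr <;> norm_num
    _ = _ := by ring

end BayesRL

end

noncomputable section

namespace BayesRL

open MDPBase

variable {S A : Type*} [MeasurableSpace S] [MeasurableSpace A] {H : ℕ}
  {TP TR : Fin H → Type*} [∀ h, MeasurableSpace (TP h)] [∀ h, MeasurableSpace (TR h)]
  (B : BayesRL S A H TP TR)

/-- Distance of two environments and of their optimal policies. -/
def gap (E E₀ : B.Env) : ENNReal := B.transGap (B.trans E) E₀ + B.polGap E E₀

/-- Mass of the state-action pairs that are rarely visited in an environment. -/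
def rareMass (δ : NNReal) (E₀ : B.Env) : ENNReal :=
  ∑ h ∈ Finset.range H,
    B.mdp.baseSA h {x | B.mdp.occ (B.trans E₀) (B.optPol E₀) h x.1 x.2 < 2 * δ}

lemma measurable_transGap :
    Measurable fun x : B.Env × B.Env => B.transGap (B.trans x.1) x.2 := by
  unfold transGap transDist
  refine Finset.measurable_sum _ fun i _ => ?_
  have h1 := B.measurable_occ_pair i
  have h2 := B.measurable_trans i
  have h3 : Measurable fun y : ((B.Env × B.Env) × S × A) × (ℝ × S) =>
      absDiff (B.trans y.1.1.1 i y.1.2.1 y.1.2.2 y.2) (B.trans y.1.1.2 i y.1.2.1 y.1.2.2 y.2) :=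
    (h2.comp (f := fun y : ((B.Env × B.Env) × S × A) × (ℝ × S) =>
      (y.1.1.1, y.1.2.1, y.1.2.2, y.2)) (by fun_prop)).absDiff
    (h2.comp (f := fun y : ((B.Env × B.Env) × S × A) × (ℝ × S) =>
      (y.1.1.2, y.1.2.1, y.1.2.2, y.2)) (by fun_prop))
  have h4 : Measurable fun y : (B.Env × B.Env) × S × A =>
      B.mdp.occ (B.trans y.1.2) (B.optPol y.1.2) i y.2.1 y.2.2 *
        ∫⁻ z, absDiff (B.trans y.1.1 i y.2.1 y.2.2 z) (B.trans y.1.2 i y.2.1 y.2.2 z) ∂B.mdp.ν :=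
    (h1.comp (f := fun y : (B.Env × B.Env) × S × A => (y.1.2, y.2)) (by fun_prop)).mul
      h3.lintegral_prod_right'
  have h5 : Measurable fun y : (B.Env × B.Env) × S => ∫⁻ a,
      B.mdp.occ (B.trans y.1.2) (B.optPol y.1.2) i y.2 a *
        ∫⁻ z, absDiff (B.trans y.1.1 i y.2 a z) (B.trans y.1.2 i y.2 a z) ∂B.mdp.ν ∂B.mdp.μA :=
    (h4.comp (f := fun y : ((B.Env × B.Env) × S) × A => (y.1.1, y.1.2, y.2))
      (by fun_prop)).lintegral_prod_right'
  exact h5.lintegral_prod_right'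

lemma measurable_polGap : Measurable fun x : B.Env × B.Env => B.polGap x.1 x.2 := by
  unfold polGap polDist
  refine Finset.measurable_sum _ fun i _ => ?_
  have h1 : Measurable fun x : B.Env × S => B.mdp.stateOcc (B.trans x.1) (B.optPol x.1) i x.2 :=
    B.mdp.measurable_stateOcc (X := B.Env) (Q := B.trans) (π := B.optPol) B.measurable_trans
      B.measurable_optPol i
  have h2 := B.measurable_optPol i
  have h3 : Measurable fun y : ((B.Env × B.Env) × S) × A =>
      absDiff (B.optPol y.1.1.1 i y.1.2 y.2) (B.optPol y.1.1.2 i y.1.2 y.2) :=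
    (h2.comp (f := fun y : ((B.Env × B.Env) × S) × A => (y.1.1.1, y.1.2, y.2)) (by fun_prop)).absDiff
    (h2.comp (f := fun y : ((B.Env × B.Env) × S) × A => (y.1.1.2, y.1.2, y.2)) (by fun_prop))
  have h4 : Measurable fun y : (B.Env × B.Env) × S =>
      B.mdp.stateOcc (B.trans y.1.2) (B.optPol y.1.2) i y.2 *
        ∫⁻ a, absDiff (B.optPol y.1.1 i y.2 a) (B.optPol y.1.2 i y.2 a) ∂B.mdp.μA :=
    (h1.comp (f := fun y : (B.Env × B.Env) × S => (y.1.2, y.2)) (by fun_prop)).mul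
      h3.lintegral_prod_right'
  exact h4.lintegral_prod_right'

lemma measurable_gap : Measurable fun x : B.Env × B.Env => B.gap x.1 x.2 :=
  B.measurable_transGap.add B.measurable_polGap

lemma measurable_transGap_left (E₀ : B.Env) : Measurable fun E => B.transGap (B.trans E) E₀ :=
  B.measurable_transGap.comp (f := fun E => (E, E₀)) (by fun_prop)

lemma measurable_polGap_left (E₀ : B.Env) : Measurable fun E => B.polGap E E₀ :=
  B.measurable_polGap.comp (f := fun E => (E, E₀)) (by fun_prop)

lemma measurable_rareMass (δ : NNReal) : Measurable (B.rareMass δ) := by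
  unfold rareMass
  refine Finset.measurable_sum _ fun i _ => ?_
  have h1 := B.measurable_occ_pair i
  exact measurable_measure_prodMk_left (ν := B.mdp.baseSA i)
    (s := {y : B.Env × S × A | B.mdp.occ (B.trans y.1) (B.optPol y.1) i y.2.1 y.2.2 < 2 * δ})
    (measurableSet_lt h1 measurable_const)

variable {N : Measure B.Env} [IsProbabilityMeasure N] {Q Q' : Trans S A}

lemma measurable_occGap (hQ : B.mdp.IsTrans Q) (E₀ : B.Env) :
    Measurable fun E => B.occGap N Q E E₀ := by
  unfold occGap
  refine Finset.measurable_sum _ fun i _ => ?_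
  have h1 := B.measurable_occ_optPol hQ i
  have h2 := B.measurable_avgOcc N hQ i
  have h3 := (B.isTrans_trans E₀).measurable_occ (B.isPolicy_optPol E₀) i
  have h4 : Measurable fun y : B.Env × S × A => absDiff (B.mdp.occ Q (B.optPol y.1) i y.2.1 y.2.2 ^ 2
    / B.avgOcc N Q i y.2.1 y.2.2) (B.mdp.occ (B.trans E₀) (B.optPol E₀) i y.2.1 y.2.2) :=
    ((h1.pow_const 2).div (h2.comp measurable_snd)).absDiff (h3.comp measurable_snd)
  exact h4.lintegral_prod_right'

lemma transGap_meanTrans_le (N : Measure B.Env) [IsProbabilityMeasure N] (E₀ : B.Env) :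
    B.transGap (B.meanTrans N) E₀ ≤ ∫⁻ E, B.transGap (B.trans E) E₀ ∂N := by
  unfold transGap
  have hd : ∀ i, Measurable fun E => B.mdp.transDist (B.trans E) (B.trans E₀) (B.optPol E₀) i := by
    intro i
    have h1 := (B.isTrans_trans E₀).measurable_occ (B.isPolicy_optPol E₀) i
    have h2 := B.measurable_trans i
    have h3 := (B.isTrans_trans E₀).meas i
    unfold transDist
    have h4 : Measurable fun y : (B.Env × S × A) × (ℝ × S) =>
      absDiff (B.trans y.1.1 i y.1.2.1 y.1.2.2 y.2) (B.trans E₀ i y.1.2.1 y.1.2.2 y.2) :=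
      (h2.comp (f := fun y : (B.Env × S × A) × (ℝ × S) => (y.1.1, y.1.2.1, y.1.2.2, y.2))
        (by fun_prop)).absDiff (by fun_prop)
    have h5 : Measurable fun y : B.Env × S × A =>
      B.mdp.occ (B.trans E₀) (B.optPol E₀) i y.2.1 y.2.2 *
        ∫⁻ z, absDiff (B.trans y.1 i y.2.1 y.2.2 z) (B.trans E₀ i y.2.1 y.2.2 z) ∂B.mdp.ν :=
      (h1.comp measurable_snd).mul h4.lintegral_prod_right'
    have h6 : Measurable fun y : B.Env × S => ∫⁻ a,
      B.mdp.occ (B.trans E₀) (B.optPol E₀) i y.2 a *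
        ∫⁻ z, absDiff (B.trans y.1 i y.2 a z) (B.trans E₀ i y.2 a z) ∂B.mdp.ν ∂B.mdp.μA :=
      (h5.comp (f := fun y : (B.Env × S) × A => (y.1.1, y.1.2, y.2))
        (by fun_prop)).lintegral_prod_right'
    exact h6.lintegral_prod_right'
  rw [lintegral_finsetSum _ fun i _ => hd i]
  refine Finset.sum_le_sum fun i _ => ?_
  have h1 := (B.isTrans_trans E₀).measurable_occ (B.isPolicy_optPol E₀) i
  have h2 := B.measurable_trans i
  have h3 := (B.isTrans_trans E₀).meas i
  have h4 : Measurable fun y : (B.Env × S × A) × (ℝ × S) =>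
      absDiff (B.trans y.1.1 i y.1.2.1 y.1.2.2 y.2) (B.trans E₀ i y.1.2.1 y.1.2.2 y.2) :=
    (h2.comp (f := fun y : (B.Env × S × A) × (ℝ × S) => (y.1.1, y.1.2.1, y.1.2.2, y.2))
      (by fun_prop)).absDiff (by fun_prop)
  have h5 : Measurable fun y : B.Env × S × A =>
      ∫⁻ z, absDiff (B.trans y.1 i y.2.1 y.2.2 z) (B.trans E₀ i y.2.1 y.2.2 z) ∂B.mdp.ν :=
    h4.lintegral_prod_right'
  have h6 : Measurable fun y : B.Env × S × A =>
      B.mdp.occ (B.trans E₀) (B.optPol E₀) i y.2.1 y.2.2 *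
        ∫⁻ z, absDiff (B.trans y.1 i y.2.1 y.2.2 z) (B.trans E₀ i y.2.1 y.2.2 z) ∂B.mdp.ν :=
    (h1.comp measurable_snd).mul h5
  unfold transDist
  rw [← lintegral_lintegral_lintegral_comm h6]
  refine lintegral_mono fun s => lintegral_mono fun a => ?_
  dsimp only
  have h7 : Measurable fun E => ∫⁻ z, absDiff (B.trans E i s a z) (B.trans E₀ i s a z) ∂B.mdp.ν :=
    h5.comp (f := fun E => (E, s, a)) (by fun_prop)
  rw [lintegral_const_mul _ h7]
  gcongr
  have h8 : Measurable fun y : B.Env × (ℝ × S) =>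
      absDiff (B.trans y.1 i s a y.2) (B.trans E₀ i s a y.2) :=
    h4.comp (f := fun y : B.Env × (ℝ × S) => ((y.1, s, a), y.2)) (by fun_prop)
  rw [lintegral_lintegral_swap h8.aemeasurable]
  refine lintegral_mono fun z => ?_
  have := absDiff_lintegral_le (μ := N) (f := fun E => B.trans E i s a z)
    (g := fun _ => B.trans E₀ i s a z) (h2.comp (f := fun E => (E, s, a, z)) (by fun_prop))
    measurable_const
  rwa [lintegral_const, measure_univ, mul_one] at this

lemma transGap_cond_le [NeZero H] {C : Set B.Env} (hw0 : N C ≠ 0) (E₀ : B.Env) :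
    N C * B.transGap (B.meanTrans (ProbabilityTheory.cond N C)) E₀
      ≤ ∫⁻ E in C, B.transGap (B.trans E) E₀ ∂N := by
  have hp : IsProbabilityMeasure (ProbabilityTheory.cond N C) := cond_isProbabilityMeasure hw0
  rw [← B.smul_cond hw0, lintegral_smul_measure, smul_eq_mul]
  exact mul_le_mul_right (B.transGap_meanTrans_le _ E₀) _

/-- Relative occupancies are close to the reference occupancy if the occupancies are, up to the
rarely visited pairs. -/
lemma lintegral_absDiff_sq_div_le {X : Type*} [MeasurableSpace X] {μ : Measure X}
    [IsProbabilityMeasure μ] {d : X → ENNReal} (hd : Measurable d) {d₀ : ENNReal} {M δ : NNReal}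
    (hδ : δ ≠ 0) (hM : ∀ᵐ x ∂μ, d x ≤ M) {D : ENNReal} (hD : D = ∫⁻ x, d x ∂μ) :
    ∫⁻ x, absDiff (d x ^ 2 / D) d₀ ∂μ
      ≤ ∫⁻ x, absDiff (d x) d₀ ∂μ + M / δ * ∫⁻ x, absDiff (d x) d₀ ∂μ + M / δ * absDiff D d₀
        + 2 * M * ((if d₀ < 2 * δ then 1 else 0) + absDiff D d₀ / δ) := by
  have hδ0 : (δ : ENNReal) ≠ 0 := by simpa using hδ
  have hDM : D ≤ M := by
    rw [hD]
    refine (lintegral_mono_ae hM).trans ?_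
    simp
  have hDt : D ≠ ⊤ := (hDM.trans_lt ENNReal.coe_lt_top).ne
  have hm : Measurable fun x => absDiff (d x) d₀ := by fun_prop
  have h0 : ∫⁻ x, absDiff (d x ^ 2 / D) d₀ ∂μ
      ≤ ∫⁻ x, absDiff (d x) d₀ ∂μ + ∫⁻ x, absDiff (d x ^ 2 / D) (d x) ∂μ := by
    rw [← lintegral_add_left hm]
    refine lintegral_mono fun x => ?_
    dsimp only
    rw [add_comm]
    exact absDiff_triangle _ _ _
  refine h0.trans ?_
  rcases le_or_gt (δ : ENNReal) D with h | h
  · have hD0 : D ≠ 0 := fun e => hδ0 (le_zero_iff.1 (e ▸ h))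
    have h1 : ∫⁻ x, absDiff (d x ^ 2 / D) (d x) ∂μ
        ≤ M / δ * ∫⁻ x, absDiff (d x) d₀ ∂μ + M / δ * absDiff D d₀ := by
      have e : M / δ * ∫⁻ x, absDiff (d x) d₀ ∂μ + M / δ * absDiff D d₀
          = ∫⁻ x, (M / δ * absDiff (d x) d₀ + M / δ * absDiff D d₀) ∂μ := by
        rw [lintegral_add_right _ measurable_const, lintegral_const_mul _ hm, lintegral_const,
          measure_univ, mul_one]
      rw [e]
      refine lintegral_mono_ae ?_
      filter_upwards [hM] with x hx
      have e1 : d x ^ 2 / D = d x / D * d x := by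
        rw [div_eq_mul_inv, div_eq_mul_inv]; ring
      have e2 : d x / D * D = d x := ENNReal.div_mul_cancel hD0 hDt
      calc absDiff (d x ^ 2 / D) (d x) = absDiff (d x / D * d x) (d x / D * D) := by rw [e1, e2]
        _ ≤ d x / D * absDiff (d x) D := absDiff_mul_left _ _ _
        _ ≤ M / δ * (absDiff (d x) d₀ + absDiff d₀ D) := by
          gcongr
          exact absDiff_triangle _ _ _
        _ = _ := by rw [absDiff_comm d₀ D]; ring
    calc _ ≤ ∫⁻ x, absDiff (d x) d₀ ∂μ
          + (M / δ * ∫⁻ x, absDiff (d x) d₀ ∂μ + M / δ * absDiff D d₀) := by gcongr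
      _ ≤ _ := by rw [← add_assoc]; exact le_self_add
  · have h1 : ∫⁻ x, absDiff (d x ^ 2 / D) (d x) ∂μ ≤ 2 * M := by
      calc ∫⁻ x, absDiff (d x ^ 2 / D) (d x) ∂μ ≤ ∫⁻ x, (d x * (D⁻¹ * M) + d x) ∂μ := by
            refine lintegral_mono_ae ?_
            filter_upwards [hM] with x hx
            refine (absDiff_le_add _ _).trans ?_
            gcongr
            calc d x ^ 2 / D = d x * (D⁻¹ * d x) := by rw [div_eq_mul_inv]; ring
              _ ≤ _ := by gcongr
        _ = D / D * M + D := by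
            rw [lintegral_add_left (by fun_prop), lintegral_mul_const _ hd, ← hD, div_eq_mul_inv]
            ring
        _ ≤ 1 * M + M := by
            gcongr
            exact ENNReal.div_self_le_one
        _ = _ := by ring
    have h2 : (1 : ENNReal) ≤ (if d₀ < 2 * δ then 1 else 0) + absDiff D d₀ / δ := by
      split_ifs with h3
      · exact le_self_add
      · rw [zero_add, ENNReal.le_div_iff_mul_le (Or.inl hδ0) (Or.inl ENNReal.coe_ne_top), one_mul]
        have h4 := le_add_absDiff d₀ D
        rw [absDiff_comm] at h4
        refine (ENNReal.add_le_add_iff_left (ENNReal.coe_ne_top (r := δ))).1 ?_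
        calc (δ : ENNReal) + δ = 2 * δ := by ring
          _ ≤ d₀ := not_lt.1 h3
          _ ≤ D + absDiff D d₀ := h4
          _ ≤ _ := by gcongr
    calc _ ≤ ∫⁻ x, absDiff (d x) d₀ ∂μ + 0 + 0
          + 2 * M * ((if d₀ < 2 * δ then 1 else 0) + absDiff D d₀ / δ) := by
          rw [add_zero, add_zero]
          refine add_le_add le_rfl (h1.trans ?_)
          calc (2 * M : ENNReal) = 2 * M * 1 := (mul_one _).symm
            _ ≤ _ := by gcongr
      _ ≤ _ := by gcongr <;> exact zero_le

lemma lintegral_occGap_le (hQ : B.mdp.IsTrans Q) {M δ : NNReal} (hδ : δ ≠ 0)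
    (hM : ∀ E : B.Env, ∀ h < H, ∀ᵐ x ∂(B.mdp.baseSA h), B.mdp.occ Q (B.optPol E) h x.1 x.2 ≤ M)
    (E₀ : B.Env) :
    ∫⁻ E, B.occGap N Q E E₀ ∂N
      ≤ H * (1 + 4 * M / δ) * (B.transGap Q E₀ + ∫⁻ E, B.polGap E E₀ ∂N)
        + 2 * M * B.rareMass δ E₀ := by
  set K := B.transGap Q E₀ + ∫⁻ E, B.polGap E E₀ ∂N with hK
  have h1 := fun i => B.measurable_occ_optPol hQ i
  have h2 := fun i => B.measurable_avgOcc N hQ i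
  have h3 := fun i => (B.isTrans_trans E₀).measurable_occ (B.isPolicy_optPol E₀) i
  have h4 : ∀ i, Measurable fun y : B.Env × S × A =>
    absDiff (B.mdp.occ Q (B.optPol y.1) i y.2.1 y.2.2 ^ 2
    / B.avgOcc N Q i y.2.1 y.2.2) (B.mdp.occ (B.trans E₀) (B.optPol E₀) i y.2.1 y.2.2) := fun i =>
    (((h1 i).pow_const 2).div ((h2 i).comp measurable_snd)).absDiff ((h3 i).comp measurable_snd)
  have h5 : ∀ i, Measurable fun y : B.Env × S × A =>
    absDiff (B.mdp.occ Q (B.optPol y.1) i y.2.1 y.2.2)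
      (B.mdp.occ (B.trans E₀) (B.optPol E₀) i y.2.1 y.2.2) := fun i =>
    (h1 i).absDiff ((h3 i).comp measurable_snd)
  unfold occGap
  rw [lintegral_finsetSum _ fun i _ => (h4 i).lintegral_prod_right']
  have key : ∀ h ∈ Finset.range H, ∫⁻ E, ∫⁻ x, absDiff (B.mdp.occ Q (B.optPol E) h x.1 x.2 ^ 2
      / B.avgOcc N Q h x.1 x.2) (B.mdp.occ (B.trans E₀) (B.optPol E₀) h x.1 x.2)
        ∂(B.mdp.baseSA h) ∂N ≤ (1 + 4 * M / δ) * K + 2 * M *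
      B.mdp.baseSA h {x | B.mdp.occ (B.trans E₀) (B.optPol E₀) h x.1 x.2 < 2 * δ} := by
    intro h hh
    have hh := Finset.mem_range.1 hh
    rw [lintegral_lintegral_swap (h4 h).aemeasurable]
    have hae : ∀ᵐ x ∂(B.mdp.baseSA h), ∀ᵐ E ∂N, B.mdp.occ Q (B.optPol E) h x.1 x.2 ≤ M := by
      rw [← Measure.ae_ae_comm (p := fun (E : B.Env) (x : S × A) => B.mdp.occ Q (B.optPol E) h x.1 x.2 ≤ M)
        (measurableSet_le (h1 h) measurable_const)]
      exact Eventually.of_forall fun E => hM E h hh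
    have hset : MeasurableSet {x : S × A |
      B.mdp.occ (B.trans E₀) (B.optPol E₀) h x.1 x.2 < 2 * δ} :=
      measurableSet_lt (h3 h) measurable_const
    set f : S × A → ENNReal := fun x => ∫⁻ E, absDiff (B.mdp.occ Q (B.optPol E) h x.1 x.2)
      (B.mdp.occ (B.trans E₀) (B.optPol E₀) h x.1 x.2) ∂N with hf
    set g : S × A → ENNReal := fun x => absDiff (B.avgOcc N Q h x.1 x.2)
      (B.mdp.occ (B.trans E₀) (B.optPol E₀) h x.1 x.2) with hg
    have mf : Measurable f := (h5 h).lintegral_prod_left'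
    have mg : Measurable g := (h2 h).absDiff (h3 h)
    have If : ∫⁻ x, f x ∂(B.mdp.baseSA h) ≤ K := by
      rw [hf, ← lintegral_lintegral_swap (h5 h).aemeasurable]
      calc _ ≤ ∫⁻ E, (B.transGap Q E₀ + B.polGap E E₀) ∂N := by
            refine lintegral_mono fun E => ?_
            refine le_trans (le_of_eq ?_) (B.lintegral_absDiff_occ_le_gap hQ E E₀ hh)
            exact lintegral_baseSA (b := B.mdp) h
              ((h5 h).comp (f := fun x => (E, x)) (by fun_prop))
        _ = _ := by rw [lintegral_add_left measurable_const, lintegral_const, measure_univ, mul_one]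
    have Ig : ∫⁻ x, g x ∂(B.mdp.baseSA h) ≤ K := B.lintegral_absDiff_avgOcc_le hQ E₀ hh
    have mi : Measurable fun x : S × A =>
        if B.mdp.occ (B.trans E₀) (B.optPol E₀) h x.1 x.2 < 2 * δ then (1 : ENNReal) else 0 :=
      Measurable.ite hset measurable_const measurable_const
    have mi' : Measurable fun x : S × A =>
        (if B.mdp.occ (B.trans E₀) (B.optPol E₀) h x.1 x.2 < 2 * δ then (1 : ENNReal) else 0)
          + g x / δ := mi.add (by fun_prop)
    calc _ ≤ ∫⁻ x, (f x + M / δ * f x + M / δ * g x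
        + 2 * M * ((if B.mdp.occ (B.trans E₀) (B.optPol E₀) h x.1 x.2 < 2 * δ then 1 else 0)
          + g x / δ)) ∂(B.mdp.baseSA h) := by
          refine lintegral_mono_ae ?_
          filter_upwards [hae] with x hx
          exact lintegral_absDiff_sq_div_le ((h1 h).comp (f := fun E => (E, x)) (by fun_prop)) hδ
            hx rfl
      _ = ∫⁻ x, f x ∂(B.mdp.baseSA h) + M / δ * ∫⁻ x, f x ∂(B.mdp.baseSA h)
          + M / δ * ∫⁻ x, g x ∂(B.mdp.baseSA h) + 2 * M * (B.mdp.baseSA h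
          {x | B.mdp.occ (B.trans E₀) (B.optPol E₀) h x.1 x.2 < 2 * δ}
            + (∫⁻ x, g x ∂(B.mdp.baseSA h)) * (δ : ENNReal)⁻¹) := by
          rw [lintegral_add_left (by fun_prop), lintegral_add_left (by fun_prop),
            lintegral_add_left (by fun_prop), lintegral_const_mul _ mf, lintegral_const_mul _ mg,
            lintegral_const_mul _ mi', lintegral_add_left mi]
          simp only [div_eq_mul_inv]
          rw [lintegral_mul_const _ mg]
          congr 3
          rw [← lintegral_indicator_one hset]
          refine lintegral_congr fun x => ?_
          simp [indicator_apply]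
      _ ≤ K + M / δ * K + M / δ * K + 2 * M * (B.mdp.baseSA h
          {x | B.mdp.occ (B.trans E₀) (B.optPol E₀) h x.1 x.2 < 2 * δ}
            + K * (δ : ENNReal)⁻¹) := by gcongr
      _ = _ := by simp only [div_eq_mul_inv]; ring
  refine (Finset.sum_le_sum key).trans (le_of_eq ?_)
  rw [Finset.sum_add_distrib, Finset.sum_const, Finset.card_range, nsmul_eq_mul, ← Finset.mul_sum]
  unfold rareMass
  ring

end BayesRL

end

noncomputable section

namespace BayesRL

open MDPBase

variable {S A : Type*} [MeasurableSpace S] [MeasurableSpace A] {H : ℕ} [NeZero H]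
  {TP TR : Fin H → Type*} [∀ h, MeasurableSpace (TP h)] [∀ h, MeasurableSpace (TR h)]
  (B : BayesRL S A H TP TR)

/-- Decrease of the entropy contribution of a cell during an episode. -/
def infoGain (N : Measure B.Env) (C : Set B.Env) : ENNReal :=
  ENNReal.ofReal (Real.negMulLog (N C).toReal) - B.postEntropy N C

/-- The error terms of the regret bound of an episode that do not depend on the partition. -/
def regretError (N : Measure B.Env) (E E₀ : B.Env) : ENNReal :=
  B.valueVar E₀ + 13 * H ^ 3 * B.occGap N (B.meanTrans N) E E₀
    + 63 * H ^ 4 * (B.transGap (B.trans E) E₀ + B.polGap E E₀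
      + (B.transGap (B.meanTrans N) E₀ + ∫⁻ E', B.polGap E' E₀ ∂N))

variable {N : Measure B.Env} [IsProbabilityMeasure N]

lemma measurable_accValue_optPol {Q : Trans S A} (hQ : B.mdp.IsTrans Q) (h : ℕ) (s : S) :
    Measurable fun E => B.accValue Q (B.optPol E) h s := by
  have := B.mdp.measurable_acc (X := B.Env) (Q := fun _ => Q) (π := B.optPol)
    (F := fun _ _ _ _ => rew) (fun n => (hQ.meas n).comp measurable_snd) B.measurable_optPol
    (fun n => (measTrans_rew (S := S) (A := A) n).comp measurable_snd) (H - h) h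
  exact this.comp (f := fun E => (E, s)) (by fun_prop)

lemma accValue_le_meanTrans_cond {C : Set B.Env} (hC : MeasurableSet C) (hw0 : N C ≠ 0)
    (hNC : iIndepFun (fun h (E : B.Env) => E h) (ProbabilityTheory.cond N C)) {ε : ENNReal}
    (hval : ∀ E ∈ C, ∀ E' ∈ C, B.accValue (B.trans E) (B.optPol E) 0 B.s₁
      ≤ B.accValue (B.trans E') (B.optPol E) 0 B.s₁ + ε) {E : B.Env} (hE : E ∈ C) :
    B.accValue (B.trans E) (B.optPol E) 0 B.s₁
      ≤ B.accValue (B.meanTrans (ProbabilityTheory.cond N C)) (B.optPol E) 0 B.s₁ + ε := by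
  have hp : IsProbabilityMeasure (ProbabilityTheory.cond N C) := cond_isProbabilityMeasure hw0
  rw [← B.lintegral_accValue_trans hNC (B.isPolicy_optPol E)]
  calc _ = ∫⁻ _, B.accValue (B.trans E) (B.optPol E) 0 B.s₁ ∂(ProbabilityTheory.cond N C) := by
        rw [lintegral_const, measure_univ, mul_one]
    _ ≤ ∫⁻ E', (B.accValue (B.trans E') (B.optPol E) 0 B.s₁ + ε) ∂(ProbabilityTheory.cond N C) := by
        refine lintegral_mono_ae ?_
        filter_upwards [ae_cond_mem hC] with E' hE'
        exact hval E hE E' hE'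
    _ = _ := by
        rw [lintegral_add_right _ measurable_const, lintegral_const, measure_univ, mul_one]

lemma two_mul_le_of_half {w x I : ENNReal} (h : w * (2⁻¹ * x) ≤ I) : w * x ≤ 2 * I := by
  calc w * x = 2 * 2⁻¹ * (w * x) := by rw [ENNReal.mul_inv_cancel (by simp) (by simp), one_mul]
    _ = 2 * (w * (2⁻¹ * x)) := by ring
    _ ≤ _ := by gcongr

/-- The regret bound on a cell of a partition. -/
lemma setLIntegral_accValue_le (hN : iIndepFun (fun h (E : B.Env) => E h) N) {C : Set B.Env}
    (hC : MeasurableSet C)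
    (hNC : N C ≠ 0 → iIndepFun (fun h (E : B.Env) => E h) (ProbabilityTheory.cond N C))
    {ε : ENNReal} (hval : ∀ E ∈ C, ∀ E' ∈ C, B.accValue (B.trans E) (B.optPol E) 0 B.s₁
      ≤ B.accValue (B.trans E') (B.optPol E) 0 B.s₁ + ε) (E₀ : B.Env) {t : ℝ} (ht : 0 < t) :
    ∫⁻ E in C, B.accValue (B.trans E) (B.optPol E) 0 B.s₁ ∂N
      ≤ ∫⁻ E in C, (B.accValue (B.meanTrans N) (B.optPol E) 0 B.s₁ + ε
          + ENNReal.ofReal (1 / t) * B.regretError N E E₀) ∂N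
        + ENNReal.ofReal (3 * t) * B.infoGain N C := by
  classical
  by_cases hw0 : N C = 0
  · rw [setLIntegral_measure_zero _ _ hw0]
    exact zero_le
  specialize hNC hw0
  have hp : IsProbabilityMeasure (ProbabilityTheory.cond N C) := cond_isProbabilityMeasure hw0
  have hQ := B.isTrans_meanTrans N
  have hQ' := B.isTrans_meanTrans (ProbabilityTheory.cond N C)
  set Q := B.meanTrans N with hQdef
  set Q' := B.meanTrans (ProbabilityTheory.cond N C) with hQ'def
  have hQ₀ := B.isTrans_trans E₀
  have hπ₀ := B.isPolicy_optPol E₀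
  have hH : (0 : ℝ) < H := by exact_mod_cast NeZero.pos H
  set X : ℕ → ENNReal := fun h => ∫⁻ x, B.avgOcc N Q' h x.1 x.2 *
          ∫⁻ z, triDisc (Q' h x.1 x.2 z) (Q h x.1 x.2 z) ∂B.mdp.ν ∂(B.mdp.baseSA h) with hX
  set R : ℕ → ENNReal := fun h => ∫⁻ x, (if B.avgOcc N Q' h x.1 x.2
          ≤ 2⁻¹ * B.avgOcc N Q h x.1 x.2 then B.avgOcc N Q h x.1 x.2 else 0) ∂(B.mdp.baseSA h) with hR
  set W := ∑ h ∈ Finset.range H, X h with hW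
  set Z := ∑ h ∈ Finset.range H, R h with hZ
  set T := ∫⁻ τ : Traj S A H, triDisc (B.avgPol N τ * likelihood Q' B.s₁ τ)
          (B.avgPol N τ * likelihood Q B.s₁ τ) ∂(B.mdp.trajRef H) with hT
  have hpe : B.postEntropy N C ≠ ⊤ := by
    have := B.postEntropy_add_le hN hw0 hNC (X := 0) (by
      rw [add_zero]
      exact le_self_add.trans (B.logDeficit_add_traj hQ hQ' hw0 prob_le_one
        (B.likelihood_cond_le hN hw0 hNC)))
    exact ((le_self_add.trans this).trans_lt ENNReal.ofReal_lt_top).ne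
  have hIW : N C * W ≤ 2 * B.infoGain N C := by
    refine two_mul_le_of_half (ENNReal.le_sub_of_add_le_left hpe ?_)
    refine le_trans (le_of_eq ?_) (B.postEntropy_add_layers hN hw0 hNC)
    rw [hW, Finset.sum_range]
    congr 4
    ext h
    have m1 := hQ.meas h.1
    have m2 := hQ'.meas h.1
    have m3 := B.measurable_avgOcc N hQ' h.1
    exact lintegral_baseSA (b := B.mdp) h.1 (f := fun x => B.avgOcc N Q' h.1 x.1 x.2 *
          ∫⁻ z, triDisc (Q' h.1 x.1 x.2 z) (Q h.1 x.1 x.2 z) ∂B.mdp.ν) (by fun_prop)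
  have hIT : N C * T ≤ 2 * B.infoGain N C :=
    two_mul_le_of_half (ENNReal.le_sub_of_add_le_left hpe (B.postEntropy_add_traj hN hw0 hNC))
  have hRT : Z ≤ H * (6 * T) := by
    rw [hZ, Finset.sum_range]
    refine (Finset.sum_le_card_nsmul _ _ (6 * T) fun h _ => ?_).trans (by simp)
    have m3 := B.measurable_avgOcc N hQ h.1
    have m4 := B.measurable_avgOcc N hQ' h.1
    have hU : MeasurableSet {x : S × A | B.avgOcc N Q' h.1 x.1 x.2
        ≤ 2⁻¹ * B.avgOcc N Q h.1 x.1 x.2} := measurableSet_le m4 (by fun_prop)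
    refine le_trans (le_of_eq ?_) (B.lintegral_avgOcc_le_triDisc (N := N) hQ hQ' h hU
      fun x hx => hx)
    have e := lintegral_baseSA (b := B.mdp) h.1 (f := fun x => if B.avgOcc N Q' h.1 x.1 x.2
        ≤ 2⁻¹ * B.avgOcc N Q h.1 x.1 x.2 then B.avgOcc N Q h.1 x.1 x.2 else 0)
      (Measurable.ite hU m3 measurable_const)
    refine e.trans (lintegral_congr fun s => lintegral_congr fun a => ?_)
    simp [indicator_apply]
  have hJ : N C * B.transGap Q' E₀ ≤ ∫⁻ E in C, B.transGap (B.trans E) E₀ ∂N :=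
    B.transGap_cond_le hw0 E₀
  set pa := ∫⁻ E', B.polGap E' E₀ ∂N with hpa
  set base : B.Env → ENNReal := fun E => B.accValue Q (B.optPol E) 0 B.s₁ + ε
    + ENNReal.ofReal (1 / t) * (B.valueVar E₀ + 13 * H ^ 3 * B.occGap N Q E E₀
      + 63 * H ^ 4 * (B.polGap E E₀ + (B.transGap Q E₀ + pa))) with hbase
  have hpt : ∀ E ∈ C, B.accValue (B.trans E) (B.optPol E) 0 B.s₁
      ≤ base E + (ENNReal.ofReal (1 / t) * (63 * H ^ 4) * B.transGap Q' E₀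
        + (ENNReal.ofReal t * W + ENNReal.ofReal (t / (12 * H)) * Z)) := by
    intro E hE
    have hπ := B.isPolicy_optPol E
    have h1 := B.accValue_le_meanTrans_cond hC hw0 hNC hval hE
    have h2 := hQ.acc_le_acc_add_sum hQ' hπ (r := rew) measurable_rew
      (c := B.mdp.actionValue H (B.trans E₀) (B.optPol E₀) rew)
      (fun n => hQ₀.measurable_actionValue hπ₀ measurable_rew n)
      (fun n s a => ((hQ₀.actionValue_le hπ₀ rew_le_one n s a).trans_lt
        (ENNReal.natCast_lt_top H)).ne) H
    have h3 := Finset.sum_le_sum fun h (hh : h ∈ Finset.range H) =>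
      B.lintegral_occ_mul_simErr_le (N := N) hQ hQ' E E₀ (Finset.mem_range.1 hh) ht
    rw [Finset.sum_add_distrib, Finset.sum_add_distrib, ← Finset.mul_sum, ← Finset.mul_sum,
      ← Finset.mul_sum, Finset.sum_add_distrib, Finset.sum_add_distrib, Finset.sum_const,
      Finset.card_range, ← Finset.mul_sum, nsmul_eq_mul] at h3
    refine h1.trans ((add_le_add_left (h2.trans (add_le_add le_rfl h3)) _).trans (le_of_eq ?_))
    change B.accValue Q (B.optPol E) 0 B.s₁ + (ENNReal.ofReal t * W +
      ENNReal.ofReal (t / (12 * H)) * Z + ENNReal.ofReal (1 / t) * (B.valueVar E₀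
        + 13 * H ^ 3 * B.occGap N Q E E₀ + H * (63 * H ^ 3 * (B.transGap Q' E₀
          + B.transGap Q E₀ + B.polGap E E₀ + pa)))) + ε = _
    simp only [hbase]
    ring
  have hc1 : ENNReal.ofReal (t / (12 * H)) * (H * (6 * T)) = ENNReal.ofReal (t / 2) * T := by
    rw [← mul_assoc, ← mul_assoc]
    congr 1
    rw [show (H : ENNReal) = ENNReal.ofReal H by simp, show (6 : ENNReal) = ENNReal.ofReal 6 by simp,
      ← ENNReal.ofReal_mul (by positivity), ← ENNReal.ofReal_mul (by positivity)]
    congr 1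
    field_simp
    norm_num
  have hm1 := B.measurable_transGap_left E₀
  calc _ ≤ ∫⁻ E in C, (base E + (ENNReal.ofReal (1 / t) * (63 * H ^ 4) * B.transGap Q' E₀
        + (ENNReal.ofReal t * W + ENNReal.ofReal (t / (12 * H)) * Z))) ∂N :=
        setLIntegral_mono' hC hpt
    _ = ∫⁻ E in C, base E ∂N + (ENNReal.ofReal (1 / t) * (63 * H ^ 4) * (N C * B.transGap Q' E₀)
        + (ENNReal.ofReal t * (N C * W) + N C * (ENNReal.ofReal (t / (12 * H)) * Z))) := by
        rw [lintegral_add_right _ measurable_const, lintegral_const, Measure.restrict_apply_univ]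
        ring
    _ ≤ ∫⁻ E in C, base E ∂N + (ENNReal.ofReal (1 / t) * (63 * H ^ 4) *
          ∫⁻ E in C, B.transGap (B.trans E) E₀ ∂N
        + (ENNReal.ofReal t * (2 * B.infoGain N C)
          + N C * (ENNReal.ofReal (t / (12 * H)) * (H * (6 * T))))) := by gcongr
    _ = ∫⁻ E in C, base E ∂N + (ENNReal.ofReal (1 / t) * (63 * H ^ 4) *
          ∫⁻ E in C, B.transGap (B.trans E) E₀ ∂N
        + (ENNReal.ofReal t * (2 * B.infoGain N C) + ENNReal.ofReal (t / 2) * (N C * T))) := by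
        rw [hc1]; ring
    _ ≤ ∫⁻ E in C, base E ∂N + (ENNReal.ofReal (1 / t) * (63 * H ^ 4) *
          ∫⁻ E in C, B.transGap (B.trans E) E₀ ∂N
        + (ENNReal.ofReal t * (2 * B.infoGain N C)
          + ENNReal.ofReal (t / 2) * (2 * B.infoGain N C))) := by gcongr
    _ = (∫⁻ E in C, base E ∂N + ∫⁻ E in C, ENNReal.ofReal (1 / t) * (63 * H ^ 4) *
          B.transGap (B.trans E) E₀ ∂N) + ENNReal.ofReal (3 * t) * B.infoGain N C := by
        rw [lintegral_const_mul _ hm1]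
        have : ENNReal.ofReal (3 * t) = ENNReal.ofReal t * 2 + ENNReal.ofReal (t / 2) * 2 := by
          rw [show (2 : ENNReal) = ENNReal.ofReal 2 by simp, ← ENNReal.ofReal_mul (by positivity),
            ← ENNReal.ofReal_mul (by positivity), ← ENNReal.ofReal_add (by positivity) (by positivity)]
          congr 1; ring
        rw [this]
        ring
    _ = _ := by
        rw [← lintegral_add_right _ (hm1.const_mul _)]
        congr 2
        ext E
        simp only [hbase, regretError]
        ring

/-- The regret bound of an episode, in terms of the posterior `N` at its start. -/
lemma lintegral_accValue_le (hN : iIndepFun (fun h (E : B.Env) => E h) N) {K : ℕ}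
    {ζ : B.Env → Fin K} (hζ : Measurable ζ)
    (hNC : ∀ k, N (ζ ⁻¹' {k}) ≠ 0 →
      iIndepFun (fun h (E : B.Env) => E h) (ProbabilityTheory.cond N (ζ ⁻¹' {k})))
    {ε : ENNReal} (hval : ∀ E E', ζ E = ζ E' → B.accValue (B.trans E) (B.optPol E) 0 B.s₁
      ≤ B.accValue (B.trans E') (B.optPol E) 0 B.s₁ + ε) (E₀ : B.Env) {t : ℝ} (ht : 0 < t) :
    ∫⁻ E, B.accValue (B.trans E) (B.optPol E) 0 B.s₁ ∂N
      ≤ ∫⁻ E, B.accValue (B.meanTrans N) (B.optPol E) 0 B.s₁ ∂N + ε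
          + ENNReal.ofReal (1 / t) * ∫⁻ E, B.regretError N E E₀ ∂N
        + ENNReal.ofReal (3 * t) * ∑ k, B.infoGain N (ζ ⁻¹' {k}) := by
  have hcells : ∀ f : B.Env → ENNReal, ∫⁻ E, f E ∂N = ∑ k, ∫⁻ E in ζ ⁻¹' {k}, f E ∂N := by
    intro f
    rw [← tsum_fintype (L := .unconditional _),
      ← lintegral_iUnion (fun k => hζ (measurableSet_singleton k))]
    · rw [← preimage_iUnion, iUnion_of_singleton, preimage_univ, Measure.restrict_univ]
    · intro i j hij
      exact Disjoint.preimage _ (by simpa using hij)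
  have hQ := B.isTrans_meanTrans N
  have m1 := B.measurable_accValue_optPol hQ 0 B.s₁
  have m2 : Measurable fun E => B.regretError N E E₀ := by
    have h1 := B.measurable_occGap (N := N) hQ E₀
    have h2 := B.measurable_polGap_left E₀
    have h3 := B.measurable_transGap_left E₀
    unfold regretError
    fun_prop
  calc _ = ∑ k, ∫⁻ E in ζ ⁻¹' {k}, B.accValue (B.trans E) (B.optPol E) 0 B.s₁ ∂N := hcells _
    _ ≤ ∑ k, (∫⁻ E in ζ ⁻¹' {k}, (B.accValue (B.meanTrans N) (B.optPol E) 0 B.s₁ + ε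
          + ENNReal.ofReal (1 / t) * B.regretError N E E₀) ∂N
        + ENNReal.ofReal (3 * t) * B.infoGain N (ζ ⁻¹' {k})) := by
        refine Finset.sum_le_sum fun k _ => B.setLIntegral_accValue_le hN
          (hζ (measurableSet_singleton k)) (hNC k) (fun E hE E' hE' => hval E E' ?_) E₀ ht
        rw [mem_preimage, mem_singleton_iff] at hE hE'
        rw [hE, hE']
    _ = _ := by
        rw [Finset.sum_add_distrib, ← hcells, ← Finset.mul_sum,
          lintegral_add_right _ (m2.const_mul _), lintegral_add_left m1,
          lintegral_const_mul _ m2, lintegral_const, measure_univ, mul_one]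

lemma lintegral_regretError_le (hN : iIndepFun (fun h (E : B.Env) => E h) N) {M δ : NNReal}
    (hM : B.OccBound M) (hδ : δ ≠ 0) (E₀ : B.Env) :
    ∫⁻ E, B.regretError N E E₀ ∂N ≤ B.valueVar E₀
      + (13 * H ^ 4 * (1 + 4 * M / δ) + 126 * H ^ 4) * ∫⁻ E, B.gap E E₀ ∂N
      + 26 * H ^ 3 * M * B.rareMass δ E₀ := by
  have hQ := B.isTrans_meanTrans N
  have h1 := B.measurable_occGap (N := N) hQ E₀
  have h2 := B.measurable_polGap_left E₀
  have h3 := B.measurable_transGap_left E₀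
  have h4 := B.lintegral_occGap_le (N := N) hQ hδ
    (fun E h hh => hM.meanTrans hN E hh) E₀
  have h5 := B.transGap_meanTrans_le N E₀
  have e : ∫⁻ E, B.gap E E₀ ∂N = ∫⁻ E, B.transGap (B.trans E) E₀ ∂N + ∫⁻ E, B.polGap E E₀ ∂N :=
    lintegral_add_left h3 _
  unfold regretError
  rw [lintegral_add_left (by fun_prop), lintegral_add_left (by fun_prop),
    lintegral_const_mul _ h1, lintegral_const_mul _ (by fun_prop), lintegral_add_left (by fun_prop),
    lintegral_add_left h3, lintegral_const, lintegral_const, measure_univ, mul_one, mul_one, ← e]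
  set g := ∫⁻ E, B.gap E E₀ ∂N
  have h6 : B.transGap (B.meanTrans N) E₀ + ∫⁻ E, B.polGap E E₀ ∂N ≤ g := by
    rw [e]; gcongr
  calc _ ≤ B.valueVar E₀ + 13 * H ^ 3 * (H * (1 + 4 * M / δ) * g + 2 * M * B.rareMass δ E₀)
        + 63 * H ^ 4 * (g + g) := by
        gcongr
        exact h4.trans (by gcongr)
    _ = _ := by ring

end BayesRL

end

noncomputable section

namespace BayesRL

open MDPBase

variable {S A : Type*} [MeasurableSpace S] [MeasurableSpace A] {H : ℕ} [NeZero H]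
  {TP TR : Fin H → Type*} [∀ h, MeasurableSpace (TP h)] [∀ h, MeasurableSpace (TR h)]
  {B : BayesRL S A H TP TR}

lemma trajLaw_star (E E' : B.Env) : B.trajLaw E (B.star E') 0 B.s₁
    = (B.mdp.trajRef H).withDensity fun τ =>
      polWeight (B.optPol E') B.s₁ τ * likelihood (B.trans E) B.s₁ τ := by
  rw [B.trajLaw_eq E (B.star_mem E')]
  congr 1
  funext τ
  exact trajDens_zero (H := H) B.s₁ τ

variable {Ω : Type*} [MeasurableSpace Ω] {P : Measure Ω} [IsProbabilityMeasure P]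
  {env : Ω → B.Env} {smp : ℕ → Ω → B.Env} {epi : ℕ → Ω → Traj S A H}

/-- The posterior after `ℓ` episodes. -/
def IsTSRun.posterior (hR : B.IsTSRun P env smp epi) (ℓ : ℕ) :
    Kernel (Fin ℓ → Traj S A H) B.Env := (hR.sample ℓ).choose

variable (hR : B.IsTSRun P env smp epi)

instance IsTSRun.isMarkovKernel_posterior (ℓ : ℕ) : IsMarkovKernel (hR.posterior ℓ) :=
  (hR.sample ℓ).choose_spec.1

lemma IsTSRun.hasCondDistrib_posterior (ℓ : ℕ) :
    HasCondDistrib (fun ω => (env ω, smp ℓ ω)) (hist epi ℓ)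
      (hR.posterior ℓ ×ₖ hR.posterior ℓ) P :=
  (hR.sample ℓ).choose_spec.2

include hR

lemma IsTSRun.aemeasurable_hist (ℓ : ℕ) : AEMeasurable (hist epi ℓ) P :=
  (hR.hasCondDistrib_posterior ℓ).aemeasurable_fst

lemma IsTSRun.aemeasurable_env : AEMeasurable env P := hR.env_law.aemeasurable

lemma IsTSRun.aemeasurable_smp (ℓ : ℕ) : AEMeasurable (smp ℓ) P :=
  (hR.hasCondDistrib_posterior ℓ).aemeasurable_snd.snd

lemma IsTSRun.aemeasurable_epi (ℓ : ℕ) : AEMeasurable (epi ℓ) P :=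
  (hR.episode ℓ).aemeasurable_snd

lemma IsTSRun.lintegral_sample (ℓ : ℕ) {F : (Fin ℓ → Traj S A H) → B.Env → B.Env → ENNReal}
    (hF : Measurable fun x : (Fin ℓ → Traj S A H) × B.Env × B.Env => F x.1 x.2.1 x.2.2) :
    ∫⁻ ω, F (hist epi ℓ ω) (env ω) (smp ℓ ω) ∂P
      = ∫⁻ ω, ∫⁻ E, ∫⁻ E', F (hist epi ℓ ω) E E' ∂(hR.posterior ℓ (hist epi ℓ ω))
        ∂(hR.posterior ℓ (hist epi ℓ ω)) ∂P := by
  have h1 := hR.hasCondDistrib_posterior ℓ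
  have e : ∀ x, ∫⁻ y, F x y.1 y.2 ∂((hR.posterior ℓ ×ₖ hR.posterior ℓ) x)
      = ∫⁻ E, ∫⁻ E', F x E E' ∂(hR.posterior ℓ x) ∂(hR.posterior ℓ x) := by
    intro x
    have m : Measurable fun y : B.Env × B.Env => F x y.1 y.2 :=
      hF.comp (f := fun y : B.Env × B.Env => (x, y)) (by fun_prop)
    rw [Kernel.prod_apply, lintegral_prod _ m.aemeasurable]
  calc _ = ∫⁻ y, F y.1 y.2.1 y.2.2 ∂(P.map fun ω => (hist epi ℓ ω, (env ω, smp ℓ ω))) :=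
        (lintegral_map' hF.aemeasurable h1.aemeasurable).symm
    _ = ∫⁻ x, ∫⁻ y, F x y.1 y.2 ∂((hR.posterior ℓ ×ₖ hR.posterior ℓ) x)
          ∂(P.map (hist epi ℓ)) := by
        rw [h1.map_eq, Measure.lintegral_compProd hF]
    _ = ∫⁻ ω, ∫⁻ y, F (hist epi ℓ ω) y.1 y.2
          ∂((hR.posterior ℓ ×ₖ hR.posterior ℓ) (hist epi ℓ ω)) ∂P :=
        lintegral_map' hF.lintegral_kernel_prod_right'.aemeasurable (hR.aemeasurable_hist ℓ)
    _ = _ := by simp only [e]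

lemma IsTSRun.lintegral_posterior (ℓ : ℕ) {F : (Fin ℓ → Traj S A H) → B.Env → ENNReal}
    (hF : Measurable fun x : (Fin ℓ → Traj S A H) × B.Env => F x.1 x.2) :
    ∫⁻ ω, F (hist epi ℓ ω) (env ω) ∂P
      = ∫⁻ ω, ∫⁻ E, F (hist epi ℓ ω) E ∂(hR.posterior ℓ (hist epi ℓ ω)) ∂P := by
  rw [hR.lintegral_sample ℓ (F := fun x E _ => F x E)
    (hF.comp (f := fun x : (Fin ℓ → Traj S A H) × B.Env × B.Env => (x.1, x.2.1)) (by fun_prop))]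
  simp

lemma IsTSRun.lintegral_episode (ℓ : ℕ)
    {F : (Fin ℓ → Traj S A H) → B.Env → B.Env → Traj S A H → ENNReal}
    (hF : Measurable fun x : ((Fin ℓ → Traj S A H) × B.Env × B.Env) × Traj S A H =>
      F x.1.1 x.1.2.1 x.1.2.2 x.2) :
    ∫⁻ ω, F (hist epi ℓ ω) (env ω) (smp ℓ ω) (epi ℓ ω) ∂P
      = ∫⁻ ω, ∫⁻ τ, polWeight (B.optPol (smp ℓ ω)) B.s₁ τ * likelihood (B.trans (env ω)) B.s₁ τ *
        F (hist epi ℓ ω) (env ω) (smp ℓ ω) τ ∂(B.mdp.trajRef H) ∂P := by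
  have h1 := hR.episode ℓ
  have h2 := B.measurable_polWeight B.s₁
  have h3 := B.measurable_likelihood B.s₁
  have h4 : Measurable fun x : ((Fin ℓ → Traj S A H) × B.Env × B.Env) × Traj S A H =>
      polWeight (B.optPol x.1.2.2) B.s₁ x.2 * likelihood (B.trans x.1.2.1) B.s₁ x.2 :=
    (h2.comp (f := fun x : ((Fin ℓ → Traj S A H) × B.Env × B.Env) × Traj S A H =>
      (x.1.2.2, x.2)) (by fun_prop)).mul
    (h3.comp (f := fun x : ((Fin ℓ → Traj S A H) × B.Env × B.Env) × Traj S A H =>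
      (x.1.2.1, x.2)) (by fun_prop))
  have hk : IsSFiniteKernel (B.stepKernel ℓ) := by
    by_contra hk
    have h5 := h1.map_eq
    rw [Measure.compProd_of_not_isSFiniteKernel _ _ hk] at h5
    have := congrArg (fun m => m univ) h5
    rw [Measure.map_apply_of_aemeasurable h1.aemeasurable MeasurableSet.univ] at this
    simp at this
  have e : ∀ x : (Fin ℓ → Traj S A H) × B.Env × B.Env,
      ∫⁻ τ, F x.1 x.2.1 x.2.2 τ ∂(B.stepKernel ℓ x)
      = ∫⁻ τ, polWeight (B.optPol x.2.2) B.s₁ τ * likelihood (B.trans x.2.1) B.s₁ τ *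
        F x.1 x.2.1 x.2.2 τ ∂(B.mdp.trajRef H) := by
    intro x
    have e1 : B.stepKernel ℓ x = B.trajLaw x.2.1 (B.star x.2.2) 0 B.s₁ := rfl
    have m1 : Measurable fun τ => polWeight (B.optPol x.2.2) B.s₁ τ *
      likelihood (B.trans x.2.1) B.s₁ τ := h4.comp (f := fun τ => (x, τ)) (by fun_prop)
    have m2 : Measurable fun τ => F x.1 x.2.1 x.2.2 τ :=
      hF.comp (f := fun τ => (x, τ)) (by fun_prop)
    rw [e1, trajLaw_star, lintegral_withDensity_eq_lintegral_mul _ m1 m2]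
    rfl
  calc _ = ∫⁻ y, F y.1.1 y.1.2.1 y.1.2.2 y.2
          ∂(P.map fun ω => ((hist epi ℓ ω, env ω, smp ℓ ω), epi ℓ ω)) :=
        (lintegral_map' hF.aemeasurable h1.aemeasurable).symm
    _ = ∫⁻ x, ∫⁻ τ, F x.1 x.2.1 x.2.2 τ ∂(B.stepKernel ℓ x)
          ∂(P.map fun ω => (hist epi ℓ ω, env ω, smp ℓ ω)) := by
        have : IsProbabilityMeasure (P.map fun ω => (hist epi ℓ ω, env ω, smp ℓ ω)) :=
          Measure.isProbabilityMeasure_map h1.aemeasurable_fst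
        rw [h1.map_eq, Measure.lintegral_compProd hF]
    _ = ∫⁻ ω, ∫⁻ τ, F (hist epi ℓ ω) (env ω) (smp ℓ ω) τ
          ∂(B.stepKernel ℓ (hist epi ℓ ω, env ω, smp ℓ ω)) ∂P :=
        lintegral_map' hF.lintegral_kernel_prod_right'.aemeasurable h1.aemeasurable_fst
    _ = _ := lintegral_congr fun ω => e (hist epi ℓ ω, env ω, smp ℓ ω)

/-- The joint law of the history, the next episode and the environment. -/
lemma IsTSRun.lintegral_hist_epi_env (ℓ : ℕ)
    {G : (Fin ℓ → Traj S A H) → Traj S A H → B.Env → ENNReal}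
    (hG : Measurable fun x : (Fin ℓ → Traj S A H) × Traj S A H × B.Env => G x.1 x.2.1 x.2.2) :
    ∫⁻ ω, G (hist epi ℓ ω) (epi ℓ ω) (env ω) ∂P
      = ∫⁻ ω, ∫⁻ τ, B.avgPol (hR.posterior ℓ (hist epi ℓ ω)) τ *
        ∫⁻ E, likelihood (B.trans E) B.s₁ τ * G (hist epi ℓ ω) τ E
          ∂(hR.posterior ℓ (hist epi ℓ ω)) ∂(B.mdp.trajRef H) ∂P := by
  have h2 := B.measurable_polWeight B.s₁
  have h3 := B.measurable_likelihood B.s₁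
  rw [hR.lintegral_episode ℓ (F := fun x E _ τ => G x τ E) (hG.comp
    (f := fun x : ((Fin ℓ → Traj S A H) × B.Env × B.Env) × Traj S A H => (x.1.1, x.2, x.1.2.1)) (by fun_prop))]
  have h5 : Measurable fun x : ((Fin ℓ → Traj S A H) × B.Env × B.Env) × Traj S A H =>
      polWeight (B.optPol x.1.2.2) B.s₁ x.2 * likelihood (B.trans x.1.2.1) B.s₁ x.2 *
        G x.1.1 x.2 x.1.2.1 :=
    ((h2.comp (f := fun x : ((Fin ℓ → Traj S A H) × B.Env × B.Env) × Traj S A H => (x.1.2.2, x.2))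
      (by fun_prop)).mul
    (h3.comp (f := fun x : ((Fin ℓ → Traj S A H) × B.Env × B.Env) × Traj S A H => (x.1.2.1, x.2)) (by fun_prop))).mul
    (hG.comp (f := fun x : ((Fin ℓ → Traj S A H) × B.Env × B.Env) × Traj S A H => (x.1.1, x.2, x.1.2.1))
      (by fun_prop))
  rw [hR.lintegral_sample ℓ (F := fun x E E' => ∫⁻ τ, polWeight (B.optPol E') B.s₁ τ *
    likelihood (B.trans E) B.s₁ τ * G x τ E ∂(B.mdp.trajRef H)) h5.lintegral_prod_right']
  refine lintegral_congr fun ω => ?_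
  set x := hist epi ℓ ω
  set q := hR.posterior ℓ x
  rw [lintegral_lintegral_lintegral_comm (h5.comp
    (f := fun y : Traj S A H × B.Env × B.Env => ((x, y.2.1, y.2.2), y.1)) (by fun_prop))]
  refine lintegral_congr fun τ => ?_
  have m1 : Measurable fun E => likelihood (B.trans E) B.s₁ τ * G x τ E :=
    (h3.comp (f := fun E => (E, τ)) (by fun_prop)).mul
      (hG.comp (f := fun E => (x, τ, E)) (by fun_prop))
  have m2 : Measurable fun E => polWeight (B.optPol E) B.s₁ τ :=
    h2.comp (f := fun E => (E, τ)) (by fun_prop)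
  unfold avgPol
  rw [← lintegral_const_mul _ m1]
  refine lintegral_congr fun E => ?_
  rw [← lintegral_mul_const _ m2]
  exact lintegral_congr fun E' => by ring

omit hR in
lemma lintegral_avgPol_mul_lintegral_likelihood (N N' : Measure B.Env) [IsProbabilityMeasure N]
    [IsProbabilityMeasure N'] :
    ∫⁻ τ, B.avgPol N τ * ∫⁻ E, likelihood (B.trans E) B.s₁ τ ∂N' ∂(B.mdp.trajRef H) = 1 := by
  have h1 := B.measurable_avgPol N
  have h3 := B.measurable_likelihood B.s₁
  have h4 : Measurable fun x : Traj S A H × B.Env =>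
      B.avgPol N x.1 * likelihood (B.trans x.2) B.s₁ x.1 :=
    (h1.comp measurable_fst).mul
      (h3.comp (f := fun x : Traj S A H × B.Env => (x.2, x.1)) (by fun_prop))
  calc _ = ∫⁻ τ, ∫⁻ E, B.avgPol N τ * likelihood (B.trans E) B.s₁ τ ∂N' ∂(B.mdp.trajRef H) :=
        lintegral_congr fun τ => (lintegral_const_mul _
          (h3.comp (f := fun E => (E, τ)) (by fun_prop))).symm
    _ = ∫⁻ E, ∫⁻ τ, B.avgPol N τ * likelihood (B.trans E) B.s₁ τ ∂(B.mdp.trajRef H) ∂N' :=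
        lintegral_lintegral_swap h4.aemeasurable
    _ = 1 := by
        simp only [B.lintegral_avgPol_mul_likelihood N (B.isTrans_trans _), lintegral_one,
          measure_univ]

/-- Adding an episode to a history. -/
def snocHist (ℓ : ℕ) (x : (Fin ℓ → Traj S A H) × Traj S A H) : Fin (ℓ + 1) → Traj S A H :=
  Fin.snoc (α := fun _ => Traj S A H) x.1 x.2

omit hR in
lemma measurable_snocHist (ℓ : ℕ) : Measurable (snocHist (S := S) (A := A) (H := H) ℓ) := by
  refine measurable_pi_lambda _ fun i => ?_
  refine Fin.lastCases ?_ (fun j => ?_) i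
  · simp only [snocHist, Fin.snoc_last]
    exact measurable_snd
  · simp only [snocHist, Fin.snoc_castSucc]
    fun_prop

omit hR in
lemma hist_succ (epi : ℕ → Ω → Traj S A H) (ℓ : ℕ) (ω : Ω) :
    hist epi (ℓ + 1) ω = snocHist ℓ (hist epi ℓ ω, epi ℓ ω) := by
  funext i
  refine Fin.lastCases ?_ (fun j => ?_) i
  · simp [snocHist, hist]
  · simp [snocHist, hist]

/-- The likelihood of an episode, relative to its mean under the posterior. -/
def IsTSRun.relLikelihood (ℓ : ℕ) (x : (Fin ℓ → Traj S A H) × Traj S A H) (E : B.Env) : ENNReal :=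
  likelihood (B.trans E) B.s₁ x.2
    * (∫⁻ E', likelihood (B.trans E') B.s₁ x.2 ∂(hR.posterior ℓ x.1))⁻¹

lemma IsTSRun.measurable_mean_likelihood (ℓ : ℕ) :
    Measurable fun x : (Fin ℓ → Traj S A H) × Traj S A H =>
      ∫⁻ E', likelihood (B.trans E') B.s₁ x.2 ∂(hR.posterior ℓ x.1) := by
  have h3 := B.measurable_likelihood B.s₁
  exact Measurable.lintegral_kernel_prod_right'
    (κ := (hR.posterior ℓ).comap (Prod.fst : (Fin ℓ → Traj S A H) × Traj S A H → _) measurable_fst)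
    (f := fun y : ((Fin ℓ → Traj S A H) × Traj S A H) × B.Env =>
      likelihood (B.trans y.2) B.s₁ y.1.2)
    (h3.comp (f := fun y : ((Fin ℓ → Traj S A H) × Traj S A H) × B.Env => (y.2, y.1.2))
      (by fun_prop))

lemma IsTSRun.measurable_relLikelihood (ℓ : ℕ) :
    Measurable (Function.uncurry (hR.relLikelihood ℓ)) := by
  have h3 := B.measurable_likelihood B.s₁
  have h4 := hR.measurable_mean_likelihood ℓ
  unfold relLikelihood Function.uncurry
  exact (h3.comp (f := fun y : ((Fin ℓ → Traj S A H) × Traj S A H) × B.Env => (y.2, y.1.2))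
    (by fun_prop)).mul (h4.inv.comp measurable_fst)

/-- Bayes' rule for the update of the posterior. -/
lemma IsTSRun.posterior_succ [MeasurableSpace.CountablyGenerated B.Env] (ℓ : ℕ) :
    ∀ᵐ ω ∂P, hR.posterior (ℓ + 1) (hist epi (ℓ + 1) ω)
      = (hR.posterior ℓ (hist epi ℓ ω)).withDensity
        (hR.relLikelihood ℓ (hist epi ℓ ω, epi ℓ ω)) := by
  have h3 := B.measurable_likelihood B.s₁
  set X := Fin ℓ → Traj S A H
  have hpair : AEMeasurable (fun ω => (hist epi ℓ ω, epi ℓ ω)) P :=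
    (hR.aemeasurable_hist ℓ).prodMk (hR.aemeasurable_epi ℓ)
  set ρ := P.map fun ω => (hist epi ℓ ω, epi ℓ ω) with hρ
  have hρp : IsProbabilityMeasure ρ := Measure.isProbabilityMeasure_map hpair
  set q := (hR.posterior ℓ).comap (Prod.fst : X × Traj S A H → X) measurable_fst with hq
  set κ := Kernel.withDensity q (hR.relLikelihood ℓ) with hκ
  have hrel := hR.measurable_relLikelihood ℓ
  have hκx : ∀ x, κ x = (hR.posterior ℓ x.1).withDensity (hR.relLikelihood ℓ x) := by
    intro x
    rw [hκ, Kernel.withDensity_apply _ hrel]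
    rfl
  have hκf : IsFiniteKernel κ := by
    refine ⟨⟨1, ENNReal.one_lt_top, fun x => ?_⟩⟩
    rw [hκx, withDensity_apply _ MeasurableSet.univ, Measure.restrict_univ]
    have m : Measurable fun E => likelihood (B.trans E) B.s₁ x.2 :=
      h3.comp (f := fun E => (E, x.2)) (by fun_prop)
    unfold relLikelihood
    rw [lintegral_mul_const _ m, ← div_eq_mul_inv]
    exact ENNReal.div_self_le_one
  set κ' := (hR.posterior (ℓ + 1)).comap (snocHist ℓ) (measurable_snocHist ℓ) with hκ'
  have heq : ρ ⊗ₘ κ = ρ ⊗ₘ κ' := by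
    refine Measure.ext_of_lintegral _ fun f hf => ?_
    rw [Measure.lintegral_compProd hf, Measure.lintegral_compProd hf,
      hρ, lintegral_map' hf.lintegral_kernel_prod_right'.aemeasurable hpair,
      lintegral_map' hf.lintegral_kernel_prod_right'.aemeasurable hpair]
    have e1 : ∫⁻ ω, ∫⁻ E, f ((hist epi ℓ ω, epi ℓ ω), E) ∂(κ' (hist epi ℓ ω, epi ℓ ω)) ∂P
        = ∫⁻ ω, f ((hist epi ℓ ω, epi ℓ ω), env ω) ∂P := by
      have := hR.lintegral_posterior (ℓ + 1) (F := fun x E =>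
        f ((fun i => x i.castSucc, x (Fin.last ℓ)), E)) (hf.comp (by fun_prop))
      simp only [hist_succ] at this
      refine Eq.trans ?_ (this.symm.trans ?_)
      · refine lintegral_congr fun ω => ?_
        rw [hκ']
        simp [snocHist]
      · simp [snocHist]
    rw [e1, hR.lintegral_hist_epi_env ℓ (G := fun x τ E => f ((x, τ), E))
      (hf.comp (f := fun x : X × Traj S A H × B.Env => ((x.1, x.2.1), x.2.2)) (by fun_prop))]
    have m1 : Measurable fun x : X × Traj S A H => ∫⁻ E, f (x, E) ∂(κ x) :=
      hf.lintegral_kernel_prod_right'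
    rw [hR.lintegral_hist_epi_env ℓ (G := fun x τ _ => ∫⁻ E, f ((x, τ), E) ∂(κ (x, τ)))
      (m1.comp (f := fun x : X × Traj S A H × B.Env => (x.1, x.2.1)) (by fun_prop))]
    refine lintegral_congr fun ω => ?_
    set x := hist epi ℓ ω
    refine lintegral_congr_ae ?_
    have hmL : Measurable fun τ => ∫⁻ E, likelihood (B.trans E) B.s₁ τ ∂(hR.posterior ℓ x) :=
      (hR.measurable_mean_likelihood ℓ).comp (f := fun τ => (x, τ)) (by fun_prop)
    filter_upwards [ae_ne_top_of_lintegral_eq_one ((B.measurable_avgPol _).mul hmL)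
      (lintegral_avgPol_mul_lintegral_likelihood (hR.posterior ℓ x) (hR.posterior ℓ x))] with τ hτ
    have mE : Measurable fun E => likelihood (B.trans E) B.s₁ τ :=
      h3.comp (f := fun E => (E, τ)) (by fun_prop)
    have mf : Measurable fun E => f ((x, τ), E) := hf.comp (by fun_prop)
    have mEf : Measurable fun E => likelihood (B.trans E) B.s₁ τ * f ((x, τ), E) := mE.mul mf
    have mr : Measurable (hR.relLikelihood ℓ (x, τ)) :=
      hrel.comp (f := fun E => ((x, τ), E)) (by fun_prop)
    rw [lintegral_mul_const _ mE, hκx, lintegral_withDensity_eq_lintegral_mul _ mr mf]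
    simp only [Pi.mul_apply, relLikelihood]
    set L := ∫⁻ E, likelihood (B.trans E) B.s₁ τ ∂(hR.posterior ℓ x) with hL
    rcases eq_or_ne (B.avgPol (hR.posterior ℓ x) τ) 0 with h0 | h0
    · simp [h0]
    have hLt : L ≠ ⊤ := fun h => hτ (by
      simp only [Pi.mul_apply, ← hL, h]
      exact ENNReal.mul_top h0)
    congr 1
    rcases eq_or_ne L 0 with hL0 | hL0
    · rw [hL0, zero_mul]
      have : (fun E => likelihood (B.trans E) B.s₁ τ) =ᵐ[hR.posterior ℓ x] 0 :=
        (lintegral_eq_zero_iff mE).1 hL0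
      symm
      rw [lintegral_eq_zero_iff mEf]
      filter_upwards [this] with E hE
      simp only [Pi.zero_apply] at hE
      simp [hE]
    · have mEf' : Measurable fun E => likelihood (B.trans E) B.s₁ τ * L⁻¹ * f ((x, τ), E) :=
        (mE.mul_const _).mul mf
      rw [← lintegral_const_mul _ mEf']
      refine lintegral_congr fun E => ?_
      calc _ = L * L⁻¹ * (likelihood (B.trans E) B.s₁ τ * f ((x, τ), E)) := by ring
        _ = _ := by rw [ENNReal.mul_inv_cancel hL0 hLt, one_mul]
  have hae : ∀ᵐ x ∂ρ, κ x = κ' x := Kernel.ae_eq_of_compProd_eq heq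
  filter_upwards [ae_of_ae_map hpair hae] with ω hω
  rw [hist_succ]
  exact (hω.symm.trans (hκx _))

end BayesRL

end

noncomputable section

lemma Real.sum_negMulLog_le_log_card {ι : Type*} [Fintype ι] {p : ι → ℝ} (hp : ∀ i, 0 ≤ p i)
    (hs : ∑ i, p i = 1) : ∑ i, Real.negMulLog (p i) ≤ Real.log (Fintype.card ι) := by
  have hne : Nonempty ι := by
    by_contra h
    rw [not_nonempty_iff] at h
    simp at hs
  have hK : (0 : ℝ) < Fintype.card ι := by exact_mod_cast Fintype.card_pos
  have h1 : ∀ i, Real.negMulLog (p i)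
      ≤ p i * Real.log (Fintype.card ι) + (1 / Fintype.card ι - p i) := by
    intro i
    rcases (hp i).eq_or_lt with h0 | h0
    · simp [← h0]
    · have h2 := Real.log_le_sub_one_of_pos (x := 1 / (p i * Fintype.card ι)) (by positivity)
      rw [one_div, Real.log_inv, Real.log_mul h0.ne' hK.ne'] at h2
      have h3 := mul_le_mul_of_nonneg_left h2 h0.le
      have h4 : p i * ((p i * Fintype.card ι)⁻¹ - 1) = 1 / Fintype.card ι - p i := by
        field_simp
      rw [h4] at h3
      rw [Real.negMulLog]
      linarith
  calc _ ≤ ∑ i, (p i * Real.log (Fintype.card ι) + (1 / Fintype.card ι - p i)) :=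
        Finset.sum_le_sum fun i _ => h1 i
    _ = _ := by
        rw [Finset.sum_add_distrib, ← Finset.sum_mul, hs, Finset.sum_sub_distrib, hs]
        simp [hK.ne']

lemma sum_lintegral_le_lintegral_sum {α ι : Type*} [MeasurableSpace α] {μ : Measure α}
    (s : Finset ι) (f : ι → α → ENNReal) :
    ∑ i ∈ s, ∫⁻ x, f i x ∂μ ≤ ∫⁻ x, ∑ i ∈ s, f i x ∂μ := by
  classical
  induction s using Finset.induction_on with
  | empty => simp
  | insert i s hi ih =>
    simp only [Finset.sum_insert hi]
    exact (add_le_add le_rfl ih).trans (le_lintegral_add _ _)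

namespace BayesRL

open MDPBase

variable {S A : Type*} [MeasurableSpace S] [MeasurableSpace A] {H : ℕ} [NeZero H]
  {TP TR : Fin H → Type*} [∀ h, MeasurableSpace (TP h)] [∀ h, MeasurableSpace (TR h)]
  {B : BayesRL S A H TP TR}

/-- A measure with a product density with respect to the prior. -/
def IsTilt (B : BayesRL S A H TP TR) (N : Measure B.Env) : Prop :=
  ∃ (c : ENNReal) (f : ∀ h, TP h × TR h → ENNReal), (∀ h, Measurable (f h)) ∧
    N = c • B.prior.withDensity fun E => ∏ h, f h (E h)

lemma isTilt_prior : B.IsTilt B.prior :=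
  ⟨1, fun _ _ => 1, fun _ => measurable_const, by simp⟩

lemma IsTilt.withDensity_likelihood {N : Measure B.Env} (hN : B.IsTilt N) (s : S)
    (τ : Traj S A H) (c : ENNReal) :
    B.IsTilt (N.withDensity fun E => likelihood (B.trans E) s τ * c) := by
  obtain ⟨c', f, hf, rfl⟩ := hN
  set g : ∀ h, TP h × TR h → ENNReal := fun h e =>
    ENNReal.ofReal (B.r h e.2 (stateFrom 0 s τ h) (τ h).1 (τ h).2.1)
      * ENNReal.ofReal (B.p h e.1 (stateFrom 0 s τ h) (τ h).1 (τ h).2.2) with hg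
  have hgm : ∀ h, Measurable (g h) := by
    intro h
    refine Measurable.mul (M := ENNReal) ?_ ?_
    · exact ENNReal.measurable_ofReal.comp ((B.r_measurable h).comp
        (f := fun e : TP h × TR h => (e.2, stateFrom 0 s τ h, (τ h).1, (τ h).2.1)) (by fun_prop))
    · exact ENNReal.measurable_ofReal.comp ((B.p_measurable h).comp
        (f := fun e : TP h × TR h => (e.1, stateFrom 0 s τ h, (τ h).1, (τ h).2.2)) (by fun_prop))
  refine ⟨c * c', fun h e => f h e * g h e, fun h => (hf h).mul (hgm h), ?_⟩
  have hlik : Measurable fun E : B.Env => ∏ h, g h (E h) :=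
    Finset.measurable_prod _ fun h _ => (hgm h).comp (measurable_pi_apply h)
  have hfp : Measurable fun E : B.Env => ∏ h, f h (E h) :=
    Finset.measurable_prod _ fun h _ => (hf h).comp (measurable_pi_apply h)
  have e : (fun E => likelihood (B.trans E) s τ * c) = c • fun E : B.Env => ∏ h, g h (E h) := by
    funext E
    simp only [Pi.smul_apply, smul_eq_mul]
    rw [mul_comm]
    congr 1
    unfold likelihood
    refine Finset.prod_congr rfl fun h _ => ?_
    simp [trans, hg]
  have e2 : (fun E : B.Env => ∏ h, (f h (E h) * g h (E h)))
      = (fun E : B.Env => ∏ h, f h (E h)) * fun E : B.Env => ∏ h, g h (E h) := by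
    funext E
    simp only [Pi.mul_apply, Finset.prod_mul_distrib]
  rw [e, withDensity_smul _ hlik, withDensity_smul_measure, e2, withDensity_mul _ hfp hlik,
    smul_smul]

lemma IsTilt.absolutelyContinuous {N : Measure B.Env} (hN : B.IsTilt N) : N ≪ B.prior := by
  obtain ⟨c, f, -, rfl⟩ := hN
  exact (Measure.smul_absolutelyContinuous).trans (withDensity_absolutelyContinuous _ _)

lemma IsTilt.iIndepFun {N : Measure B.Env} [IsProbabilityMeasure N] (hN : B.IsTilt N) :
    iIndepFun (fun h (E : B.Env) => E h) N := by
  obtain ⟨c, f, hf, rfl⟩ := hN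
  exact iIndepFun_smul_withDensity_prod B.iIndepFun_prior hf inferInstance

lemma IsTilt.iIndepFun_cond {N : Measure B.Env} [IsProbabilityMeasure N] (hN : B.IsTilt N)
    {C : Set B.Env} (hC : MeasurableSet C)
    (hprior : B.prior C ≠ 0 → ProbabilityTheory.iIndepFun (fun h (E : B.Env) => E h)
      (ProbabilityTheory.cond B.prior C)) (hNC : N C ≠ 0) :
    ProbabilityTheory.iIndepFun (fun h (E : B.Env) => E h) (ProbabilityTheory.cond N C) := by
  have h0 : B.prior C ≠ 0 := fun h => hNC (hN.absolutelyContinuous h)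
  have hp := cond_isProbabilityMeasure hNC
  have hp' := cond_isProbabilityMeasure h0
  obtain ⟨c, f, hf, rfl⟩ := hN
  set F : B.Env → ENNReal := fun E => ∏ h, f h (E h) with hF
  have e : ProbabilityTheory.cond (c • B.prior.withDensity F) C
      = (((c • B.prior.withDensity F) C)⁻¹ * c * B.prior C)
        • (ProbabilityTheory.cond B.prior C).withDensity F := by
    rw [ProbabilityTheory.cond, Measure.restrict_smul, restrict_withDensity hC,
      ← B.smul_cond h0, withDensity_smul_measure, smul_smul, smul_smul]
  rw [e] at hp ⊢
  exact iIndepFun_smul_withDensity_prod (hprior h0) hf hp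

variable {Ω : Type*} [MeasurableSpace Ω] {P : Measure Ω} [IsProbabilityMeasure P]
  {env : Ω → B.Env} {smp : ℕ → Ω → B.Env} {epi : ℕ → Ω → Traj S A H}
  (hR : B.IsTSRun P env smp epi)

lemma IsTSRun.posterior_zero (x : Fin 0 → Traj S A H) : hR.posterior 0 x = B.prior := by
  ext C hC
  have h1 := hR.lintegral_posterior 0 (F := fun _ E => C.indicator 1 E)
    ((measurable_one.indicator hC).comp measurable_snd)
  have h2 : ∀ ω, hist epi 0 ω = x := fun ω => Subsingleton.elim _ _
  simp only [h2, lintegral_const, measure_univ, mul_one, lintegral_indicator_one hC] at h1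
  rw [← h1, ← hR.env_law.map_eq, Measure.map_apply_of_aemeasurable hR.aemeasurable_env hC]
  rw [← lintegral_map' (f := C.indicator (1 : B.Env → ENNReal)) (g := env)
    (measurable_one.indicator hC).aemeasurable hR.aemeasurable_env, lintegral_indicator_one hC,
    Measure.map_apply_of_aemeasurable hR.aemeasurable_env hC]

lemma IsTSRun.isTilt_posterior [MeasurableSpace.CountablyGenerated B.Env] (ℓ : ℕ) :
    ∀ᵐ ω ∂P, B.IsTilt (hR.posterior ℓ (hist epi ℓ ω)) := by
  induction ℓ with
  | zero =>
    refine Eventually.of_forall fun ω => ?_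
    rw [hR.posterior_zero]
    exact isTilt_prior
  | succ ℓ ih =>
    filter_upwards [ih, hR.posterior_succ ℓ] with ω h1 h2
    rw [h2]
    exact h1.withDensity_likelihood _ _ _

lemma IsTSRun.lintegral_postEntropy [MeasurableSpace.CountablyGenerated B.Env] (ℓ : ℕ)
    {C : Set B.Env} (hC : MeasurableSet C) :
    ∫⁻ ω, B.postEntropy (hR.posterior ℓ (hist epi ℓ ω)) C ∂P
      = ∫⁻ ω, ENNReal.ofReal (Real.negMulLog
        (hR.posterior (ℓ + 1) (hist epi (ℓ + 1) ω) C).toReal) ∂P := by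
  have h3 := B.measurable_likelihood B.s₁
  have m1 := hR.measurable_mean_likelihood ℓ
  have hl : ∀ τ, Measurable fun E => likelihood (B.trans E) B.s₁ τ := fun τ =>
    h3.comp (f := fun E => (E, τ)) (by fun_prop)
  have m2 : Measurable fun x : (Fin ℓ → Traj S A H) × Traj S A H =>
      ∫⁻ E in C, likelihood (B.trans E) B.s₁ x.2 ∂(hR.posterior ℓ x.1) := by
    have e0 : ∀ x : (Fin ℓ → Traj S A H) × Traj S A H,
        ∫⁻ E in C, likelihood (B.trans E) B.s₁ x.2 ∂(hR.posterior ℓ x.1)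
        = ∫⁻ E, C.indicator (fun E => likelihood (B.trans E) B.s₁ x.2) E ∂(hR.posterior ℓ x.1) :=
      fun x => (lintegral_indicator hC _).symm
    rw [funext e0]
    refine Measurable.lintegral_kernel_prod_right'
      (κ := (hR.posterior ℓ).comap (Prod.fst : (Fin ℓ → Traj S A H) × Traj S A H → _)
        measurable_fst)
      (f := fun y : ((Fin ℓ → Traj S A H) × Traj S A H) × B.Env =>
        C.indicator (fun E => likelihood (B.trans E) B.s₁ y.1.2) y.2) ?_
    have e : (fun y : ((Fin ℓ → Traj S A H) × Traj S A H) × B.Env =>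
        C.indicator (fun E => likelihood (B.trans E) B.s₁ y.1.2) y.2)
        = (Prod.snd ⁻¹' C).indicator fun y : ((Fin ℓ → Traj S A H) × Traj S A H) × B.Env =>
          likelihood (B.trans y.2) B.s₁ y.1.2 := by
      funext y
      rfl
    rw [e]
    exact (h3.comp (f := fun y : ((Fin ℓ → Traj S A H) × Traj S A H) × B.Env => (y.2, y.1.2))
      (by fun_prop)).indicator (measurable_snd hC)
  have m3 : Measurable fun x : (Fin ℓ → Traj S A H) × Traj S A H =>
      ENNReal.ofReal (Real.negMulLog
        ((∫⁻ E in C, likelihood (B.trans E) B.s₁ x.2 ∂(hR.posterior ℓ x.1)) /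
          ∫⁻ E, likelihood (B.trans E) B.s₁ x.2 ∂(hR.posterior ℓ x.1)).toReal) :=
    ENNReal.measurable_ofReal.comp
      (Real.continuous_negMulLog.measurable.comp (m2.div m1).ennreal_toReal)
  have h4 := hR.lintegral_hist_epi_env ℓ (G := fun x τ _ => ENNReal.ofReal (Real.negMulLog
        ((∫⁻ E in C, likelihood (B.trans E) B.s₁ τ ∂(hR.posterior ℓ x)) /
          ∫⁻ E, likelihood (B.trans E) B.s₁ τ ∂(hR.posterior ℓ x)).toReal))
    (m3.comp (f := fun x : (Fin ℓ → Traj S A H) × Traj S A H × B.Env => (x.1, x.2.1)) (by fun_prop))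
  refine Eq.trans ?_ (h4.symm.trans ?_)
  · refine lintegral_congr fun ω => ?_
    unfold postEntropy
    refine lintegral_congr fun τ => ?_
    rw [lintegral_mul_const _ (hl τ), mul_assoc]
  · refine lintegral_congr_ae ?_
    filter_upwards [hR.posterior_succ ℓ] with ω hω
    rw [hω, withDensity_apply _ hC]
    unfold relLikelihood
    rw [lintegral_mul_const _ (hl _), div_eq_mul_inv]

lemma postEntropy_le {N : Measure B.Env} [IsProbabilityMeasure N] (hN : B.IsTilt N)
    {C : Set B.Env} (hC : MeasurableSet C)
    (hprior : B.prior C ≠ 0 → iIndepFun (fun h (E : B.Env) => E h)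
      (ProbabilityTheory.cond B.prior C)) :
    B.postEntropy N C ≤ ENNReal.ofReal (Real.negMulLog (N C).toReal) := by
  by_cases h0 : N C = 0
  · have : ∀ f : B.Env → ENNReal, ∫⁻ E in C, f E ∂N = 0 := fun f =>
      setLIntegral_measure_zero _ _ h0
    unfold postEntropy
    simp [this]
  · exact le_self_add.trans
      (B.postEntropy_add_traj hN.iIndepFun h0 (hN.iIndepFun_cond hC hprior h0))

variable {ε : ℝ} {K : ℕ} {ζ : B.Env → Fin K}

/-- The total information gained about the cell of the true environment is at most its entropy. -/
lemma IsTSRun.sum_infoGain_le [MeasurableSpace.CountablyGenerated B.Env]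
    (hζ : B.IsLayeredPartition ε K ζ) (L : ℕ) :
    ∑ ℓ ∈ Finset.range L, ∫⁻ ω, ∑ k, B.infoGain (hR.posterior ℓ (hist epi ℓ ω)) (ζ ⁻¹' {k}) ∂P
      ≤ ENNReal.ofReal (Real.log K) := by
  have hC : ∀ k, MeasurableSet (ζ ⁻¹' {k}) := fun k => hζ.measurable (measurableSet_singleton k)
  set e : ℕ → Fin K → Ω → ENNReal := fun ℓ k ω => ENNReal.ofReal (Real.negMulLog
    (hR.posterior ℓ (hist epi ℓ ω) (ζ ⁻¹' {k})).toReal) with he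
  have hem : ∀ ℓ k, AEMeasurable (e ℓ k) P := by
    intro ℓ k
    exact (ENNReal.measurable_ofReal.comp (Real.continuous_negMulLog.measurable.comp
      ((hR.posterior ℓ).measurable_coe (hC k)).ennreal_toReal)).comp_aemeasurable
      (hR.aemeasurable_hist ℓ)
  have hstep : ∀ ℓ, ∫⁻ ω, ∑ k, B.infoGain (hR.posterior ℓ (hist epi ℓ ω)) (ζ ⁻¹' {k}) ∂P
      + ∫⁻ ω, ∑ k, e (ℓ + 1) k ω ∂P ≤ ∫⁻ ω, ∑ k, e ℓ k ω ∂P := by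
    intro ℓ
    rw [lintegral_finsetSum' _ fun k _ => hem (ℓ + 1) k]
    simp only [he]
    rw [← Finset.sum_congr rfl fun k _ => hR.lintegral_postEntropy ℓ (hC k)]
    refine (add_le_add le_rfl (sum_lintegral_le_lintegral_sum _ _)).trans
      ((le_lintegral_add _ _).trans (lintegral_mono_ae ?_))
    filter_upwards [hR.isTilt_posterior ℓ] with ω hω
    rw [← Finset.sum_add_distrib]
    refine Finset.sum_le_sum fun k _ => ?_
    unfold infoGain
    rw [tsub_add_cancel_of_le (postEntropy_le hω (hC k) (hζ.layered k))]
  have htel : ∀ L, ∑ ℓ ∈ Finset.range L,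
      ∫⁻ ω, ∑ k, B.infoGain (hR.posterior ℓ (hist epi ℓ ω)) (ζ ⁻¹' {k}) ∂P
      + ∫⁻ ω, ∑ k, e L k ω ∂P ≤ ∫⁻ ω, ∑ k, e 0 k ω ∂P := by
    intro L
    induction L with
    | zero => simp
    | succ L ih =>
      rw [Finset.sum_range_succ, add_assoc]
      exact (add_le_add le_rfl (hstep L)).trans ih
  refine (le_self_add.trans (htel L)).trans ?_
  have h0 : ∀ ω, ∑ k, e 0 k ω ≤ ENNReal.ofReal (Real.log K) := by
    intro ω
    simp only [he, hR.posterior_zero]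
    have hp : ∀ k, 0 ≤ (B.prior (ζ ⁻¹' {k})).toReal := fun k => ENNReal.toReal_nonneg
    have hp1 : ∀ k, (B.prior (ζ ⁻¹' {k})).toReal ≤ 1 := fun k =>
      ENNReal.toReal_le_of_le_ofReal zero_le_one (by simpa using prob_le_one)
    rw [← ENNReal.ofReal_sum_of_nonneg fun k _ => Real.negMulLog_nonneg (hp k) (hp1 k)]
    refine ENNReal.ofReal_le_ofReal ?_
    have hs : ∑ k, (B.prior (ζ ⁻¹' {k})).toReal = 1 := by
      rw [← ENNReal.toReal_sum fun k _ => measure_ne_top _ _, ← tsum_fintype (L := .unconditional _),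
        ← measure_iUnion _ hC, ← preimage_iUnion, iUnion_of_singleton, preimage_univ, measure_univ,
        ENNReal.toReal_one]
      intro i j hij
      exact Disjoint.preimage _ (by simpa using hij)
    simpa using Real.sum_negMulLog_le_log_card hp hs
  calc _ ≤ ∫⁻ _, ENNReal.ofReal (Real.log K) ∂P := lintegral_mono h0
    _ = _ := by simp

end BayesRL

end

noncomputable section

lemma absDiff_eq_enorm {a b : ENNReal} (ha : a ≠ ⊤) (hb : b ≠ ⊤) :
    absDiff a b = ‖a.toReal - b.toReal‖ₑ := by
  rw [Real.enorm_eq_ofReal_abs]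
  rcases le_total a b with h | h
  · have h' : a.toReal ≤ b.toReal := ENNReal.toReal_mono hb h
    rw [absDiff, tsub_eq_zero_of_le h, zero_add, abs_of_nonpos (by linarith), neg_sub,
      ENNReal.ofReal_sub _ ENNReal.toReal_nonneg, ENNReal.ofReal_toReal ha, ENNReal.ofReal_toReal hb]
  · have h' : b.toReal ≤ a.toReal := ENNReal.toReal_mono ha h
    rw [absDiff, tsub_eq_zero_of_le h, add_zero, abs_of_nonneg (by linarith),
      ENNReal.ofReal_sub _ ENNReal.toReal_nonneg, ENNReal.ofReal_toReal ha, ENNReal.ofReal_toReal hb]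

section Coupling

variable {X : Type*} [MeasurableSpace X] [TopologicalSpace X] [BorelSpace X]
  [TopologicalSpace.MetrizableSpace X] [SecondCountableTopology X] {μ : Measure X}
  [IsProbabilityMeasure μ] {m : ℕ → Measure (X × X)} [∀ n, IsProbabilityMeasure (m n)]

/-- If the two coordinates approach each other with respect to bounded continuous functions, then
also with respect to integrable functions. -/
lemma tendsto_lintegral_absDiff_coupling (h1 : ∀ n, (m n).map Prod.fst = μ)
    (h2 : ∀ n, (m n).map Prod.snd = μ)
    (hφ : ∀ φ : BoundedContinuousFunction X ℝ,
      Tendsto (fun n => ∫⁻ x, ‖φ x.1 - φ x.2‖ₑ ∂(m n)) atTop (𝓝 0))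
    {f : X → ENNReal} (hf : Measurable f) (hfi : ∫⁻ x, f x ∂μ ≠ ⊤) :
    Tendsto (fun n => ∫⁻ x, absDiff (f x.1) (f x.2) ∂(m n)) atTop (𝓝 0) := by
  have hg : Integrable (fun x => (f x).toReal) μ :=
    integrable_toReal_of_lintegral_ne_top hf.aemeasurable hfi
  rw [ENNReal.tendsto_nhds_zero]
  intro ε hε
  have hη : ε / 4 ≠ 0 := (ENNReal.div_pos hε.ne' (by simp)).ne'
  obtain ⟨φ, hφ1, -⟩ := hg.exists_boundedContinuous_lintegral_sub_le hη
  filter_upwards [ENNReal.tendsto_nhds_zero.1 (hφ φ) (ε / 4) (ENNReal.div_pos hε.ne' (by simp))]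
    with n hn
  have hmd : Measurable fun x => ‖(f x).toReal - φ x‖ₑ :=
    (hf.ennreal_toReal.sub φ.continuous.measurable).enorm
  have hmφ : Measurable fun x : X × X => ‖φ x.1 - φ x.2‖ₑ :=
    ((φ.continuous.measurable.comp measurable_fst).sub
      (φ.continuous.measurable.comp measurable_snd)).enorm
  have hfin : ∀ᵐ x ∂μ, f x < ⊤ := ae_lt_top hf hfi
  have hf1 : ∀ᵐ x ∂(m n), f x.1 < ⊤ :=
    ae_of_ae_map measurable_fst.aemeasurable (by rw [h1 n]; exact hfin)
  have hf2 : ∀ᵐ x ∂(m n), f x.2 < ⊤ :=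
    ae_of_ae_map measurable_snd.aemeasurable (by rw [h2 n]; exact hfin)
  have e1 : ∫⁻ x, ‖(f x.1).toReal - φ x.1‖ₑ ∂(m n) ≤ ε / 4 := by
    rw [← h1 n, lintegral_map hmd measurable_fst] at hφ1
    exact hφ1
  have e2 : ∫⁻ x, ‖(f x.2).toReal - φ x.2‖ₑ ∂(m n) ≤ ε / 4 := by
    rw [← h2 n, lintegral_map hmd measurable_snd] at hφ1
    exact hφ1
  calc _ ≤ ∫⁻ x, (‖(f x.1).toReal - φ x.1‖ₑ + ‖φ x.1 - φ x.2‖ₑ + ‖(f x.2).toReal - φ x.2‖ₑ)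
          ∂(m n) := by
        refine lintegral_mono_ae ?_
        filter_upwards [hf1, hf2] with x hx1 hx2
        rw [absDiff_eq_enorm hx1.ne hx2.ne]
        have : (f x.1).toReal - (f x.2).toReal = ((f x.1).toReal - φ x.1) + (φ x.1 - φ x.2)
          - ((f x.2).toReal - φ x.2) := by ring
        rw [this]
        exact (enorm_sub_le).trans (add_le_add (enorm_add_le _ _) le_rfl)
    _ = ∫⁻ x, ‖(f x.1).toReal - φ x.1‖ₑ ∂(m n) + ∫⁻ x, ‖φ x.1 - φ x.2‖ₑ ∂(m n)
          + ∫⁻ x, ‖(f x.2).toReal - φ x.2‖ₑ ∂(m n) := by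
        have hmd1 : Measurable fun x : X × X => ‖(f x.1).toReal - φ x.1‖ₑ :=
          hmd.comp measurable_fst
        rw [lintegral_add_left (f := fun x : X × X => ‖(f x.1).toReal - φ x.1‖ₑ + ‖φ x.1 - φ x.2‖ₑ)
          (hmd1.add hmφ), lintegral_add_left hmd1]
    _ ≤ ε / 4 + ε / 4 + ε / 4 := by gcongr
    _ ≤ ε / 4 * 4 := by
        rw [show (4 : ENNReal) = 1 + 1 + 1 + 1 by norm_num, mul_add, mul_add, mul_add, mul_one]
        exact le_self_add
    _ = ε := ENNReal.div_mul_cancel (by simp) (by simp)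

lemma tendsto_lintegral_lintegral_absDiff_coupling {Y : Type*} [MeasurableSpace Y] {ν : Measure Y}
    [SFinite ν] (h1 : ∀ n, (m n).map Prod.fst = μ) (h2 : ∀ n, (m n).map Prod.snd = μ)
    (hφ : ∀ φ : BoundedContinuousFunction X ℝ,
      Tendsto (fun n => ∫⁻ x, ‖φ x.1 - φ x.2‖ₑ ∂(m n)) atTop (𝓝 0))
    {f : X → Y → ENNReal} (hf : Measurable fun z : X × Y => f z.1 z.2)
    (hfi : ∫⁻ x, ∫⁻ y, f x y ∂ν ∂μ ≠ ⊤) :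
    Tendsto (fun n => ∫⁻ x, ∫⁻ y, absDiff (f x.1 y) (f x.2 y) ∂ν ∂(m n)) atTop (𝓝 0) := by
  rw [lintegral_lintegral_swap hf.aemeasurable] at hfi
  have hm : Measurable fun z : (X × X) × Y => absDiff (f z.1.1 z.2) (f z.1.2 z.2) :=
    (hf.comp (f := fun z : (X × X) × Y => (z.1.1, z.2)) (by fun_prop)).absDiff
      (hf.comp (f := fun z : (X × X) × Y => (z.1.2, z.2)) (by fun_prop))
  have hf1 : Measurable fun y => ∫⁻ x, f x y ∂μ := hf.lintegral_prod_left'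
  have e : ∀ n, ∫⁻ x, ∫⁻ y, absDiff (f x.1 y) (f x.2 y) ∂ν ∂(m n)
      = ∫⁻ y, ∫⁻ x, absDiff (f x.1 y) (f x.2 y) ∂(m n) ∂ν := fun n =>
    lintegral_lintegral_swap hm.aemeasurable
  have hfy : ∀ y, Measurable fun x => f x y := fun y =>
    hf.comp (f := fun x => (x, y)) (by fun_prop)
  simp only [e]
  have := tendsto_lintegral_of_dominated_convergence (μ := ν)
    (F := fun n y => ∫⁻ x, absDiff (f x.1 y) (f x.2 y) ∂(m n)) (f := fun _ => 0)
    (fun y => ∫⁻ x, f x y ∂μ + ∫⁻ x, f x y ∂μ) (fun n => hm.lintegral_prod_left')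
    (fun n => Eventually.of_forall fun y => ?_) ?_ ?_
  · simpa using this
  · dsimp only
    calc _ ≤ ∫⁻ x, (f x.1 y + f x.2 y) ∂(m n) := lintegral_mono fun x => absDiff_le_add _ _
      _ = ∫⁻ x, f x.1 y ∂(m n) + ∫⁻ x, f x.2 y ∂(m n) :=
        lintegral_add_left ((hfy y).comp measurable_fst) _
      _ = _ := by
        have e1 : ∫⁻ x, f x.1 y ∂(m n) = ∫⁻ x, f x y ∂μ := by
          rw [← h1 n, lintegral_map (hfy y) measurable_fst]
        have e2 : ∫⁻ x, f x.2 y ∂(m n) = ∫⁻ x, f x y ∂μ := by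
          rw [← h2 n, lintegral_map (hfy y) measurable_snd]
        rw [e1, e2]
  · rw [lintegral_add_left hf1]
    exact ENNReal.add_ne_top.2 ⟨hfi, hfi⟩
  · filter_upwards [ae_lt_top hf1 hfi] with y hy
    exact tendsto_lintegral_absDiff_coupling h1 h2 hφ (hfy y) hy.ne

end Coupling

namespace BayesRL

open MDPBase

variable {S A : Type*} [MeasurableSpace S] [MeasurableSpace A] {H : ℕ} [NeZero H]
  {TP TR : Fin H → Type*}
  [∀ h, MeasurableSpace (TP h)] [∀ h, TopologicalSpace (TP h)] [∀ h, BorelSpace (TP h)]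
  [∀ h, TopologicalSpace.MetrizableSpace (TP h)] [∀ h, SecondCountableTopology (TP h)]
  [∀ h, MeasurableSpace (TR h)] [∀ h, TopologicalSpace (TR h)] [∀ h, BorelSpace (TR h)]
  [∀ h, TopologicalSpace.MetrizableSpace (TR h)] [∀ h, SecondCountableTopology (TR h)]
  {B : BayesRL S A H TP TR}
  {Ω : Type*} [MeasurableSpace Ω] {P : Measure Ω} [IsProbabilityMeasure P]
  {env : Ω → B.Env} {smp : ℕ → Ω → B.Env} {epi : ℕ → Ω → Traj S A H}
  (hR : B.IsTSRun P env smp epi)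

/-- The joint law of the sampled and the true environment. -/
def pairLaw (P : Measure Ω) (env : Ω → B.Env) (smp : ℕ → Ω → B.Env) (ℓ : ℕ) :
    Measure (B.Env × B.Env) := P.map fun ω => (smp ℓ ω, env ω)

include hR

lemma IsTSRun.aemeasurable_pair (ℓ : ℕ) : AEMeasurable (fun ω => (smp ℓ ω, env ω)) P :=
  (hR.aemeasurable_smp ℓ).prodMk hR.aemeasurable_env

lemma IsTSRun.lintegral_pairLaw (ℓ : ℕ) {F : B.Env × B.Env → ENNReal} (hF : Measurable F) :
    ∫⁻ x, F x ∂(B.pairLaw P env smp ℓ) = ∫⁻ ω, F (smp ℓ ω, env ω) ∂P :=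
  lintegral_map' hF.aemeasurable (hR.aemeasurable_pair ℓ)

lemma IsTSRun.lintegral_hist_smp (ℓ : ℕ) {F : (Fin ℓ → Traj S A H) → B.Env → ENNReal}
    (hF : Measurable fun x : (Fin ℓ → Traj S A H) × B.Env => F x.1 x.2) :
    ∫⁻ ω, F (hist epi ℓ ω) (smp ℓ ω) ∂P = ∫⁻ ω, F (hist epi ℓ ω) (env ω) ∂P := by
  rw [hR.lintegral_posterior ℓ hF, hR.lintegral_sample ℓ (F := fun x _ E => F x E)
    (hF.comp (f := fun x : (Fin ℓ → Traj S A H) × B.Env × B.Env => (x.1, x.2.2)) (by fun_prop))]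
  simp

lemma IsTSRun.map_snd_pairLaw (ℓ : ℕ) : (B.pairLaw P env smp ℓ).map Prod.snd = B.prior := by
  rw [pairLaw, AEMeasurable.map_map_of_aemeasurable measurable_snd.aemeasurable
    (hR.aemeasurable_pair ℓ), ← hR.env_law.map_eq]
  rfl

lemma IsTSRun.map_fst_pairLaw (ℓ : ℕ) : (B.pairLaw P env smp ℓ).map Prod.fst = B.prior := by
  rw [pairLaw, AEMeasurable.map_map_of_aemeasurable measurable_fst.aemeasurable
    (hR.aemeasurable_pair ℓ), ← hR.env_law.map_eq]
  refine Measure.ext_of_lintegral _ fun f hf => ?_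
  rw [lintegral_map' hf.aemeasurable hR.aemeasurable_env]
  refine (lintegral_map' hf.aemeasurable (hR.aemeasurable_smp ℓ)).trans ?_
  exact hR.lintegral_hist_smp ℓ (F := fun _ E => f E) (hf.comp measurable_snd)

/-- The sampled environments approach the true one. -/
lemma IsTSRun.tendsto_boundedContinuous (hcons : B.HasConsistentEstimator P env epi)
    (φ : BoundedContinuousFunction B.Env ℝ) :
    Tendsto (fun ℓ => ∫⁻ x, ‖φ x.1 - φ x.2‖ₑ ∂(B.pairLaw P env smp ℓ)) atTop (𝓝 0) := by
  obtain ⟨T, hT, hlim⟩ := hcons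
  have mφ := φ.continuous.measurable
  have hm : ∀ ℓ, Measurable fun x : (Fin ℓ → Traj S A H) × B.Env => ‖φ (T ℓ x.1) - φ x.2‖ₑ := by
    intro ℓ
    exact ((mφ.comp ((hT ℓ).comp measurable_fst)).sub (mφ.comp measurable_snd)).enorm
  have hae : ∀ ℓ, AEMeasurable (fun ω => ‖φ (T ℓ (hist epi ℓ ω)) - φ (env ω)‖ₑ) P := fun ℓ =>
    (hm ℓ).comp_aemeasurable (f := fun ω => (hist epi ℓ ω, env ω))
      ((hR.aemeasurable_hist ℓ).prodMk hR.aemeasurable_env)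
  have h0 : Tendsto (fun ℓ => ∫⁻ ω, ‖φ (T ℓ (hist epi ℓ ω)) - φ (env ω)‖ₑ ∂P) atTop (𝓝 0) := by
    have := tendsto_lintegral_of_dominated_convergence' (μ := P)
      (F := fun ℓ ω => ‖φ (T ℓ (hist epi ℓ ω)) - φ (env ω)‖ₑ) (f := fun _ => 0)
      (fun _ => ENNReal.ofReal (2 * ‖φ‖)) hae (fun ℓ => Eventually.of_forall fun ω => ?_)
      (by rw [lintegral_const, measure_univ, mul_one]; exact ENNReal.ofReal_ne_top) ?_
    · simpa using this
    · dsimp only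
      rw [← ofReal_norm]
      refine ENNReal.ofReal_le_ofReal ?_
      rw [← dist_eq_norm]
      exact φ.dist_le_two_norm _ _
    · filter_upwards [hlim] with ω hω
      have h1 : Tendsto (fun ℓ => φ (T ℓ (hist epi ℓ ω)) - φ (env ω)) atTop (𝓝 0) := by
        have := ((φ.continuous.tendsto _).comp hω).sub_const (φ (env ω))
        simpa using this
      simpa using h1.enorm
  have h1 := h0.add h0
  rw [add_zero] at h1
  refine tendsto_of_tendsto_of_tendsto_of_le_of_le tendsto_const_nhds h1 (fun ℓ => zero_le)
    fun ℓ => ?_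
  have hm2 : Measurable fun x : B.Env × B.Env => ‖φ x.1 - φ x.2‖ₑ :=
    ((mφ.comp measurable_fst).sub (mφ.comp measurable_snd)).enorm
  dsimp only
  rw [hR.lintegral_pairLaw ℓ hm2]
  have h2 := hR.lintegral_hist_smp ℓ (F := fun x E => ‖φ (T ℓ x) - φ E‖ₑ) (hm ℓ)
  nth_rewrite 1 [← h2]
  rw [← lintegral_add_right' _ (hae ℓ)]
  refine lintegral_mono fun ω => ?_
  have : φ (smp ℓ ω) - φ (env ω) = (φ (T ℓ (hist epi ℓ ω)) - φ (env ω))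
    - (φ (T ℓ (hist epi ℓ ω)) - φ (smp ℓ ω)) := by ring
  dsimp only
  rw [this, add_comm]
  exact enorm_sub_le

lemma IsTSRun.tendsto_lintegral_absDiff (hcons : B.HasConsistentEstimator P env epi)
    {Y : Type*} [MeasurableSpace Y] {ν : Measure Y} [SFinite ν] {f : B.Env → Y → ENNReal}
    (hf : Measurable fun z : B.Env × Y => f z.1 z.2)
    (hfi : ∫⁻ x, ∫⁻ y, f x y ∂ν ∂B.prior ≠ ⊤) :
    Tendsto (fun ℓ => ∫⁻ x, ∫⁻ y, absDiff (f x.1 y) (f x.2 y) ∂ν ∂(B.pairLaw P env smp ℓ))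
      atTop (𝓝 0) := by
  have : ∀ ℓ, IsProbabilityMeasure (B.pairLaw P env smp ℓ) := fun ℓ =>
    Measure.isProbabilityMeasure_map (hR.aemeasurable_pair ℓ)
  exact tendsto_lintegral_lintegral_absDiff_coupling hR.map_fst_pairLaw hR.map_snd_pairLaw
    (hR.tendsto_boundedContinuous hcons) hf hfi

omit hR in
lemma OccBound.gap_le {M : NNReal} (hM : B.OccBound M) (E E₀ : B.Env) :
    B.gap E E₀ ≤ M * ∑ h ∈ Finset.range H,
      (∫⁻ y, absDiff (B.trans E h y.1.1 y.1.2 y.2) (B.trans E₀ h y.1.1 y.1.2 y.2)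
          ∂((B.mdp.baseSA h).prod B.mdp.ν)
        + ∫⁻ y, absDiff (B.optPol E h y.1 y.2) (B.optPol E₀ h y.1 y.2) ∂(B.mdp.baseSA h)) := by
  unfold gap transGap polGap
  rw [← Finset.sum_add_distrib, Finset.mul_sum]
  refine Finset.sum_le_sum fun h hh => ?_
  have hh := Finset.mem_range.1 hh
  have hQ := B.isTrans_trans E₀
  have hπ := B.isPolicy_optPol E₀
  have h1 := hQ.measurable_occ hπ h
  have h2 := hQ.meas h
  have h3 := (B.isTrans_trans E).meas h
  have h4 := hπ.meas h
  have h5 := (B.isPolicy_optPol E).meas h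
  have hMh := hM E₀ E₀ h hh
  have m1 : Measurable fun y : (S × A) × (ℝ × S) =>
      absDiff (B.trans E h y.1.1 y.1.2 y.2) (B.trans E₀ h y.1.1 y.1.2 y.2) := 
    (h3.comp (f := fun y : (S × A) × (ℝ × S) => (y.1.1, y.1.2, y.2)) (by fun_prop)).absDiff
    (h2.comp (f := fun y : (S × A) × (ℝ × S) => (y.1.1, y.1.2, y.2)) (by fun_prop))
  have m2 : Measurable fun y : S × A => absDiff (B.optPol E h y.1 y.2) (B.optPol E₀ h y.1 y.2) :=
    h5.absDiff h4
  rw [mul_add]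
  refine add_le_add ?_ ?_
  · have m1' : Measurable fun x : S × A =>
        ∫⁻ z, absDiff (B.trans E h x.1 x.2 z) (B.trans E₀ h x.1 x.2 z) ∂B.mdp.ν :=
      m1.lintegral_prod_right'
    have m3 : Measurable fun x : S × A => B.mdp.occ (B.trans E₀) (B.optPol E₀) h x.1 x.2 *
        ∫⁻ z, absDiff (B.trans E h x.1 x.2 z) (B.trans E₀ h x.1 x.2 z) ∂B.mdp.ν := h1.mul m1'
    rw [lintegral_prod _ m1.aemeasurable, ← lintegral_const_mul _ m1']
    unfold transDist
    refine (lintegral_baseSA (b := B.mdp) h m3).symm.le.trans (lintegral_mono_ae ?_)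
    filter_upwards [hMh] with x hx
    gcongr
  · have m4 : Measurable fun s : S =>
        ∫⁻ a, absDiff (B.optPol E h s a) (B.optPol E₀ h s a) ∂B.mdp.μA := m2.lintegral_prod_right'
    rw [lintegral_baseSA (b := B.mdp) h m2, ← lintegral_const_mul _ m4]
    unfold polDist
    refine lintegral_mono_ae ?_
    have h6 := Measure.ae_ae_of_ae_prod hMh
    filter_upwards [h6] with s hs
    gcongr
    calc B.mdp.stateOcc (B.trans E₀) (B.optPol E₀) h s
        = ∫⁻ a, B.mdp.occ (B.trans E₀) (B.optPol E₀) h s a ∂B.μA := by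
          unfold occ
          have h7 : Measurable fun a => B.optPol E₀ h s a :=
            h4.comp (f := fun a => (s, a)) (by fun_prop)
          rw [lintegral_const_mul _ h7]
          have := hπ.prob h s
          simp only [mdp] at this
          rw [this, mul_one]
      _ ≤ ∫⁻ _, M ∂B.μA := lintegral_mono_ae hs
      _ = M := by simp

omit hR in
lemma measurable_lintegral_absDiff_trans (h : ℕ) : Measurable fun x : B.Env × B.Env =>
    ∫⁻ y, absDiff (B.trans x.1 h y.1.1 y.1.2 y.2) (B.trans x.2 h y.1.1 y.1.2 y.2)
      ∂((B.mdp.baseSA h).prod B.mdp.ν) := by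
  have m1 := B.measurable_trans h
  have : Measurable fun z : (B.Env × B.Env) × ((S × A) × (ℝ × S)) =>
      absDiff (B.trans z.1.1 h z.2.1.1 z.2.1.2 z.2.2) (B.trans z.1.2 h z.2.1.1 z.2.1.2 z.2.2) :=
    (m1.comp (f := fun z : (B.Env × B.Env) × ((S × A) × (ℝ × S)) =>
      (z.1.1, z.2.1.1, z.2.1.2, z.2.2)) (by fun_prop)).absDiff
    (m1.comp (f := fun z : (B.Env × B.Env) × ((S × A) × (ℝ × S)) =>
      (z.1.2, z.2.1.1, z.2.1.2, z.2.2)) (by fun_prop))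
  exact this.lintegral_prod_right'

omit hR in
lemma measurable_lintegral_absDiff_optPol (h : ℕ) : Measurable fun x : B.Env × B.Env =>
    ∫⁻ y, absDiff (B.optPol x.1 h y.1 y.2) (B.optPol x.2 h y.1 y.2) ∂(B.mdp.baseSA h) := by
  have m1 := B.measurable_optPol h
  have : Measurable fun z : (B.Env × B.Env) × (S × A) =>
      absDiff (B.optPol z.1.1 h z.2.1 z.2.2) (B.optPol z.1.2 h z.2.1 z.2.2) :=
    (m1.comp (f := fun z : (B.Env × B.Env) × (S × A) => (z.1.1, z.2)) (by fun_prop)).absDiff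
    (m1.comp (f := fun z : (B.Env × B.Env) × (S × A) => (z.1.2, z.2)) (by fun_prop))
  exact this.lintegral_prod_right'

lemma IsTSRun.tendsto_lintegral_absDiff_trans (hcons : B.HasConsistentEstimator P env epi)
    (h : ℕ) : Tendsto (fun ℓ => ∫⁻ x, ∫⁻ y,
      absDiff (B.trans x.1 h y.1.1 y.1.2 y.2) (B.trans x.2 h y.1.1 y.1.2 y.2)
        ∂((B.mdp.baseSA h).prod B.mdp.ν) ∂(B.pairLaw P env smp ℓ)) atTop (𝓝 0) := by
  have m1 : Measurable fun z : B.Env × ((S × A) × (ℝ × S)) =>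
      B.trans z.1 h z.2.1.1 z.2.1.2 z.2.2 := (B.measurable_trans h).comp
    (f := fun z : B.Env × ((S × A) × (ℝ × S)) => (z.1, z.2.1.1, z.2.1.2, z.2.2)) (by fun_prop)
  have key := hR.tendsto_lintegral_absDiff hcons (ν := (B.mdp.baseSA h).prod B.mdp.ν)
    (f := fun E y => B.trans E h y.1.1 y.1.2 y.2) m1
  refine key ?_
  clear key
  have : ∀ E, ∫⁻ y, B.trans E h y.1.1 y.1.2 y.2 ∂((B.mdp.baseSA h).prod B.mdp.ν) = 1 := by
    intro E
    have m2 : Measurable fun y : (S × A) × (ℝ × S) => B.trans E h y.1.1 y.1.2 y.2 :=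
      m1.comp (f := fun y => (E, y)) (by fun_prop)
    rw [lintegral_prod _ m2.aemeasurable]
    simp [(B.isTrans_trans E).prob]
  simp [this]

lemma IsTSRun.tendsto_lintegral_absDiff_optPol (hcons : B.HasConsistentEstimator P env epi)
    (h : ℕ) : Tendsto (fun ℓ => ∫⁻ x, ∫⁻ y,
      absDiff (B.optPol x.1 h y.1 y.2) (B.optPol x.2 h y.1 y.2)
        ∂(B.mdp.baseSA h) ∂(B.pairLaw P env smp ℓ)) atTop (𝓝 0) := by
  have key := hR.tendsto_lintegral_absDiff hcons (ν := B.mdp.baseSA h)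
    (f := fun E y => B.optPol E h y.1 y.2) (B.measurable_optPol h)
  refine key ?_
  clear key
  have : ∀ E, ∫⁻ y, B.optPol E h y.1 y.2 ∂(B.mdp.baseSA h) = 1 := by
    intro E
    rw [lintegral_baseSA (b := B.mdp) h (f := fun y => B.optPol E h y.1 y.2)
      ((B.isPolicy_optPol E).meas h)]
    simp [(B.isPolicy_optPol E).prob]
  simp [this]

lemma IsTSRun.tendsto_gap (hcons : B.HasConsistentEstimator P env epi) {M : NNReal}
    (hM : B.OccBound M) :
    Tendsto (fun ℓ => ∫⁻ x, B.gap x.1 x.2 ∂(B.pairLaw P env smp ℓ)) atTop (𝓝 0) := by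
  set f : ℕ → B.Env × B.Env → ENNReal := fun h x =>
    ∫⁻ y, absDiff (B.trans x.1 h y.1.1 y.1.2 y.2) (B.trans x.2 h y.1.1 y.1.2 y.2)
      ∂((B.mdp.baseSA h).prod B.mdp.ν) with hf
  set g : ℕ → B.Env × B.Env → ENNReal := fun h x =>
    ∫⁻ y, absDiff (B.optPol x.1 h y.1 y.2) (B.optPol x.2 h y.1 y.2) ∂(B.mdp.baseSA h) with hg
  have mf : ∀ h, Measurable (f h) := measurable_lintegral_absDiff_trans
  have mg : ∀ h, Measurable (g h) := measurable_lintegral_absDiff_optPol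
  have tf : ∀ h, Tendsto (fun ℓ => ∫⁻ x, f h x ∂(B.pairLaw P env smp ℓ)) atTop (𝓝 0) :=
    hR.tendsto_lintegral_absDiff_trans hcons
  have tg : ∀ h, Tendsto (fun ℓ => ∫⁻ x, g h x ∂(B.pairLaw P env smp ℓ)) atTop (𝓝 0) :=
    hR.tendsto_lintegral_absDiff_optPol hcons
  have hle : ∀ x : B.Env × B.Env, B.gap x.1 x.2 ≤ M * ∑ h ∈ Finset.range H, (f h x + g h x) :=
    fun x => hM.gap_le x.1 x.2
  clear_value f g
  have t3 := ENNReal.Tendsto.const_mul (a := (M : ENNReal)) (tendsto_finsetSum (Finset.range H)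
      fun h _ => (tf h).add (tg h)) (Or.inr ENNReal.coe_ne_top)
  rw [Finset.sum_eq_zero fun _ _ => add_zero _, mul_zero] at t3
  refine tendsto_of_tendsto_of_tendsto_of_le_of_le tendsto_const_nhds t3 (fun ℓ => zero_le)
    fun ℓ => ?_
  dsimp only
  refine (lintegral_mono hle).trans (le_of_eq ?_)
  have mfg : ∀ h, Measurable fun x => f h x + g h x := fun h => (mf h).add (mg h)
  rw [lintegral_const_mul _ (Finset.measurable_fun_sum _ fun h _ => mfg h),
    lintegral_finsetSum _ fun h _ => mfg h]
  congr 1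
  exact Finset.sum_congr rfl fun h _ => lintegral_add_left (mf h) _

omit hR in
/-- The rarely visited pairs have small mass on average. -/
lemma VisitsAll.exists_lintegral_rareMass_le (hV : B.VisitsAll) {η : ENNReal} (hη : η ≠ 0) :
    ∃ δ : NNReal, δ ≠ 0 ∧ ∫⁻ E, B.rareMass δ E ∂B.prior ≤ η := by
  set δ : ℕ → NNReal := fun n => 1 / ((n : NNReal) + 1) with hδ
  have hδ0 : Tendsto δ atTop (𝓝 0) := tendsto_one_div_add_atTop_nhds_zero_nat
  have hδ1 : Antitone δ := by
    intro i j hij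
    simp only [hδ]
    gcongr
  have hlim : ∀ᵐ E ∂B.prior, Tendsto (fun n => B.rareMass (δ n) E) atTop (𝓝 0) := by
    filter_upwards [hV] with E hE
    have : ∀ h ∈ Finset.range H, Tendsto (fun n => B.mdp.baseSA h
        {x | B.mdp.occ (B.trans E) (B.optPol E) h x.1 x.2 < 2 * δ n}) atTop (𝓝 0) := by
      intro h hh
      have hh := Finset.mem_range.1 hh
      have m1 := (B.isTrans_trans E).measurable_occ (B.isPolicy_optPol E) h
      have h1 := hE ⟨h, hh⟩
      have h2 := B.occDensity_eq E (B.star_mem E) ⟨h, hh⟩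
      rw [base_eq] at h1 h2
      have h3 : B.mdp.baseSA h (⋂ n, {x | B.mdp.occ (B.trans E) (B.optPol E) h x.1 x.2 < 2 * δ n})
          = 0 := by
        have h4 : ∀ᵐ x ∂(B.mdp.baseSA h), B.mdp.occ (B.trans E) (B.optPol E) h x.1 x.2 ≠ 0 := by
          filter_upwards [h1, h2] with x hx1 hx2
          rw [hx2] at hx1
          exact hx1
        refine measure_mono_null (fun x hx => ?_) (ae_iff.1 h4)
        simp only [mem_ofPred_eq, not_not]
        rw [mem_iInter] at hx
        refine le_zero_iff.1 (ge_of_tendsto' (b := B.mdp.occ (B.trans E) (B.optPol E) h x.1 x.2)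
          (f := fun n => 2 * (δ n : ENNReal)) (x := atTop) ?_ fun n => (hx n).le)
        have := ENNReal.Tendsto.const_mul (a := 2) (ENNReal.tendsto_coe.2 hδ0) (Or.inr (by simp))
        simpa using this
      rw [← h3]
      refine tendsto_measure_iInter_atTop
        (fun n => (measurableSet_lt m1 measurable_const).nullMeasurableSet) ?_ ⟨0, measure_ne_top _ _⟩
      intro i j hij x hx
      simp only [mem_ofPred_eq] at hx ⊢
      refine hx.trans_le ?_
      have := ENNReal.coe_le_coe.2 (hδ1 hij)
      gcongr
    have := tendsto_finsetSum _ this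
    rw [Finset.sum_const_zero] at this
    exact this
  have := tendsto_lintegral_of_dominated_convergence (μ := B.prior)
    (F := fun n E => B.rareMass (δ n) E) (f := fun _ => 0) (fun _ => H)
    (fun n => B.measurable_rareMass _) (fun n => Eventually.of_forall fun E => ?_) (by simp) hlim
  · rw [lintegral_zero] at this
    obtain ⟨n, hn⟩ := ((ENNReal.tendsto_nhds_zero.1 this) η (pos_iff_ne_zero.2 hη)).exists
    exact ⟨δ n, by simp only [hδ]; positivity, hn⟩
  · unfold rareMass
    refine (Finset.sum_le_card_nsmul _ _ 1 fun h _ => prob_le_one).trans ?_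
    simp

end BayesRL

end

noncomputable section

/-- Popoviciu's inequality for a measure given by a density. -/
lemma lintegral_mul_absDiff_sq_le {Z : Type*} [MeasurableSpace Z] {ν : Measure Z}
    {q f : Z → ENNReal} (hq : Measurable q) (hf : Measurable f) (hq1 : ∫⁻ z, q z ∂ν = 1)
    {K : NNReal} (hK : ∀ z, f z ≤ K) {lo hi : ℝ}
    (hb : ∀ᵐ z ∂(ν.withDensity q), (f z).toReal ∈ Icc lo hi) :
    ∫⁻ z, q z * absDiff (f z) (∫⁻ z, q z * f z ∂ν) ^ 2 ∂ν
      ≤ ENNReal.ofReal (((hi - lo) / 2) ^ 2) := by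
  set μ := ν.withDensity q with hμ
  have hp : IsProbabilityMeasure μ := ⟨by
    rw [hμ, withDensity_apply _ MeasurableSet.univ, Measure.restrict_univ, hq1]⟩
  have hft : ∀ z, f z ≠ ⊤ := fun z => ((hK z).trans_lt ENNReal.coe_lt_top).ne
  have e1 : ∫⁻ z, q z * f z ∂ν = ∫⁻ z, f z ∂μ :=
    (lintegral_withDensity_eq_lintegral_mul _ hq hf).symm
  have hmt : ∫⁻ z, f z ∂μ ≠ ⊤ := by
    refine ((lintegral_mono hK).trans_lt ?_).ne
    simp
  have e2 : (∫⁻ z, f z ∂μ).toReal = μ[fun z => (f z).toReal] :=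
    (integral_toReal hf.aemeasurable (ae_lt_top hf hmt)).symm
  have hX : MemLp (fun z => (f z).toReal) 2 μ := by
    refine MemLp.of_bound hf.ennreal_toReal.aestronglyMeasurable K (Eventually.of_forall fun z => ?_)
    rw [Real.norm_of_nonneg ENNReal.toReal_nonneg]
    exact ENNReal.toReal_le_of_le_ofReal K.2 (by simpa using hK z)
  calc _ = ∫⁻ z, absDiff (f z) (∫⁻ z, f z ∂μ) ^ 2 ∂μ := by
        rw [e1]
        exact (lintegral_withDensity_eq_lintegral_mul _ hq
          ((hf.absDiff measurable_const).pow_const 2)).symm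
    _ = evariance (fun z => (f z).toReal) μ := by
        unfold evariance
        refine lintegral_congr fun z => ?_
        rw [absDiff_eq_enorm (hft z) hmt, e2]
    _ = ENNReal.ofReal (variance (fun z => (f z).toReal) μ) := (ofReal_variance hX).symm
    _ ≤ _ := ENNReal.ofReal_le_ofReal
        (variance_le_sq_of_bounded hb hf.ennreal_toReal.aemeasurable)

namespace BayesRL

open MDPBase

variable {S A : Type*} [MeasurableSpace S] [MeasurableSpace A] {H : ℕ}
  {TP TR : Fin H → Type*} [∀ h, MeasurableSpace (TP h)] [∀ h, MeasurableSpace (TR h)]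
  (B : BayesRL S A H TP TR)

section Reward

variable (h : Fin H) (θ : TR h) (s : S) (a : A)

instance : IsProbabilityMeasure (B.rewardLaw h θ s a) := ⟨by
  rw [rewardLaw, withDensity_apply _ MeasurableSet.univ, Measure.restrict_univ, B.r_prob]⟩

lemma ae_rewardLaw_mem : ∀ᵐ x ∂(B.rewardLaw h θ s a), x ∈ Icc (0 : ℝ) 1 :=
  (withDensity_absolutelyContinuous _ _).ae_le (ae_restrict_mem measurableSet_Icc)

lemma isBoundedUnder_le_rewardLaw :
    IsBoundedUnder (· ≤ ·) (ae (B.rewardLaw h θ s a)) fun x : ℝ => x :=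
  isBoundedUnder_of_eventually_le (a := 1)
    ((B.ae_rewardLaw_mem h θ s a).mono fun _ hx => hx.2)

lemma isBoundedUnder_ge_rewardLaw :
    IsBoundedUnder (· ≥ ·) (ae (B.rewardLaw h θ s a)) fun x : ℝ => x :=
  isBoundedUnder_of_eventually_ge (a := 0)
    ((B.ae_rewardLaw_mem h θ s a).mono fun _ hx => hx.1)

lemma ae_rewardLaw_mem_essInf_essSup : ∀ᵐ x ∂(B.rewardLaw h θ s a),
    x ∈ Icc (essInf (fun y : ℝ => y) (B.rewardLaw h θ s a))
      (essSup (fun y : ℝ => y) (B.rewardLaw h θ s a)) := by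
  filter_upwards [ae_le_essSup (B.isBoundedUnder_le_rewardLaw h θ s a),
    ae_essInf_le (B.isBoundedUnder_ge_rewardLaw h θ s a)] with x h1 h2
  exact ⟨h2, h1⟩

/-- The range of the rewards. -/
def rewardRange : ℝ := essSup (fun y : ℝ => y) (B.rewardLaw h θ s a)
  - essInf (fun y : ℝ => y) (B.rewardLaw h θ s a)

lemma rewardRange_le_one : B.rewardRange h θ s a ≤ 1 := by
  have h1 : essSup (fun y : ℝ => y) (B.rewardLaw h θ s a) ≤ 1 :=
    essSup_le_of_ae_le 1 ((B.ae_rewardLaw_mem h θ s a).mono fun _ hx => hx.2)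
      (B.isBoundedUnder_ge_rewardLaw h θ s a).isCoboundedUnder_le
  have h2 : 0 ≤ essInf (fun y : ℝ => y) (B.rewardLaw h θ s a) :=
    le_essInf_of_ae_le 0 ((B.ae_rewardLaw_mem h θ s a).mono fun _ hx => hx.1)
      (B.isBoundedUnder_le_rewardLaw h θ s a).isCoboundedUnder_ge
  unfold rewardRange
  linarith

lemma rewardRange_pos : 0 < B.rewardRange h θ s a := by
  by_contra hn
  have hae := B.ae_rewardLaw_mem_essInf_essSup h θ s a
  set c := essInf (fun y : ℝ => y) (B.rewardLaw h θ s a) with hc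
  have h1 : ∀ᵐ x ∂(B.rewardLaw h θ s a), x = c := by
    filter_upwards [hae] with x hx
    unfold rewardRange at hn
    rw [← hc] at hn
    linarith [hx.1, hx.2]
  have h2 : ∀ᵐ x ∂(B.rewardLaw h θ s a), x ≠ c :=
    ((withDensity_absolutelyContinuous _ _).trans Measure.restrict_le_self.absolutelyContinuous).ae_le
      (Measure.ae_ne volume c)
  obtain ⟨x, hx1, hx2⟩ := (h1.and h2).exists
  exact hx2 hx1

end Reward

lemma value_mem {π : Fin H → S → A → ℝ} (hπ : π ∈ B.Pol) (E : B.Env) (h : Fin H) (s : S) :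
    B.value E π h s ∈ Icc (0 : ℝ) H := by
  rw [B.value_eq E hπ]
  refine ⟨ENNReal.toReal_nonneg, ENNReal.toReal_le_of_le_ofReal (by positivity) ?_⟩
  simpa using B.accValue_le (B.isTrans_trans E) (B.isPolicy_polDens hπ) h.1 s

/-- The oscillation of the optimal values of a layer. -/
def valueOsc (E : B.Env) (h : Fin H) : ℝ :=
  (⨆ s, B.value E (B.star E) h s) - ⨅ s, B.value E (B.star E) h s

lemma bddAbove_value (E : B.Env) (h : Fin H) :
    BddAbove (range fun s => B.value E (B.star E) h s) :=
  ⟨H, by rintro _ ⟨s, rfl⟩; exact (B.value_mem (B.star_mem E) E h s).2⟩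

lemma bddBelow_value (E : B.Env) (h : Fin H) :
    BddBelow (range fun s => B.value E (B.star E) h s) :=
  ⟨0, by rintro _ ⟨s, rfl⟩; exact (B.value_mem (B.star_mem E) E h s).1⟩

lemma valueOsc_nonneg (E : B.Env) (h : Fin H) : 0 ≤ B.valueOsc E h := by
  have : Nonempty S := ⟨B.s₁⟩
  have := ciInf_le_ciSup (B.bddBelow_value E h) (B.bddAbove_value E h)
  unfold valueOsc
  linarith

lemma valueOsc_le (E : B.Env) (h : Fin H) : B.valueOsc E h ≤ H := by
  have : Nonempty S := ⟨B.s₁⟩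
  have h1 := ciSup_le fun s => (B.value_mem (B.star_mem E) E h s).2
  have h2 := le_ciInf fun s => (B.value_mem (B.star_mem E) E h s).1
  unfold valueOsc
  linarith

variable [NeZero H]

lemma valueDiameter_eq (E : B.Env) : B.valueDiameter E = (⨆ h, B.valueOsc E h)
    + ⨆ x : Fin H × S × A, B.rewardRange x.1 (E x.1).2 x.2.1 x.2.2 := rfl

lemma rewardRange_le_iSup (E : B.Env) (h : Fin H) (s : S) (a : A) : B.rewardRange h (E h).2 s a
    ≤ ⨆ x : Fin H × S × A, B.rewardRange x.1 (E x.1).2 x.2.1 x.2.2 :=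
  le_ciSup (f := fun x : Fin H × S × A => B.rewardRange x.1 (E x.1).2 x.2.1 x.2.2)
    ⟨1, by rintro _ ⟨x, rfl⟩; exact B.rewardRange_le_one _ _ _ _⟩ (h, s, a)

lemma valueOsc_le_iSup (E : B.Env) (h : Fin H) : B.valueOsc E h ≤ ⨆ h, B.valueOsc E h :=
  le_ciSup (Set.finite_range _).bddAbove h

lemma valueDiameter_pos (E : B.Env) : 0 < B.valueDiameter E := by
  obtain ⟨a⟩ := nonempty_of_isProbabilityMeasure B.μA
  have h1 := B.rewardRange_le_iSup E 0 B.s₁ a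
  have h2 := B.rewardRange_pos 0 (E 0).2 B.s₁ a
  have h3 := B.valueOsc_le_iSup E 0
  have h4 := B.valueOsc_nonneg E 0
  rw [valueDiameter_eq]
  linarith

lemma valueDiameter_le (E : B.Env) : B.valueDiameter E ≤ H + 1 := by
  obtain ⟨a⟩ := nonempty_of_isProbabilityMeasure B.μA
  have : Nonempty (Fin H × S × A) := ⟨(0, B.s₁, a)⟩
  rw [valueDiameter_eq]
  exact add_le_add (ciSup_le fun h => B.valueOsc_le E h)
    (ciSup_le fun x => B.rewardRange_le_one _ _ _ _)

section Average

variable {B} (hm : Measurable B.valueDiameter)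

include hm

lemma integrable_valueDiameter_sq : Integrable (fun E => B.valueDiameter E ^ 2) B.prior := by
  refine Integrable.of_bound (hm.pow_const 2).aestronglyMeasurable (((H : ℝ) + 1) ^ 2)
    (Eventually.of_forall fun E => ?_)
  have := (B.valueDiameter_pos E).le
  rw [Real.norm_of_nonneg (by positivity)]
  exact pow_le_pow_left₀ this (B.valueDiameter_le E) 2

omit hm in
lemma avgDiameter_sq : B.avgDiameter ^ 2 = ∫ E, B.valueDiameter E ^ 2 ∂B.prior :=
  Real.sq_sqrt (integral_nonneg fun _ => sq_nonneg _)

lemma avgDiameter_pos : 0 < B.avgDiameter := by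
  unfold avgDiameter
  rw [Real.sqrt_pos, integral_pos_iff_support_of_nonneg (fun _ => sq_nonneg _)
    (integrable_valueDiameter_sq hm)]
  have : Function.support (fun E => B.valueDiameter E ^ 2) = univ := by
    ext E
    simp [(B.valueDiameter_pos E).ne']
  rw [this, measure_univ]
  exact one_pos

lemma lintegral_valueDiameter_sq (c : ℝ) (hc : 0 ≤ c) :
    ∫⁻ E, ENNReal.ofReal (c * B.valueDiameter E ^ 2) ∂B.prior
      = ENNReal.ofReal (c * B.avgDiameter ^ 2) := by
  rw [← ofReal_integral_eq_lintegral_ofReal ((integrable_valueDiameter_sq hm).const_mul c)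
    (Eventually.of_forall fun E => by positivity), integral_const_mul, avgDiameter_sq]

end Average

lemma exists_bounds_acc (E : B.Env) {h : ℕ} (hh : h < H) : ∃ lo hi : ℝ,
    hi - lo ≤ (⨆ h, B.valueOsc E h) ∧ ∀ s, (B.mdp.acc (B.trans E) (B.optPol E) (fun _ _ _ => rew)
      (H - (h + 1)) (h + 1) s).toReal ∈ Icc lo hi := by
  by_cases h1 : h + 1 < H
  · refine ⟨⨅ s, B.value E (B.star E) ⟨h + 1, h1⟩ s, ⨆ s, B.value E (B.star E) ⟨h + 1, h1⟩ s,
      B.valueOsc_le_iSup E ⟨h + 1, h1⟩, fun s => ?_⟩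
    have e := B.value_eq E (B.star_mem E) ⟨h + 1, h1⟩ s
    change _ = (B.mdp.acc (B.trans E) (B.optPol E) (fun _ _ _ => rew)
      (H - (h + 1)) (h + 1) s).toReal at e
    rw [← e]
    exact ⟨ciInf_le (B.bddBelow_value E _) s, le_ciSup (B.bddAbove_value E _) s⟩
  · refine ⟨0, 0, ?_, fun s => ?_⟩
    · have h3 := B.valueOsc_le_iSup E 0
      have h4 := B.valueOsc_nonneg E 0
      linarith
    · have : H - (h + 1) = 0 := by omega
      rw [this]
      simp [acc]

lemma ae_withDensity_trans (E : B.Env) {h : ℕ} (hh : h < H) (s : S) (a : A) {p : ℝ → Prop}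
    (hp : ∀ᵐ x ∂(B.rewardLaw ⟨h, hh⟩ (E ⟨h, hh⟩).2 s a), p x) :
    ∀ᵐ z ∂(B.mdp.ν.withDensity (B.trans E h s a)), p z.1 := by
  have hm : Measurable fun z : ℝ × S => B.trans E h s a z := (B.measurable_trans h).comp
      (f := fun z : ℝ × S => (E, s, a, z)) (by fun_prop)
  have hr : Measurable fun x => ENNReal.ofReal (B.r ⟨h, hh⟩ (E ⟨h, hh⟩).2 s a x) :=
    ENNReal.measurable_ofReal.comp ((B.r_measurable ⟨h, hh⟩).comp
      (f := fun x => ((E ⟨h, hh⟩).2, s, a, x)) (by fun_prop))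
  rw [rewardLaw, ae_withDensity_iff hr] at hp
  rw [ae_withDensity_iff hm]
  have hp' : ∀ᵐ z ∂B.mdp.ν, ENNReal.ofReal (B.r ⟨h, hh⟩ (E ⟨h, hh⟩).2 s a z.1) ≠ 0 → p z.1 :=
    Measure.quasiMeasurePreserving_fst.ae hp
  filter_upwards [hp'] with z hz hz0
  refine hz fun h0 => hz0 ?_
  simp [trans, hh, h0]

/-- The conditional variances of the continuation values are bounded by the value diameter. -/
lemma valueVar_le (E : B.Env) :
    B.valueVar E ≤ ENNReal.ofReal (H / 4 * B.valueDiameter E ^ 2) := by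
  have hQ := B.isTrans_trans E
  have hπ := B.isPolicy_optPol E
  have key : ∀ h ∈ Finset.range H, ∫⁻ x, B.mdp.occ (B.trans E) (B.optPol E) h x.1 x.2 *
    ∫⁻ z, B.trans E h x.1 x.2 z * absDiff (B.mdp.contVal H (B.trans E) (B.optPol E) rew h z)
      (B.mdp.actionValue H (B.trans E) (B.optPol E) rew h x.1 x.2) ^ 2 ∂B.mdp.ν ∂(B.mdp.baseSA h)
      ≤ ENNReal.ofReal (B.valueDiameter E ^ 2 / 4) := by
    intro h hh
    have hh := Finset.mem_range.1 hh
    have hc := hQ.measurable_contVal (H := H) hπ (measurable_rew (S := S)) h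
    have hocc := hQ.measurable_occ hπ h
    have hin : ∀ x : S × A, ∫⁻ z, B.trans E h x.1 x.2 z *
        absDiff (B.mdp.contVal H (B.trans E) (B.optPol E) rew h z)
        (B.mdp.actionValue H (B.trans E) (B.optPol E) rew h x.1 x.2) ^ 2 ∂B.mdp.ν
        ≤ ENNReal.ofReal (B.valueDiameter E ^ 2 / 4) := by
      intro x
      obtain ⟨lo, hi, hlh, hb⟩ := B.exists_bounds_acc E hh
      have hr := B.rewardRange_le_iSup E ⟨h, hh⟩ x.1 x.2
      have hr0 := B.rewardRange_pos ⟨h, hh⟩ (E ⟨h, hh⟩).2 x.1 x.2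
      unfold rewardRange at hr0
      have hlh0 : lo ≤ hi := (hb x.1).1.trans (hb x.1).2
      have hq : Measurable fun z => B.trans E h x.1 x.2 z :=
        (hQ.meas h).comp (f := fun z => (x.1, x.2, z)) (by fun_prop)
      set u := essSup (fun y : ℝ => y) (B.rewardLaw ⟨h, hh⟩ (E ⟨h, hh⟩).2 x.1 x.2) with hu
      set l := essInf (fun y : ℝ => y) (B.rewardLaw ⟨h, hh⟩ (E ⟨h, hh⟩).2 x.1 x.2) with hl
      have hmain := lintegral_mul_absDiff_sq_le (ν := B.mdp.ν) hq hc (hQ.prob h x.1 x.2)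
        (K := H) (fun z => by simpa using hQ.contVal_le (H := H) hπ rew_le_one h z)
        (lo := l + lo) (hi := u + hi) (by
          have hae := B.ae_withDensity_trans E hh x.1 x.2 (p := fun y => y ∈ Icc (0 : ℝ) 1 ∧ y ∈ Icc l u)
            ((B.ae_rewardLaw_mem _ _ _ _).and (B.ae_rewardLaw_mem_essInf_essSup _ _ _ _))
          filter_upwards [hae] with z hz
          have hfin : B.mdp.acc (B.trans E) (B.optPol E) (fun _ _ _ => rew)
            (H - (h + 1)) (h + 1) z.2 ≠ ⊤ :=
            ((hQ.acc_le hπ (fun _ _ _ z => rew_le_one z) _ _ _).trans_lt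
              (ENNReal.natCast_lt_top _)).ne
          unfold contVal
          rw [ENNReal.toReal_add (by simp [rew]) hfin, rew, min_eq_left hz.1.2,
            ENNReal.toReal_ofReal hz.1.1]
          exact ⟨add_le_add hz.2.1 (hb z.2).1, add_le_add hz.2.2 (hb z.2).2⟩)
      refine hmain.trans (ENNReal.ofReal_le_ofReal ?_)
      have h1 : u + hi - (l + lo) ≤ B.valueDiameter E := by
        rw [valueDiameter_eq]
        unfold rewardRange at hr
        rw [← hu, ← hl] at hr
        unfold rewardRange
        linarith
      have h2 : 0 ≤ u + hi - (l + lo) := by linarith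
      nlinarith
    calc _ ≤ ∫⁻ x, B.mdp.occ (B.trans E) (B.optPol E) h x.1 x.2 *
          ENNReal.ofReal (B.valueDiameter E ^ 2 / 4) ∂(B.mdp.baseSA h) :=
          lintegral_mono fun x => mul_le_mul_right (hin x) _
      _ = _ := by
          rw [lintegral_mul_const _ hocc, lintegral_baseSA (b := B.mdp) h hocc,
            hQ.lintegral_occ hπ h, one_mul]
  refine (Finset.sum_le_sum key).trans ?_
  rw [Finset.sum_const, Finset.card_range, nsmul_eq_mul, ← ENNReal.ofReal_natCast,
    ← ENNReal.ofReal_mul (by positivity)]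
  refine ENNReal.ofReal_le_ofReal (le_of_eq ?_)
  ring

end BayesRL

end

noncomputable section

lemma le_two_mul_sqrt_of_forall_le {x a b : ℝ} (ha : 0 ≤ a) (hb : 0 ≤ b)
    (h : ∀ u, 0 < u → x ≤ u * a + b / u) : x ≤ 2 * √(a * b) := by
  rcases ha.eq_or_lt with rfl | ha0
  · simp only [zero_mul, Real.sqrt_zero, mul_zero]
    refine le_of_forall_pos_le_add fun e he => ?_
    have := h ((b + 1) / e) (by positivity)
    rw [mul_zero, zero_add] at this
    refine this.trans ?_
    rw [zero_add, div_div_eq_mul_div, div_le_iff₀ (by positivity)]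
    nlinarith
  rcases hb.eq_or_lt with rfl | hb0
  · simp only [mul_zero, Real.sqrt_zero]
    refine le_of_forall_pos_le_add fun e he => ?_
    have := h (e / (a + 1)) (by positivity)
    rw [zero_div, add_zero] at this
    refine this.trans ?_
    rw [zero_add, div_mul_eq_mul_div, div_le_iff₀ (by positivity)]
    nlinarith
  have h1 := h (√b / √a) (by positivity)
  have ea : a = √a * √a := (Real.mul_self_sqrt ha).symm
  have eb : b = √b * √b := (Real.mul_self_sqrt hb).symm
  have e1 : √b / √a * a = √a * √b := by
    nth_rewrite 2 [ea]
    field_simp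
  have e2 : b / (√b / √a) = √a * √b := by
    nth_rewrite 1 [eb]
    field_simp
  rw [e1, e2] at h1
  rw [Real.sqrt_mul ha]
  linarith

lemma exists_eq_iInf_natCast {p : ℕ → Prop} (h : (⨅ (K : ℕ) (_ : p K), (K : ℕ∞)) ≠ ⊤) :
    ∃ K, p K ∧ (⨅ (K : ℕ) (_ : p K), (K : ℕ∞)) = K := by
  classical
  have hex : ∃ K, p K := by
    by_contra hn
    push Not at hn
    exact h (by simp [hn])
  exact ⟨Nat.find hex, Nat.find_spec hex, le_antisymm (iInf₂_le _ (Nat.find_spec hex))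
    (le_iInf₂ fun K hK => by exact_mod_cast Nat.find_min' hex hK)⟩

lemma le_add_ofReal_of_toReal_sub_le {a b : ENNReal} (ha : a ≠ ⊤) (hb : b ≠ ⊤) {e : ℝ}
    (he : 0 ≤ e) (h : a.toReal - b.toReal ≤ e) : a ≤ b + ENNReal.ofReal e := by
  rw [← ENNReal.ofReal_toReal ha, ← ENNReal.ofReal_toReal hb,
    ← ENNReal.ofReal_add ENNReal.toReal_nonneg he]
  exact ENNReal.ofReal_le_ofReal (by linarith)

lemma lintegral_le_of_forall_le {X : Type*} [MeasurableSpace X] {μ : Measure X}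
    [IsProbabilityMeasure μ] {f : X → ENNReal} {c : ENNReal} (h : ∀ x, f x ≤ c) :
    ∫⁻ x, f x ∂μ ≤ c := by
  refine (lintegral_mono h).trans ?_
  rw [lintegral_const, measure_univ, mul_one]

lemma integral_toReal_sub_toReal {X : Type*} [MeasurableSpace X] {μ : Measure X}
    [IsProbabilityMeasure μ] {f g : X → ENNReal} (hf : AEMeasurable f μ) (hg : AEMeasurable g μ)
    {c : NNReal} (hfc : ∀ x, f x ≤ c) (hgc : ∀ x, g x ≤ c) :
    ∫ x, ((f x).toReal - (g x).toReal) ∂μ = (∫⁻ x, f x ∂μ).toReal - (∫⁻ x, g x ∂μ).toReal := by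
  have f1 : ∫⁻ x, f x ∂μ ≠ ⊤ := ((lintegral_le_of_forall_le hfc).trans_lt ENNReal.coe_lt_top).ne
  have f2 : ∫⁻ x, g x ∂μ ≠ ⊤ := ((lintegral_le_of_forall_le hgc).trans_lt ENNReal.coe_lt_top).ne
  rw [integral_sub (integrable_toReal_of_lintegral_ne_top hf f1)
    (integrable_toReal_of_lintegral_ne_top hg f2),
    integral_toReal hf (Eventually.of_forall fun x => (hfc x).trans_lt ENNReal.coe_lt_top),
    integral_toReal hg (Eventually.of_forall fun x => (hgc x).trans_lt ENNReal.coe_lt_top)]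

lemma lintegral_affine {X : Type*} [MeasurableSpace X] {μ : Measure X} [IsProbabilityMeasure μ]
    {f₀ f₁ f₂ f₃ f₄ : X → ENNReal} {c₀ c₁ c₂ c₃ c₄ : ENNReal} (h₀ : AEMeasurable f₀ μ)
    (h₁ : AEMeasurable f₁ μ) (h₂ : AEMeasurable f₂ μ) (h₃ : AEMeasurable f₃ μ) (hc₄ : c₄ ≠ ⊤) :
    ∫⁻ x, (f₀ x + c₀ + c₁ * (f₁ x + c₂ * f₂ x + c₃ * f₃ x) + c₄ * f₄ x) ∂μ
      = ∫⁻ x, f₀ x ∂μ + c₀ + c₁ * (∫⁻ x, f₁ x ∂μ + c₂ * ∫⁻ x, f₂ x ∂μ + c₃ * ∫⁻ x, f₃ x ∂μ)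
        + c₄ * ∫⁻ x, f₄ x ∂μ := by
  have m1 : AEMeasurable (fun x => c₂ * f₂ x) μ := h₂.const_mul _
  have m2 : AEMeasurable (fun x => f₁ x + c₂ * f₂ x) μ := h₁.add m1
  have m3 : AEMeasurable (fun x => f₁ x + c₂ * f₂ x + c₃ * f₃ x) μ := m2.add (h₃.const_mul _)
  have m4 : AEMeasurable (fun x => f₀ x + c₀) μ := h₀.add aemeasurable_const
  have m5 : AEMeasurable (fun x => f₀ x + c₀ + c₁ * (f₁ x + c₂ * f₂ x + c₃ * f₃ x)) μ :=
    m4.add (m3.const_mul _)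
  rw [lintegral_add_left' m5, lintegral_add_left' m4, lintegral_add_left' h₀,
    lintegral_const_mul'' _ m3, lintegral_add_left' m2, lintegral_add_left' h₁,
    lintegral_const_mul'' _ h₂, lintegral_const_mul'' _ h₃, lintegral_const_mul' _ _ hc₄,
    lintegral_const, measure_univ, mul_one]

lemma Measurable.lintegral_lintegral_kernel {X Y : Type*} [MeasurableSpace X] [MeasurableSpace Y]
    (κ : Kernel X Y) [IsSFiniteKernel κ] {F : Y → Y → ENNReal}
    (hF : Measurable fun y : Y × Y => F y.1 y.2) :
    Measurable fun x => ∫⁻ y, ∫⁻ y', F y y' ∂(κ x) ∂(κ x) := by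
  have e : ∀ x, ∫⁻ y, ∫⁻ y', F y y' ∂(κ x) ∂(κ x) = ∫⁻ y, F y.1 y.2 ∂((κ ×ₖ κ) x) := by
    intro x
    rw [Kernel.prod_apply, lintegral_prod _ hF.aemeasurable]
  simp only [e]
  exact hF.lintegral_kernel

namespace BayesRL

open MDPBase

section Value

variable {S A : Type*} [MeasurableSpace S] [MeasurableSpace A] {H : ℕ} [NeZero H]
  {TP TR : Fin H → Type*} [∀ h, MeasurableSpace (TP h)] [∀ h, MeasurableSpace (TR h)]
  (B : BayesRL S A H TP TR)

/-- The value of the optimal policy of `E'` in the environment `E`. -/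
def crossValue (E E' : B.Env) : ENNReal := B.accValue (B.trans E) (B.optPol E') 0 B.s₁

lemma measurable_crossValue : Measurable fun x : B.Env × B.Env => B.crossValue x.1 x.2 := by
  have h1 : ∀ n, Measurable fun y : (B.Env × B.Env) × S × A × (ℝ × S) =>
      B.trans y.1.1 n y.2.1 y.2.2.1 y.2.2.2 := fun n => (B.measurable_trans n).comp
    (f := fun y : (B.Env × B.Env) × S × A × (ℝ × S) => (y.1.1, y.2)) (by fun_prop)
  have h2 : ∀ n, Measurable fun y : (B.Env × B.Env) × S × A =>
      B.optPol y.1.2 n y.2.1 y.2.2 := fun n => (B.measurable_optPol n).comp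
    (f := fun y : (B.Env × B.Env) × S × A => (y.1.2, y.2)) (by fun_prop)
  have := B.mdp.measurable_acc (X := B.Env × B.Env) (Q := fun x => B.trans x.1)
    (π := fun x => B.optPol x.2) (F := fun _ _ _ _ => rew) h1 h2
    (fun n => (measTrans_rew (S := S) (A := A) n).comp measurable_snd) (H - 0) 0
  exact this.comp (f := fun x => (x, B.s₁)) (by fun_prop)

lemma crossValue_le (E E' : B.Env) : B.crossValue E E' ≤ H :=
  B.accValue_le (B.isTrans_trans E) (B.isPolicy_optPol E') _ _

lemma crossValue_ne_top (E E' : B.Env) : B.crossValue E E' ≠ ⊤ :=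
  B.accValue_ne_top (B.isTrans_trans E) (B.isPolicy_optPol E') _ _

lemma value_eq_crossValue (E E' : B.Env) :
    B.value E (B.star E') 0 B.s₁ = (B.crossValue E E').toReal :=
  B.value_zero_eq E (B.star_mem E') B.s₁

end Value

section Run

variable {S A : Type*} [MeasurableSpace S] [MeasurableSpace A] {H : ℕ} [NeZero H]
  {TP TR : Fin H → Type*} [∀ h, MeasurableSpace (TP h)] [∀ h, MeasurableSpace (TR h)]
  {B : BayesRL S A H TP TR}
  {Ω : Type*} [MeasurableSpace Ω] {P : Measure Ω} [IsProbabilityMeasure P]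
  {env : Ω → B.Env} {smp : ℕ → Ω → B.Env} {epi : ℕ → Ω → Traj S A H}
  (hR : B.IsTSRun P env smp epi)

/-- Constant of the distance of the sampled environment in the regret bound. -/
def gapCoeff (H : ℕ) (M δ : NNReal) : ENNReal := 13 * H ^ 4 * (1 + 4 * M / δ) + 126 * H ^ 4

/-- Expected total information gain of an episode. -/
def IsTSRun.meanInfoGain (ℓ : ℕ) {K : ℕ} (ζ : B.Env → Fin K) : ENNReal :=
  ∫⁻ ω, ∑ k, B.infoGain (hR.posterior ℓ (hist epi ℓ ω)) (ζ ⁻¹' {k}) ∂P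

lemma lintegral_crossValue_le_of_isTilt {N : Measure B.Env} [IsProbabilityMeasure N]
    (hN : B.IsTilt N) {ε : ℝ} (hε : 0 < ε) {K : ℕ} {ζ : B.Env → Fin K}
    (hζ : B.IsLayeredPartition ε K ζ) (hm : Measurable B.valueDiameter)
    {M δ : NNReal} (hM : B.OccBound M) (hδ : δ ≠ 0) {t : ℝ} (ht : 0 < t) :
    ∫⁻ E, B.crossValue E E ∂N ≤ ∫⁻ E, ∫⁻ E', B.crossValue E E' ∂N ∂N + ENNReal.ofReal ε
      + ENNReal.ofReal (1 / t) * (∫⁻ E, ENNReal.ofReal (H / 4 * B.valueDiameter E ^ 2) ∂N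
        + gapCoeff H M δ * ∫⁻ E₀, ∫⁻ E, B.gap E E₀ ∂N ∂N
        + 26 * H ^ 3 * M * ∫⁻ E, B.rareMass δ E ∂N)
      + ENNReal.ofReal (3 * t) * ∑ k, B.infoGain N (ζ ⁻¹' {k}) := by
  have hi := hN.iIndepFun
  have hC : ∀ k, MeasurableSet (ζ ⁻¹' {k}) := fun k => hζ.measurable (measurableSet_singleton k)
  have mV := B.measurable_crossValue
  have ea : ∫⁻ E, B.accValue (B.meanTrans N) (B.optPol E) 0 B.s₁ ∂N
      = ∫⁻ E, ∫⁻ E', B.crossValue E E' ∂N ∂N := by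
    rw [lintegral_lintegral_swap mV.aemeasurable]
    refine lintegral_congr fun E => ?_
    exact (B.lintegral_accValue_trans hi (B.isPolicy_optPol E) B.s₁).symm
  have m1 : Measurable fun E₀ => ENNReal.ofReal (H / 4 * B.valueDiameter E₀ ^ 2) := by fun_prop
  have m2 : Measurable fun E₀ => ∫⁻ E, B.gap E E₀ ∂N :=
    (B.measurable_gap).lintegral_prod_left'
  have m3 := B.measurable_rareMass δ
  have key : ∀ E₀, ∫⁻ E, B.crossValue E E ∂N
      ≤ (∫⁻ E, ∫⁻ E', B.crossValue E E' ∂N ∂N + ENNReal.ofReal ε)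
        + ENNReal.ofReal (1 / t) * (ENNReal.ofReal (H / 4 * B.valueDiameter E₀ ^ 2)
          + gapCoeff H M δ * ∫⁻ E, B.gap E E₀ ∂N + 26 * H ^ 3 * M * B.rareMass δ E₀)
        + ENNReal.ofReal (3 * t) * ∑ k, B.infoGain N (ζ ⁻¹' {k}) := by
    intro E₀
    have h1 := B.lintegral_accValue_le hi hζ.measurable
      (fun k hk => hN.iIndepFun_cond (hC k) (hζ.layered k) hk) (ε := ENNReal.ofReal ε)
      (fun E E' h => le_add_ofReal_of_toReal_sub_le (B.crossValue_ne_top E E)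
        (B.crossValue_ne_top E' E) hε.le (by
          rw [← value_eq_crossValue, ← value_eq_crossValue]
          exact hζ.value_le E E' h)) E₀ ht
    rw [ea] at h1
    refine h1.trans ?_
    gcongr
    exact (B.lintegral_regretError_le hi hM hδ E₀).trans (by
      unfold gapCoeff
      gcongr
      exact B.valueVar_le E₀)
  calc _ = ∫⁻ _, ∫⁻ E, B.crossValue E E ∂N ∂N := by rw [lintegral_const, measure_univ, mul_one]
    _ ≤ _ := lintegral_mono key
    _ = _ := by
      rw [lintegral_affine (f₀ := fun _ => ∫⁻ E, ∫⁻ E', B.crossValue E E' ∂N ∂N)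
        (f₄ := fun _ => ∑ k, B.infoGain N (ζ ⁻¹' {k})) aemeasurable_const m1.aemeasurable
        m2.aemeasurable m3.aemeasurable ENNReal.ofReal_ne_top, lintegral_const, lintegral_const,
        measure_univ, mul_one, mul_one]

lemma IsTSRun.lintegral_crossValue_le [MeasurableSpace.CountablyGenerated B.Env]
    (ℓ : ℕ) {ε : ℝ} (hε : 0 < ε) {K : ℕ} {ζ : B.Env → Fin K}
    (hζ : B.IsLayeredPartition ε K ζ) (hm : Measurable B.valueDiameter)
    {M δ : NNReal} (hM : B.OccBound M) (hδ : δ ≠ 0) {t : ℝ} (ht : 0 < t) :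
    ∫⁻ ω, B.crossValue (env ω) (env ω) ∂P
      ≤ ∫⁻ ω, B.crossValue (env ω) (smp ℓ ω) ∂P + ENNReal.ofReal ε
        + ENNReal.ofReal (1 / t) * (ENNReal.ofReal (H / 4 * B.avgDiameter ^ 2)
          + gapCoeff H M δ * ∫⁻ ω, B.gap (smp ℓ ω) (env ω) ∂P
          + 26 * H ^ 3 * M * ∫⁻ E, B.rareMass δ E ∂B.prior)
        + ENNReal.ofReal (3 * t) * hR.meanInfoGain ℓ ζ := by
  have mV := B.measurable_crossValue
  have m1 : Measurable fun E₀ => ENNReal.ofReal (H / 4 * B.valueDiameter E₀ ^ 2) := by fun_prop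
  have m3 := B.measurable_rareMass δ
  have mg : Measurable fun x : B.Env × B.Env => B.gap x.2 x.1 :=
    B.measurable_gap.comp (f := fun x : B.Env × B.Env => (x.2, x.1)) (by fun_prop)
  have hh := hR.aemeasurable_hist ℓ
  have elaw : ∀ f : B.Env → ENNReal, Measurable f →
      ∫⁻ ω, ∫⁻ E, f E ∂(hR.posterior ℓ (hist epi ℓ ω)) ∂P = ∫⁻ E, f E ∂B.prior := by
    intro f hf
    rw [← hR.lintegral_posterior ℓ (F := fun _ E => f E) (hf.comp measurable_snd),
      ← hR.env_law.map_eq, lintegral_map' hf.aemeasurable hR.aemeasurable_env]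
  have e0 : ∫⁻ ω, B.crossValue (env ω) (env ω) ∂P
      = ∫⁻ ω, ∫⁻ E, B.crossValue E E ∂(hR.posterior ℓ (hist epi ℓ ω)) ∂P :=
    hR.lintegral_posterior ℓ (F := fun _ E => B.crossValue E E)
      (mV.comp (f := fun x : (Fin ℓ → Traj S A H) × B.Env => (x.2, x.2)) (by fun_prop))
  have e1 : ∫⁻ ω, B.crossValue (env ω) (smp ℓ ω) ∂P
      = ∫⁻ ω, ∫⁻ E, ∫⁻ E', B.crossValue E E' ∂(hR.posterior ℓ (hist epi ℓ ω))
        ∂(hR.posterior ℓ (hist epi ℓ ω)) ∂P :=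
    hR.lintegral_sample ℓ (F := fun _ E E' => B.crossValue E E') (mV.comp measurable_snd)
  have e2 : ∫⁻ ω, B.gap (smp ℓ ω) (env ω) ∂P
      = ∫⁻ ω, ∫⁻ E₀, ∫⁻ E, B.gap E E₀ ∂(hR.posterior ℓ (hist epi ℓ ω))
        ∂(hR.posterior ℓ (hist epi ℓ ω)) ∂P :=
    hR.lintegral_sample ℓ (F := fun _ E E' => B.gap E' E) (mg.comp measurable_snd)
  rw [e0, e1, e2, ← lintegral_valueDiameter_sq hm (H / 4) (by positivity), ← elaw _ m1, ← elaw _ m3]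
  unfold meanInfoGain
  have n1 : AEMeasurable (fun ω => ∫⁻ E, ∫⁻ E', B.crossValue E E'
      ∂(hR.posterior ℓ (hist epi ℓ ω)) ∂(hR.posterior ℓ (hist epi ℓ ω))) P :=
    (Measurable.lintegral_lintegral_kernel (hR.posterior ℓ) mV).comp_aemeasurable hh
  have n2 : AEMeasurable (fun ω => ∫⁻ E₀, ∫⁻ E, B.gap E E₀
      ∂(hR.posterior ℓ (hist epi ℓ ω)) ∂(hR.posterior ℓ (hist epi ℓ ω))) P :=
    (Measurable.lintegral_lintegral_kernel (hR.posterior ℓ) mg).comp_aemeasurable hh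
  have n3 : AEMeasurable (fun ω => ∫⁻ E, ENNReal.ofReal (H / 4 * B.valueDiameter E ^ 2)
      ∂(hR.posterior ℓ (hist epi ℓ ω))) P :=
    (m1.lintegral_kernel (κ := hR.posterior ℓ)).comp_aemeasurable hh
  have n4 : AEMeasurable (fun ω => ∫⁻ E, B.rareMass δ E ∂(hR.posterior ℓ (hist epi ℓ ω))) P :=
    (m3.lintegral_kernel (κ := hR.posterior ℓ)).comp_aemeasurable hh
  rw [← lintegral_affine n1 n3 n2 n4 ENNReal.ofReal_ne_top]
  refine lintegral_mono_ae ?_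
  filter_upwards [hR.isTilt_posterior ℓ] with ω hω
  exact lintegral_crossValue_le_of_isTilt hω hε hζ hm hM hδ ht

include hR in
lemma IsTSRun.integral_regret_eq (ℓ : ℕ) :
    ∫ ω, (B.value (env ω) (B.star (env ω)) 0 B.s₁ - B.value (env ω) (B.star (smp ℓ ω)) 0 B.s₁) ∂P
      = (∫⁻ ω, B.crossValue (env ω) (env ω) ∂P).toReal
        - (∫⁻ ω, B.crossValue (env ω) (smp ℓ ω) ∂P).toReal := by
  have mV := B.measurable_crossValue
  have m1 : AEMeasurable (fun ω => B.crossValue (env ω) (env ω)) P :=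
    mV.comp_aemeasurable (f := fun ω => (env ω, env ω))
      (hR.aemeasurable_env.prodMk hR.aemeasurable_env)
  have m2 : AEMeasurable (fun ω => B.crossValue (env ω) (smp ℓ ω)) P :=
    mV.comp_aemeasurable (f := fun ω => (env ω, smp ℓ ω))
      (hR.aemeasurable_env.prodMk (hR.aemeasurable_smp ℓ))
  simp only [value_eq_crossValue]
  exact integral_toReal_sub_toReal m1 m2 (c := H)
    (fun ω => by simpa using B.crossValue_le (env ω) (env ω))
    fun ω => by simpa using B.crossValue_le (env ω) (smp ℓ ω)

include hR in
lemma IsTSRun.integral_regret_le (ℓ : ℕ) :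
    ∫ ω, (B.value (env ω) (B.star (env ω)) 0 B.s₁ - B.value (env ω) (B.star (smp ℓ ω)) 0 B.s₁) ∂P
      ≤ H := by
  rw [hR.integral_regret_eq]
  have : (∫⁻ ω, B.crossValue (env ω) (env ω) ∂P).toReal ≤ H := by
    refine ENNReal.toReal_le_of_le_ofReal (by positivity) ?_
    simpa using lintegral_le_of_forall_le fun ω => B.crossValue_le (env ω) (env ω)
  have h0 : 0 ≤ (∫⁻ ω, B.crossValue (env ω) (smp ℓ ω) ∂P).toReal := ENNReal.toReal_nonneg
  linarith

end Run

variable {S A : Type*} [MeasurableSpace S] [MeasurableSpace A] {H : ℕ} [NeZero H]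
  {TP TR : Fin H → Type*}
  [∀ h, MeasurableSpace (TP h)] [∀ h, TopologicalSpace (TP h)] [∀ h, BorelSpace (TP h)]
  [∀ h, TopologicalSpace.MetrizableSpace (TP h)] [∀ h, SecondCountableTopology (TP h)]
  [∀ h, MeasurableSpace (TR h)] [∀ h, TopologicalSpace (TR h)] [∀ h, BorelSpace (TR h)]
  [∀ h, TopologicalSpace.MetrizableSpace (TR h)] [∀ h, SecondCountableTopology (TR h)]
  {B : BayesRL S A H TP TR}
  {Ω : Type*} [MeasurableSpace Ω] {P : Measure Ω} [IsProbabilityMeasure P]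
  {env : Ω → B.Env} {smp : ℕ → Ω → B.Env} {epi : ℕ → Ω → Traj S A H}
  (hR : B.IsTSRun P env smp epi)

include hR

lemma IsTSRun.exists_forall_integral_regret_le (hB : B.Standing)
    (hcons : B.HasConsistentEstimator P env epi) (hV : B.VisitsAll) :
    ∃ ℓ₀ : ℕ, ∀ ε : ℝ, 0 < ε → ∀ (K : ℕ) (ζ : B.Env → Fin K), B.IsLayeredPartition ε K ζ →
      ∀ u : ℝ, 0 < u → ∀ ℓ, ℓ₀ ≤ ℓ → hR.meanInfoGain ℓ ζ ≠ ⊤ →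
      ∫ ω, (B.value (env ω) (B.star (env ω)) 0 B.s₁ - B.value (env ω) (B.star (smp ℓ ω)) 0 B.s₁) ∂P
        ≤ ε + H * B.avgDiameter ^ 2 / u + u * (hR.meanInfoGain ℓ ζ).toReal := by
  obtain ⟨M, hM⟩ := hB.exists_occBound
  have hm := hB.diameter_measurable
  have hl := avgDiameter_pos hm
  have hH : (0 : ℝ) < H := by exact_mod_cast NeZero.pos H
  set η : ℝ := H * B.avgDiameter ^ 2 / 24 with hη
  have hη0 : 0 < η := by positivity
  have hη1 : ENNReal.ofReal η ≠ 0 := by simpa using hη0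
  have hc2 : 26 * (H : ENNReal) ^ 3 * M ≠ ⊤ :=
    ENNReal.mul_ne_top (ENNReal.mul_ne_top (by simp) (by simp)) ENNReal.coe_ne_top
  obtain ⟨δ, hδ, hrare⟩ := hV.exists_lintegral_rareMass_le
    (η := ENNReal.ofReal η / (26 * H ^ 3 * M)) (ENNReal.div_ne_zero.2 ⟨hη1, hc2⟩)
  have hc1 : gapCoeff H M δ ≠ ⊤ := by
    unfold gapCoeff
    have h1 : (4 * M / δ : ENNReal) ≠ ⊤ :=
      ENNReal.div_ne_top (ENNReal.mul_ne_top (by simp) ENNReal.coe_ne_top) (by simpa using hδ)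
    exact ENNReal.add_ne_top.2 ⟨ENNReal.mul_ne_top (ENNReal.mul_ne_top (by simp) (by simp))
      (ENNReal.add_ne_top.2 ⟨by simp, h1⟩), ENNReal.mul_ne_top (by simp) (by simp)⟩
  have hgap := ENNReal.Tendsto.const_mul (hR.tendsto_gap hcons hM) (Or.inr hc1)
  rw [mul_zero] at hgap
  obtain ⟨ℓ₀, hℓ₀⟩ := eventually_atTop.1
    (ENNReal.tendsto_nhds_zero.1 hgap (ENNReal.ofReal η) (pos_iff_ne_zero.2 hη1))
  refine ⟨ℓ₀, fun ε hε K ζ hζ u hu ℓ hℓ hI => ?_⟩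
  have h1 := hR.lintegral_crossValue_le ℓ hε hζ hm hM hδ (t := u / 3) (by positivity)
  have h2 := hℓ₀ ℓ hℓ
  rw [hR.lintegral_pairLaw ℓ B.measurable_gap] at h2
  have h3 : 26 * (H : ENNReal) ^ 3 * M * ∫⁻ E, B.rareMass δ E ∂B.prior ≤ ENNReal.ofReal η :=
    (mul_le_mul_right hrare _).trans ENNReal.mul_div_le
  have h4 : ∫⁻ ω, B.crossValue (env ω) (env ω) ∂P
      ≤ ∫⁻ ω, B.crossValue (env ω) (smp ℓ ω) ∂P
        + ENNReal.ofReal (ε + H * B.avgDiameter ^ 2 / u + u * (hR.meanInfoGain ℓ ζ).toReal) := by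
    calc _ ≤ ∫⁻ ω, B.crossValue (env ω) (smp ℓ ω) ∂P + ENNReal.ofReal ε
        + ENNReal.ofReal (1 / (u / 3)) * (ENNReal.ofReal (H / 4 * B.avgDiameter ^ 2)
          + ENNReal.ofReal η + ENNReal.ofReal η)
        + ENNReal.ofReal (3 * (u / 3)) * hR.meanInfoGain ℓ ζ := h1.trans (by gcongr)
      _ = _ := by
        have e : ENNReal.ofReal (3 * (u / 3)) * hR.meanInfoGain ℓ ζ
            = ENNReal.ofReal (u * (hR.meanInfoGain ℓ ζ).toReal) := by
          rw [ENNReal.ofReal_mul hu.le, ENNReal.ofReal_toReal hI]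
          congr 2; ring
        rw [e, ← ENNReal.ofReal_add (by positivity) hη0.le,
          ← ENNReal.ofReal_add (by positivity) hη0.le, ← ENNReal.ofReal_mul (by positivity),
          add_assoc, add_assoc, ← ENNReal.ofReal_add (by positivity) (by positivity),
          ← ENNReal.ofReal_add (by positivity) (by positivity)]
        congr 2
        rw [hη]
        field_simp
        ring
  rw [hR.integral_regret_eq]
  have f2 : ∫⁻ ω, B.crossValue (env ω) (smp ℓ ω) ∂P ≠ ⊤ :=
    ((lintegral_le_of_forall_le fun ω => B.crossValue_le (env ω) (smp ℓ ω)).trans_lt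
      (ENNReal.natCast_lt_top H)).ne
  have h5 := ENNReal.toReal_mono (ENNReal.add_ne_top.2 ⟨f2, ENNReal.ofReal_ne_top⟩) h4
  rw [ENNReal.toReal_add f2 ENNReal.ofReal_ne_top, ENNReal.toReal_ofReal (by positivity)] at h5
  linarith

/-- The regret bound for a layered partition. -/
lemma IsTSRun.exists_forall_bayesRegret_le (hB : B.Standing)
    (hcons : B.HasConsistentEstimator P env epi) (hV : B.VisitsAll) :
    ∃ T₀ : ℝ, ∀ ε : ℝ, 0 < ε → ∀ (K : ℕ) (ζ : B.Env → Fin K), B.IsLayeredPartition ε K ζ →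
      ∀ L : ℕ, B.bayesRegret P env smp L
        ≤ 2 * B.avgDiameter * √(Real.log K * ((L * H : ℕ) : ℝ)) + L * ε + T₀ := by
  obtain ⟨ℓ₀, hℓ₀⟩ := hR.exists_forall_integral_regret_le hB hcons hV
  have hl := avgDiameter_pos hB.diameter_measurable
  refine ⟨ℓ₀ * H, fun ε hε K ζ hζ L => ?_⟩
  have hlog : 0 ≤ Real.log K := Real.log_natCast_nonneg K
  have hsum := hR.sum_infoGain_le hζ L
  have hfin : ∀ ℓ ∈ Finset.range L, hR.meanInfoGain ℓ ζ ≠ ⊤ := by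
    intro ℓ hℓ
    exact ((Finset.single_le_sum (f := fun ℓ => hR.meanInfoGain ℓ ζ) (fun _ _ => zero_le)
      hℓ).trans_lt (hsum.trans_lt ENNReal.ofReal_lt_top)).ne
  have hsum' : ∑ ℓ ∈ Finset.range L, (hR.meanInfoGain ℓ ζ).toReal ≤ Real.log K := by
    rw [← ENNReal.toReal_sum hfin]
    exact ENNReal.toReal_le_of_le_ofReal hlog hsum
  have key : ∀ u : ℝ, 0 < u → B.bayesRegret P env smp L - (L * ε + ℓ₀ * H)
      ≤ u * Real.log K + (L * H * B.avgDiameter ^ 2) / u := by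
    intro u hu
    have h1 : B.bayesRegret P env smp L ≤ ∑ ℓ ∈ Finset.range L,
        ((if ℓ < ℓ₀ then (H : ℝ) else 0) + (ε + H * B.avgDiameter ^ 2 / u
          + u * (hR.meanInfoGain ℓ ζ).toReal)) := by
      refine Finset.sum_le_sum fun ℓ hℓ => ?_
      split_ifs with h
      · have h2 := hR.integral_regret_le ℓ
        have h3 : 0 ≤ ε + H * B.avgDiameter ^ 2 / u + u * (hR.meanInfoGain ℓ ζ).toReal := by
          positivity
        linarith
      · rw [zero_add]
        exact hℓ₀ ε hε K ζ hζ u hu ℓ (not_lt.1 h) (hfin ℓ hℓ)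
    have h2 : ∑ ℓ ∈ Finset.range L, (if ℓ < ℓ₀ then (H : ℝ) else 0) ≤ ℓ₀ * H := by
      rw [← Finset.sum_filter, Finset.sum_const, nsmul_eq_mul]
      have : (Finset.filter (fun ℓ => ℓ < ℓ₀) (Finset.range L)).card ≤ ℓ₀ := by
        refine (Finset.card_le_card (t := Finset.range ℓ₀) fun ℓ hℓ => ?_).trans (by simp)
        rw [Finset.mem_filter] at hℓ
        exact Finset.mem_range.2 hℓ.2
      gcongr
    rw [Finset.sum_add_distrib, Finset.sum_add_distrib, Finset.sum_const, Finset.card_range,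
      nsmul_eq_mul, ← Finset.mul_sum] at h1
    have h3 := mul_le_mul_of_nonneg_left hsum' hu.le
    have h4 : (L : ℝ) * (ε + H * B.avgDiameter ^ 2 / u)
        = L * ε + (L * H * B.avgDiameter ^ 2) / u := by ring
    rw [h4] at h1
    linarith
  have h5 := le_two_mul_sqrt_of_forall_le hlog (by positivity) key
  have h6 : √(Real.log K * (L * H * B.avgDiameter ^ 2))
      = B.avgDiameter * √(Real.log K * ((L * H : ℕ) : ℝ)) := by
    rw [show Real.log K * (L * H * B.avgDiameter ^ 2)
      = B.avgDiameter ^ 2 * (Real.log K * ((L * H : ℕ) : ℝ)) by push_cast; ring,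
      Real.sqrt_mul (by positivity), Real.sqrt_sq hl.le]
  rw [h6] at h5
  linarith

end BayesRL

end

noncomputable section

namespace BayesRL

section Covering

variable {X : Type*} {d : X → X → ENNReal} {ε : ℝ}

lemma exists_finset_of_covNum_ne_top (h : covNum d ε ≠ ⊤) :
    ∃ C : Finset X, (∀ x, ∃ c ∈ C, d x c ≤ ENNReal.ofReal ε) ∧ (C.card : ℕ∞) = covNum d ε := by
  classical
  set p : ℕ → Prop := fun K => ∃ C : Finset X,
    (∀ x, ∃ c ∈ C, d x c ≤ ENNReal.ofReal ε) ∧ C.card = K with hp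
  have hex : ∃ K, p K := by
    by_contra hn
    push Not at hn
    refine h (iInf₂_eq_top.2 fun C hC => absurd ⟨C, hC, rfl⟩ (hn C.card))
  obtain ⟨C, hC, hK⟩ := Nat.find_spec hex
  refine ⟨C, hC, le_antisymm (le_iInf₂ fun C' hC' => ?_) (iInf₂_le C hC)⟩
  rw [hK]
  exact_mod_cast Nat.find_min' hex ⟨C', hC', rfl⟩

lemma one_le_covNum [Nonempty X] : 1 ≤ covNum d ε := by
  refine le_iInf₂ fun C hC => ?_
  obtain ⟨c, hc, -⟩ := hC (Classical.arbitrary X)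
  exact_mod_cast Finset.card_pos.2 ⟨c, hc⟩

lemma eventually_log_one_div_ge (c : ℝ) : ∀ᶠ ε : ℝ in 𝓝[>] 0, c ≤ Real.log (1 / ε) := by
  have h := Real.tendsto_log_nhdsGT_zero.eventually_le_atBot (-c)
  filter_upwards [h] with ε hε
  rw [one_div, Real.log_inv]
  linarith

lemma eventually_le_kolDim_ratio {f : ℝ → ℝ} {κ : ℝ}
    (h : ∀ᶠ ε in 𝓝[>] (0 : ℝ), κ * Real.log (1 / ε) ≤ f ε)
    (hd : ∀ᶠ ε in 𝓝[>] (0 : ℝ), ((f ε : ℝ) : EReal) ≤ ENNReal.log ((covNum d ε : ℕ∞) : ENNReal)) :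
    (κ : EReal) ≤ kolDim d := by
  refine le_limsup_of_frequently_le (Eventually.frequently ?_)
  filter_upwards [h, hd, eventually_log_one_div_ge 1] with ε h1 h2 h3
  rw [EReal.le_div_iff_mul_le (by exact_mod_cast (by linarith)) (EReal.coe_ne_top _)]
  refine le_trans ?_ h2
  exact_mod_cast h1

lemma kolDim_nonneg [Nonempty X] : 0 ≤ kolDim d := by
  have := eventually_le_kolDim_ratio (d := d) (f := fun _ => 0) (κ := 0) (by simp)
    (Eventually.of_forall fun ε => by
      have h1 : (1 : ENNReal) ≤ ((covNum d ε : ℕ∞) : ENNReal) := by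
        exact_mod_cast one_le_covNum (d := d) (ε := ε)
      simpa using h1)
  simpa using this

lemma log_natCast {n : ℕ} (hn : n ≠ 0) : ENNReal.log (n : ENNReal) = ((Real.log n : ℝ) : EReal) := by
  rw [ENNReal.log_pos_real (by exact_mod_cast hn) (ENNReal.natCast_ne_top n), ENNReal.toReal_natCast]

lemma eventually_log_covNum_le [Nonempty X] {κ : ℝ} (h : kolDim d < (κ : EReal)) :
    ∀ᶠ ε in 𝓝[>] (0 : ℝ), covNum d ε ≠ ⊤ ∧
      Real.log ((covNum d ε).toNat : ℝ) ≤ κ * Real.log (1 / ε) := by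
  filter_upwards [eventually_lt_of_limsup_lt h, eventually_log_one_div_ge 1] with ε h1 h2
  rw [EReal.div_lt_iff (by exact_mod_cast (by linarith)) (EReal.coe_ne_top _)] at h1
  have hne : covNum d ε ≠ ⊤ := by
    intro ht
    rw [ht] at h1
    simp at h1
  refine ⟨hne, ?_⟩
  have h3 : 1 ≤ covNum d ε := one_le_covNum
  rw [← ENat.natCast_toNat hne] at h1 h3
  have h4 : (covNum d ε).toNat ≠ 0 := by
    have : 1 ≤ (covNum d ε).toNat := by exact_mod_cast h3
    omega
  rw [ENat.toENNReal_coe, log_natCast h4] at h1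
  exact le_of_lt (by exact_mod_cast h1)

end Covering

section Segment

variable {X S A Z : Type*} [MeasurableSpace Z] {μ : Measure Z} {f : X → S → A → Z → ℝ}

/-- Uniform `l₁`-distance of two parametrized functions. -/
def supL1 (μ : Measure Z) (f : X → S → A → Z → ℝ) (x y : X) : ENNReal :=
  ⨆ (s : S) (a : A), ∫⁻ z, ENNReal.ofReal |f x s a z - f y s a z| ∂μ

lemma supL1_triangle (hf : ∀ x s a, Measurable (f x s a)) (x y z : X) :
    supL1 μ f x y ≤ supL1 μ f x z + supL1 μ f y z := by
  refine iSup₂_le fun s a => ?_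
  refine le_trans ?_ (add_le_add (le_iSup₂ (f := fun s a => ∫⁻ w, ENNReal.ofReal
    |f x s a w - f z s a w| ∂μ) s a) (le_iSup₂ (f := fun s a => ∫⁻ w, ENNReal.ofReal
    |f y s a w - f z s a w| ∂μ) s a))
  have h1 := hf x s a
  have h2 := hf z s a
  rw [← lintegral_add_left (by fun_prop)]
  refine lintegral_mono fun w => ?_
  dsimp only
  rw [← ENNReal.ofReal_add (abs_nonneg _) (abs_nonneg _)]
  refine ENNReal.ofReal_le_ofReal ?_
  rw [abs_sub_comm (f y s a w)]
  exact abs_sub_le _ _ _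

lemma supL1_segment (x y : X) {t u : ℝ} {x₁ x₂ : X}
    (h₁ : ∀ s a, ∀ᵐ w ∂μ, f x₁ s a w = t * f x s a w + (1 - t) * f y s a w)
    (h₂ : ∀ s a, ∀ᵐ w ∂μ, f x₂ s a w = u * f x s a w + (1 - u) * f y s a w) :
    supL1 μ f x₁ x₂ = ENNReal.ofReal |t - u| * supL1 μ f x y := by
  unfold supL1
  simp only [ENNReal.mul_iSup]
  congr 1
  ext s
  congr 1
  ext a
  rw [← lintegral_const_mul' _ _ ENNReal.ofReal_ne_top]
  refine lintegral_congr_ae ?_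
  filter_upwards [h₁ s a, h₂ s a] with w hw₁ hw₂
  rw [hw₁, hw₂, ← ENNReal.ofReal_mul (abs_nonneg _), ← abs_mul]
  congr 2
  ring

/-- A convex set of functions with more than one point has positive dimension. -/
lemma half_le_kolDim_of_convex (hf : ∀ x s a, Measurable (f x s a))
    (hconv : ∀ x y, ∀ t ∈ Icc (0 : ℝ) 1, ∃ z, ∀ s a, ∀ᵐ w ∂μ,
      f z s a w = t * f x s a w + (1 - t) * f y s a w) {x y : X} (hxy : supL1 μ f x y ≠ 0) :
    ((1 / 2 : ℝ) : EReal) ≤ kolDim (supL1 μ f) := by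
  obtain ⟨D, hD0, hD⟩ : ∃ D : ℝ, 0 < D ∧ ENNReal.ofReal D ≤ supL1 μ f x y := by
    by_cases ht : supL1 μ f x y = ⊤
    · exact ⟨1, one_pos, by rw [ht]; exact le_top⟩
    · exact ⟨_, ENNReal.toReal_pos hxy ht, ENNReal.ofReal_toReal_le⟩
  refine eventually_le_kolDim_ratio (f := fun ε => Real.log (D / 8) + Real.log (1 / ε)) ?_ ?_
  · filter_upwards [eventually_log_one_div_ge (-2 * Real.log (D / 8))] with ε hε
    linarith
  have hsm : ∀ᶠ ε : ℝ in 𝓝[>] 0, ε ∈ Ioo (0 : ℝ) (D / 8) := Ioo_mem_nhdsGT (by positivity)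
  filter_upwards [hsm] with ε hε
  obtain ⟨h0, h1⟩ := hε
  set n := ⌊D / (4 * ε)⌋₊ with hn
  have h2 : 2 ≤ D / (4 * ε) := by
    rw [le_div_iff₀ (by positivity)]; linarith
  have hn1 : (n : ℝ) ≤ D / (4 * ε) := Nat.floor_le (by positivity)
  have hn2 : D / (4 * ε) < n + 1 := Nat.lt_floor_add_one _
  have hn0 : (1 : ℝ) < n := by linarith
  have hnε : (n : ℝ) * (4 * ε) ≤ D := by rwa [le_div_iff₀ (by positivity)] at hn1
  have hcard : (n : ℕ∞) ≤ covNum (supL1 μ f) ε := by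
    refine le_iInf₂ fun C hC => ?_
    have hz : ∀ i : Fin n, ∃ z, ∀ s a, ∀ᵐ w ∂μ,
        f z s a w = ((i : ℕ) / n : ℝ) * f x s a w + (1 - ((i : ℕ) / n : ℝ)) * f y s a w := by
      intro i
      refine hconv x y _ ⟨by positivity, ?_⟩
      rw [div_le_one (by linarith)]
      exact_mod_cast i.2.le
    choose z hz using hz
    choose c hcC hc using hC
    have hinj : Function.Injective fun i => c (z i) := by
      intro i j hij
      by_contra hne
      have e1 : supL1 μ f (z i) (z j) ≤ ENNReal.ofReal (2 * ε) := by
        refine (supL1_triangle hf (z i) (z j) (c (z i))).trans ?_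
        dsimp only at hij
        have h3 := hc (z j)
        rw [← hij] at h3
        calc _ ≤ ENNReal.ofReal ε + ENNReal.ofReal ε := add_le_add (hc (z i)) h3
          _ = _ := by rw [← ENNReal.ofReal_add h0.le h0.le]; congr 1; ring
      rw [supL1_segment x y (hz i) (hz j)] at e1
      have e2 : ENNReal.ofReal (1 / n * D) ≤ ENNReal.ofReal (2 * ε) := by
        rw [ENNReal.ofReal_mul (by positivity)]
        refine le_trans (mul_le_mul' (ENNReal.ofReal_le_ofReal ?_) hD) e1
        rw [← sub_div, abs_div, abs_of_pos (show (0 : ℝ) < n by linarith)]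
        have h4 : (1 : ℝ) ≤ |((i : ℕ) : ℝ) - ((j : ℕ) : ℝ)| := by
          have h5 : ((i : ℕ) : ℤ) - ((j : ℕ) : ℤ) ≠ 0 := by
            intro h
            exact hne (Fin.ext (by omega))
          exact_mod_cast Int.one_le_abs h5
        gcongr
      rw [ENNReal.ofReal_le_ofReal_iff (by positivity), div_mul_eq_mul_div, one_mul,
        div_le_iff₀ (by linarith)] at e2
      nlinarith
    have := Fintype.card_le_of_injective (fun i => (⟨c (z i), hcC (z i)⟩ : C))
      (fun i j h => hinj (congrArg Subtype.val h))
    rw [Fintype.card_fin, Fintype.card_coe] at this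
    exact_mod_cast this
  have hn' : n ≠ 0 := by
    intro h
    rw [h] at hn0
    norm_num at hn0
  calc _ ≤ ((Real.log n : ℝ) : EReal) := by
        rw [EReal.coe_le_coe_iff, ← Real.log_mul (by positivity) (by positivity)]
        refine Real.log_le_log (by positivity) ?_
        rw [mul_one_div, div_div]
        have : D / (8 * ε) = D / (4 * ε) / 2 := by rw [div_div]; ring
        rw [this]
        linarith
    _ = ENNReal.log (n : ENNReal) := (log_natCast hn').symm
    _ ≤ _ := ENNReal.log_le_log (by exact_mod_cast hcard)

end Segment

end BayesRL

end

noncomputable section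

lemma absDiff_ofReal_le (a b : ℝ) :
    absDiff (ENNReal.ofReal a) (ENNReal.ofReal b) ≤ ENNReal.ofReal |a - b| := by
  refine absDiff_le_of_le ?_ ?_
  · refine (ENNReal.ofReal_le_ofReal ?_).trans ENNReal.ofReal_add_le
    linarith [le_abs_self (a - b)]
  · refine (ENNReal.ofReal_le_ofReal ?_).trans ENNReal.ofReal_add_le
    linarith [neg_abs_le (a - b)]

lemma exists_measurable_index {X : Type*} [MeasurableSpace X] {d : X → X → ENNReal}
    (hd : ∀ c, Measurable fun x => d x c) {η : ENNReal} {C : Finset X}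
    (hC : ∀ x, ∃ c ∈ C, d x c ≤ η) : ∃ i : X → Fin C.card, Measurable i ∧
      ∀ x y, i x = i y → ∃ c, d x c ≤ η ∧ d y c ≤ η := by
  classical
  set e := C.equivFin with he
  have hp : ∀ x, ∃ N, ∃ h : N < C.card, d x (e.symm ⟨N, h⟩) ≤ η := by
    intro x
    obtain ⟨c, hc, hx⟩ := hC x
    exact ⟨e ⟨c, hc⟩, (e ⟨c, hc⟩).2, by simpa using hx⟩
  have hm : ∀ N, MeasurableSet {x | ∃ h : N < C.card, d x (e.symm ⟨N, h⟩) ≤ η} := by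
    intro N
    by_cases h : N < C.card
    · simp only [h, exists_true_left]
      exact measurableSet_le (hd _) measurable_const
    · simp [h]
  have hfind := measurable_find hp hm
  refine ⟨fun x => ⟨Nat.find (hp x), (Nat.find_spec (hp x)).choose⟩,
    measurable_to_countable' fun k => ?_, fun x y hxy => ?_⟩
  · have : (fun x => (⟨Nat.find (hp x), (Nat.find_spec (hp x)).choose⟩ : Fin C.card)) ⁻¹' {k}
        = (fun x => Nat.find (hp x)) ⁻¹' {k.1} := by
      ext x
      simp [Fin.ext_iff]
    rw [this]
    exact hfind (measurableSet_singleton _)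
  · obtain ⟨h1, h2⟩ := Nat.find_spec (hp x)
    obtain ⟨h3, h4⟩ := Nat.find_spec (hp y)
    refine ⟨_, h2, ?_⟩
    have h5 : Nat.find (hp x) = Nat.find (hp y) := congrArg Fin.val hxy
    have h6 : (⟨Nat.find (hp x), h1⟩ : Fin C.card) = ⟨Nat.find (hp y), h3⟩ := Fin.ext h5
    rw [h6]
    exact h4

namespace BayesRL

open MDPBase

variable {S A : Type*} [MeasurableSpace S] [MeasurableSpace A] {H : ℕ}
  {TP TR : Fin H → Type*} [∀ h, MeasurableSpace (TP h)] [∀ h, MeasurableSpace (TR h)]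
  (B : BayesRL S A H TP TR)

lemma measurable_p (h : Fin H) (θ : TP h) (s : S) (a : A) : Measurable (B.p h θ s a) :=
  (B.p_measurable h).comp (f := fun s' => (θ, s, a, s')) (by fun_prop)

lemma measurable_r (h : Fin H) (θ : TR h) (s : S) (a : A) : Measurable (B.r h θ s a) :=
  (B.r_measurable h).comp (f := fun x => (θ, s, a, x)) (by fun_prop)

lemma lintegral_absDiff_trans_le (E E' : B.Env) (h : Fin H) (s : S) (a : A) :
    ∫⁻ z, absDiff (B.trans E h s a z) (B.trans E' h s a z) ∂B.mdp.ν
      ≤ B.l1P h (E h).1 (E' h).1 + B.l1R h (E h).2 (E' h).2 := by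
  have m1 := B.measurable_p h (E h).1 s a
  have m2 := B.measurable_p h (E' h).1 s a
  have m3 := B.measurable_r h (E h).2 s a
  have m4 := B.measurable_r h (E' h).2 s a
  have hP : ∫⁻ s', ENNReal.ofReal |B.p h (E h).1 s a s' - B.p h (E' h).1 s a s'| ∂B.μS
      ≤ B.l1P h (E h).1 (E' h).1 := le_iSup₂ (f := fun s a =>
        ∫⁻ s', ENNReal.ofReal |B.p h (E h).1 s a s' - B.p h (E' h).1 s a s'| ∂B.μS) s a
  have hR : ∫⁻ x in Icc (0 : ℝ) 1, ENNReal.ofReal |B.r h (E h).2 s a x - B.r h (E' h).2 s a x|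
      ≤ B.l1R h (E h).2 (E' h).2 := le_iSup₂ (f := fun s a => ∫⁻ x in Icc (0 : ℝ) 1,
        ENNReal.ofReal |B.r h (E h).2 s a x - B.r h (E' h).2 s a x|) s a
  calc _ ≤ ∫⁻ z : ℝ × S, (ENNReal.ofReal |B.r h (E h).2 s a z.1 - B.r h (E' h).2 s a z.1|
          * ENNReal.ofReal (B.p h (E h).1 s a z.2) + ENNReal.ofReal (B.r h (E' h).2 s a z.1)
          * ENNReal.ofReal |B.p h (E h).1 s a z.2 - B.p h (E' h).1 s a z.2|) ∂B.mdp.ν := by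
        refine lintegral_mono fun z => ?_
        simp only [trans, h.2, dif_pos]
        exact (absDiff_mul_le _ _ _ _).trans (add_le_add
          (mul_le_mul_left (absDiff_ofReal_le _ _) _) (mul_le_mul_right (absDiff_ofReal_le _ _) _))
    _ = (∫⁻ x in Icc (0 : ℝ) 1, ENNReal.ofReal |B.r h (E h).2 s a x - B.r h (E' h).2 s a x|)
          * (∫⁻ s', ENNReal.ofReal (B.p h (E h).1 s a s') ∂B.μS)
        + (∫⁻ x in Icc (0 : ℝ) 1, ENNReal.ofReal (B.r h (E' h).2 s a x))
          * ∫⁻ s', ENNReal.ofReal |B.p h (E h).1 s a s' - B.p h (E' h).1 s a s'| ∂B.μS := by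
        rw [lintegral_add_left (by fun_prop)]
        congr 1
        · have k1 : AEMeasurable (fun x => ENNReal.ofReal |B.r h (E h).2 s a x - B.r h (E' h).2 s a x|)
              (volume.restrict (Icc (0 : ℝ) 1)) := by fun_prop
          have k2 : AEMeasurable (fun s' => ENNReal.ofReal (B.p h (E h).1 s a s')) B.μS := by
            fun_prop
          exact lintegral_prod_mul k1 k2
        · have k1 : AEMeasurable (fun x => ENNReal.ofReal (B.r h (E' h).2 s a x))
              (volume.restrict (Icc (0 : ℝ) 1)) := by fun_prop
          have k2 : AEMeasurable (fun s' =>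
              ENNReal.ofReal |B.p h (E h).1 s a s' - B.p h (E' h).1 s a s'|) B.μS := by fun_prop
          exact lintegral_prod_mul k1 k2
    _ ≤ _ := by
        rw [B.p_prob, B.r_prob, mul_one, one_mul, add_comm]
        exact add_le_add hP hR

lemma prod_indicator_eq {ι : Type*} [Fintype ι] {X : ι → Type*} (s : ∀ i, Set (X i))
    (x : ∀ i, X i) : ∏ i, (s i).indicator (1 : X i → ENNReal) (x i)
      = (univ.pi s).indicator 1 x := by
  classical
  by_cases hx : x ∈ univ.pi s
  · rw [indicator_of_mem hx, Pi.one_apply]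
    exact Finset.prod_eq_one fun i _ => by rw [indicator_of_mem (hx i (mem_univ i)), Pi.one_apply]
  · rw [indicator_of_notMem hx]
    simp only [Set.mem_pi, mem_univ, true_imp_iff, not_forall] at hx
    obtain ⟨i, hi⟩ := hx
    exact Finset.prod_eq_zero (Finset.mem_univ i) (indicator_of_notMem hi _)

/-- Conditioning on a box preserves the independence of the layers. -/
lemma iIndepFun_cond_pi {s : ∀ h, Set (TP h × TR h)} (hs : ∀ h, MeasurableSet (s h))
    (h0 : B.prior (univ.pi s) ≠ 0) : iIndepFun (fun h (E : B.Env) => E h)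
      (ProbabilityTheory.cond B.prior (univ.pi s)) := by
  have hp := cond_isProbabilityMeasure h0
  have e : ProbabilityTheory.cond B.prior (univ.pi s) = (B.prior (univ.pi s))⁻¹ •
      B.prior.withDensity fun E : B.Env => ∏ h, (s h).indicator 1 (E h) := by
    simp only [prod_indicator_eq]
    rw [withDensity_indicator_one (MeasurableSet.univ_pi hs)]
    rfl
  rw [e] at hp ⊢
  exact iIndepFun_smul_withDensity_prod B.iIndepFun_prior
    (fun h => measurable_one.indicator (hs h)) hp

variable [NeZero H]

/-- The values of a policy in two environments differ by at most the distance of the environments. -/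
lemma crossValue_le_add_l1 (E E' E₀ : B.Env) :
    B.crossValue E E₀ ≤ B.crossValue E' E₀
      + H * ∑ h, (B.l1P h (E h).1 (E' h).1 + B.l1R h (E h).2 (E' h).2) := by
  have hQ := B.isTrans_trans E'
  have hQ' := B.isTrans_trans E
  have hπ := B.isPolicy_optPol E₀
  have h1 := hQ.acc_le_acc_add_sum hQ' hπ (r := rew) measurable_rew (c := fun _ _ _ => 0)
    (fun n => measurable_const) (fun _ _ _ => ENNReal.zero_ne_top) H
  refine h1.trans (add_le_add le_rfl ?_)
  rw [Finset.sum_range, Finset.mul_sum]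
  refine Finset.sum_le_sum fun h _ => ?_
  have hocc := hQ.measurable_occ hπ h.1
  have hsim : ∀ s a, simErr B.mdp H (B.trans E') (B.trans E) (B.optPol E₀) rew (fun _ _ _ => 0) h.1 s a
      ≤ H * (B.l1P h (E h).1 (E' h).1 + B.l1R h (E h).2 (E' h).2) := by
    intro s a
    have m1 : Measurable fun z => B.trans E h.1 s a z :=
      (hQ'.meas h.1).comp (f := fun z => (s, a, z)) (by fun_prop)
    have m2 : Measurable fun z => B.trans E' h.1 s a z :=
      (hQ.meas h.1).comp (f := fun z => (s, a, z)) (by fun_prop)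
    calc _ ≤ ∫⁻ z, H * absDiff (B.trans E h.1 s a z) (B.trans E' h.1 s a z) ∂B.mdp.ν := by
          refine lintegral_mono fun z => ?_
          dsimp only
          rw [mul_comm]
          refine mul_le_mul_left ?_ _
          exact (absDiff_le_of_le_of_le (hQ'.contVal_le (H := H) hπ rew_le_one h.1 z) zero_le)
      _ = H * ∫⁻ z, absDiff (B.trans E h.1 s a z) (B.trans E' h.1 s a z) ∂B.mdp.ν :=
          lintegral_const_mul _ (m1.absDiff m2)
      _ ≤ _ := mul_le_mul_right (B.lintegral_absDiff_trans_le E E' h s a) _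
  set c := H * (B.l1P h (E h).1 (E' h).1 + B.l1R h (E h).2 (E' h).2) with hc
  calc _ ≤ ∫⁻ s, ∫⁻ a, B.mdp.occ (B.trans E') (B.optPol E₀) h.1 s a * c ∂B.mdp.μA ∂(B.mdp.baseS h.1) :=
        lintegral_mono fun s => lintegral_mono fun a => mul_le_mul_right (hsim s a) _
    _ = ∫⁻ x, B.mdp.occ (B.trans E') (B.optPol E₀) h.1 x.1 x.2 * c ∂(B.mdp.baseSA h.1) :=
        (lintegral_baseSA (b := B.mdp) h.1 (f := fun x =>
          B.mdp.occ (B.trans E') (B.optPol E₀) h.1 x.1 x.2 * c) (hocc.mul_const c)).symm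
    _ = c := by
        rw [lintegral_mul_const _ hocc, lintegral_baseSA (b := B.mdp) h.1 hocc,
          hQ.lintegral_occ hπ h.1, one_mul]

variable {B}

/-- Coverings of the layers yield a layered value partition. -/
lemma L1Measurable.exists_isLayeredPartition (hm : B.L1Measurable) {η : ℝ} (hη : 0 < η)
    (hP : ∀ h, covNum (B.l1P h) η ≠ ⊤) (hR : ∀ h, covNum (B.l1R h) η ≠ ⊤) :
    ∃ (K : ℕ) (ζ : B.Env → Fin K), B.IsLayeredPartition (4 * H ^ 2 * η) K ζ ∧
      Real.log K ≤ ∑ h, (Real.log ((covNum (B.l1P h) η).toNat : ℝ)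
        + Real.log ((covNum (B.l1R h) η).toNat : ℝ)) := by
  classical
  choose CP hCP cardP using fun h => exists_finset_of_covNum_ne_top (hP h)
  choose CR hCR cardR using fun h => exists_finset_of_covNum_ne_top (hR h)
  choose iP miP hiP using fun h => exists_measurable_index (d := B.l1P h)
    (fun c => hm.1 h c) (hCP h)
  choose iR miR hiR using fun h => exists_measurable_index (d := B.l1R h)
    (fun c => hm.2 h c) (hCR h)
  set g : B.Env → ∀ h, Fin (CP h).card × Fin (CR h).card :=
    fun E h => (iP h (E h).1, iR h (E h).2) with hg
  have mgh : ∀ h, Measurable fun e : TP h × TR h => (iP h e.1, iR h e.2) := fun h =>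
    ((miP h).comp measurable_fst).prodMk ((miR h).comp measurable_snd)
  have mg : Measurable g := measurable_pi_lambda _ fun h =>
    (mgh h).comp (measurable_pi_apply h)
  set e := Fintype.equivFin (∀ h, Fin (CP h).card × Fin (CR h).card) with he
  refine ⟨_, fun E => e (g E), ⟨(measurable_of_countable e).comp mg, ?_, ?_⟩, ?_⟩
  · intro E E' hEE
    have hgE : g E = g E' := e.injective hEE
    have h1 : ∀ h, B.l1P h (E h).1 (E' h).1 + B.l1R h (E h).2 (E' h).2
        ≤ ENNReal.ofReal (4 * η) := by
      intro h
      have h2 := congrFun hgE h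
      simp only [hg, Prod.mk.injEq] at h2
      obtain ⟨c, hc1, hc2⟩ := hiP h _ _ h2.1
      obtain ⟨c', hc3, hc4⟩ := hiR h _ _ h2.2
      have t1 : B.l1P h (E h).1 (E' h).1 ≤ B.l1P h (E h).1 c + B.l1P h (E' h).1 c :=
        supL1_triangle (fun θ s a => B.measurable_p h θ s a) _ _ _
      have t2 : B.l1R h (E h).2 (E' h).2 ≤ B.l1R h (E h).2 c' + B.l1R h (E' h).2 c' :=
        supL1_triangle (fun θ s a => B.measurable_r h θ s a) _ _ _
      calc _ ≤ (ENNReal.ofReal η + ENNReal.ofReal η) + (ENNReal.ofReal η + ENNReal.ofReal η) :=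
            add_le_add (t1.trans (add_le_add hc1 hc2)) (t2.trans (add_le_add hc3 hc4))
        _ = _ := by
            rw [← ENNReal.ofReal_add hη.le hη.le, ← ENNReal.ofReal_add (by positivity) (by positivity)]
            congr 1; ring
    have h3 : B.crossValue E E ≤ B.crossValue E' E + ENNReal.ofReal (4 * H ^ 2 * η) := by
      refine (B.crossValue_le_add_l1 E E' E).trans (add_le_add le_rfl ?_)
      calc _ ≤ (H : ENNReal) * ∑ _h : Fin H, ENNReal.ofReal (4 * η) :=
            mul_le_mul_right (Finset.sum_le_sum fun h _ => h1 h) _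
        _ = _ := by
            rw [Finset.sum_const, Finset.card_univ, Fintype.card_fin, nsmul_eq_mul,
              ← ENNReal.ofReal_natCast, ← ENNReal.ofReal_mul (by positivity),
              ← ENNReal.ofReal_mul (by positivity)]
            congr 1; ring
    have h4 := ENNReal.toReal_mono (ENNReal.add_ne_top.2 ⟨B.crossValue_ne_top E' E,
      ENNReal.ofReal_ne_top⟩) h3
    rw [ENNReal.toReal_add (B.crossValue_ne_top E' E) ENNReal.ofReal_ne_top,
      ENNReal.toReal_ofReal (by positivity)] at h4
    rw [value_eq_crossValue, value_eq_crossValue]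
    linarith
  · intro k hk
    have hset : (fun E => e (g E)) ⁻¹' {k} = univ.pi fun h =>
        (fun e : TP h × TR h => (iP h e.1, iR h e.2)) ⁻¹' {e.symm k h} := by
      ext E
      simp only [mem_preimage, mem_singleton_iff, Set.mem_pi, mem_univ, true_imp_iff]
      rw [← Equiv.eq_symm_apply, funext_iff]
    rw [hset] at hk ⊢
    exact B.iIndepFun_cond_pi (fun h => (mgh h) (measurableSet_singleton _)) hk
  · have hcP : ∀ h, (covNum (B.l1P h) η).toNat = (CP h).card := fun h => by
      rw [← cardP h, ENat.toNat_natCast]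
    have hcR : ∀ h, (covNum (B.l1R h) η).toNat = (CR h).card := fun h => by
      rw [← cardR h, ENat.toNat_natCast]
    simp only [hcP, hcR]
    have hneP : ∀ h, (CP h).Nonempty := fun h => by
      obtain ⟨x⟩ := nonempty_of_isProbabilityMeasure (B.ρP h)
      obtain ⟨c, hc, -⟩ := hCP h x
      exact ⟨c, hc⟩
    have hneR : ∀ h, (CR h).Nonempty := fun h => by
      obtain ⟨x⟩ := nonempty_of_isProbabilityMeasure (B.ρR h)
      obtain ⟨c, hc, -⟩ := hCR h x
      exact ⟨c, hc⟩
    have hP0 : ∀ h, ((CP h).card : ℝ) ≠ 0 := fun h => by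
      exact_mod_cast (Finset.card_pos.2 (hneP h)).ne'
    have hR0 : ∀ h, ((CR h).card : ℝ) ≠ 0 := fun h => by
      exact_mod_cast (Finset.card_pos.2 (hneR h)).ne'
    rw [Fintype.card_pi]
    simp only [Fintype.card_prod, Fintype.card_fin]
    push_cast
    rw [Real.log_prod fun h _ => mul_ne_zero (hP0 h) (hR0 h)]
    exact Finset.sum_le_sum fun h _ => (Real.log_mul (hP0 h) (hR0 h)).le

end BayesRL

end

noncomputable section

lemma EReal.coe_finsetSum {ι : Type*} (s : Finset ι) (f : ι → ℝ) :
    ((∑ i ∈ s, f i : ℝ) : EReal) = ∑ i ∈ s, (f i : EReal) := by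
  classical
  induction s using Finset.induction_on with
  | empty => simp
  | insert i s hi ih => rw [Finset.sum_insert hi, Finset.sum_insert hi, EReal.coe_add, ih]

namespace BayesRL

variable {S A : Type*} [MeasurableSpace S] [MeasurableSpace A] {H : ℕ}
  {TP TR : Fin H → Type*} [∀ h, MeasurableSpace (TP h)] [∀ h, MeasurableSpace (TR h)]
  (B : BayesRL S A H TP TR)

lemma kolDim_l1P_nonneg (h : Fin H) : 0 ≤ kolDim (B.l1P h) :=
  have := nonempty_of_isProbabilityMeasure (B.ρP h)
  kolDim_nonneg

lemma kolDim_l1R_nonneg (h : Fin H) : 0 ≤ kolDim (B.l1R h) :=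
  have := nonempty_of_isProbabilityMeasure (B.ρR h)
  kolDim_nonneg

/-- A finite dimension is the sum of the nonnegative dimensions of the layers. -/
lemma exists_kolDim_eq_coe (hd : B.dimL1 ≠ ⊤) : ∃ a b : Fin H → ℝ, (∀ h, 0 ≤ a h) ∧ (∀ h, 0 ≤ b h) ∧
    (∀ h, kolDim (B.l1P h) = a h) ∧ (∀ h, kolDim (B.l1R h) = b h) ∧
    B.dimL1.toReal = ∑ h, (a h + b h) := by
  have hle : ∀ h, kolDim (B.l1P h) + kolDim (B.l1R h) < ⊤ := fun h =>
    (Finset.single_le_sum (f := B.dimLayer)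
      (fun h _ => add_nonneg (B.kolDim_l1P_nonneg h) (B.kolDim_l1R_nonneg h))
      (Finset.mem_univ h)).trans_lt hd.lt_top
  have hP : ∀ h, ((kolDim (B.l1P h)).toReal : EReal) = kolDim (B.l1P h) := fun h =>
    EReal.coe_toReal ((le_add_of_nonneg_right (B.kolDim_l1R_nonneg h)).trans_lt (hle h)).ne
      (EReal.bot_lt_zero.trans_le (B.kolDim_l1P_nonneg h)).ne'
  have hR : ∀ h, ((kolDim (B.l1R h)).toReal : EReal) = kolDim (B.l1R h) := fun h =>
    EReal.coe_toReal ((le_add_of_nonneg_left (B.kolDim_l1P_nonneg h)).trans_lt (hle h)).ne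
      (EReal.bot_lt_zero.trans_le (B.kolDim_l1R_nonneg h)).ne'
  refine ⟨fun h => (kolDim (B.l1P h)).toReal, fun h => (kolDim (B.l1R h)).toReal,
    fun h => EReal.toReal_nonneg (B.kolDim_l1P_nonneg h),
    fun h => EReal.toReal_nonneg (B.kolDim_l1R_nonneg h), fun h => (hP h).symm,
    fun h => (hR h).symm, ?_⟩
  have : B.dimL1 = ((∑ h, ((kolDim (B.l1P h)).toReal + (kolDim (B.l1R h)).toReal) : ℝ) : EReal) := by
    rw [EReal.coe_finsetSum]
    refine Finset.sum_congr rfl fun h _ => ?_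
    rw [EReal.coe_add, hP, hR]
    rfl
  rw [this, EReal.toReal_coe]

variable [NeZero H] {B}

lemma l1P_eq_zero (hB : B.Standing) {h : Fin H} (h0 : kolDim (B.l1P h) = 0) (θ θ' : TP h) :
    B.l1P h θ θ' = 0 := by
  by_contra hne
  have key := half_le_kolDim_of_convex (μ := B.μS) (f := B.p h) (B.measurable_p h) (hB.convexP h)
    (x := θ) (y := θ') hne
  have h1 : ((1 / 2 : ℝ) : EReal) ≤ ((0 : ℝ) : EReal) := by rw [EReal.coe_zero, ← h0]; exact key
  norm_num [EReal.coe_le_coe_iff] at h1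

lemma l1R_eq_zero (hB : B.Standing) {h : Fin H} (h0 : kolDim (B.l1R h) = 0) (θ θ' : TR h) :
    B.l1R h θ θ' = 0 := by
  by_contra hne
  have key := half_le_kolDim_of_convex (μ := volume.restrict (Icc (0 : ℝ) 1)) (f := B.r h)
    (B.measurable_r h) (hB.convexR h) (x := θ) (y := θ') hne
  have h1 : ((1 / 2 : ℝ) : EReal) ≤ ((0 : ℝ) : EReal) := by rw [EReal.coe_zero, ← h0]; exact key
  norm_num [EReal.coe_le_coe_iff] at h1

/-- In dimension zero all environments coincide, and there is no regret. -/
lemma bayesRegret_nonpos_of_dimL1_eq_zero (hB : B.Standing) (hd : B.dimL1 ≠ ⊤)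
    (h0 : B.dimL1.toReal = 0) {Ω : Type*} [MeasurableSpace Ω] (P : Measure Ω) (env : Ω → B.Env)
    (smp : ℕ → Ω → B.Env) (L : ℕ) : B.bayesRegret P env smp L ≤ 0 := by
  obtain ⟨a, b, ha, hb, hP, hR, hs⟩ := B.exists_kolDim_eq_coe hd
  rw [h0] at hs
  have hab := (Finset.sum_eq_zero_iff_of_nonneg fun h _ => add_nonneg (ha h) (hb h)).1 hs.symm
  have ha0 : ∀ h, a h = 0 := fun h => by
    linarith [hab h (Finset.mem_univ h), ha h, hb h]
  have hb0 : ∀ h, b h = 0 := fun h => by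
    linarith [hab h (Finset.mem_univ h), ha h, hb h]
  have hle : ∀ E E' E₀, B.crossValue E E₀ ≤ B.crossValue E' E₀ := fun E E' E₀ => by
    have h1 := B.crossValue_le_add_l1 E E' E₀
    rw [Finset.sum_eq_zero fun h _ => ?_, mul_zero, add_zero] at h1
    · exact h1
    · rw [l1P_eq_zero hB (by rw [hP, ha0]; rfl), l1R_eq_zero hB (by rw [hR, hb0]; rfl), add_zero]
  refine Finset.sum_nonpos fun ℓ _ => integral_nonpos fun ω => ?_
  have h1 := hB.optimal (smp ℓ ω) (B.star (env ω)) (B.star_mem _) 0 B.s₁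
  have h2 : ∀ E E', B.value E (B.star E') 0 B.s₁ = B.value (smp ℓ ω) (B.star E') 0 B.s₁ :=
    fun E E' => by
      rw [value_eq_crossValue, value_eq_crossValue,
        le_antisymm (hle E (smp ℓ ω) E') (hle (smp ℓ ω) E E')]
  simp only [Pi.zero_apply]
  rw [h2, h2 (env ω)]
  linarith

/-- Layered value partitions whose logarithmic size is controlled by the dimension. -/
lemma eventually_exists_isLayeredPartition (hm : B.L1Measurable) (hd : B.dimL1 ≠ ⊤)
    (hpos : 0 < B.dimL1.toReal) : ∀ᶠ η in 𝓝[>] (0 : ℝ), ∃ (K : ℕ) (ζ : B.Env → Fin K),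
      B.IsLayeredPartition (4 * H ^ 2 * η) K ζ ∧
      Real.log K ≤ 2 * B.dimL1.toReal * Real.log (1 / η) := by
  obtain ⟨a, b, ha, hb, hP, hR, hs⟩ := B.exists_kolDim_eq_coe hd
  have hH : (0 : ℝ) < H := Nat.cast_pos.2 (NeZero.pos H)
  set γ : ℝ := B.dimL1.toReal / (2 * H) with hγ
  have hγ0 : 0 < γ := by positivity
  have e1 : ∀ h, ∀ᶠ η in 𝓝[>] (0 : ℝ), covNum (B.l1P h) η ≠ ⊤ ∧
      Real.log ((covNum (B.l1P h) η).toNat : ℝ) ≤ (a h + γ) * Real.log (1 / η) := fun h => by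
    have := nonempty_of_isProbabilityMeasure (B.ρP h)
    exact eventually_log_covNum_le (by rw [hP, EReal.coe_lt_coe_iff]; linarith)
  have e2 : ∀ h, ∀ᶠ η in 𝓝[>] (0 : ℝ), covNum (B.l1R h) η ≠ ⊤ ∧
      Real.log ((covNum (B.l1R h) η).toNat : ℝ) ≤ (b h + γ) * Real.log (1 / η) := fun h => by
    have := nonempty_of_isProbabilityMeasure (B.ρR h)
    exact eventually_log_covNum_le (by rw [hR, EReal.coe_lt_coe_iff]; linarith)
  filter_upwards [eventually_all.2 e1, eventually_all.2 e2, self_mem_nhdsWithin] with η h1 h2 hη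
  obtain ⟨K, ζ, hζ, hK⟩ := hm.exists_isLayeredPartition hη (fun h => (h1 h).1) (fun h => (h2 h).1)
  refine ⟨K, ζ, hζ, hK.trans ?_⟩
  calc _ ≤ ∑ h, ((a h + b h) + 2 * γ) * Real.log (1 / η) :=
        Finset.sum_le_sum fun h _ => by linarith [(h1 h).2, (h2 h).2]
    _ = _ := by
        rw [← Finset.sum_mul, Finset.sum_add_distrib, ← hs, Finset.sum_const, Finset.card_univ,
          Fintype.card_fin, nsmul_eq_mul, hγ]
        field_simp
        ring

end BayesRL

lemma secondCountableTopology_of_separable (X : Type*) [TopologicalSpace X]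
    [TopologicalSpace.MetrizableSpace X] [TopologicalSpace.SeparableSpace X] :
    SecondCountableTopology X := by
  let _ := TopologicalSpace.metrizableSpaceMetric X
  exact UniformSpace.secondCountable_of_separable X

namespace BayesRL

variable {S A : Type*} [MeasurableSpace S] [MeasurableSpace A] {H : ℕ}
  {TP TR : Fin H → Type*} [∀ h, MeasurableSpace (TP h)] [∀ h, MeasurableSpace (TR h)]
  {B : BayesRL S A H TP TR} [NeZero H]

/-- Optimizing the size of the value partition. -/
lemma exists_forall_bayesRegret_le_dimL1 (hB : B.Standing) (hm : B.L1Measurable) (hd : B.dimL1 ≠ ⊤)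
    {Ω : Type*} [MeasurableSpace Ω] {P : Measure Ω} {env : Ω → B.Env} {smp : ℕ → Ω → B.Env}
    {T₀ : ℝ} (hT : ∀ ε : ℝ, 0 < ε → ∀ (K : ℕ) (ζ : B.Env → Fin K), B.IsLayeredPartition ε K ζ →
      ∀ L : ℕ, B.bayesRegret P env smp L
        ≤ 2 * B.avgDiameter * √(Real.log K * ((L * H : ℕ) : ℝ)) + L * ε + T₀) :
    ∃ T₁ : ℕ, ∀ L : ℕ, T₁ ≤ L * H → B.bayesRegret P env smp L ≤
      5 * (B.avgDiameter * √(B.dimL1.toReal * ((L * H : ℕ) : ℝ)))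
        * Real.log ((L * H : ℕ) : ℝ) ^ 1 := by
  have hH : (1 : ℝ) ≤ H := Nat.one_le_cast.2 (NeZero.pos H)
  have hl := avgDiameter_pos hB.diameter_measurable
  have hd0 : 0 ≤ B.dimL1.toReal := by
    obtain ⟨a, b, ha, hb, -, -, hs⟩ := B.exists_kolDim_eq_coe hd
    rw [hs]
    exact Finset.sum_nonneg fun h _ => add_nonneg (ha h) (hb h)
  rcases hd0.eq_or_lt with h0 | hpos
  · refine ⟨0, fun L _ => ?_⟩
    rw [← h0, zero_mul, Real.sqrt_zero, mul_zero, mul_zero, zero_mul]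
    exact bayesRegret_nonpos_of_dimL1_eq_zero hB hd h0.symm P env smp L
  set d := B.dimL1.toReal with hd'
  have hη : Tendsto (fun L : ℕ => 1 / (4 * (H : ℝ) ^ 2 * L)) atTop (𝓝[>] 0) := by
    refine tendsto_nhdsWithin_iff.2 ⟨?_, ?_⟩
    · refine Tendsto.div_atTop tendsto_const_nhds ?_
      exact tendsto_natCast_atTop_atTop.const_mul_atTop (by positivity)
    · filter_upwards [eventually_gt_atTop 0] with L hL
      have : (0 : ℝ) < L := Nat.cast_pos.2 hL
      exact mem_Ioi.2 (by positivity)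
  have hsq : Tendsto (fun L : ℕ => B.avgDiameter * √(d * L)) atTop atTop :=
    (Real.tendsto_sqrt_atTop.comp
      (tendsto_natCast_atTop_atTop.const_mul_atTop hpos)).const_mul_atTop hl
  have hev : ∀ᶠ L : ℕ in atTop, B.bayesRegret P env smp L ≤
      5 * (B.avgDiameter * √(d * ((L * H : ℕ) : ℝ))) * Real.log ((L * H : ℕ) : ℝ) ^ 1 := by
    filter_upwards [hη.eventually (eventually_exists_isLayeredPartition hm hd hpos),
      hsq.eventually_ge_atTop (1 + T₀), eventually_ge_atTop (4 * H ^ 2),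
      eventually_ge_atTop 3] with L hL1 hL2 hL3 hL4
    obtain ⟨K, ζ, hζ, hK⟩ := hL1
    have hL0 : (0 : ℝ) < L := by exact_mod_cast (by omega : 0 < L)
    have hε : 4 * (H : ℝ) ^ 2 * (1 / (4 * (H : ℝ) ^ 2 * L)) = 1 / L := by field_simp
    rw [hε] at hζ
    have h1 := hT (1 / L) (by positivity) K ζ hζ L
    rw [mul_one_div_cancel hL0.ne'] at h1
    have hLT : (L : ℝ) ≤ ((L * H : ℕ) : ℝ) := by
      push_cast
      exact le_mul_of_one_le_right hL0.le hH
    set T : ℝ := ((L * H : ℕ) : ℝ) with hTdef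
    have hT0 : 0 < T := hL0.trans_le hLT
    have hlog1 : 1 ≤ Real.log T := by
      rw [Real.le_log_iff_exp_le hT0]
      have : (3 : ℝ) ≤ L := by exact_mod_cast hL4
      linarith [Real.exp_one_lt_d9]
    have hlogη : Real.log (1 / (1 / (4 * (H : ℝ) ^ 2 * L))) ≤ 2 * Real.log T := by
      rw [one_div_one_div]
      have h4 : 4 * (H : ℝ) ^ 2 ≤ L := by exact_mod_cast hL3
      calc _ ≤ Real.log (T * T) := Real.log_le_log (by positivity)
            (mul_le_mul (h4.trans hLT) hLT hL0.le hT0.le)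
        _ = _ := by rw [Real.log_mul hT0.ne' hT0.ne']; ring
    have hsqrt : √(Real.log K * T) ≤ 2 * (√(d * T) * Real.log T) := by
      rw [Real.sqrt_le_left (by positivity), mul_pow, mul_pow, Real.sq_sqrt (by positivity)]
      have h5 : Real.log K ≤ 4 * d * Real.log T := by
        have := mul_le_mul_of_nonneg_left hlogη (by positivity : 0 ≤ 2 * d)
        linarith
      have h6 : Real.log T ≤ Real.log T ^ 2 := by nlinarith
      calc Real.log K * T ≤ 4 * d * Real.log T * T := by gcongr
        _ ≤ 4 * d * Real.log T ^ 2 * T := by gcongr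
        _ = _ := by ring
    have h7 : 1 + T₀ ≤ B.avgDiameter * √(d * T) * Real.log T := by
      refine hL2.trans ((?_ : _ ≤ B.avgDiameter * √(d * T)).trans
        (le_mul_of_one_le_right (by positivity) hlog1))
      gcongr
    have h8 := mul_le_mul_of_nonneg_left hsqrt (by positivity : 0 ≤ 2 * B.avgDiameter)
    rw [pow_one]
    linarith
  obtain ⟨L₀, hL₀⟩ := eventually_atTop.1 hev
  exact ⟨L₀ * H, fun L hL => hL₀ L (Nat.le_of_mul_le_mul_right hL (NeZero.pos H))⟩

end BayesRL

/-- The Bayesian regret bounds for Thompson sampling.  `C` and `k` are universal: `Õ` hides only an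
absolute constant and a power of `log T`, where `T = L * H` is the number of steps. -/
theorem theorem1 : ∃ (C : ℝ) (k : ℕ), 0 < C ∧
    ∀ (S A : Type*) [MeasurableSpace S] [MeasurableSpace A] (H : ℕ) [NeZero H]
      (TP TR : Fin H → Type*)
      [∀ h, MeasurableSpace (TP h)] [∀ h, TopologicalSpace (TP h)] [∀ h, BorelSpace (TP h)]
      [∀ h, TopologicalSpace.MetrizableSpace (TP h)]
      [∀ h, TopologicalSpace.SeparableSpace (TP h)]
      [∀ h, MeasurableSpace (TR h)] [∀ h, TopologicalSpace (TR h)] [∀ h, BorelSpace (TR h)]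
      [∀ h, TopologicalSpace.MetrizableSpace (TR h)]
      [∀ h, TopologicalSpace.SeparableSpace (TR h)]
      (B : BayesRL S A H TP TR) (_ : B.Standing)
      (Ω : Type*) [MeasurableSpace Ω] (P : Measure Ω) [IsProbabilityMeasure P]
      (env : Ω → B.Env) (smp : ℕ → Ω → B.Env) (epi : ℕ → Ω → BayesRL.Traj S A H)
      (_ : B.IsTSRun P env smp epi)
      (_ : B.HasConsistentEstimator P env epi) (_ : B.VisitsAll),
      (∃ T₀ : ℝ, ∀ ε : ℝ, 0 < ε → B.Ksurr ε ≠ ⊤ → ∀ L : ℕ,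
        B.bayesRegret P env smp L ≤
          2 * B.avgDiameter * √(Real.log ((B.Ksurr ε).toNat : ℝ) * ((L * H : ℕ) : ℝ))
            + L * ε + T₀)
      ∧ (B.L1Measurable → B.dimL1 ≠ ⊤ → ∃ T₁ : ℕ, ∀ L : ℕ, T₁ ≤ L * H →
        B.bayesRegret P env smp L ≤
          C * (B.avgDiameter * √(B.dimL1.toReal * ((L * H : ℕ) : ℝ)))
            * Real.log ((L * H : ℕ) : ℝ) ^ k)
      ∧ (B.L1Measurable → ∀ dhom : ℝ, (∀ h, B.dimLayer h = (dhom : EReal)) →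
        ∃ T₁ : ℕ, ∀ L : ℕ, T₁ ≤ L * H →
        B.bayesRegret P env smp L ≤
          C * (B.avgDiameter * √(H * dhom * ((L * H : ℕ) : ℝ)))
            * Real.log ((L * H : ℕ) : ℝ) ^ k) := by
  refine ⟨5, 1, by norm_num, ?_⟩
  intro S A _ _ H _ TP TR _ _ _ _ _ _ _ _ _ _ B hB Ω _ P _ env smp epi hrun hcons hV
  have := fun h => secondCountableTopology_of_separable (TP h)
  have := fun h => secondCountableTopology_of_separable (TR h)
  obtain ⟨T₀, hT₀⟩ := hrun.exists_forall_bayesRegret_le hB hcons hV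
  refine ⟨⟨T₀, fun ε hε hK L => ?_⟩, fun hm hd => ?_, fun hm dhom hdim => ?_⟩
  · obtain ⟨K, ⟨ζ, hζ⟩, hKe⟩ := exists_eq_iInf_natCast hK
    have e : (B.Ksurr ε).toNat = K := by
      rw [show B.Ksurr ε = K from hKe, ENat.toNat_natCast]
    rw [e]
    exact hT₀ ε hε K ζ hζ L
  · exact B.exists_forall_bayesRegret_le_dimL1 hB hm hd hT₀
  · have hd : B.dimL1 = ((H * dhom : ℝ) : EReal) := by
      rw [BayesRL.dimL1, Finset.sum_congr rfl fun h _ => hdim h, ← EReal.coe_finsetSum, Finset.sum_const,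
        Finset.card_univ, Fintype.card_fin, nsmul_eq_mul]
    have key := B.exists_forall_bayesRegret_le_dimL1 hB hm (hd ▸ EReal.coe_ne_top _) hT₀
    rwa [hd, EReal.toReal_coe] at key

end
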